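/- **Data.** Let $\mathcal B$ be a connected complex manifold of dimension $r$, $\mathcal B''\subset\mathcal B$ a divisor, $\mathcal B'=\mathcal B\setminus\mathcal B''$. Let $\hat\Gamma\to\mathcal B'$ be a local system of lattices with a flat antisymmetric integral pairing $\langle\,,\rangle$ whose radical is a trivial local system $\Gamma_f$, with $\Gamma=\hat\Gamma/\Gamma_f$ of rank $2r$. Functionals in $\Gamma_u^*\otimes\mathbb C$ are paired by the inverse pairing: if $b=\langle c,\cdot\rangle$ with $c\in\Gamma_u\otimes\mathbb C$, then $\langle a,b\rangle=a(c)$. Let $Z(u):\hat\Gamma_u\to\mathbb C$ be homomorphisms, constant on $\Gamma_f$, such that $Z_\gamma$ is holomorphic for every local flat section $\gamma$, $\langle dZ\wedge dZ\rangle=0$ and $\langle dZ\wedge d\bar Z\rangle$ is a Kähler form on $\mathcal B'$. Let $\theta_f:\Gamma_f\to\mathbb R/2\pi\mathbb Z$ be a homomorphism and $\Omega:\hat\Gamma\to\mathbb Q$ a function with $\Omega(-\gamma)=\Omega(\gamma)$. Let $\mathcal M'\to\mathcal B'$ be the torus bundle whose points over $u$ are the maps $\theta:\hat\Gamma_u\to\mathbb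 R/2\pi\mathbb Z$ with $\theta_{\gamma+\gamma'}=\theta_\gamma+\theta_{\gamma'}+\pi\langle\gamma,\gamma'\rangle$ and $\theta|_{\Gamma_f}=\theta_f$; its smooth structure is the one in which $u$ and, for local flat sections $\gamma$, the $\theta_\gamma$ are smooth. **Assumptions near $\mathcal B''$.** Let $U\subset\mathcal B$ be an open neighborhood of a point of $\mathcal B''$ such that: 1. On $U\cap\mathcal B'$ there is a sublattice $\hat\Gamma_{\rm light}\subset\hat\Gamma$ that is a trivial local system, isotropic, with torsion-free quotient; put $\hat\Gamma_{\rm local}=\hat\Gamma_{\rm light}^{\perp}$. For $\gamma\in\hat\Gamma_{\rm light}$, $\Omega(\gamma)$ is constant and lies in $\{0,1\}$, and $\tilde\Gamma_{\rm light}=\{\gamma\in\hat\Gamma_{\rm light}:\Omega(\gamma)\ne0\}$ is finite. Choose a set $P\subset\tilde\Gamma_{\rm light}$ of representatives of $\tilde\Gamma_{\rm light}/\{\pm1\}$. 2. $\hat\Gamma|_{U\cap\mathcal B'}$ has a flat multivalued trivialization by a fixed lattice $L$, which depends on $u$ and on a choice of $\arg Z_\gamma$ for $\gamma\in P$, identifies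 $\langle\,,\rangle$ and $\Gamma_f$ with fixed data on $L$, and in which increasing $\arg Z_\gamma$ by $2\pi n_\gamma$ corresponds to $x\mapsto x+\sum_{\gamma\in P}n_\gamma\langle x,\gamma\rangle\gamma$. In it $$Z_x=\tilde Z_x+\frac1{2\pi i}\sum_{\gamma\in P}\langle x,\gamma\rangle Z_\gamma\bigl(\log(Z_\gamma/\pi)-1\bigr),\qquad x\in L,$$ with $\tilde Z:L\to\mathcal O(U)$ a homomorphism and the logarithms taken with the chosen arguments. (So $Z_x=\tilde Z_x$ extends to $U$ for $x\in\hat\Gamma_{\rm local}$.) 3. At every point of $U$ the $dZ_x$, $x\in\hat\Gamma_{\rm local}$, span the holomorphic cotangent space, and $\mathcal B''\cap U=\{u\in U: Z_\gamma(u)=0\text{ for some }\gamma\in P\}$. 4. For $u\in U\cap\mathcal B''$ and every homomorphism $\theta:\hat\Gamma_{\rm light}\to\mathbb R/2\pi\mathbb Z$ that equals $\theta_f$ on $\hat\Gamma_{\rm light}\cap\Gamma_f$, the image of $S_{u,\theta}=\{\gamma\in P: Z_\gamma(u)=0,\ \theta_\gamma=0\}$ in the image $\Gamma_{\rm light}\subset\Gamma$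 of $\hat\Gamma_{\rm light}$ is a basis of a primitive sublattice of $\Gamma_{\rm light}$. **The space $\mathcal M_U\supset\mathcal M'_U=\mathcal M'|_{U\cap\mathcal B'}$.** Its points are represented by triples $(u,\alpha,\theta)$ with $u\in U$, $\alpha=(\alpha_\gamma)_{\gamma\in P}$ a choice of arguments of the $Z_\gamma(u)$ (any real number if $Z_\gamma(u)=0$) and $\theta:L\to\mathbb R/2\pi\mathbb Z$ a twisted character as above extending $\theta_f$. Triples $(u,\alpha,\theta)$ and $(u,\alpha^*,\theta^*)$ are identified if there are $\varepsilon_\gamma\in\mathbb R$ with $\theta^*_x=\theta_x+\sum_{\gamma\in P}\langle x,\gamma\rangle\varepsilon_\gamma$ and $\varepsilon_\gamma=\frac{\alpha^*_\gamma-\alpha_\gamma}{2\pi}(\theta_\gamma-\pi)$, $\theta_\gamma\in[0,2\pi)$, for every $\gamma\in P$ that is not in $S_{u,\theta}=\{\gamma\in P: Z_\gamma(u)=\theta_\gamma=0\}$. Over $U\cap\mathcal B'$ this is $\mathcal M'_U$. A map from an open subset of $\mathbb R^n$ to $\mathcal M_U$ is smooth if it can locally be represented by triples for which, for some $K\subset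 P$, there are smooth $u\in U$, $\vartheta_x\in\mathbb R$ ($x\in L$), $t_\gamma\in\mathbb R$ ($\gamma\in P$) and $w_{\gamma,1},w_{\gamma,2}\in\mathbb C$ ($\gamma\in K$) such that $\theta_\gamma=t_\gamma$ mod $2\pi$; for $\gamma\in K$, $Z_\gamma(u)=\tfrac i2w_{\gamma,1}w_{\gamma,2}$, $t_\gamma=\tfrac12(|w_{\gamma,2}|^2-|w_{\gamma,1}|^2)\in(-2\pi,2\pi)$ and $\alpha_\gamma=\arg w_{\gamma,1}+\arg w_{\gamma,2}+\tfrac\pi2$ for some real choices of these arguments (arbitrary reals where a coordinate vanishes); for $\gamma\in P\setminus K$, $0<t_\gamma<2\pi$ wherever $Z_\gamma(u)=0$; and, for the same choices of arguments, $$\theta_x=\vartheta_x+\sum_{\gamma\in P}\langle x,\gamma\rangle\tfrac{\alpha_\gamma}{2\pi}(t_\gamma-\pi)+\sum_{\gamma\in K}\langle x,\gamma\rangle\arg w_{\gamma,2}\pmod{2\pi}.$$ A smooth $k$-form on $\mathcal M_U$ is a rule assigning to each smooth map $p:\mathbb R^n\to\mathcal M_U$ a smooth $k$-form $p^*\omega$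 on $\mathbb R^n$ with $(p\circ f)^*\omega=f^*p^*\omega$ for smooth $f:\mathbb R^m\to\mathbb R^n$; it is closed if all $p^*\omega$ are closed. **The model forms.** For $\zeta\in\mathbb C^\times$ put $\mathcal X^{\rm sf}_\gamma(\zeta)=\exp(\zeta^{-1}Z_\gamma+i\theta_\gamma+\zeta\bar Z_\gamma)$. A sectorial decomposition is a partition of $\mathbb C^\times$ into $2K$ half-open sectors of opening angle $\pi/K$, $K\ge5$, each containing its clockwise boundary ray; it is good at $u\in U\cap\mathcal B'$ if no boundary ray equals $\ell_\gamma(u)=-Z_\gamma(u)\mathbb R_{>0}$ for a $\gamma\in\tilde\Gamma_{\rm light}$. Then put $$\mathcal X^{\rm model}_\gamma(\zeta)=\mathcal X^{\rm sf}_\gamma(\zeta)\exp\Bigl(-\frac1{4\pi i}\sum_{\gamma'\in\tilde\Gamma_{\rm light}}\Omega(\gamma')\langle\gamma,\gamma'\rangle\int_{r^-_{\gamma'}}\frac{d\zeta'}{\zeta'}\frac{\zeta'+\zeta}{\zeta'-\zeta}\log\bigl(1-\mathcal X^{\rm sf}_{\gamma'}(\zeta')\bigr)\Bigr),$$ where $r_{\gamma'}$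 is the counterclockwise boundary ray of the sector containing $\ell_{\gamma'}(u)$, and the integral over $r^-_{\gamma'}$ is the limit as $\delta\to0^+$ of the integral over $e^{-i\delta}r_{\gamma'}$. Define the $2$-form $\varpi^{\rm model}(\zeta)=\frac1{8\pi}\langle d\log\mathcal X^{\rm model}(\zeta)\wedge d\log\mathcal X^{\rm model}(\zeta)\rangle$ on the part of $\mathcal M'_U$ where the decomposition is good. **Proposition.** The $\mathbb P^1$-family of closed $2$-forms $\varpi^{\rm model}(\zeta)$ on $\mathcal M'_U$ extends to a $\mathbb P^1$-family of smooth closed $2$-forms on all of $\mathcal M_U$: there are smooth closed complex-valued $2$-forms $\omega_+,\omega_3,\omega_-$ on $\mathcal M_U$, with $\omega_-=\overline{\omega_+}$ and $\omega_3$ real, such that for every $\zeta\in\mathbb C^\times$ and every sectorial decomposition, on the part of $\mathcal M'_U$ where the decomposition is good, $$-\frac{i}{2\zeta}\,\omega_+ +\omega_3-\frac i2\zeta\,\omega_-=\varpi^{\rm model}(\zeta).$$ -/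

import Mathlib

open scoped Manifold ContDiff Topology

noncomputable section

namespace ModelGeometry

/-- The model space `ℂ^r` of an `r`-dimensional complex manifold. -/
abbrev CSpace (r : ℕ) : Type := EuclideanSpace ℂ (Fin r)

/-- The parameter space `ℝ^n` of plots. -/
abbrev RSpace (n : ℕ) : Type := EuclideanSpace ℝ (Fin n)

/-! ### Differential forms on a diffeological space -/

/-- A smooth complex-valued differential `k`-form on a diffeological space: a smooth `k`-form on
`ℝ^n` for every plot `p : ℝ^n → X` (the pullback of the form along `p`), compatible with smooth
reparametrisations. On a manifold these are the usual smooth `k`-forms.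
(The values of `toFun` at maps that are not plots carry no information.) -/
structure DForm (k : ℕ) (X : Type*) [DiffeologicalSpace X] where
  toFun : ∀ {n : ℕ}, (RSpace n → X) → RSpace n → RSpace n [⋀^Fin k]→L[ℝ] ℂ
  contDiff : ∀ {n : ℕ} (p : RSpace n → X), Diffeology.IsPlot p → ContDiff ℝ ∞ (toFun p)
  pullback : ∀ {n m : ℕ} (p : RSpace n → X), Diffeology.IsPlot p →
    ∀ f : RSpace m → RSpace n, ContDiff ℝ ∞ f → ∀ s : RSpace m,
      toFun (p ∘ f) s = (toFun p (f s)).compContinuousLinearMap (fderiv ℝ f s)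

/-- A form is closed if all its pullbacks along plots are closed. -/
def DForm.IsClosed {k : ℕ} {X : Type*} [DiffeologicalSpace X] (η : DForm k X) : Prop :=
  ∀ (n : ℕ) (p : RSpace n → X), Diffeology.IsPlot p → ∀ s, extDeriv (η.toFun p) s = 0

/-- `η'` is the complex conjugate of `η`. -/
def DForm.IsConj {k : ℕ} {X : Type*} [DiffeologicalSpace X] (η' η : DForm k X) : Prop :=
  ∀ (n : ℕ) (p : RSpace n → X), Diffeology.IsPlot p → ∀ s v,
    η'.toFun p s v = (starRingEnd ℂ) (η.toFun p s v)

/-! ### Local systems and the inverse pairing -/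

/-- A local system of abelian groups over the open subset `D` of `B`: groups `Fiber u` and, for `w`
near `u`, the parallel transport `transport u w` from the fiber at `u` to the one at `w`, which is
an isomorphism and locally path independent. Nothing is said about fibers outside `D`
or about `transport u w` for `w` far from `u`. -/
structure LocalSystem (B : Type) [TopologicalSpace B] (D : Set B) where
  Fiber : B → Type
  [group : ∀ u, AddCommGroup (Fiber u)]
  transport : ∀ u w, Fiber u →+ Fiber w
  transport_self : ∀ u ∈ D, ∀ γ, transport u u γ = γ
  transport_near : ∀ u ∈ D, ∀ᶠ w in 𝓝 u, Function.Bijective (transport u w) ∧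
    ∀ᶠ w' in 𝓝 w, ∀ γ, transport w w' (transport u w γ) = transport u w' γ

attribute [instance] LocalSystem.group

open Classical in
/-- The pairing on `Hom(G, ℂ)` inverse to an antisymmetric pairing `P` on a lattice `G`, on
functionals that vanish on the radical of `P`:
if `b x = ∑_γ c γ * P γ x` for all `x`, then `⟨a, b⟩ = ∑_γ c γ * a γ`.
In a Frobenius basis (`⟨m_i, e_j⟩ = p_i δ_ij`, `⟨m_i, m_j⟩ = ⟨e_i, e_j⟩ = 0`) of `G` modulo the
radical this is `∑_i p_i⁻¹ (a m_i * b e_i - a e_i * b m_i)`. -/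
def dualPairing {G : Type} [AddCommGroup G] (P : G →+ G →+ ℤ) (a b : G → ℂ) : ℂ :=
  if h : ∃ c : G →₀ ℂ, ∀ x, b x = c.sum fun γ z => z * (P γ x : ℂ) then
    h.choose.sum fun γ z => z * a γ
  else 0

/-- The representative in `[0, 2π)` of an angle. -/
def liftAngle (a : Real.Angle) : ℝ := toIcoMod Real.two_pi_pos 0 a.toReal

lemma liftAngle_coe (a : Real.Angle) : (liftAngle a : Real.Angle) = a := by
  have h : liftAngle a = a.toReal - toIcoDiv Real.two_pi_pos 0 a.toReal • (2 * Real.pi) := rfl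
  rw [h, Real.Angle.coe_sub, Real.Angle.coe_toReal, Real.Angle.coe_zsmul,
    Real.Angle.coe_two_pi, smul_zero, sub_zero]

lemma liftAngle_nonneg (a : Real.Angle) : 0 ≤ liftAngle a :=
  (toIcoMod_mem_Ico Real.two_pi_pos 0 a.toReal).1

lemma liftAngle_lt (a : Real.Angle) : liftAngle a < 2 * Real.pi := by
  have h := (toIcoMod_mem_Ico Real.two_pi_pos 0 a.toReal).2
  rwa [zero_add] at h

/-! ### The basic data -/

section Data

variable {r : ℕ} {B : Type} [TopologicalSpace B] [ChartedSpace (CSpace r) B]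

/-- The differential at `u` of a holomorphic function on `B`, as a function on tangent vectors. -/
def holoDiff (f : B → ℂ) (u : B) : TangentSpace 𝓘(ℂ, CSpace r) u →L[ℂ] ℂ :=
  mfderiv 𝓘(ℂ, CSpace r) 𝓘(ℂ) f u

variable (r B) in
/-- The data `(B, B'', Γ̂, Γ_f, ⟨,⟩, Z, θ_f, Ω)` over a complex manifold `B` of dimension `r`. -/
structure CoulombData where
  /-- the discriminant locus `B''` -/
  disc : Set B
  disc_closed : IsClosed disc
  disc_interior : interior disc = ∅
  /-- `B''` is locally the zero locus of a holomorphic function -/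
  disc_divisor : ∀ u : B, ∃ V : Set B, IsOpen V ∧ u ∈ V ∧ ∃ f : B → ℂ,
    MDifferentiableOn 𝓘(ℂ, CSpace r) 𝓘(ℂ) f V ∧ disc ∩ V = {w ∈ V | f w = 0}
  /-- the local system `Γ̂` of charge lattices over `B' = B \ B''` -/
  charge : LocalSystem B discᶜ
  /-- the flavor lattice `Γ_f` -/
  Flavor : Type
  [flavorGroup : AddCommGroup Flavor]
  flavor_free : Module.Free ℤ Flavor
  flavor_finite : Module.Finite ℤ Flavor
  charge_free : ∀ u ∉ disc, Module.Free ℤ (charge.Fiber u)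
  charge_finite : ∀ u ∉ disc, Module.Finite ℤ (charge.Fiber u)
  charge_rank : ∀ u ∉ disc,
    Module.finrank ℤ (charge.Fiber u) = 2 * r + Module.finrank ℤ Flavor
  /-- the inclusion of the trivial local system with fiber `Γ_f` -/
  flavorIncl : ∀ u, Flavor →+ charge.Fiber u
  flavorIncl_injective : ∀ u ∉ disc, Function.Injective (flavorIncl u)
  flavorIncl_flat : ∀ u ∉ disc, ∀ᶠ w in 𝓝 u, ∀ f,
    charge.transport u w (flavorIncl u f) = flavorIncl w f
  /-- the flat antisymmetric integral pairing, with radical `Γ_f` -/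
  pair : ∀ u, charge.Fiber u →+ charge.Fiber u →+ ℤ
  pair_antisymm : ∀ u ∉ disc, ∀ γ γ', pair u γ γ' = -pair u γ' γ
  pair_flat : ∀ u ∉ disc, ∀ᶠ w in 𝓝 u, ∀ γ γ',
    pair w (charge.transport u w γ) (charge.transport u w γ') = pair u γ γ'
  pair_radical : ∀ u ∉ disc, ∀ γ, (∀ γ', pair u γ γ' = 0) ↔ γ ∈ (flavorIncl u).range
  /-- the central charges -/
  Z : ∀ u, charge.Fiber u →+ ℂ
  Z_flavor : ∀ u ∉ disc, ∀ w ∉ disc, ∀ f, Z u (flavorIncl u f) = Z w (flavorIncl w f)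
  Z_holomorphic : ∀ u ∉ disc, ∀ γ, MDifferentiableAt 𝓘(ℂ, CSpace r) 𝓘(ℂ)
    (fun w => Z w (charge.transport u w γ)) u
  /-- `⟨dZ ∧ dZ⟩ = 0` -/
  dZ_isotropic : ∀ u ∉ disc, ∀ v v' : TangentSpace 𝓘(ℂ, CSpace r) u,
    dualPairing (pair u) (fun γ => holoDiff (fun w => Z w (charge.transport u w γ)) u v)
      (fun γ => holoDiff (fun w => Z w (charge.transport u w γ)) u v') = 0
  /-- `⟨dZ ∧ dZ̄⟩` is a positive `(1,1)`-form -/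
  dZ_kahler : ∀ u ∉ disc, ∀ v : TangentSpace 𝓘(ℂ, CSpace r) u, v ≠ 0 →
    0 < (dualPairing (pair u) (fun γ => holoDiff (fun w => Z w (charge.transport u w γ)) u v)
      (fun γ => (starRingEnd ℂ)
        (holoDiff (fun w => Z w (charge.transport u w γ)) u v))).im
  /-- the flavor character `θ_f` -/
  θf : Flavor →+ Real.Angle
  /-- the BPS indices -/
  Ω : ∀ u, charge.Fiber u → ℚ
  Ω_neg : ∀ u ∉ disc, ∀ γ, Ω u (-γ) = Ω u γ

attribute [instance] CoulombData.flavorGroup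

/-! ### The assumptions near a point of the discriminant locus -/

/-- A function `α` is a choice of the arguments of the complex numbers `z`. -/
def IsBranch {ι : Type} (z : ι → ℂ) (α : ι → ℝ) : Prop :=
  ∀ i, z i = (‖z i‖ : ℂ) * Complex.exp (α i * Complex.I)

open Classical in
/-- A neighborhood `U` of a point of the discriminant locus, with the light charges on it.

The charge lattice is described over `U \ B''` by the multivalued flat frame
`frame u α : L → Γ̂_u`, where `L` is a fixed lattice and `α` is a choice of the arguments of the
central charges of (representatives modulo sign of) the active light charges. -/
structure SingularNbhd (C : CoulombData r B) where
  U : Set B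
  U_open : IsOpen U
  center : B
  center_mem : center ∈ U
  center_disc : center ∈ C.disc
  /-- the typical fiber of `Γ̂` over `U \ B''` -/
  L : Type
  [groupL : AddCommGroup L]
  pairL : L →+ L →+ ℤ
  flavorL : C.Flavor →+ L
  /-- the lattice of light charges `Γ̂_light`; it is isotropic and `L / Γ̂_light` is torsion free -/
  light : AddSubgroup L
  light_isotropic : ∀ x ∈ light, ∀ y ∈ light, pairL x y = 0
  light_primitive : ∀ (N : ℤ) (x : L), N ≠ 0 → N • x ∈ light → x ∈ light
  /-- representatives modulo sign of the active light charges -/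
  pos : Finset L
  pos_light : ∀ γ ∈ pos, γ ∈ light
  pos_neg : ∀ γ ∈ pos, -γ ∉ pos
  /-- the functions `Z̃_x`, holomorphic on `U` -/
  Zt : L →+ (B → ℂ)
  Zt_holomorphic : ∀ x, MDifferentiableOn 𝓘(ℂ, CSpace r) 𝓘(ℂ) (Zt x) U
  frame : ∀ u, (pos → ℝ) → L →+ C.charge.Fiber u
  frame_bijective : ∀ u ∈ U \ C.disc, ∀ α, IsBranch (fun γ : pos => Zt γ u) α →
    Function.Bijective (frame u α)
  frame_pair : ∀ u ∈ U \ C.disc, ∀ α, IsBranch (fun γ : pos => Zt γ u) α → ∀ x y,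
    C.pair u (frame u α x) (frame u α y) = pairL x y
  frame_flavor : ∀ u ∈ U \ C.disc, ∀ α, IsBranch (fun γ : pos => Zt γ u) α → ∀ f,
    frame u α (flavorL f) = C.flavorIncl u f
  /-- the frame is flat along continuous choices of the arguments -/
  frame_flat : ∀ u ∈ U \ C.disc, ∀ α : B → pos → ℝ, ContinuousAt α u →
    (∀ᶠ w in 𝓝 u, IsBranch (fun γ : pos => Zt γ w) (α w)) →
    ∀ᶠ w in 𝓝 u, ∀ x, C.charge.transport u w (frame u (α u) x) = frame w (α w) x
  /-- the monodromy of `Γ̂` around the divisors `Z_γ = 0` -/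
  frame_monodromy : ∀ u ∈ U \ C.disc, ∀ α, IsBranch (fun γ : pos => Zt γ u) α →
    ∀ (n : pos → ℤ) (x : L), frame u (fun γ => α γ + 2 * Real.pi * n γ) x =
      frame u α (x + ∑ γ : pos, (n γ * pairL x γ) • (γ : L))
  /-- the form of the central charges near the discriminant locus; the sum runs over representatives
  modulo sign -/
  central_charge : ∀ u ∈ U \ C.disc, ∀ α, IsBranch (fun γ : pos => Zt γ u) α → ∀ x,
    C.Z u (frame u α x) = Zt x u + 1 / (2 * Real.pi * Complex.I) *
      ∑ γ : pos, (pairL x γ : ℂ) * Zt γ u *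
        ((Real.log (‖Zt γ u‖ / Real.pi) : ℂ) + α γ * Complex.I - 1)
  /-- the active light charges are those in `± pos`, and their BPS indices are `1` -/
  Ω_light : ∀ u ∈ U \ C.disc, ∀ α, IsBranch (fun γ : pos => Zt γ u) α → ∀ x ∈ light,
    C.Ω u (frame u α x) = if x ∈ pos ∨ -x ∈ pos then 1 else 0
  /-- the differentials `dZ_x`, for `x` in the orthogonal complement `Γ̂_local` of `Γ̂_light`, span
  the holomorphic cotangent spaces -/
  local_span : ∀ u ∈ U, Submodule.span ℂ
    {φ : TangentSpace 𝓘(ℂ, CSpace r) u →L[ℂ] ℂ |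
      ∃ x : L, (∀ y ∈ light, pairL x y = 0) ∧ φ = holoDiff (Zt x) u} = ⊤
  disc_eq : C.disc ∩ U = {u ∈ U | ∃ γ : pos, Zt γ u = 0}
  /-- at `u ∈ U ∩ B''`, for a unitary character `θ` of `Γ̂_light` that restricts to `θ_f`, the set
  `S` of `γ ∈ pos` with `Z_γ(u) = θ_γ = 0` is a basis of a primitive sublattice of the image of
  `Γ̂_light` in the gauge charge lattice: it is linearly independent ... -/
  collapse_independent : ∀ u ∈ U ∩ C.disc, ∀ θ : light →+ Real.Angle,
    (∀ (f : C.Flavor) (h : flavorL f ∈ light), θ ⟨flavorL f, h⟩ = C.θf f) →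
    ∀ c : pos → ℤ,
      (∀ γ : pos, ¬(Zt γ u = 0 ∧ θ ⟨γ, pos_light γ γ.2⟩ = 0) → c γ = 0) →
      ∑ γ : pos, c γ • (γ : L) ∈ flavorL.range → c = 0
  /-- ... and it spans a primitive sublattice -/
  collapse_primitive : ∀ u ∈ U ∩ C.disc, ∀ θ : light →+ Real.Angle,
    (∀ (f : C.Flavor) (h : flavorL f ∈ light), θ ⟨flavorL f, h⟩ = C.θf f) →
    ∀ c : pos → ℤ,
      (∀ γ : pos, ¬(Zt γ u = 0 ∧ θ ⟨γ, pos_light γ γ.2⟩ = 0) → c γ = 0) →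
      ∀ x ∈ light, ∀ N : ℤ, N ≠ 0 → N • x - ∑ γ : pos, c γ • (γ : L) ∈ flavorL.range →
      ∃ c' : pos → ℤ,
        (∀ γ : pos, ¬(Zt γ u = 0 ∧ θ ⟨γ, pos_light γ γ.2⟩ = 0) → c' γ = 0) ∧
        x - ∑ γ : pos, c' γ • (γ : L) ∈ flavorL.range

attribute [instance] SingularNbhd.groupL

namespace SingularNbhd

variable {C : CoulombData r B} (N : SingularNbhd C)

/-- The principal arguments of the light central charges. -/
def argBranch (u : B) : N.pos → ℝ := fun γ => (N.Zt γ u).arg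

lemma argBranch_isBranch (u : B) :
    IsBranch (fun γ : N.pos => N.Zt γ u) (N.argBranch u) :=
  fun γ => (Complex.norm_mul_exp_arg_mul_I (N.Zt γ u)).symm

/-! ### The manifold `M'_U` -/

/-- `M'_U`: pairs of a point of `U \ B''` and a twisted unitary character of the charge lattice
restricting to the flavor character. -/
structure Regular where
  u : B
  mem : u ∈ N.U \ C.disc
  θ : C.charge.Fiber u → Real.Angle
  twisted : ∀ x y, θ (x + y) = θ x + θ y + ((Real.pi * C.pair u x y : ℝ) : Real.Angle)
  flavor : ∀ f, θ (C.flavorIncl u f) = C.θf f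

/-! ### The space `M_U` -/

/-- A point `u` of `U`, a choice of arguments at `u`, and a twisted unitary character on the typical
fiber of the charge lattice. Over `U \ B''` the choice of arguments makes this a point of `M'_U`. -/
structure PrePoint where
  u : B
  mem : u ∈ N.U
  α : N.pos → ℝ
  branch : IsBranch (fun γ : N.pos => N.Zt γ u) α
  θ : N.L → Real.Angle
  twisted : ∀ x y, θ (x + y) = θ x + θ y + ((Real.pi * N.pairL x y : ℝ) : Real.Angle)
  flavor : ∀ f, θ (N.flavorL f) = C.θf f

/-- Two points are identified if they lie over the same point of `U`, and
`θ'_x - ∑ ⟨x, γ⟩ (arg Z_γ / 2π) (θ_γ - π)`, where `θ_γ ∈ [0, 2π)`, has the same value on both up to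
the torus with parameters `ε_γ` for the `γ` with `Z_γ = θ_γ = 0`, which is collapsed.
Here `γ` runs over `N.pos`. -/
def rel (P Q : N.PrePoint) : Prop :=
  P.u = Q.u ∧ ∃ ε : N.pos → ℝ,
    (∀ x, Q.θ x = P.θ x + ((∑ γ : N.pos, (N.pairL x γ : ℝ) * ε γ : ℝ) : Real.Angle)) ∧
    ∀ γ : N.pos, (N.Zt γ P.u = 0 ∧ P.θ γ = 0) ∨
      ε γ = (Q.α γ - P.α γ) / (2 * Real.pi) * (liftAngle (P.θ γ) - Real.pi)

lemma rel_light {P Q : N.PrePoint} (h : N.rel P Q) (γ : N.pos) : Q.θ γ = P.θ γ := by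
  obtain ⟨-, ε, hε, -⟩ := h
  rw [hε γ]
  have : ∑ γ' : N.pos, (N.pairL (γ : N.L) (γ' : N.L) : ℝ) * ε γ' = 0 := by
    refine Finset.sum_eq_zero fun γ' _ => ?_
    rw [N.light_isotropic _ (N.pos_light _ γ.2) _ (N.pos_light _ γ'.2)]
    simp
  rw [this]
  simp

lemma rel_equivalence : Equivalence N.rel where
  refl P := ⟨rfl, fun _ => 0, fun x => by simp, fun γ => Or.inr (by simp)⟩
  symm {P Q} h := by
    have hl := N.rel_light h
    obtain ⟨hu, ε, hθ, hε⟩ := h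
    refine ⟨hu.symm, fun γ => -ε γ, fun x => ?_, fun γ => ?_⟩
    · rw [hθ x, add_assoc, ← Real.Angle.coe_add, ← Finset.sum_add_distrib]
      simp
    · rw [hl γ, ← hu]
      rcases hε γ with h | h
      · exact Or.inl h
      · right
        simp only [h]
        ring
  trans {P Q R} h h' := by
    have hl := N.rel_light h
    obtain ⟨hu, ε, hθ, hε⟩ := h
    obtain ⟨hu', ε', hθ', hε'⟩ := h'
    refine ⟨hu.trans hu', fun γ => ε γ + ε' γ, fun x => ?_, fun γ => ?_⟩
    · rw [hθ' x, hθ x, add_assoc, ← Real.Angle.coe_add, ← Finset.sum_add_distrib]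
      simp only [mul_add]
    · have h2 := hε' γ
      rw [hl γ, ← hu] at h2
      rcases hε γ with h | h
      · exact Or.inl h
      · rcases h2 with h2 | h2
        · exact Or.inl h2
        · right
          simp only [h, h2]
          ring

/-- The equivalence relation defining `M_U`. -/
instance totalSetoid : Setoid N.PrePoint := ⟨N.rel, N.rel_equivalence⟩

/-- The space `M_U`. -/
def Total : Type := Quotient N.totalSetoid

/-- The inclusion of `M'_U` in `M_U`. -/
def incl (m : N.Regular) : N.Total :=
  Quotient.mk N.totalSetoid
    { u := m.u
      mem := m.mem.1
      α := N.argBranch m.u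
      branch := N.argBranch_isBranch m.u
      θ := fun x => m.θ (N.frame m.u (N.argBranch m.u) x)
      twisted := fun x y => by
        rw [map_add, m.twisted, N.frame_pair _ m.mem _ (N.argBranch_isBranch m.u)]
      flavor := fun f => by
        rw [N.frame_flavor _ m.mem _ (N.argBranch_isBranch m.u), m.flavor] }

/-- The point of `M_U` represented by `P` has the coordinates `(u, ϑ, t, w₁, w₂)`, with respect to the
set `K` of light charges for which the coordinates `w₁, w₂` are used:
* `Z_γ = (i/2) w₁ w₂` and `θ_γ = (|w₂|² - |w₁|²)/2` for `γ ∈ K`;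
* `θ_γ = t_γ ∈ (0, 2π)` if `Z_γ = 0` and `γ ∉ K`;
* `ϑ_x = θ_x - ∑ ⟨x, γ⟩ (arg Z_γ / 2π) (t_γ - π) - ∑_{γ ∈ K} ⟨x, γ⟩ arg w₂`. -/
def HasCoords (P : N.PrePoint) (K : Set N.pos) (u : B) (ϑ : N.L → ℝ) (t : N.pos → ℝ)
    (w₁ w₂ : N.pos → ℂ) : Prop :=
  P.u = u ∧ ∃ β₁ β₂ : N.pos → ℝ,
    (∀ γ : N.pos, P.θ γ = (t γ : Real.Angle)) ∧
    (∀ γ ∈ K, w₁ γ = (‖w₁ γ‖ : ℂ) * Complex.exp (β₁ γ * Complex.I) ∧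
      w₂ γ = (‖w₂ γ‖ : ℂ) * Complex.exp (β₂ γ * Complex.I) ∧
      P.α γ = β₁ γ + β₂ γ + Real.pi / 2 ∧
      t γ = (‖w₂ γ‖ ^ 2 - ‖w₁ γ‖ ^ 2) / 2 ∧ |t γ| < 2 * Real.pi ∧
      N.Zt γ u = Complex.I / 2 * w₁ γ * w₂ γ) ∧
    (∀ γ ∉ K, N.Zt γ u = 0 → 0 < t γ ∧ t γ < 2 * Real.pi) ∧
    ∀ x, P.θ x = ((ϑ x + ∑ γ : N.pos, (N.pairL x γ : ℝ) *
      (K.indicator β₂ γ + P.α γ / (2 * Real.pi) * (t γ - Real.pi)) : ℝ) : Real.Angle)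

/-- A map from an open subset `W` of `ℝ^n` to `M_U` is smooth if it can locally be given by
smooth coordinates `(u, ϑ, t, w₁, w₂)`. -/
def SmoothOn {n : ℕ} (W : Set (RSpace n)) (p : RSpace n → N.Total) : Prop :=
  ∀ s₀ ∈ W, ∃ V : Set (RSpace n), IsOpen V ∧ s₀ ∈ V ∧ V ⊆ W ∧
    ∃ (K : Set N.pos) (u : RSpace n → B) (ϑ : N.L → RSpace n → ℝ) (t : N.pos → RSpace n → ℝ)
      (w₁ w₂ : N.pos → RSpace n → ℂ),
      ContMDiffOn 𝓘(ℝ, RSpace n) 𝓘(ℝ, CSpace r) ∞ u V ∧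
      (∀ x, ContDiffOn ℝ ∞ (ϑ x) V) ∧ (∀ γ, ContDiffOn ℝ ∞ (t γ) V) ∧
      (∀ γ, ContDiffOn ℝ ∞ (w₁ γ) V) ∧ (∀ γ, ContDiffOn ℝ ∞ (w₂ γ) V) ∧
      ∀ s ∈ V, ∃ P : N.PrePoint, p s = Quotient.mk N.totalSetoid P ∧
        N.HasCoords P K (u s) (fun x => ϑ x s) (fun γ => t γ s) (fun γ => w₁ γ s)
          (fun γ => w₂ γ s)

lemma exists_hasCoords (P : N.PrePoint) : ∃ (K : Set N.pos) (ϑ : N.L → ℝ) (t : N.pos → ℝ),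
    N.HasCoords P K P.u ϑ t (fun _ => 0) (fun _ => 0) := by
  refine ⟨{γ | N.Zt γ P.u = 0 ∧ P.θ γ = 0},
    fun x => (P.θ x).toReal - ∑ γ : N.pos, (N.pairL x γ : ℝ) *
      (P.α γ / (2 * Real.pi) * (liftAngle (P.θ γ) - Real.pi)),
    fun γ => liftAngle (P.θ γ), rfl, fun γ => P.α γ - Real.pi / 2, fun _ => 0,
    fun γ => (liftAngle_coe _).symm, ?_, ?_, ?_⟩
  · rintro γ ⟨h1, h2⟩
    have h0 : liftAngle (P.θ γ) = 0 := by
      rw [h2]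
      simp [liftAngle]
    refine ⟨by simp, by simp, by ring, by simp [h0], ?_, by simp [h1]⟩
    simp only [h0]
    simpa using Real.pi_pos
  · intro γ hγ h1
    refine ⟨lt_of_le_of_ne (liftAngle_nonneg _) fun h : 0 = liftAngle (P.θ γ) => hγ ⟨h1, ?_⟩, liftAngle_lt _⟩
    rw [← liftAngle_coe (P.θ γ), ← h]
    simp
  · intro x
    have hi : ∀ γ : N.pos, ({γ | N.Zt γ P.u = 0 ∧ P.θ γ = 0} : Set N.pos).indicator
        (fun _ => (0 : ℝ)) γ = 0 := fun γ => by simp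
    simp only [hi, zero_add, sub_add_cancel, Real.Angle.coe_toReal]

/-- The smooth structure of `M_U`, given by its smooth maps from Euclidean spaces. -/
instance totalDiffeology : DiffeologicalSpace N.Total :=
  DiffeologicalSpace.ofCorePlotsOn
    { isPlotOn := fun {_ W} _ p => N.SmoothOn W p
      isPlotOn_congr := by
        have key : ∀ {n : ℕ} {W : Set (RSpace n)} {p q : RSpace n → N.Total},
            Set.EqOn p q W → N.SmoothOn W p → N.SmoothOn W q := by
          intro n W p q h hp s₀ hs₀
          obtain ⟨V, hV, hs, hVW, K, u, ϑ, t, w₁, w₂, h1, h2, h3, h4, h5, h6⟩ := hp s₀ hs₀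
          refine ⟨V, hV, hs, hVW, K, u, ϑ, t, w₁, w₂, h1, h2, h3, h4, h5, fun s hs => ?_⟩
          rw [← h (hVW hs)]
          exact h6 s hs
        intro n W hW p q h
        exact ⟨key h, key h.symm⟩
      isPlot_const := by
        intro n x s₀ _
        obtain ⟨P, rfl⟩ := Quotient.exists_rep x
        obtain ⟨K, ϑ, t, h⟩ := N.exists_hasCoords P
        exact ⟨Set.univ, isOpen_univ, Set.mem_univ _, subset_rfl, K, fun _ => P.u,
          fun x _ => ϑ x, fun γ _ => t γ, fun _ _ => 0, fun _ _ => 0, contMDiffOn_const,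
          fun _ => contDiffOn_const, fun _ => contDiffOn_const, fun _ => contDiffOn_const,
          fun _ => contDiffOn_const, fun s _ => ⟨P, rfl, h⟩⟩
      isPlotOn_reparam := by
        intro n m W W' hW hW' p f hf hp hfs s₀ hs₀
        obtain ⟨V, hV, hs, hVW, K, u, ϑ, t, w₁, w₂, h1, h2, h3, h4, h5, h6⟩ := hp _ (hf hs₀)
        have hm : Set.MapsTo f (W' ∩ f ⁻¹' V) V := fun s hs => hs.2
        have hfs' := hfs.mono (Set.inter_subset_left (s := W') (t := f ⁻¹' V))
        exact ⟨W' ∩ f ⁻¹' V, hfs.continuousOn.isOpen_inter_preimage hW' hV, ⟨hs₀, hs⟩,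
          Set.inter_subset_left, K, u ∘ f, fun x => ϑ x ∘ f, fun γ => t γ ∘ f,
          fun γ => w₁ γ ∘ f, fun γ => w₂ γ ∘ f, h1.comp hfs'.contMDiffOn hm,
          fun x => (h2 x).comp hfs' hm, fun γ => (h3 γ).comp hfs' hm,
          fun γ => (h4 γ).comp hfs' hm, fun γ => (h5 γ).comp hfs' hm, fun s hs => h6 _ hs.2⟩
      locality := by
        intro n W hW p h s₀ hs₀
        obtain ⟨V', hV', hs', hp⟩ := h s₀ hs₀
        obtain ⟨V, hV, hs, hVW, K, u, ϑ, t, w₁, w₂, h1, h2, h3, h4, h5, h6⟩ := hp s₀ hs'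
        exact ⟨V ∩ W, hV.inter hW, ⟨hs, hs₀⟩, Set.inter_subset_right, K, u, ϑ, t, w₁, w₂,
          h1.mono Set.inter_subset_left, fun x => (h2 x).mono Set.inter_subset_left,
          fun x => (h3 x).mono Set.inter_subset_left, fun x => (h4 x).mono Set.inter_subset_left,
          fun x => (h5 x).mono Set.inter_subset_left, fun s hs => h6 s hs.1⟩ }

/-! ### The model twisted characters and 2-forms -/

/-- The semi-flat twisted character `X^sf_γ(ζ) = exp(Z_γ/ζ + iθ_γ + ζ conj(Z_γ))`. -/
def Xsf (m : N.Regular) (ζ : ℂ) (γ : C.charge.Fiber m.u) : ℂ :=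
  Complex.exp (C.Z m.u γ / ζ + ζ * (starRingEnd ℂ) (C.Z m.u γ)) * ((m.θ γ).toCircle : ℂ)

open Classical in
/-- The active light charges, in the typical fiber. -/
def active : Finset N.L := N.pos ∪ N.pos.image fun γ => -γ

end SingularNbhd

end Data

/-- A decomposition of `ℂ \ {0}` into `2K` half-open sectors of opening angle `π/K`, `K ≥ 5`; the
boundary rays `r_A`, for `A` an integer modulo `2K`, have the angles `offset + A π / K`, and each
sector contains its clockwise boundary ray. -/
structure Sectors where
  K : ℕ
  five_le : 5 ≤ K
  offset : ℝ

/-- The angle of the ray `r_A`. -/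
def Sectors.angle (V : Sectors) (A : ℤ) : ℝ := V.offset + A * Real.pi / V.K

/-- The ray from `0` to `∞` with the given angle. -/
def ray (φ : ℝ) : Set ℂ := {z | ∃ s : ℝ, 0 < s ∧ z = s * Complex.exp (φ * Complex.I)}

/-- The angle of the counterclockwise boundary ray of the sector that contains `z ≠ 0`. -/
def Sectors.endAngle (V : Sectors) (z : ℂ) : ℝ :=
  V.angle (⌊(z.arg - V.offset) * V.K / Real.pi⌋ + 1)

namespace SingularNbhd

variable {r : ℕ} {B : Type} [TopologicalSpace B] [ChartedSpace (CSpace r) B]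
  {C : CoulombData r B} (N : SingularNbhd C)

/-- The sectorial decomposition is good at `u ∈ U \ B''`: no boundary ray is one of the rays
`ℓ_γ(u) = -Z_γ(u) ℝ_{>0}`, for `γ` an active light charge. -/
def IsGood (V : Sectors) (u : B) : Prop :=
  ∀ x ∈ N.active, ∀ A : ℤ, -C.Z u (N.frame u (N.argBranch u) x) ∉ ray (V.angle A)

/-- `∫_r dζ'/ζ' (ζ'+ζ)/(ζ'-ζ) log(1 - X^sf_γ(ζ'))` over the ray `r` of angle `φ`. -/
def rayIntegral (m : N.Regular) (ζ : ℂ) (γ : C.charge.Fiber m.u) (φ : ℝ) : ℂ :=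
  ∫ s in Set.Ioi (0 : ℝ), (1 / s : ℂ) *
    ((s * Complex.exp (φ * Complex.I) + ζ) / (s * Complex.exp (φ * Complex.I) - ζ)) *
    Complex.log (1 - N.Xsf m (s * Complex.exp (φ * Complex.I)) γ)

/-- The model twisted character: `X^model_γ(ζ)` is
`X^sf_γ(ζ) exp(-(1/4πi) ∑_γ' Ω(γ') ⟨γ, γ'⟩ ∫_{r⁻} dζ'/ζ' (ζ'+ζ)/(ζ'-ζ) log(1 - X^sf_γ'(ζ')))`,
where `γ'` runs over the active light charges, and `r⁻` is the ray infinitesimally clockwise of the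
counterclockwise boundary ray `r` of the sector that contains the ray `ℓ_γ'`. -/
def Xmodel (V : Sectors) (m : N.Regular) (ζ : ℂ) (γ : C.charge.Fiber m.u) : ℂ :=
  N.Xsf m ζ γ * Complex.exp (-(1 / (4 * Real.pi * Complex.I)) *
    ∑ x ∈ N.active, (C.Ω m.u (N.frame m.u (N.argBranch m.u) x) : ℂ) *
      (C.pair m.u γ (N.frame m.u (N.argBranch m.u) x) : ℂ) *
      Filter.limUnder (𝓝[>] (0 : ℝ)) (fun δ =>
        N.rayIntegral m ζ (N.frame m.u (N.argBranch m.u) x)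
          (V.endAngle (-C.Z m.u (N.frame m.u (N.argBranch m.u) x)) - δ)))

/-- The value on the vector `v` of the pullback along `q : ℝ^n → M'_U` of the 1-form
`d log X^model(ζ)`, which has values in `Hom(Γ̂, ℂ)`; flat sections of `Γ̂` are used to
differentiate. -/
def dlogXmodel (V : Sectors) (ζ : ℂ) {n : ℕ} (q : RSpace n → N.Regular) (s v : RSpace n)
    (γ : C.charge.Fiber (q s).u) : ℂ :=
  fderiv ℝ (fun s' => N.Xmodel V (q s') ζ (C.charge.transport (q s).u (q s').u γ)) s v /
    N.Xmodel V (q s) ζ γ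

/-- The pullback along `q : ℝ^n → M'_U` of the 2-form
`ϖ^model(ζ) = (1/8π) ⟨d log X^model(ζ) ∧ d log X^model(ζ)⟩`, evaluated on the vectors `v`, `w`. -/
def varpiModel (V : Sectors) (ζ : ℂ) {n : ℕ} (q : RSpace n → N.Regular) (s v w : RSpace n) : ℂ :=
  1 / (4 * Real.pi) *
    dualPairing (C.pair (q s).u) (N.dlogXmodel V ζ q s v) (N.dlogXmodel V ζ q s w)

end SingularNbhd

end ModelGeometry

end

/-!
The idea is to write everything in the flat frame of the charge lattice. There the logarithmic
derivative of the model characters is that of the semi-flat characters of the regular parts `Z̃`,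
plus, for each light charge `γ` up to sign, a multiple of the functional `⟨·, γ⟩`. The light
charges are mutually orthogonal, so in the inverse pairing each of them contributes separately,
and only through the wedge product of that multiple with `d log X^sf_γ(ζ)`. It has to be shown
that this contribution is a Laurent polynomial in `ζ` whose coefficients are smooth closed forms
in the coordinates of the extended space.

*Dependence on `ζ`.* The ray integrals of `γ` and `-γ` may be rotated to the BPS ray
(`integral_ray_eq`). In the wedge product of their differentials with `d log X^sf_γ(ζ)` the pole
of the Cauchy kernel cancels, and what remains are three moments (`rayForm_wedge`), which are
Bessel sums. So only `ζ⁻¹`, `1`, `ζ` occur, and the coefficients are given by two functions of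
`ρ = |Z_γ|` and `t = θ_γ`, the potential `instU` and the connection coefficient `instW` of a
periodic monopole.

*Smoothness.* Poisson resummation (`theta_inversion`) turns the Bessel sums into sums over the
images of the charge at `t ∈ 2πℤ`. With `R = √(4ρ² + t²)`, for `|t| < 2π`, the image at `t = 0`
contributes `1/(2R)` to `instU` and `(t/R - 1)/2` to `instW`, and the other images contribute `u`
and `ρ² g` with smooth functions `u, g` of `(ρ², t)` (`instU_eq`, `instW_eq'`); these extend
holomorphically to complex arguments, as locally uniform limits of holomorphic functions, and obey
the monopole equations. The singular terms belong to the Hopf coordinates `Z = (i/2) w₁ w₂`,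
`t = (|w₂|² - |w₁|²)/2` of flat space: together with the angle conjugate to `t` they give the
constant coefficient forms `½ dw₁ ∧ dw₂` and `(i/2)(dw₁ ∧ dw̄₁ + dw₂ ∧ dw̄₂)` (`light_eq_of_ne_zero`).
Hence the contribution of `γ` is given by the smooth forms `lightPlus` and `lightZero`, which are
closed by the monopole equations (`extDeriv_light`).

*Globalisation.* Every smooth map to the extended space has coordinates near each point in which
`w₁, w₂` are used for all light charges (`exists_coords`), and `ω₊`, `ω₃` are defined by a formula
in such coordinates (`Coords.formPlus`, `Coords.formZero`). Two systems of coordinates give the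
same forms (`Coords.form_eq`). At a point near which each vanishing `Z_γ` and `θ_γ` vanishes
identically, the change of `dϑ` compensates the change of the arguments of `w₁, w₂` charge by
charge; such points are dense in the domain of the map, and the forms are continuous. At regular
points the formula is the model form for every `ζ` (`varpiModel_eq`). The terms in `ζ⁻²` and `ζ²`
vanish as `⟨dZ ∧ dZ⟩ = 0`, since the logarithms in the flat frame do not contribute to this
pairing (`form_dz_dz`).
-/

open scoped Manifold ContDiff Topology

noncomputable section

namespace ModelGeometry

/-! ### The inverse pairing on a finitely generated lattice -/

/-- An additive map to a field of characteristic zero that vanishes on the common kernel of finitely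
many integral functionals is a combination of them: it factors through the image in `ℤ^ι`, and
divisible groups are injective. -/
lemma exists_eq_sum_of_vanish {G K ι : Type} [AddCommGroup G] [Field K] [CharZero K] [Fintype ι]
    [DecidableEq ι] (f : ι → G →+ ℤ) (b : G →+ K) (hb : ∀ x, (∀ i, f i x = 0) → b x = 0) :
    ∃ c : ι → K, ∀ x, b x = ∑ i, c i * (f i x : K) := by
  let F : G →ₗ[ℤ] (ι → ℤ) := LinearMap.pi fun i => (f i).toIntLinearMap
  have hF : LinearMap.ker F ≤ LinearMap.ker b.toIntLinearMap := by
    intro x hx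
    rw [LinearMap.mem_ker] at hx ⊢
    exact hb x fun i => congrFun hx i
  let F' := (LinearMap.ker F).liftQ F le_rfl
  have hF' : Function.Injective F' := by
    rw [← LinearMap.ker_eq_bot]
    exact Submodule.ker_liftQ_eq_bot _ _ _ le_rfl
  let b' := (LinearMap.ker F).liftQ b.toIntLinearMap hF
  -- a field of characteristic zero is divisible, hence an injective `ℤ`-module
  have : DivisibleBy K ℤ :=
    { div := fun a n => a / n
      div_zero := fun a => by simp
      div_cancel := fun {n} a hn => by
        have : (n : K) ≠ 0 := by exact_mod_cast hn
        rw [zsmul_eq_mul]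
        field_simp }
  obtain ⟨h, hh⟩ := (Module.Baer.of_divisible K).extension_property F' hF' b'
  refine ⟨fun i => h (Pi.single i 1), fun x => ?_⟩
  have h1 : b x = h (F x) := (LinearMap.congr_fun hh (Submodule.Quotient.mk x)).symm
  rw [h1, LinearMap.pi_apply_eq_sum_univ h (F x)]
  refine Finset.sum_congr rfl fun i _ => ?_
  have h2 : (fun j => if i = j then (1 : ℤ) else 0) = Pi.single i 1 := by
    ext j
    simp [Pi.single_apply, eq_comm]
  rw [zsmul_eq_mul, mul_comm, h2]
  rfl

/-- A functional vanishes on the radical of a pairing. -/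
def VanishesOnRadical {G K : Type} [AddCommGroup G] [AddCommGroup K] (P : G →+ G →+ ℤ)
    (b : G →+ K) : Prop :=
  ∀ x, (∀ y, P y x = 0) → b x = 0

/-- Elements `e_i` and real coefficients `c_ij` that compute the inverse of a pairing: every
functional `b` that vanishes on the radical is `⟨∑_ij c_ij b(e_j) e_i, ·⟩`. -/
structure InverseMatrix {G : Type} [AddCommGroup G] (P : G →+ G →+ ℤ) where
  k : ℕ
  e : Fin k → G
  c : Fin k → Fin k → ℝ
  repr : ∀ b : G →+ ℂ, VanishesOnRadical P b →
    ∀ x, b x = ∑ i, (∑ j, (c i j : ℂ) * b (e j)) * (P (e i) x : ℂ)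

/-- The real functionals that vanish on the radical form a space `W`. The map from coefficients `v`
to `∑ v_i ⟨e_i, ·⟩` is onto `W`, evaluation on the generators `e_i` is injective on `W`, and a
linear right inverse of the first composed with a linear left inverse of the second is the matrix.
-/
lemma InverseMatrix.nonempty {G : Type} [AddCommGroup G] [Module.Finite ℤ G] (P : G →+ G →+ ℤ) :
    Nonempty (InverseMatrix P) := by
  obtain ⟨k, e, he⟩ := Module.Finite.exists_fin (R := ℤ) (M := G)
  have hgen : ∀ {A : Type} [AddCommGroup A] (f g : G →+ A), (∀ i, f (e i) = g (e i)) → f = g := by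
    intro A _ f g h
    have : f.toIntLinearMap = g.toIntLinearMap := by
      apply LinearMap.ext_on he
      rintro _ ⟨i, rfl⟩
      exact h i
    ext x
    exact LinearMap.congr_fun this x
  let W : Submodule ℝ (G → ℝ) :=
    { carrier := {b | (∀ x y, b (x + y) = b x + b y) ∧ ∀ x, (∀ y, P y x = 0) → b x = 0}
      zero_mem' := ⟨fun _ _ => (add_zero 0).symm, fun x _ => rfl⟩
      add_mem' := fun {a b} ha hb => ⟨fun x y => by
        simp only [Pi.add_apply, ha.1, hb.1]
        ring, fun x hx => by rw [Pi.add_apply, ha.2 x hx, hb.2 x hx, add_zero]⟩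
      smul_mem' := fun r a ha => ⟨fun x y => by
        simp only [Pi.smul_apply, ha.1, smul_add], fun x hx => by
        rw [Pi.smul_apply, ha.2 x hx, smul_zero]⟩ }
  let T : (Fin k → ℝ) →ₗ[ℝ] W :=
    { toFun := fun v => ⟨fun x => ∑ i, v i * (P (e i) x : ℝ), fun x y => by
        simp [mul_add, Finset.sum_add_distrib], fun x hx => by simp [hx]⟩
      map_add' := fun v w => by
        ext x
        simp [add_mul, Finset.sum_add_distrib]
      map_smul' := fun r v => by
        ext x
        simp [Finset.mul_sum, mul_assoc] }
  have hTapp : ∀ v x, (T v : G → ℝ) x = ∑ i, v i * (P (e i) x : ℝ) := fun v x => rfl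
  have hT : Function.Surjective T := by
    rintro ⟨b, hb⟩
    obtain ⟨c, hc⟩ := exists_eq_sum_of_vanish (fun i => P (e i)) (AddMonoidHom.mk' b hb.1)
      (fun x hx => hb.2 x fun y => by
        have : P.flip x = 0 := hgen _ _ fun i => by simpa using hx i
        simpa using DFunLike.congr_fun this y)
    exact ⟨c, Subtype.ext (funext fun x => by rw [hTapp, ← hc x]; rfl)⟩
  let ev : W →ₗ[ℝ] (Fin k → ℝ) :=
    { toFun := fun b i => (b : G → ℝ) (e i)
      map_add' := fun a b => rfl
      map_smul' := fun r a => rfl }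
  have hev : LinearMap.ker ev = ⊥ := by
    rw [LinearMap.ker_eq_bot]
    intro a b h
    exact Subtype.ext (funext fun x => DFunLike.congr_fun
      (hgen (AddMonoidHom.mk' a.1 a.2.1) (AddMonoidHom.mk' b.1 b.2.1) fun i => congrFun h i) x)
  obtain ⟨σ, hσ⟩ := T.exists_rightInverse_of_surjective (LinearMap.range_eq_top.2 hT)
  obtain ⟨l, hl⟩ := ev.exists_leftInverse_of_injective hev
  let τ := σ.comp l
  have hreal : ∀ b : G →+ ℝ, VanishesOnRadical P b → ∀ x,
      b x = ∑ i, (∑ j, τ (Pi.single j 1) i * b (e j)) * (P (e i) x : ℝ) := by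
    intro b hb x
    let b' : W := ⟨b, fun x y => map_add b x y, hb⟩
    have h1 : T (τ (ev b')) = b' := by
      have h2 := LinearMap.congr_fun hl b'
      have h3 := LinearMap.congr_fun hσ b'
      simp only [LinearMap.comp_apply, LinearMap.id_apply] at h2 h3
      simp only [τ, LinearMap.comp_apply, h2, h3]
    have h4 : b x = (T (τ (ev b')) : G → ℝ) x := by rw [h1]
    rw [h4, hTapp]
    refine Finset.sum_congr rfl fun i _ => ?_
    congr 1
    rw [LinearMap.pi_apply_eq_sum_univ τ (ev b'), Finset.sum_apply]
    refine Finset.sum_congr rfl fun j _ => ?_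
    have h2 : (fun l => if j = l then (1 : ℝ) else 0) = Pi.single j 1 := by
      ext l
      simp [Pi.single_apply, eq_comm]
    rw [Pi.smul_apply, smul_eq_mul, mul_comm, h2]
    rfl
  refine ⟨⟨k, e, fun i j => τ (Pi.single j 1) i, fun b hb x => ?_⟩⟩
  have hre := hreal (Complex.reAddGroupHom.comp b) (fun x hx => by simp [hb x hx]) x
  have him := hreal (Complex.imAddGroupHom.comp b) (fun x hx => by simp [hb x hx]) x
  apply Complex.ext
  · simpa [Complex.re_sum, Complex.im_sum] using hre
  · simpa [Complex.re_sum, Complex.im_sum] using him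

namespace InverseMatrix

variable {G : Type} [AddCommGroup G] {P : G →+ G →+ ℤ} (M : InverseMatrix P)

/-- The inverse pairing computed from the matrix. -/
def form (a b : G →+ ℂ) : ℂ := ∑ i, ∑ j, (M.c i j : ℂ) * a (M.e i) * b (M.e j)

lemma form_eq_of_repr (hP : ∀ x y, P x y = -P y x) {a b : G →+ ℂ} (ha : VanishesOnRadical P a)
    {κ : Type} (s : Finset κ) (w : κ → ℂ) (g : κ → G) (hb : ∀ x, b x = ∑ l ∈ s, w l * (P (g l) x : ℂ)) :
    M.form a b = ∑ l ∈ s, w l * a (g l) := by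
  have hb0 : VanishesOnRadical P b := fun x hx => by
    rw [hb x]
    exact Finset.sum_eq_zero fun l _ => by simp [hx]
  set β : Fin M.k → ℂ := fun i => ∑ j, (M.c i j : ℂ) * b (M.e j) with hβ
  set α : Fin M.k → ℂ := fun i => ∑ j, (M.c i j : ℂ) * a (M.e j) with hα
  have h1 : M.form a b = ∑ i, β i * a (M.e i) := by
    simp only [form, hβ, Finset.sum_mul]
    exact Finset.sum_congr rfl fun i _ => Finset.sum_congr rfl fun j _ => by ring
  have h2 : ∀ x, a x = ∑ m, α m * (P (M.e m) x : ℂ) := M.repr a ha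
  have h3 : ∀ x, b x = ∑ i, β i * (P (M.e i) x : ℂ) := M.repr b hb0
  have key : ∀ m, ∑ i, β i * (P (M.e m) (M.e i) : ℂ) = ∑ l ∈ s, w l * (P (M.e m) (g l) : ℂ) := by
    intro m
    have h4 := (h3 (M.e m)).symm.trans (hb (M.e m))
    calc _ = -∑ i, β i * (P (M.e i) (M.e m) : ℂ) := by
            rw [← Finset.sum_neg_distrib]
            exact Finset.sum_congr rfl fun i _ => by rw [hP]; push_cast; ring
      _ = _ := by
            rw [h4, ← Finset.sum_neg_distrib]
            exact Finset.sum_congr rfl fun i _ => by rw [hP]; push_cast; ring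
  rw [h1]
  simp only [h2, Finset.mul_sum]
  rw [Finset.sum_comm, Finset.sum_comm (s := s)]
  refine Finset.sum_congr rfl fun m _ => ?_
  calc _ = α m * ∑ i, β i * (P (M.e m) (M.e i) : ℂ) := by
          rw [Finset.mul_sum]
          exact Finset.sum_congr rfl fun i _ => by ring
    _ = _ := by
          rw [key, Finset.mul_sum]
          exact Finset.sum_congr rfl fun i _ => by ring

/-- The inverse pairing of a charge lattice, computed in the typical fiber. -/
lemma dualPairing_eq {H : Type} [AddCommGroup H] {Q : H →+ H →+ ℤ} (F : G →+ H)
    (hF : Function.Bijective F) (hQ : ∀ x y, Q (F x) (F y) = P x y) (hP : ∀ x y, P x y = -P y x)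
    (a b : H → ℂ) (a' b' : G →+ ℂ) (haa : ∀ x, a (F x) = a' x) (hbb : ∀ x, b (F x) = b' x)
    (ha : VanishesOnRadical P a') (hb : VanishesOnRadical P b') :
    dualPairing Q a b = M.form a' b' := by
  classical
  have hex : ∃ c : H →₀ ℂ, ∀ x, b x = c.sum fun γ z => z * (Q γ x : ℂ) := by
    refine ⟨∑ i, Finsupp.single (F (M.e i)) (∑ j, (M.c i j : ℂ) * b' (M.e j)), fun x => ?_⟩
    obtain ⟨x, rfl⟩ := hF.2 x
    rw [hbb, M.repr b' hb x, ← Finsupp.sum_finsetSum_index (by simp) (by intros; ring)]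
    refine Finset.sum_congr rfl fun i _ => ?_
    rw [Finsupp.sum_single_index (by simp), hQ]
  rw [dualPairing, dif_pos hex]
  have hc := hex.choose_spec
  set c := hex.choose
  choose g hg using hF.2
  rw [M.form_eq_of_repr hP ha c.support c g (fun x => by
    rw [← hbb, hc, Finsupp.sum]
    refine Finset.sum_congr rfl fun l _ => ?_
    rw [← hQ, hg]), Finsupp.sum]
  refine Finset.sum_congr rfl fun l _ => ?_
  rw [← haa, hg]

lemma form_antisymm (hP : ∀ x y, P x y = -P y x) {a b : G →+ ℂ} (ha : VanishesOnRadical P a)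
    (hb : VanishesOnRadical P b) : M.form a b = -M.form b a := by
  rw [M.form_eq_of_repr hP ha Finset.univ _ M.e (M.repr b hb)]
  have h1 : ∀ i, a (M.e i) = -∑ m, (∑ j, (M.c m j : ℂ) * a (M.e j)) * (P (M.e i) (M.e m) : ℂ) := by
    intro i
    rw [M.repr a ha (M.e i), ← Finset.sum_neg_distrib]
    exact Finset.sum_congr rfl fun m _ => by rw [hP]; push_cast; ring
  rw [M.form_eq_of_repr hP hb Finset.univ _ M.e (M.repr a ha)]
  have h2 : ∀ m, b (M.e m) = ∑ i, (∑ j, (M.c i j : ℂ) * b (M.e j)) * (P (M.e i) (M.e m) : ℂ) :=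
    fun m => M.repr b hb _
  conv_lhs => enter [2, i]; rw [h1 i]
  conv_rhs => enter [1, 2, i]; rw [h2 i]
  simp only [mul_neg, Finset.mul_sum, Finset.sum_neg_distrib]
  rw [Finset.sum_comm]
  congr 1
  exact Finset.sum_congr rfl fun i _ => Finset.sum_congr rfl fun j _ => by ring

/-- The functional `⟨·, γ⟩`. -/
def pairRight (P : G →+ G →+ ℤ) (γ : G) : G →+ ℂ := (Int.castAddHom ℂ).comp (P.flip γ)

@[simp] lemma pairRight_apply (γ x : G) : pairRight P γ x = (P x γ : ℂ) := rfl

lemma pairRight_vanishes (hP : ∀ x y, P x y = -P y x) (γ : G) :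
    VanishesOnRadical P (pairRight P γ) := fun x hx => by
  rw [pairRight_apply, hP, hx]
  simp

lemma form_pairRight (hP : ∀ x y, P x y = -P y x) {a : G →+ ℂ} (ha : VanishesOnRadical P a)
    (γ : G) : M.form a (pairRight P γ) = -a γ := by
  rw [M.form_eq_of_repr hP ha {()} (fun _ => -1) (fun _ => γ) (fun x => by
    rw [pairRight_apply, hP]
    simp)]
  simp

lemma pairRight_form (hP : ∀ x y, P x y = -P y x) {a : G →+ ℂ} (ha : VanishesOnRadical P a)
    (γ : G) : M.form (pairRight P γ) a = a γ := by
  rw [M.form_antisymm hP (pairRight_vanishes hP γ) ha, M.form_pairRight hP ha, neg_neg]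

lemma form_add_left (a a' b : G →+ ℂ) : M.form (a + a') b = M.form a b + M.form a' b := by
  simp only [form, AddMonoidHom.add_apply, mul_add, add_mul, Finset.sum_add_distrib]

lemma form_add_right (a b b' : G →+ ℂ) : M.form a (b + b') = M.form a b + M.form a b' := by
  simp only [form, AddMonoidHom.add_apply, mul_add, Finset.sum_add_distrib]

lemma form_smul_left (z : ℂ) (a b : G →+ ℂ) : M.form (z • a) b = z * M.form a b := by
  simp only [form, AddMonoidHom.smul_apply, smul_eq_mul, Finset.mul_sum]
  exact Finset.sum_congr rfl fun i _ => Finset.sum_congr rfl fun j _ => by ring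

lemma form_smul_right (z : ℂ) (a b : G →+ ℂ) : M.form a (z • b) = z * M.form a b := by
  simp only [form, AddMonoidHom.smul_apply, smul_eq_mul, Finset.mul_sum]
  exact Finset.sum_congr rfl fun i _ => Finset.sum_congr rfl fun j _ => by ring

lemma form_sum_left {κ : Type} (s : Finset κ) (a : κ → G →+ ℂ) (b : G →+ ℂ) :
    M.form (∑ l ∈ s, a l) b = ∑ l ∈ s, M.form (a l) b := by
  classical
  induction s using Finset.induction_on with
  | empty => simp [form]
  | insert x s hx ih => rw [Finset.sum_insert hx, Finset.sum_insert hx, form_add_left, ih]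

lemma form_sum_right {κ : Type} (s : Finset κ) (a : G →+ ℂ) (b : κ → G →+ ℂ) :
    M.form a (∑ l ∈ s, b l) = ∑ l ∈ s, M.form a (b l) := by
  classical
  induction s using Finset.induction_on with
  | empty => simp [form]
  | insert x s hx ih => rw [Finset.sum_insert hx, Finset.sum_insert hx, form_add_right, ih]

end InverseMatrix

end ModelGeometry

namespace ModelGeometry

/-! ### Holomorphic functions of several variables are smooth -/

section Holomorphic

variable {E : Type*} [NormedAddCommGroup E] [NormedSpace ℂ E]

/-- The Cauchy estimate for the differential of a holomorphic function of several variables. -/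
lemma norm_fderiv_le_of_bounded {f : E → ℂ} {y : E} {δ M : ℝ} (hδ : 0 < δ)
    (hf : ∀ x ∈ Metric.closedBall y δ, DifferentiableAt ℂ f x)
    (hM : ∀ x ∈ Metric.closedBall y δ, ‖f x‖ ≤ M) : ‖fderiv ℂ f y‖ ≤ M / δ := by
  have hM0 : 0 ≤ M := (norm_nonneg _).trans (hM y (Metric.mem_closedBall_self hδ.le))
  refine ContinuousLinearMap.opNorm_le_bound _ (by positivity) fun w => ?_
  rcases eq_or_ne w 0 with rfl | hw
  · simp
  have hw' : 0 < ‖w‖ := norm_pos_iff.2 hw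
  have hR : 0 < δ / ‖w‖ := by positivity
  have hmem : ∀ z ∈ Metric.closedBall (0 : ℂ) (δ / ‖w‖), y + z • w ∈ Metric.closedBall y δ := by
    intro z hz
    rw [mem_closedBall_zero_iff] at hz
    rw [Metric.mem_closedBall, dist_eq_norm, add_sub_cancel_left, norm_smul]
    calc ‖z‖ * ‖w‖ ≤ δ / ‖w‖ * ‖w‖ := by gcongr
      _ = δ := by field_simp
  have hd : ∀ z ∈ Metric.closedBall (0 : ℂ) (δ / ‖w‖),
      HasDerivAt (fun z : ℂ => f (y + z • w)) (fderiv ℂ f (y + z • w) w) z := by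
    intro z hz
    have h1 : HasDerivAt (fun z : ℂ => y + z • w) w z := by
      simpa using ((hasDerivAt_id z).smul_const w).const_add y
    exact (hf _ (hmem z hz)).hasFDerivAt.comp_hasDerivAt z h1
  have hcl : DiffContOnCl ℂ (fun z : ℂ => f (y + z • w)) (Metric.ball 0 (δ / ‖w‖)) := by
    apply DifferentiableOn.diffContOnCl
    rw [closure_ball _ hR.ne']
    exact fun z hz => (hd z hz).differentiableAt.differentiableWithinAt
  have h2 := Complex.norm_deriv_le_of_forall_mem_sphere_norm_le hR hcl
    (fun z hz => hM _ (hmem z (Metric.sphere_subset_closedBall hz)))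
  rw [(hd 0 (Metric.mem_closedBall_self hR.le)).deriv, zero_smul, add_zero] at h2
  refine h2.trans_eq ?_
  field_simp

/-- The directional derivatives of a holomorphic function are holomorphic: differentiate Cauchy's
integral formula on the complex lines in the given direction. -/
lemma differentiableOn_fderiv_apply [FiniteDimensional ℂ E] {f : E → ℂ} {U : Set E} (hU : IsOpen U)
    (hf : DifferentiableOn ℂ f U) (v : E) : DifferentiableOn ℂ (fun x => fderiv ℂ f x v) U := by
  intro x₀ hx₀
  apply DifferentiableAt.differentiableWithinAt
  have : ProperSpace E := FiniteDimensional.proper ℂ E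
  have hd : ∀ x ∈ U, DifferentiableAt ℂ f x := fun x hx => hf.differentiableAt (hU.mem_nhds hx)
  obtain ⟨δ', hδ', hball⟩ := Metric.isOpen_iff.1 hU x₀ hx₀
  -- room for two steps of size `δ`: along the direction `v`, and for the bound on the derivative
  set δ := δ' / 4 with hδ
  have hδ0 : 0 < δ := by positivity
  have hsub : Metric.closedBall x₀ (3 * δ) ⊆ U :=
    (Metric.closedBall_subset_ball (by rw [hδ]; linarith)).trans hball
  obtain ⟨M, hM⟩ := (isCompact_closedBall x₀ (3 * δ)).exists_bound_of_continuousOn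
    (hf.continuousOn.mono hsub)
  have hsub2 : ∀ y ∈ Metric.ball x₀ (2 * δ), Metric.closedBall y δ ⊆ Metric.closedBall x₀ (3 * δ) := by
    intro y hy
    apply Metric.closedBall_subset_closedBall'
    rw [Metric.mem_ball] at hy
    linarith
  have hbd : ∀ y ∈ Metric.ball x₀ (2 * δ), ‖fderiv ℂ f y‖ ≤ M / δ := fun y hy =>
    norm_fderiv_le_of_bounded hδ0 (fun x hx => hd x (hsub (hsub2 y hy hx)))
      (fun x hx => hM x (hsub2 y hy hx))
  set ε := δ / (‖v‖ + 1) with hε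
  have hε0 : 0 < ε := by positivity
  have hmem : ∀ x ∈ Metric.ball x₀ δ, ∀ z : ℂ, ‖z‖ ≤ ε → x + z • v ∈ Metric.ball x₀ (2 * δ) := by
    intro x hx z hz
    rw [Metric.mem_ball, dist_eq_norm] at hx ⊢
    have h1 : ‖z • v‖ ≤ δ := by
      rw [norm_smul]
      calc ‖z‖ * ‖v‖ ≤ ε * (‖v‖ + 1) := by gcongr; linarith
        _ = δ := by rw [hε]; field_simp
    calc ‖x + z • v - x₀‖ = ‖(x - x₀) + z • v‖ := by congr 1; abel
      _ ≤ ‖x - x₀‖ + ‖z • v‖ := norm_add_le _ _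
      _ < 2 * δ := by linarith
  have hU2 : ∀ y ∈ Metric.ball x₀ (2 * δ), y ∈ U := fun y hy =>
    hsub (Metric.ball_subset_closedBall (Metric.ball_subset_ball (by linarith) hy))
  -- Cauchy's formula for the derivative on the line `x + ℂ v`
  have hcauchy : ∀ x ∈ Metric.ball x₀ δ, fderiv ℂ f x v = (2 * Real.pi * Complex.I : ℂ)⁻¹ •
      ∮ z in C(0, ε), (z - 0) ^ (-2 : ℤ) • f (x + z • v) := by
    intro x hx
    have hd' : ∀ z ∈ Metric.closedBall (0 : ℂ) ε,
        HasDerivAt (fun z : ℂ => f (x + z • v)) (fderiv ℂ f (x + z • v) v) z := by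
      intro z hz
      have h1 : HasDerivAt (fun z : ℂ => x + z • v) v z := by
        simpa using ((hasDerivAt_id z).smul_const v).const_add x
      exact (hd _ (hU2 _ (hmem x hx z (by simpa using hz)))).hasFDerivAt.comp_hasDerivAt z h1
    have hcl : DiffContOnCl ℂ (fun z : ℂ => f (x + z • v)) (Metric.ball 0 ε) := by
      apply DifferentiableOn.diffContOnCl
      rw [closure_ball _ hε0.ne']
      exact fun z hz => (hd' z hz).differentiableAt.differentiableWithinAt
    have h2 := hcl.deriv_eq_smul_circleIntegral hε0
    rw [(hd' 0 (Metric.mem_closedBall_self hε0.le)).deriv, zero_smul, add_zero] at h2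
    rw [eq_inv_smul_iff₀ Complex.two_pi_I_ne_zero, ← h2]
    congr 1
    funext z
    rw [zpow_neg, one_div]
    rfl
  have hcirc : ∀ θ, ‖circleMap 0 ε θ‖ = ε := fun θ => by
    rw [norm_circleMap_zero, abs_of_pos hε0]
  have hcoef : Continuous fun θ : ℝ => deriv (circleMap 0 ε) θ * (circleMap 0 ε θ - 0) ^ (-2 : ℤ) := by
    simp only [deriv_circleMap, sub_zero]
    refine ((continuous_circleMap 0 ε).mul continuous_const).mul
      ((continuous_circleMap 0 ε).zpow₀ _ fun θ => Or.inl ?_)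
    rw [← norm_pos_iff, hcirc]
    exact hε0
  have hcont : ∀ x ∈ Metric.ball x₀ δ, Continuous fun θ : ℝ => f (x + circleMap 0 ε θ • v) := by
    intro x hx
    refine continuous_iff_continuousAt.2 fun θ => ContinuousAt.comp (g := f) ?_ ?_
    · exact (hd _ (hU2 _ (hmem x hx _ (hcirc θ).le))).continuousAt
    · exact (continuous_const.add ((continuous_circleMap 0 ε).smul continuous_const)).continuousAt
  -- differentiate under the integral sign
  borelize E
  have key := intervalIntegral.hasFDerivAt_integral_of_dominated_of_fderiv_le (𝕜 := ℂ)
    (μ := MeasureTheory.volume) (a := 0) (b := 2 * Real.pi) (x₀ := x₀)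
    (s := Metric.ball x₀ δ)
    (F := fun x θ => (deriv (circleMap 0 ε) θ * (circleMap 0 ε θ - 0) ^ (-2 : ℤ)) *
      f (x + circleMap 0 ε θ • v))
    (F' := fun x θ => (deriv (circleMap 0 ε) θ * (circleMap 0 ε θ - 0) ^ (-2 : ℤ)) •
      fderiv ℂ f (x + circleMap 0 ε θ • v))
    (bound := fun θ => ‖deriv (circleMap 0 ε) θ * (circleMap 0 ε θ - 0) ^ (-2 : ℤ)‖ * (M / δ))
    (Metric.ball_mem_nhds _ hδ0)
    (Filter.eventually_of_mem (Metric.ball_mem_nhds _ hδ0) fun x hx =>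
      (hcoef.mul (hcont x hx)).aestronglyMeasurable)
    ((hcoef.mul (hcont x₀ (Metric.mem_ball_self hδ0))).intervalIntegrable _ _)
    (by
      apply MeasureTheory.AEStronglyMeasurable.smul hcoef.aestronglyMeasurable
      have h1 : Measurable fun θ : ℝ => fderiv ℂ f (x₀ + circleMap 0 ε θ • v) :=
        (measurable_fderiv ℂ f).comp
          (continuous_const.add ((continuous_circleMap 0 ε).smul continuous_const)).measurable
      have : ProperSpace (E →L[ℂ] ℂ) := FiniteDimensional.proper ℂ _
      exact h1.aestronglyMeasurable)
    (Filter.Eventually.of_forall fun θ _ x hx => by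
      rw [norm_smul]
      gcongr
      exact hbd _ (hmem x hx _ (hcirc θ).le))
    ((hcoef.norm.mul continuous_const).intervalIntegrable _ _)
    (Filter.Eventually.of_forall fun θ _ x hx => by
      have h1 := (hd _ (hU2 _ (hmem x hx _ (hcirc θ).le))).hasFDerivAt.comp x
        ((hasFDerivAt_id x).add_const (circleMap 0 ε θ • v))
      exact h1.const_mul _)
  refine DifferentiableAt.congr_of_eventuallyEq
    (f := fun x => (2 * Real.pi * Complex.I : ℂ)⁻¹ • ∮ z in C(0, ε), (z - 0) ^ (-2 : ℤ) • f (x + z • v))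
    ?_ (Filter.eventually_of_mem (Metric.ball_mem_nhds _ hδ0) hcauchy)
  refine DifferentiableAt.fun_const_smul ?_ _
  refine key.differentiableAt.congr_of_eventuallyEq (Filter.Eventually.of_forall fun x => ?_)
  simp only [circleIntegral, smul_eq_mul, mul_assoc]

/-- A complex differentiable function on an open subset of a finite-dimensional space is smooth. -/
lemma contDiffOn_of_differentiableOn_complex [FiniteDimensional ℂ E] {f : E → ℂ} {U : Set E}
    (hU : IsOpen U)
    (hf : DifferentiableOn ℂ f U) : ContDiffOn ℂ ∞ f U := by
  rw [contDiffOn_infty]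
  intro n
  induction n generalizing f with
  | zero => exact contDiffOn_zero.2 hf.continuousOn
  | succ n ih =>
    push_cast
    rw [contDiffOn_succ_iff_fderiv_of_isOpen hU]
    refine ⟨hf, by simp, contDiffOn_clm_apply.2 fun v => ih (differentiableOn_fderiv_apply hU hf v)⟩

end Holomorphic

end ModelGeometry

namespace ModelGeometry

/-! ### The regular parts of the periodic monopole potential and of its connection -/

/-- The principal square root. -/
def csq (w : ℂ) : ℂ := w ^ (1 / 2 : ℂ)

lemma csq_sq (w : ℂ) : csq w ^ 2 = w := by
  have := Complex.cpow_nat_inv_pow w two_ne_zero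
  rwa [csq, one_div]

lemma csq_re_nonneg (w : ℂ) : 0 ≤ (csq w).re := by
  rcases eq_or_ne w 0 with rfl | hw
  · simp [csq]
  · rw [csq, Complex.cpow_def_of_ne_zero hw, Complex.exp_re]
    refine mul_nonneg (Real.exp_pos _).le (Real.cos_nonneg_of_mem_Icc ?_)
    have h1 : (Complex.log w * (1 / 2)).im = w.arg / 2 := by
      simp [Complex.mul_im, Complex.log_im]
      ring
    rw [h1]
    have := Complex.neg_pi_lt_arg w
    have := Complex.arg_le_pi w
    constructor <;> linarith

lemma csq_ne_zero {w : ℂ} (hw : w ≠ 0) : csq w ≠ 0 := fun h => hw (by rw [← csq_sq w, h]; simp)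

lemma csq_ofReal {x : ℝ} (hx : 0 ≤ x) : csq x = (Real.sqrt x : ℂ) := by
  rw [csq, Real.sqrt_eq_rpow, Complex.ofReal_cpow hx]
  norm_num

lemma hasDerivAt_csq {w : ℂ} (hw : w ∈ Complex.slitPlane) :
    HasDerivAt csq (1 / (2 * csq w)) w := by
  have h := (Complex.hasStrictDerivAt_cpow_const (c := (1 / 2 : ℂ)) hw).hasDerivAt
  refine HasDerivAt.congr_deriv (f := csq) h ?_
  have hw0 := Complex.slitPlane_ne_zero hw
  rw [Complex.cpow_sub _ _ hw0, Complex.cpow_one]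
  have h2 : (w ^ (1 / 2 : ℂ)) ^ 2 = w := csq_sq w
  have h3 : w ^ (1 / 2 : ℂ) ≠ 0 := csq_ne_zero hw0
  rw [csq]
  field_simp
  rw [h2]

/-- The distance `sqrt(4a + τ²)`, as a holomorphic function. -/
def rad (a τ : ℂ) : ℂ := csq (4 * a + τ ^ 2)

lemma rad_sq (a τ : ℂ) : rad a τ ^ 2 = 4 * a + τ ^ 2 := csq_sq _

/-- The positions `2π(n+1)` of the nonzero poles, up to sign. -/
def pole (n : ℕ) : ℝ := 2 * Real.pi * (n + 1)

/-- The summands of the regular part of the potential: the potentials of the charges at `± pole n`,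
normalised to vanish at the origin. -/
def uTerm (n : ℕ) (p : ℂ × ℂ) : ℂ :=
  (1 / rad p.1 (pole n + p.2) + 1 / rad p.1 (pole n - p.2)) / 2 - 1 / pole n

/-- The summands of the regular part of the connection, divided by `|Z|²`. -/
def gTerm (n : ℕ) (p : ℂ × ℂ) : ℂ :=
  -2 * (1 / (rad p.1 (pole n + p.2) * (rad p.1 (pole n + p.2) + (pole n + p.2))) -
    1 / (rad p.1 (pole n - p.2) * (rad p.1 (pole n - p.2) + (pole n - p.2))))

/-- A convex neighborhood of the points `(a, t)` with `a ≥ 0` and `|t| ≤ 2π - 2δ`. -/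
def regDomain (δ : ℝ) : Set (ℂ × ℂ) :=
  {p | -(δ ^ 2 / 16) < p.1.re ∧ |p.2.re| < 2 * Real.pi - δ ∧ |p.2.im| < δ / 2}

lemma regDomain_isOpen (δ : ℝ) : IsOpen (regDomain δ) := by
  have h1 : Continuous fun p : ℂ × ℂ => p.1.re := by fun_prop
  have h2 : Continuous fun p : ℂ × ℂ => |p.2.re| := by fun_prop
  have h3 : Continuous fun p : ℂ × ℂ => |p.2.im| := by fun_prop
  exact (isOpen_lt continuous_const h1).inter
    ((isOpen_lt h2 continuous_const).inter (isOpen_lt h3 continuous_const))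

lemma regDomain_convex (δ : ℝ) : Convex ℝ (regDomain δ) := by
  have h : regDomain δ = (Complex.reLm.comp (LinearMap.fst ℝ ℂ ℂ)) ⁻¹' Set.Ioi (-(δ ^ 2 / 16)) ∩
      ((Complex.reLm.comp (LinearMap.snd ℝ ℂ ℂ)) ⁻¹'
        Set.Ioo (-(2 * Real.pi - δ)) (2 * Real.pi - δ) ∩
      (Complex.imLm.comp (LinearMap.snd ℝ ℂ ℂ)) ⁻¹' Set.Ioo (-(δ / 2)) (δ / 2)) := by
    ext p
    simp [regDomain, abs_lt]
  rw [h]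
  exact ((convex_Ioi _).linear_preimage _).inter
    (((convex_Ioo _ _).linear_preimage _).inter ((convex_Ioo _ _).linear_preimage _))

/-- What is needed of `τ` and `rad a τ` to bound the summands. -/
structure RadBound (δ : ℝ) (n : ℕ) (a τ : ℂ) : Prop where
  slit : 4 * a + τ ^ 2 ∈ Complex.slitPlane
  rad_ne : rad a τ ≠ 0
  add_ne : rad a τ + τ ≠ 0
  rad_le : ‖(rad a τ)⁻¹‖ ≤ 2 / (δ * (n + 1))
  add_le : ‖(rad a τ + τ)⁻¹‖ ≤ 1 / δ
  le : ‖τ‖ ≤ 14 * (n + 1)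

/-- For complex `(a, t)` near a real point with `a ≥ 0` and `|t| < 2π`, the square root at the pole
`2π(n+1)` is in its holomorphic domain and of order at least `n + 1`: there `4a + τ²` has a positive
real part, as the real part of `τ` dominates its imaginary part. -/
lemma radBound {δ : ℝ} (hδ : 0 < δ) (n : ℕ) {a t : ℂ}
    (ha : -(δ ^ 2 / 16) < a.re) (ht : |t.re| < 2 * Real.pi - δ) (ht' : |t.im| < δ / 2) :
    RadBound δ n a (pole n + t) := by
  have hpi := Real.pi_gt_three
  have hpi4 := Real.pi_lt_d2
  have hn : (0 : ℝ) ≤ n := n.cast_nonneg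
  rw [abs_lt] at ht ht'
  have hre : (pole n + t : ℂ).re = pole n + t.re := by simp
  have him : (pole n + t : ℂ).im = t.im := by simp
  set τ : ℂ := pole n + t with hτ
  have h1 : δ * (n + 1) ≤ τ.re := by
    rw [hre, pole]
    nlinarith
  have h0 : 0 < δ * (n + 1) := by positivity
  have h0' : δ ≤ δ * (n + 1) := by nlinarith
  have hw : (δ * (n + 1)) ^ 2 / 2 ≤ (4 * a + τ ^ 2).re := by
    have h2 : (4 * a + τ ^ 2).re = 4 * a.re + (τ.re ^ 2 - τ.im ^ 2) := by
      simp [pow_two]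
    rw [h2, him]
    have h3 : t.im ^ 2 ≤ (δ / 2) ^ 2 := sq_le_sq' (by linarith) (by linarith)
    have h4 : (δ * (n + 1)) ^ 2 ≤ τ.re ^ 2 := by gcongr
    have h5 : δ ^ 2 ≤ (δ * (n + 1)) ^ 2 := by gcongr
    nlinarith
  have hwpos : 0 < (4 * a + τ ^ 2).re := lt_of_lt_of_le (by positivity) hw
  have hslit : 4 * a + τ ^ 2 ∈ Complex.slitPlane := Or.inl hwpos
  have hradre : 0 ≤ (rad a τ).re := csq_re_nonneg _
  have haddre : δ ≤ (rad a τ + τ).re := by rw [Complex.add_re]; linarith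
  have hrne : rad a τ ≠ 0 := csq_ne_zero (Complex.slitPlane_ne_zero hslit)
  have hane : rad a τ + τ ≠ 0 := fun h => by
    rw [h] at haddre
    simp at haddre
    linarith
  refine ⟨hslit, hrne, hane, ?_, ?_, ?_⟩
  · rw [norm_inv, inv_le_comm₀ (norm_pos_iff.2 hrne) (by positivity), inv_div]
    have h6 : (δ * (n + 1) / 2) ^ 2 ≤ ‖rad a τ‖ ^ 2 := by
      rw [← norm_pow, rad_sq]
      refine le_trans ?_ (Complex.re_le_norm _)
      nlinarith
    exact (pow_le_pow_iff_left₀ (by positivity) (norm_nonneg _) two_ne_zero).1 h6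
  · rw [norm_inv, one_div]
    exact inv_anti₀ hδ (haddre.trans (Complex.re_le_norm _))
  · refine (norm_add_le _ _).trans ?_
    have h7 := Complex.norm_le_abs_re_add_abs_im t
    have h8 : |t.re| ≤ 2 * Real.pi - δ := abs_le.2 ⟨ht.1.le, ht.2.le⟩
    have h9 : |t.im| ≤ δ / 2 := abs_le.2 ⟨ht'.1.le, ht'.2.le⟩
    have h10 : ‖(pole n : ℂ)‖ = 2 * Real.pi * (n + 1) := by
      rw [Complex.norm_real, pole, Real.norm_eq_abs, abs_of_nonneg (by positivity)]
    rw [h10]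
    nlinarith

open ContinuousLinearMap in
lemma hasFDerivAt_rad {a τ : ℂ} (h : 4 * a + τ ^ 2 ∈ Complex.slitPlane) :
    HasFDerivAt (fun p : ℂ × ℂ => rad p.1 p.2)
      ((2 / rad a τ) • fst ℂ ℂ ℂ + (τ / rad a τ) • snd ℂ ℂ ℂ) (a, τ) := by
  have h1 : HasFDerivAt (fun p : ℂ × ℂ => 4 * p.1 + p.2 ^ 2)
      ((4 : ℂ) • fst ℂ ℂ ℂ + (2 * τ) • snd ℂ ℂ ℂ) (a, τ) := by
    have h2 : HasFDerivAt (fun p : ℂ × ℂ => p.1) (fst ℂ ℂ ℂ) (a, τ) := hasFDerivAt_fst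
    have h3 : HasFDerivAt (fun p : ℂ × ℂ => p.2) (snd ℂ ℂ ℂ) (a, τ) := hasFDerivAt_snd
    refine ((h2.const_mul 4).add (h3.pow 2)).congr_fderiv ?_
    ext <;> simp
  have h4 := (hasDerivAt_csq h).comp_hasFDerivAt (a, τ) h1
  refine HasFDerivAt.congr_fderiv h4 ?_
  have h5 : csq (4 * a + τ ^ 2) ≠ 0 := csq_ne_zero (Complex.slitPlane_ne_zero h)
  ext
  · simp [rad]
    field_simp
    norm_num
  · simp [rad]
    field_simp

open ContinuousLinearMap in
lemma hasFDerivAt_inv_rad {δ : ℝ} {n : ℕ} {a τ : ℂ} (h : RadBound δ n a τ) :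
    HasFDerivAt (fun p : ℂ × ℂ => 1 / rad p.1 p.2)
      ((-2 / rad a τ ^ 3) • fst ℂ ℂ ℂ + (-τ / rad a τ ^ 3) • snd ℂ ℂ ℂ) (a, τ) := by
  have h1 := (hasDerivAt_inv h.rad_ne).comp_hasFDerivAt (a, τ) (hasFDerivAt_rad h.slit)
  have h2 : (fun p : ℂ × ℂ => 1 / rad p.1 p.2) = Inv.inv ∘ fun p : ℂ × ℂ => rad p.1 p.2 := by
    ext p
    simp
  rw [h2]
  refine h1.congr_fderiv ?_
  have := h.rad_ne
  ext
  · simp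
    field_simp
  · simp
    field_simp

open ContinuousLinearMap in
lemma hasFDerivAt_inv_rad_mul {δ : ℝ} {n : ℕ} {a τ : ℂ} (h : RadBound δ n a τ) :
    HasFDerivAt (fun p : ℂ × ℂ => 1 / (rad p.1 p.2 * (rad p.1 p.2 + p.2)))
      ((-(4 * rad a τ + 2 * τ) / (rad a τ ^ 3 * (rad a τ + τ) ^ 2)) • fst ℂ ℂ ℂ +
        (-1 / rad a τ ^ 3) • snd ℂ ℂ ℂ) (a, τ) := by
  have h0 : HasFDerivAt (fun p : ℂ × ℂ => p.2) (snd ℂ ℂ ℂ) (a, τ) := hasFDerivAt_snd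
  have hr := hasFDerivAt_rad h.slit
  have hm := hr.mul (hr.add h0)
  have h1 := (hasDerivAt_inv (mul_ne_zero h.rad_ne h.add_ne)).comp_hasFDerivAt (a, τ) hm
  have h2 : (fun p : ℂ × ℂ => 1 / (rad p.1 p.2 * (rad p.1 p.2 + p.2))) =
      Inv.inv ∘ fun p : ℂ × ℂ => rad p.1 p.2 * (rad p.1 p.2 + p.2) := by
    ext p
    simp
  rw [h2]
  refine HasFDerivAt.congr_fderiv h1 ?_
  have := h.rad_ne
  have := h.add_ne
  ext
  · simp
    field_simp
    ring
  · simp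
    field_simp
    ring

/-- The derivative of `uTerm` in `a`. It is `-1/2` times the derivative of `gTerm` in `t`, by one of
the two monopole equations. -/
def uTermA (n : ℕ) (p : ℂ × ℂ) : ℂ :=
  -(1 / rad p.1 (pole n + p.2) ^ 3 + 1 / rad p.1 (pole n - p.2) ^ 3)

/-- The derivative of `uTerm` in `t`. -/
def uTermT (n : ℕ) (p : ℂ × ℂ) : ℂ :=
  (-(pole n + p.2) / rad p.1 (pole n + p.2) ^ 3 + (pole n - p.2) / rad p.1 (pole n - p.2) ^ 3) / 2

/-- The derivative of `gTerm` in `a`. -/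
def gTermA (n : ℕ) (p : ℂ × ℂ) : ℂ :=
  2 * ((4 * rad p.1 (pole n + p.2) + 2 * (pole n + p.2)) /
      (rad p.1 (pole n + p.2) ^ 3 * (rad p.1 (pole n + p.2) + (pole n + p.2)) ^ 2) -
    (4 * rad p.1 (pole n - p.2) + 2 * (pole n - p.2)) /
      (rad p.1 (pole n - p.2) ^ 3 * (rad p.1 (pole n - p.2) + (pole n - p.2)) ^ 2))

section

variable {δ : ℝ} (hδ : 0 < δ) {p : ℂ × ℂ} (hp : p ∈ regDomain δ) (n : ℕ)
include hδ hp

lemma radBound_add : RadBound δ n p.1 (pole n + p.2) := radBound hδ n hp.1 hp.2.1 hp.2.2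

lemma radBound_sub : RadBound δ n p.1 (pole n - p.2) := by
  rw [sub_eq_add_neg]
  exact radBound hδ n hp.1 (by simpa using hp.2.1) (by simpa using hp.2.2)

open ContinuousLinearMap

lemma hasFDerivAt_uTerm :
    HasFDerivAt (uTerm n) (uTermA n p • fst ℂ ℂ ℂ + uTermT n p • snd ℂ ℂ ℂ) p := by
  have hA : HasFDerivAt (fun p : ℂ × ℂ => (p.1, (pole n + p.2 : ℂ))) ((fst ℂ ℂ ℂ).prod (snd ℂ ℂ ℂ)) p :=
    hasFDerivAt_fst.prodMk (hasFDerivAt_snd.const_add _)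
  have hB : HasFDerivAt (fun p : ℂ × ℂ => (p.1, (pole n - p.2 : ℂ))) ((fst ℂ ℂ ℂ).prod (-snd ℂ ℂ ℂ)) p :=
    hasFDerivAt_fst.prodMk (hasFDerivAt_snd.const_sub _)
  have h1 := HasFDerivAt.comp p (hasFDerivAt_inv_rad (radBound_add hδ hp n)) hA
  have h2 := HasFDerivAt.comp p (hasFDerivAt_inv_rad (radBound_sub hδ hp n)) hB
  have h3 := (((h1.add h2).mul_const (1 / 2 : ℂ)).sub_const (1 / (pole n : ℂ)))
  have h4 : uTerm n = fun p => ((fun p : ℂ × ℂ => 1 / rad p.1 p.2) ∘ (fun p : ℂ × ℂ => (p.1, (pole n + p.2 : ℂ))) +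
    (fun p : ℂ × ℂ => 1 / rad p.1 p.2) ∘ (fun p : ℂ × ℂ => (p.1, (pole n - p.2 : ℂ)))) p * (1 / 2) - 1 / (pole n : ℂ) := by
    funext p
    simp [uTerm]
    ring
  rw [h4]
  refine HasFDerivAt.congr_fderiv h3 ?_
  ext
  · simp [uTermA, uTermT]
    ring
  · simp [uTermA, uTermT]
    ring

lemma hasFDerivAt_gTerm :
    HasFDerivAt (gTerm n) (gTermA n p • fst ℂ ℂ ℂ + (-2 * uTermA n p) • snd ℂ ℂ ℂ) p := by
  have hA : HasFDerivAt (fun p : ℂ × ℂ => (p.1, (pole n + p.2 : ℂ))) ((fst ℂ ℂ ℂ).prod (snd ℂ ℂ ℂ)) p :=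
    hasFDerivAt_fst.prodMk (hasFDerivAt_snd.const_add _)
  have hB : HasFDerivAt (fun p : ℂ × ℂ => (p.1, (pole n - p.2 : ℂ))) ((fst ℂ ℂ ℂ).prod (-snd ℂ ℂ ℂ)) p :=
    hasFDerivAt_fst.prodMk (hasFDerivAt_snd.const_sub _)
  have h1 := HasFDerivAt.comp p (hasFDerivAt_inv_rad_mul (radBound_add hδ hp n)) hA
  have h2 := HasFDerivAt.comp p (hasFDerivAt_inv_rad_mul (radBound_sub hδ hp n)) hB
  have h3 := (h1.sub h2).const_mul (-2 : ℂ)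
  refine HasFDerivAt.congr_fderiv h3 ?_
  ext
  · simp [uTermA, gTermA]
    ring
  · simp [uTermA, gTermA]
    ring

/-- The summands satisfy the monopole equation in the radial direction. -/
lemma gTermA_eq : 2 * p.1 * gTermA n p + 2 * gTerm n p = 4 * uTermT n p := by
  have hA := radBound_add hδ hp n
  have hB := radBound_sub hδ hp n
  have key : ∀ τ : ℂ, RadBound δ n p.1 τ →
      p.1 * ((4 * rad p.1 τ + 2 * τ) / (rad p.1 τ ^ 3 * (rad p.1 τ + τ) ^ 2)) =
        1 / (rad p.1 τ * (rad p.1 τ + τ)) - τ / rad p.1 τ ^ 3 / 2 := by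
    intro τ hτ
    have h1 := hτ.rad_ne
    have h2 := hτ.add_ne
    have h3 := rad_sq p.1 τ
    have h4 : p.1 = (rad p.1 τ - τ) * (rad p.1 τ + τ) / 4 := by
      linear_combination -(1 / 4 : ℂ) * h3
    generalize rad p.1 τ = q at *
    rw [h4]
    field_simp
    ring
  have k1 := key _ hA
  have k2 := key _ hB
  simp only [gTermA, gTerm, uTermT]
  linear_combination 4 * k1 - 4 * k2

end

end ModelGeometry

namespace ModelGeometry

section

variable {δ : ℝ} {n : ℕ} {a τ : ℂ}

lemma RadBound.norm_inv_cube (hδ : 0 < δ) (h : RadBound δ n a τ) :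
    ‖1 / rad a τ ^ 3‖ ≤ (2 / δ) ^ 3 * (1 / (n + 1 : ℝ) ^ 2) := by
  have hr : (0 : ℝ) < 1 / (n + 1) := by positivity
  have hr1 : 1 / (n + 1 : ℝ) ≤ 1 := by
    rw [div_le_one (by positivity)]
    linarith [n.cast_nonneg (α := ℝ)]
  have h1 : 2 / (δ * (n + 1)) = 2 / δ * (1 / (n + 1)) := by field_simp
  have h2 := h.rad_le
  rw [one_div, ← inv_pow, norm_pow]
  calc ‖(rad a τ)⁻¹‖ ^ 3 ≤ (2 / (δ * (n + 1))) ^ 3 := by gcongr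
    _ = (2 / δ) ^ 3 * ((1 / (n + 1)) ^ 2 * (1 / (n + 1))) := by rw [h1]; ring
    _ ≤ (2 / δ) ^ 3 * ((1 / (n + 1)) ^ 2 * 1) := by gcongr
    _ = _ := by rw [mul_one, one_div_pow]

lemma RadBound.norm_div_cube (hδ : 0 < δ) (h : RadBound δ n a τ) :
    ‖τ / rad a τ ^ 3‖ ≤ 14 * (2 / δ) ^ 3 * (1 / (n + 1 : ℝ) ^ 2) := by
  have h1 : 2 / (δ * (n + 1)) = 2 / δ * (1 / (n + 1)) := by field_simp
  have h2 := h.rad_le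
  rw [div_eq_mul_inv, ← inv_pow, norm_mul, norm_pow]
  calc ‖τ‖ * ‖(rad a τ)⁻¹‖ ^ 3 ≤ (14 * (n + 1)) * (2 / (δ * (n + 1))) ^ 3 := by
        gcongr
        exact h.le
    _ = _ := by rw [h1]; field_simp

lemma RadBound.norm_dterm (hδ : 0 < δ) (h : RadBound δ n a τ) :
    ‖(4 * rad a τ + 2 * τ) / (rad a τ ^ 3 * (rad a τ + τ) ^ 2)‖ ≤
      (4 * (2 / δ) ^ 2 + 28 * (2 / δ) ^ 3) * (1 / δ) ^ 2 * (1 / (n + 1 : ℝ) ^ 2) := by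
  have h1 : 2 / (δ * (n + 1)) = 2 / δ * (1 / (n + 1)) := by field_simp
  have h0 := h.rad_ne
  have h2 : (4 * rad a τ + 2 * τ) / (rad a τ ^ 3 * (rad a τ + τ) ^ 2) =
      (4 * (rad a τ)⁻¹ ^ 2 + 2 * (τ / rad a τ ^ 3)) * (rad a τ + τ)⁻¹ ^ 2 := by
    have := h.add_ne
    field_simp
  rw [h2, norm_mul, norm_pow]
  have h3 : ‖4 * (rad a τ)⁻¹ ^ 2 + 2 * (τ / rad a τ ^ 3)‖ ≤
      (4 * (2 / δ) ^ 2 + 28 * (2 / δ) ^ 3) * (1 / (n + 1 : ℝ) ^ 2) := by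
    refine (norm_add_le _ _).trans ?_
    rw [norm_mul, norm_mul, norm_pow, Complex.norm_ofNat, Complex.norm_ofNat]
    calc _ ≤ 4 * (2 / (δ * (n + 1))) ^ 2 + 2 * (14 * (2 / δ) ^ 3 * (1 / (n + 1 : ℝ) ^ 2)) := by
          gcongr
          · exact h.rad_le
          · exact h.norm_div_cube hδ
      _ = _ := by rw [h1, mul_pow, one_div_pow]; ring
  calc _ ≤ ((4 * (2 / δ) ^ 2 + 28 * (2 / δ) ^ 3) * (1 / (n + 1 : ℝ) ^ 2)) * (1 / δ) ^ 2 := by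
        gcongr
        exact h.add_le
    _ = _ := by ring

end

lemma norm_smul_fst_add_smul_snd_le (x y : ℂ) :
    ‖x • ContinuousLinearMap.fst ℂ ℂ ℂ + y • ContinuousLinearMap.snd ℂ ℂ ℂ‖ ≤ ‖x‖ + ‖y‖ := by
  refine (norm_add_le _ _).trans ?_
  rw [norm_smul, norm_smul]
  have h1 := ContinuousLinearMap.norm_fst_le ℂ ℂ ℂ
  have h2 := ContinuousLinearMap.norm_snd_le ℂ ℂ ℂ
  nlinarith [norm_nonneg x, norm_nonneg y]

lemma summable_inv_sq : Summable fun n : ℕ => 1 / (n + 1 : ℝ) ^ 2 := by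
  have := (summable_nat_add_iff 1).2 (Real.summable_one_div_nat_pow.2 (one_lt_two))
  simpa using this

lemma zero_mem_regDomain {δ : ℝ} (hδ : 0 < δ) (hδ1 : δ ≤ 1) : (0 : ℂ × ℂ) ∈ regDomain δ := by
  have := Real.pi_gt_three
  refine ⟨?_, ?_, ?_⟩
  · simp
    positivity
  · simp
    linarith
  · simp
    linarith

lemma rad_zero_left {x : ℝ} (hx : 0 ≤ x) : rad 0 x = x := by
  have h : (4 * 0 + (x : ℂ) ^ 2) = ((x ^ 2 : ℝ) : ℂ) := by
    push_cast
    ring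
  rw [rad, h, csq_ofReal (by positivity), Real.sqrt_sq hx]

lemma pole_pos (n : ℕ) : 0 < pole n := by
  have := Real.pi_pos
  rw [pole]
  positivity

lemma uTerm_zero (n : ℕ) : uTerm n 0 = 0 := by
  have h := pole_pos n
  have h' : (pole n : ℂ) ≠ 0 := by exact_mod_cast h.ne'
  simp [uTerm, rad_zero_left h.le]

lemma gTerm_zero (n : ℕ) : gTerm n 0 = 0 := by
  simp [gTerm]

/-- The sum of the potentials of the charges at the nonzero multiples of `2π`. -/
def uSum (p : ℂ × ℂ) : ℂ := ∑' n, uTerm n p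

/-- The regular part of the connection, divided by `|Z|²`. -/
def gReg (p : ℂ × ℂ) : ℂ := ∑' n, gTerm n p

section

variable {δ : ℝ} (hδ : 0 < δ) (hδ1 : δ ≤ 1) {p : ℂ × ℂ} (hp : p ∈ regDomain δ)
include hδ hp

lemma norm_uTermA_le (n : ℕ) : ‖uTermA n p‖ ≤ 2 * (2 / δ) ^ 3 * (1 / (n + 1 : ℝ) ^ 2) := by
  rw [uTermA, norm_neg]
  refine (norm_add_le _ _).trans ?_
  linarith [(radBound_add hδ hp n).norm_inv_cube hδ, (radBound_sub hδ hp n).norm_inv_cube hδ]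

lemma norm_uTermT_le (n : ℕ) : ‖uTermT n p‖ ≤ 14 * (2 / δ) ^ 3 * (1 / (n + 1 : ℝ) ^ 2) := by
  rw [uTermT, norm_div, neg_div, Complex.norm_ofNat]
  have h := norm_add_le (-((pole n + p.2) / rad p.1 (pole n + p.2) ^ 3))
    ((pole n - p.2) / rad p.1 (pole n - p.2) ^ 3)
  rw [norm_neg] at h
  linarith [(radBound_add hδ hp n).norm_div_cube hδ, (radBound_sub hδ hp n).norm_div_cube hδ]

lemma norm_gTermA_le (n : ℕ) : ‖gTermA n p‖ ≤
    4 * ((4 * (2 / δ) ^ 2 + 28 * (2 / δ) ^ 3) * (1 / δ) ^ 2) * (1 / (n + 1 : ℝ) ^ 2) := by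
  rw [gTermA, norm_mul, Complex.norm_ofNat]
  have h := norm_sub_le ((4 * rad p.1 (pole n + p.2) + 2 * (pole n + p.2)) /
      (rad p.1 (pole n + p.2) ^ 3 * (rad p.1 (pole n + p.2) + (pole n + p.2)) ^ 2))
    ((4 * rad p.1 (pole n - p.2) + 2 * (pole n - p.2)) /
      (rad p.1 (pole n - p.2) ^ 3 * (rad p.1 (pole n - p.2) + (pole n - p.2)) ^ 2))
  linarith [(radBound_add hδ hp n).norm_dterm hδ, (radBound_sub hδ hp n).norm_dterm hδ]

lemma summable_uTermA : Summable fun n => uTermA n p :=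
  .of_norm_bounded (summable_inv_sq.mul_left _) (norm_uTermA_le hδ hp)

lemma summable_uTermT : Summable fun n => uTermT n p :=
  .of_norm_bounded (summable_inv_sq.mul_left _) (norm_uTermT_le hδ hp)

lemma summable_gTermA : Summable fun n => gTermA n p :=
  .of_norm_bounded (summable_inv_sq.mul_left _) (norm_gTermA_le hδ hp)

include hδ1
open ContinuousLinearMap

lemma hasFDerivAt_uSum :
    HasFDerivAt uSum ((∑' n, uTermA n p) • fst ℂ ℂ ℂ + (∑' n, uTermT n p) • snd ℂ ℂ ℂ) p := by
  have h := hasFDerivAt_tsum_of_isPreconnected (f := uTerm)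
    (f' := fun n p => uTermA n p • fst ℂ ℂ ℂ + uTermT n p • snd ℂ ℂ ℂ)
    ((summable_inv_sq.mul_left (2 * (2 / δ) ^ 3)).add
      (summable_inv_sq.mul_left (14 * (2 / δ) ^ 3)))
    (regDomain_isOpen δ) (regDomain_convex δ).isPreconnected
    (fun n x hx => hasFDerivAt_uTerm hδ hx n)
    (fun n x hx => (norm_smul_fst_add_smul_snd_le _ _).trans
      (add_le_add (norm_uTermA_le hδ hx n) (norm_uTermT_le hδ hx n)))
    (zero_mem_regDomain hδ hδ1) (by simp [uTerm_zero, summable_zero]) hp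
  rwa [((summable_uTermA hδ hp).smul_const _).tsum_add ((summable_uTermT hδ hp).smul_const _),
    (summable_uTermA hδ hp).tsum_smul_const, (summable_uTermT hδ hp).tsum_smul_const] at h

lemma summable_gTerm : Summable fun n => gTerm n p :=
  summable_of_summable_hasFDerivAt_of_isPreconnected (f := gTerm)
    (f' := fun n p => gTermA n p • fst ℂ ℂ ℂ + (-2 * uTermA n p) • snd ℂ ℂ ℂ)
    ((summable_inv_sq.mul_left (4 * ((4 * (2 / δ) ^ 2 + 28 * (2 / δ) ^ 3) * (1 / δ) ^ 2))).add
      ((summable_inv_sq.mul_left (2 * (2 / δ) ^ 3)).mul_left 2))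
    (regDomain_isOpen δ) (regDomain_convex δ).isPreconnected
    (fun n x hx => hasFDerivAt_gTerm hδ hx n)
    (fun n x hx => (norm_smul_fst_add_smul_snd_le _ _).trans
      (add_le_add (norm_gTermA_le hδ hx n) (by
        rw [norm_mul, norm_neg, Complex.norm_ofNat]
        linarith [norm_uTermA_le hδ hx n])))
    (zero_mem_regDomain hδ hδ1) (by simp [gTerm_zero, summable_zero]) hp

lemma summable_uTerm : Summable fun n => uTerm n p :=
  summable_of_summable_hasFDerivAt_of_isPreconnected (f := uTerm)
    (f' := fun n p => uTermA n p • fst ℂ ℂ ℂ + uTermT n p • snd ℂ ℂ ℂ)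
    ((summable_inv_sq.mul_left (2 * (2 / δ) ^ 3)).add
      (summable_inv_sq.mul_left (14 * (2 / δ) ^ 3)))
    (regDomain_isOpen δ) (regDomain_convex δ).isPreconnected
    (fun n x hx => hasFDerivAt_uTerm hδ hx n)
    (fun n x hx => (norm_smul_fst_add_smul_snd_le _ _).trans
      (add_le_add (norm_uTermA_le hδ hx n) (norm_uTermT_le hδ hx n)))
    (zero_mem_regDomain hδ hδ1) (by simp [uTerm_zero, summable_zero]) hp

lemma hasFDerivAt_gReg :
    HasFDerivAt gReg ((∑' n, gTermA n p) • fst ℂ ℂ ℂ + (-2 * ∑' n, uTermA n p) • snd ℂ ℂ ℂ) p := by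
  have h := hasFDerivAt_tsum_of_isPreconnected (f := gTerm)
    (f' := fun n p => gTermA n p • fst ℂ ℂ ℂ + (-2 * uTermA n p) • snd ℂ ℂ ℂ)
    ((summable_inv_sq.mul_left (4 * ((4 * (2 / δ) ^ 2 + 28 * (2 / δ) ^ 3) * (1 / δ) ^ 2))).add
      ((summable_inv_sq.mul_left (2 * (2 / δ) ^ 3)).mul_left 2))
    (regDomain_isOpen δ) (regDomain_convex δ).isPreconnected
    (fun n x hx => hasFDerivAt_gTerm hδ hx n)
    (fun n x hx => (norm_smul_fst_add_smul_snd_le _ _).trans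
      (add_le_add (norm_gTermA_le hδ hx n) (by
        rw [norm_mul, norm_neg, Complex.norm_ofNat]
        linarith [norm_uTermA_le hδ hx n])))
    (zero_mem_regDomain hδ hδ1) (by simp [gTerm_zero, summable_zero]) hp
  rwa [((summable_gTermA hδ hp).smul_const _).tsum_add
    (((summable_uTermA hδ hp).mul_left (-2)).smul_const _),
    (summable_gTermA hδ hp).tsum_smul_const,
    ((summable_uTermA hδ hp).mul_left (-2)).tsum_smul_const, tsum_mul_left] at h

lemma gReg_radial : 2 * p.1 * (∑' n, gTermA n p) + 2 * gReg p = 4 * ∑' n, uTermT n p := by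
  rw [gReg, ← tsum_mul_left, ← tsum_mul_left, ← tsum_mul_left,
    ← ((summable_gTermA hδ hp).mul_left _).tsum_add ((summable_gTerm hδ hδ1 hp).mul_left _)]
  exact tsum_congr fun n => gTermA_eq hδ hp n

end

lemma exists_mem_regDomain {a t : ℝ} (ha : 0 ≤ a) (ht : |t| < 2 * Real.pi) :
    ∃ δ, 0 < δ ∧ δ ≤ 1 ∧ ((a : ℂ), (t : ℂ)) ∈ regDomain δ := by
  refine ⟨min 1 ((2 * Real.pi - |t|) / 2), by
    have : 0 < 2 * Real.pi - |t| := by linarith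
    positivity, min_le_left _ _, ?_⟩
  have h0 : 0 < min 1 ((2 * Real.pi - |t|) / 2) := by
    have : 0 < 2 * Real.pi - |t| := by linarith
    positivity
  have h1 := min_le_right 1 ((2 * Real.pi - |t|) / 2)
  refine ⟨?_, ?_, ?_⟩
  · simp only [Complex.ofReal_re]
    nlinarith
  · simp only [Complex.ofReal_re]
    linarith
  · simp only [Complex.ofReal_im, abs_zero]
    linarith

/-- The regular parts are smooth near the real points with `a ≥ 0`, `|t| < 2π`, and satisfy the
monopole equations there. -/
lemma regular_parts {a t : ℝ} (ha : 0 ≤ a) (ht : |t| < 2 * Real.pi) :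
    ContDiffAt ℂ ∞ uSum (a, t) ∧ ContDiffAt ℂ ∞ gReg (a, t) ∧
      ∃ ua ut ga : ℂ,
        HasFDerivAt uSum (ua • ContinuousLinearMap.fst ℂ ℂ ℂ + ut • ContinuousLinearMap.snd ℂ ℂ ℂ)
          (a, t) ∧
        HasFDerivAt gReg (ga • ContinuousLinearMap.fst ℂ ℂ ℂ +
          (-2 * ua) • ContinuousLinearMap.snd ℂ ℂ ℂ) (a, t) ∧
        2 * a * ga + 2 * gReg (a, t) = 4 * ut := by
  obtain ⟨δ, hδ, hδ1, hp⟩ := exists_mem_regDomain ha ht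
  have ho := regDomain_isOpen δ
  refine ⟨(contDiffOn_of_differentiableOn_complex ho fun p hp =>
      (hasFDerivAt_uSum hδ hδ1 hp).differentiableAt.differentiableWithinAt).contDiffAt
        (ho.mem_nhds hp),
    (contDiffOn_of_differentiableOn_complex ho fun p hp =>
      (hasFDerivAt_gReg hδ hδ1 hp).differentiableAt.differentiableWithinAt).contDiffAt
        (ho.mem_nhds hp), _, _, _, hasFDerivAt_uSum hδ hδ1 hp, hasFDerivAt_gReg hδ hδ1 hp,
    gReg_radial hδ hδ1 hp⟩

end ModelGeometry

namespace ModelGeometry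

/-! ### Poisson resummation -/

lemma summable_exp_neg_sq_linear {w α : ℝ} (hw : 0 < w) (hα : 0 < α) (β : ℝ) :
    Summable fun n : ℕ => Real.exp (-(w * (α * n + β) ^ 2)) := by
  have hr : Real.exp (-(2 * w * α)) < 1 := by
    rw [← Real.exp_zero]
    exact Real.exp_lt_exp.2 (by nlinarith [mul_pos hw hα])
  refine Summable.of_nonneg_of_le (fun n => (Real.exp_pos _).le) (fun n => ?_)
    ((summable_geometric_of_lt_one (Real.exp_pos _).le hr).mul_left (Real.exp (w - 2 * w * β)))
  rw [← Real.exp_nat_mul, ← Real.exp_add]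
  refine Real.exp_le_exp.2 ?_
  nlinarith [mul_nonneg hw.le (sq_nonneg (α * n + β - 1))]

/-- The summands of the theta function `∑ e^{-n²/v} cos(nt)`. -/
def thetaCos (v t : ℝ) (n : ℕ) : ℝ := Real.cos ((n + 1) * t) * Real.exp (-((n + 1) ^ 2 / v))

/-- The Gaussian centered at a charge at distance `τ`. -/
def gaussPole (v τ : ℝ) : ℝ := Real.exp (-(τ ^ 2 * v / 4))

lemma summable_thetaExp {v : ℝ} (hv : 0 < v) :
    Summable fun n : ℕ => Real.exp (-((n + 1 : ℝ) ^ 2 / v)) := by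
  refine (summable_exp_neg_sq_linear (w := 1 / v) (α := 1) (by positivity) one_pos 1).congr
    fun n => ?_
  congr 1
  ring

lemma summable_thetaCos {v : ℝ} (hv : 0 < v) (t : ℝ) : Summable (thetaCos v t) := by
  refine Summable.of_norm_bounded (summable_thetaExp hv) fun n => ?_
  rw [thetaCos, norm_mul, Real.norm_eq_abs, Real.norm_eq_abs, Real.abs_exp]
  exact mul_le_of_le_one_left (Real.exp_pos _).le (Real.abs_cos_le_one _)

lemma summable_gaussPole {v : ℝ} (hv : 0 < v) (t : ℝ) :
    Summable fun n => gaussPole v (pole n + t) := by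
  refine (summable_exp_neg_sq_linear (w := v / 4) (α := 2 * Real.pi) (by positivity)
    Real.two_pi_pos (2 * Real.pi + t)).congr fun n => ?_
  rw [gaussPole, pole]
  congr 1
  ring

/-- Jacobi's inversion formula for the theta function. -/
lemma theta_inversion {v : ℝ} (hv : 0 < v) (t : ℝ) :
    1 + 2 * ∑' n, thetaCos v t n = Real.sqrt (Real.pi * v) *
      (gaussPole v t + ∑' n, gaussPole v (pole n + t) + ∑' n, gaussPole v (pole n - t)) := by
  have hpi := Real.pi_pos
  have hmain := Complex.tsum_exp_neg_quadratic (a := ((1 / (Real.pi * v) : ℝ) : ℂ))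
    (by rw [Complex.ofReal_re]; positivity) (Complex.I * t / (2 * Real.pi))
  have hv0 : (v : ℂ) ≠ 0 := by exact_mod_cast hv.ne'
  have hpi0 : (Real.pi : ℂ) ≠ 0 := by exact_mod_cast hpi.ne'
  have hsq : ((1 / (Real.pi * v) : ℝ) : ℂ) ^ (1 / 2 : ℂ) = ((1 / Real.sqrt (Real.pi * v) : ℝ) : ℂ) := by
    have := csq_ofReal (x := 1 / (Real.pi * v)) (by positivity)
    rw [csq] at this
    rw [this, Real.sqrt_div zero_le_one, Real.sqrt_one]
  -- the left hand side
  have hL : HasSum (fun n : ℤ => Complex.exp (-Real.pi * ((1 / (Real.pi * v) : ℝ) : ℂ) * n ^ 2 +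
      2 * Real.pi * (Complex.I * t / (2 * Real.pi)) * n))
      ((1 + 2 * ∑' n, thetaCos v t n : ℝ) : ℂ) := by
    have hterm : ∀ x : ℝ, Complex.exp (-Real.pi * ((1 / (Real.pi * v) : ℝ) : ℂ) * x ^ 2 +
        2 * Real.pi * (Complex.I * t / (2 * Real.pi)) * x) =
        (Real.exp (-(x ^ 2 / v)) : ℂ) * Complex.exp ((x * t : ℝ) * Complex.I) := by
      intro x
      rw [Complex.ofReal_exp, ← Complex.exp_add]
      congr 1
      push_cast
      field_simp
    have hs : ∀ σ : ℝ, Summable fun n : ℕ => (Real.exp (-((n + 1 : ℝ) ^ 2 / v)) : ℂ) *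
        Complex.exp ((σ * (n + 1) * t : ℝ) * Complex.I) := by
      intro σ
      refine Summable.of_norm_bounded (summable_thetaExp hv) fun n => ?_
      rw [norm_mul, Complex.norm_exp_ofReal_mul_I, mul_one, Complex.norm_real, Real.norm_eq_abs,
        Real.abs_exp]
    have h1 := (hs 1).hasSum
    have h2 := (hs (-1)).hasSum
    have h4 : ∀ n : ℕ, (Real.exp (-((n + 1 : ℝ) ^ 2 / v)) : ℂ) *
        Complex.exp ((1 * (n + 1) * t : ℝ) * Complex.I) +
        (Real.exp (-((n + 1 : ℝ) ^ 2 / v)) : ℂ) *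
        Complex.exp ((-1 * (n + 1) * t : ℝ) * Complex.I) = ((2 * thetaCos v t n : ℝ) : ℂ) := by
      intro n
      rw [thetaCos]
      push_cast
      rw [Complex.cos]
      ring_nf
    have h5 : ∑' n : ℕ, (Real.exp (-((n + 1 : ℝ) ^ 2 / v)) : ℂ) *
        Complex.exp ((1 * (n + 1) * t : ℝ) * Complex.I) +
        ∑' n : ℕ, (Real.exp (-((n + 1 : ℝ) ^ 2 / v)) : ℂ) *
        Complex.exp ((-1 * (n + 1) * t : ℝ) * Complex.I) = ((2 * ∑' n, thetaCos v t n : ℝ) : ℂ) := by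
      rw [← (hs 1).tsum_add (hs (-1)), tsum_congr h4, ← Complex.ofReal_tsum, tsum_mul_left]
    have h6 : ((1 + 2 * ∑' n, thetaCos v t n : ℝ) : ℂ) = 1 +
        ∑' n : ℕ, (Real.exp (-((n + 1 : ℝ) ^ 2 / v)) : ℂ) *
        Complex.exp ((1 * (n + 1) * t : ℝ) * Complex.I) +
        ∑' n : ℕ, (Real.exp (-((n + 1 : ℝ) ^ 2 / v)) : ℂ) *
        Complex.exp ((-1 * (n + 1) * t : ℝ) * Complex.I) := by
      rw [add_assoc, h5]
      push_cast
      ring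
    rw [h6]
    refine HasSum.of_nat_of_neg_add_one ?_ ?_
    · have h7 := (hasSum_nat_add_iff' (f := fun n : ℕ => Complex.exp (-Real.pi *
        ((1 / (Real.pi * v) : ℝ) : ℂ) * (n : ℤ) ^ 2 +
        2 * Real.pi * (Complex.I * t / (2 * Real.pi)) * (n : ℤ))) (g := 1 +
        ∑' n : ℕ, (Real.exp (-((n + 1 : ℝ) ^ 2 / v)) : ℂ) *
        Complex.exp ((1 * (n + 1) * t : ℝ) * Complex.I)) 1).1
      refine h7 ?_
      have h8 : (1 + ∑' n : ℕ, (Real.exp (-((n + 1 : ℝ) ^ 2 / v)) : ℂ) *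
        Complex.exp ((1 * (n + 1) * t : ℝ) * Complex.I)) - ∑ i ∈ Finset.range 1,
        Complex.exp (-Real.pi * ((1 / (Real.pi * v) : ℝ) : ℂ) * (i : ℤ) ^ 2 +
        2 * Real.pi * (Complex.I * t / (2 * Real.pi)) * (i : ℤ)) =
        ∑' n : ℕ, (Real.exp (-((n + 1 : ℝ) ^ 2 / v)) : ℂ) *
        Complex.exp ((1 * (n + 1) * t : ℝ) * Complex.I) := by simp
      rw [h8]
      refine h1.congr_fun fun n => ?_
      have := hterm (n + 1)
      push_cast at this ⊢
      rw [this, one_mul]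
    · refine h2.congr_fun fun n => ?_
      have := hterm (-(n + 1))
      push_cast at this ⊢
      rw [this]
      ring_nf
  -- the right hand side, again with the sum over `ℤ` split into `n = 0`, `n > 0` and `n < 0`
  have hR : HasSum (fun n : ℤ => Complex.exp (-Real.pi / ((1 / (Real.pi * v) : ℝ) : ℂ) *
      (n + Complex.I * (Complex.I * t / (2 * Real.pi))) ^ 2))
      ((gaussPole v t + ∑' n, gaussPole v (pole n + t) + ∑' n, gaussPole v (pole n - t) : ℝ) : ℂ) := by
    have hterm : ∀ x : ℝ, Complex.exp (-Real.pi / ((1 / (Real.pi * v) : ℝ) : ℂ) *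
      (x + Complex.I * (Complex.I * t / (2 * Real.pi))) ^ 2) =
      (gaussPole v (2 * Real.pi * x - t) : ℂ) := by
      intro x
      rw [gaussPole, Complex.ofReal_exp]
      congr 1
      have hI : Complex.I * (Complex.I * t / (2 * Real.pi)) = -(t / (2 * Real.pi) : ℂ) := by
        linear_combination (t / (2 * Real.pi) : ℂ) * Complex.I_mul_I
      rw [hI]
      push_cast
      field_simp
      ring
    have h1 := Complex.hasSum_ofReal.2 (summable_gaussPole hv t).hasSum
    have h2 := Complex.hasSum_ofReal.2 (summable_gaussPole hv (-t)).hasSum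
    have h6 : ((gaussPole v t + ∑' n, gaussPole v (pole n + t) + ∑' n, gaussPole v (pole n - t) : ℝ) : ℂ)
        = (((gaussPole v t + ∑' n, gaussPole v (pole n - t) : ℝ) : ℂ) +
          ((∑' n, gaussPole v (pole n + t) : ℝ) : ℂ)) := by
      push_cast
      ring
    rw [h6]
    refine HasSum.of_nat_of_neg_add_one ?_ ?_
    · have h7 := (hasSum_nat_add_iff' (f := fun n : ℕ => Complex.exp
        (-Real.pi / ((1 / (Real.pi * v) : ℝ) : ℂ) *
        ((n : ℤ) + Complex.I * (Complex.I * t / (2 * Real.pi))) ^ 2))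
        (g := ((gaussPole v t + ∑' n, gaussPole v (pole n - t) : ℝ) : ℂ)) 1).1
      refine h7 ?_
      have h9 := hterm 0
      have h8 : ((gaussPole v t + ∑' n, gaussPole v (pole n - t) : ℝ) : ℂ) - ∑ i ∈ Finset.range 1,
        Complex.exp (-Real.pi / ((1 / (Real.pi * v) : ℝ) : ℂ) *
        ((i : ℤ) + Complex.I * (Complex.I * t / (2 * Real.pi))) ^ 2) =
        ((∑' n, gaussPole v (pole n - t) : ℝ) : ℂ) := by
        rw [Finset.sum_range_one]
        have h10 : gaussPole v (2 * Real.pi * 0 - t) = gaussPole v t := by simp [gaussPole]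
        rw [h10] at h9
        push_cast at h9 ⊢
        rw [h9]
        ring
      rw [h8]
      refine (by simpa only [sub_eq_add_neg] using h2 : HasSum
        (fun n => ((gaussPole v (pole n - t) : ℝ) : ℂ)) _).congr_fun fun n => ?_
      have := hterm (n + 1)
      push_cast at this ⊢
      rw [this, pole]
    · refine h1.congr_fun fun n => ?_
      have := hterm (-(n + 1))
      push_cast at this ⊢
      rw [this, pole, gaussPole, gaussPole]
      push_cast
      ring_nf
  rw [hL.tsum_eq, hR.tsum_eq, hsq] at hmain
  have h3 : (1 / ((1 / Real.sqrt (Real.pi * v) : ℝ) : ℂ)) = ((Real.sqrt (Real.pi * v) : ℝ) : ℂ) := by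
    push_cast
    rw [one_div_one_div]
  rw [h3] at hmain
  exact_mod_cast hmain

/-! ### Integrals -/

open Set MeasureTheory

lemma integral_gauss_inv {b : ℝ} (hb : 0 < b) :
    ∫ v in Ioi (0 : ℝ), 1 / v * Real.sqrt (Real.pi * v) * Real.exp (-(b * v)) = Real.pi / Real.sqrt b := by
  have h := Real.integral_rpow_mul_exp_neg_mul_Ioi (a := 1 / 2) (by norm_num) hb
  have h2 : ∀ v ∈ Ioi (0 : ℝ), 1 / v * Real.sqrt (Real.pi * v) * Real.exp (-(b * v)) =
      Real.sqrt Real.pi * (v ^ ((1 / 2 : ℝ) - 1) * Real.exp (-(b * v))) := by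
    intro v hv
    have hv : 0 < v := hv
    rw [Real.rpow_sub_one hv.ne', ← Real.sqrt_eq_rpow, Real.sqrt_mul Real.pi_pos.le]
    ring
  rw [setIntegral_congr_fun measurableSet_Ioi h2, integral_const_mul, h, Real.Gamma_one_half_eq,
    ← Real.sqrt_eq_rpow, Real.sqrt_div zero_le_one, Real.sqrt_one]
  have := Real.mul_self_sqrt Real.pi_pos.le
  rw [mul_left_comm, this]
  ring

lemma integral_gauss {b : ℝ} (hb : 0 < b) :
    ∫ v in Ioi (0 : ℝ), Real.sqrt (Real.pi * v) * Real.exp (-(b * v)) =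
      Real.pi / 2 / Real.sqrt b ^ 3 := by
  have h := Real.integral_rpow_mul_exp_neg_mul_Ioi (a := 1 / 2 + 1) (by norm_num) hb
  have h2 : ∀ v ∈ Ioi (0 : ℝ), Real.sqrt (Real.pi * v) * Real.exp (-(b * v)) =
      Real.sqrt Real.pi * (v ^ ((1 / 2 + 1 : ℝ) - 1) * Real.exp (-(b * v))) := by
    intro v hv
    have hv : 0 < v := hv
    rw [add_sub_cancel_right, ← Real.sqrt_eq_rpow, Real.sqrt_mul Real.pi_pos.le]
    ring
  rw [setIntegral_congr_fun measurableSet_Ioi h2, integral_const_mul, h,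
    Real.Gamma_add_one (by norm_num), Real.Gamma_one_half_eq, Real.rpow_add_one (by positivity),
    ← Real.sqrt_eq_rpow, Real.sqrt_div zero_le_one, Real.sqrt_one]
  have h3 := Real.mul_self_sqrt Real.pi_pos.le
  have h4 := Real.sq_sqrt hb.le
  have h5 : 0 < Real.sqrt b := Real.sqrt_pos.2 hb
  have h6 : b = Real.sqrt b ^ 2 := h4.symm
  calc _ = (Real.sqrt Real.pi * Real.sqrt Real.pi) * (1 / Real.sqrt b * (1 / b) * (1 / 2)) := by ring
    _ = _ := by
      rw [h3]
      nth_rewrite 2 [h6]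
      field_simp

lemma integrableOn_of_integral_ne_zero {f : ℝ → ℝ} {s : Set ℝ} (h : ∫ v in s, f v ≠ 0) :
    IntegrableOn f s := by
  by_contra h'
  exact h (integral_undef h')

lemma integrableOn_gauss_inv {b : ℝ} (hb : 0 < b) :
    IntegrableOn (fun v => 1 / v * Real.sqrt (Real.pi * v) * Real.exp (-(b * v))) (Ioi 0) := by
  apply integrableOn_of_integral_ne_zero
  rw [integral_gauss_inv hb]
  have := Real.sqrt_pos.2 hb
  have := Real.pi_pos
  positivity

lemma integrableOn_gauss {b : ℝ} (hb : 0 < b) :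
    IntegrableOn (fun v => Real.sqrt (Real.pi * v) * Real.exp (-(b * v))) (Ioi 0) := by
  apply integrableOn_of_integral_ne_zero
  rw [integral_gauss hb]
  have := Real.sqrt_pos.2 hb
  have := Real.pi_pos
  positivity

lemma abs_exp_sub_exp_le {a b v : ℝ} (hv : 0 ≤ v) :
    |Real.exp (-(a * v)) - Real.exp (-(b * v))| ≤ |a - b| * v * Real.exp (-(min a b * v)) := by
  have key : ∀ {a b : ℝ}, a ≤ b → |Real.exp (-(a * v)) - Real.exp (-(b * v))| ≤
      |a - b| * v * Real.exp (-(min a b * v)) := by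
    intro a b hab
    have h1 : Real.exp (-(b * v)) ≤ Real.exp (-(a * v)) := Real.exp_le_exp.2 (by nlinarith)
    rw [abs_of_nonneg (by linarith), abs_of_nonpos (by linarith), min_eq_left hab]
    have h2 : Real.exp (-(b * v)) = Real.exp (-(a * v)) * Real.exp (-((b - a) * v)) := by
      rw [← Real.exp_add]
      congr 1
      ring
    have h3 := Real.add_one_le_exp (-((b - a) * v))
    rw [h2]
    nlinarith [Real.exp_pos (-(a * v))]
  rcases le_total a b with h | h
  · exact key h
  · rw [abs_sub_comm, abs_sub_comm a b, min_comm]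
    exact key h

lemma integrableOn_frullani {a b : ℝ} (ha : 0 < a) (hb : 0 < b) :
    IntegrableOn (fun v => 1 / v * (Real.exp (-(a * v)) - Real.exp (-(b * v)))) (Ioi 0) := by
  have h := (exp_neg_integrableOn_Ioi 0 (lt_min ha hb)).const_mul |a - b|
  refine Integrable.mono' h ?_ ?_
  · refine ContinuousOn.aestronglyMeasurable ?_ measurableSet_Ioi
    exact (continuousOn_const.div continuousOn_id fun v hv => (ne_of_gt hv)).mul (by fun_prop)
  · refine (ae_restrict_iff' measurableSet_Ioi).2 (Filter.Eventually.of_forall fun v hv => ?_)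
    have hv : 0 < v := hv
    rw [norm_mul, Real.norm_eq_abs, Real.norm_eq_abs, abs_of_pos (by positivity : 0 < 1 / v)]
    calc _ ≤ 1 / v * (|a - b| * v * Real.exp (-(min a b * v))) := by
          gcongr
          exact abs_exp_sub_exp_le hv.le
      _ = _ := by
          rw [neg_mul]
          field_simp

lemma integral_frullani {a b : ℝ} (ha : 0 < a) (hb : 0 < b) :
    ∫ v in Ioi (0 : ℝ), 1 / v * (Real.exp (-(a * v)) - Real.exp (-(b * v))) = Real.log (b / a) := by
  have h := Frullani.integral_Ioi_eq (f := fun v : ℝ => Real.exp (-v)) (L := 1) (R := 0)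
    ((by fun_prop : Continuous fun v : ℝ => Real.exp (-v)).locallyIntegrable.locallyIntegrableOn _)
    ha hb (tendsto_nhdsWithin_of_tendsto_nhds (by
      simpa using (by fun_prop : Continuous fun v : ℝ => Real.exp (-v)).tendsto 0))
    (Real.tendsto_exp_neg_atTop_nhds_zero) (by
      simpa [one_div] using integrableOn_frullani ha hb)
  simpa [one_div] using h

end ModelGeometry

namespace ModelGeometry

open Set MeasureTheory

/-! ### The instanton sums -/

/-- The decaying weight `exp(-c (s + 1/s))`. -/
def rayDecay (c s : ℝ) : ℝ := Real.exp (-(c * (s + 1 / s)))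

lemma rayDecay_pos (c s : ℝ) : 0 < rayDecay c s := Real.exp_pos _

lemma continuousOn_rayDecay (c : ℝ) : ContinuousOn (rayDecay c) (Ioi 0) := by
  have : ContinuousOn (fun s : ℝ => 1 / s) (Ioi 0) :=
    continuousOn_const.div continuousOn_id fun v hv => (ne_of_gt hv)
  exact Real.continuous_exp.comp_continuousOn
    ((continuousOn_const.mul (continuousOn_id.add this)).neg)

/-- The decaying weight dominates every power of `s` occurring along the rays. -/
lemma integrableOn_rayDecay_mul {c : ℝ} (hc : 0 < c) :
    IntegrableOn (fun s => (1 / s ^ 2 + 1 / s + 1 + s) * rayDecay c s) (Ioi 0) := by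
  have h := (exp_neg_integrableOn_Ioi 0 (half_pos hc)).const_mul (2 / c ^ 2 + 1 / c + 1 + 2 / c)
  refine Integrable.mono' h ?_ ?_
  · refine ContinuousOn.aestronglyMeasurable (ContinuousOn.mul ?_ (continuousOn_rayDecay c))
      measurableSet_Ioi
    have h1 : ContinuousOn (fun s : ℝ => 1 / s) (Ioi 0) :=
      continuousOn_const.div continuousOn_id fun v hv => (ne_of_gt hv)
    have h2 : ContinuousOn (fun s : ℝ => 1 / s ^ 2) (Ioi 0) :=
      continuousOn_const.div (continuousOn_id.pow 2) fun v hv => (pow_ne_zero 2 (ne_of_gt hv))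
    exact ((h2.add h1).add continuousOn_const).add continuousOn_id
  · refine (ae_restrict_iff' measurableSet_Ioi).2 (Filter.Eventually.of_forall fun s hs => ?_)
    have hs : 0 < s := hs
    have h1 : rayDecay c s = Real.exp (-(c / s)) * Real.exp (-(c * s)) := by
      rw [rayDecay, ← Real.exp_add]
      congr 1
      ring
    have h2 : Real.exp (-(c * s)) = Real.exp (-(c / 2) * s) * Real.exp (-(c / 2) * s) := by
      rw [← Real.exp_add]
      congr 1
      ring
    set E := Real.exp (-(c / s)) with hE
    set F := Real.exp (-(c / 2) * s) with hF
    have hE0 : 0 < E := Real.exp_pos _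
    have hF0 : 0 < F := Real.exp_pos _
    have hE1 : E ≤ 1 := Real.exp_le_one_iff.2 (by
      have : 0 < c / s := by positivity
      linarith)
    have hF1 : F ≤ 1 := Real.exp_le_one_iff.2 (by nlinarith [mul_pos hc hs])
    have hE2 : 1 / s ^ 2 * E ≤ 2 / c ^ 2 := by
      have h3 := Real.quadratic_le_exp_of_nonneg (x := c / s) (by positivity)
      have h4 : E * Real.exp (c / s) = 1 := by rw [hE, ← Real.exp_add]; simp
      have h5 : (c / s) ^ 2 / 2 * E ≤ 1 := by
        rw [← h4, mul_comm]
        gcongr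
        have : 0 < c / s := by positivity
        linarith
      calc 1 / s ^ 2 * E = ((c / s) ^ 2 / 2 * E) * (2 / c ^ 2) := by field_simp
        _ ≤ 1 * (2 / c ^ 2) := by gcongr
        _ = _ := one_mul _
    have hE3 : 1 / s * E ≤ 1 / c := by
      have h3 := Real.add_one_le_exp (c / s)
      have h4 : E * Real.exp (c / s) = 1 := by rw [hE, ← Real.exp_add]; simp
      have h5 : c / s * E ≤ 1 := by
        rw [← h4, mul_comm]
        gcongr
        linarith
      calc 1 / s * E = (c / s * E) * (1 / c) := by field_simp
        _ ≤ 1 * (1 / c) := by gcongr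
        _ = _ := one_mul _
    have hF2 : s * F ≤ 2 / c := by
      have h3 := Real.add_one_le_exp (c / 2 * s)
      have h4 : F * Real.exp (c / 2 * s) = 1 := by rw [hF, ← Real.exp_add]; simp
      have h5 : c / 2 * s * F ≤ 1 := by
        rw [← h4, mul_comm]
        gcongr
        linarith
      calc s * F = (c / 2 * s * F) * (2 / c) := by field_simp
        _ ≤ 1 * (2 / c) := by gcongr
        _ = _ := one_mul _
    rw [norm_mul, Real.norm_eq_abs, Real.norm_eq_abs, abs_of_pos (rayDecay_pos _ _),
      abs_of_pos (by positivity), h1, h2]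
    calc (1 / s ^ 2 + 1 / s + 1 + s) * (E * (F * F))
        = ((1 / s ^ 2 * E) * F + (1 / s * E) * F + E * F + (s * F) * E) * F := by ring
      _ ≤ (2 / c ^ 2 * 1 + 1 / c * 1 + 1 * 1 + 2 / c * 1) * F := by gcongr
      _ = _ := by ring

lemma integrableOn_of_rayDecay_bound {E : Type*} [NormedAddCommGroup E] {c C : ℝ} (hc : 0 < c)
    {f : ℝ → E} (hf : AEStronglyMeasurable f (volume.restrict (Ioi 0)))
    (h : ∀ s > 0, ‖f s‖ ≤ C * ((1 / s ^ 2 + 1 / s + 1 + s) * rayDecay c s)) :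
    IntegrableOn f (Ioi 0) :=
  Integrable.mono' ((integrableOn_rayDecay_mul hc).const_mul C) hf
    ((ae_restrict_iff' measurableSet_Ioi).2 (Filter.Eventually.of_forall fun s hs => h s hs))

lemma two_le_add_inv {s : ℝ} (hs : 0 < s) : 2 ≤ s + 1 / s := by
  have h : s + 1 / s - 2 = (s - 1) ^ 2 / s := by
    field_simp
    ring
  have : 0 ≤ (s - 1) ^ 2 / s := by positivity
  linarith

/-- The semi-flat character along its own BPS ray. -/
def bpsX (ρ t s : ℝ) : ℂ := (rayDecay ρ s : ℂ) * Complex.exp (t * Complex.I)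

/-- The occupation number `X / (1 - X)` along the BPS ray. -/
def bpsQ (ρ t s : ℝ) : ℂ := bpsX ρ t s / (1 - bpsX ρ t s)

lemma norm_bpsX (ρ t s : ℝ) : ‖bpsX ρ t s‖ = rayDecay ρ s := by
  rw [bpsX, norm_mul, Complex.norm_exp_ofReal_mul_I, mul_one, Complex.norm_real, Real.norm_eq_abs,
    abs_of_pos (rayDecay_pos _ _)]

lemma rayDecay_lt_one {ρ s : ℝ} (hρ : 0 < ρ) (hs : 0 < s) : rayDecay ρ s < 1 := by
  have h := two_le_add_inv hs
  calc rayDecay ρ s < Real.exp 0 := Real.exp_lt_exp.2 (by nlinarith)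
    _ = 1 := Real.exp_zero

lemma rayDecay_nat (ρ s : ℝ) (n : ℕ) : rayDecay ρ s ^ (n + 1) = rayDecay ((n + 1) * ρ) s := by
  rw [rayDecay, ← Real.exp_nat_mul, rayDecay]
  congr 1
  push_cast
  ring

lemma hasSum_bpsQ {ρ s : ℝ} (hρ : 0 < ρ) (hs : 0 < s) (t : ℝ) :
    HasSum (fun n : ℕ => (rayDecay ((n + 1) * ρ) s : ℂ) * Complex.exp (((n + 1) * t : ℝ) * Complex.I))
      (bpsQ ρ t s) := by
  have h := (hasSum_geometric_of_norm_lt_one (ξ := bpsX ρ t s)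
    (by rw [norm_bpsX]; exact rayDecay_lt_one hρ hs)).mul_left (bpsX ρ t s)
  rw [← div_eq_mul_inv] at h
  refine h.congr_fun fun n => ?_
  rw [← pow_succ', bpsX, mul_pow, ← Complex.exp_nat_mul, ← rayDecay_nat]
  push_cast
  ring_nf

lemma rayDecay_le {ρ s : ℝ} (hρ : 0 < ρ) (hs : 0 < s) (n : ℕ) :
    rayDecay ((n + 1) * ρ) s ≤ Real.exp (-(2 * ρ)) ^ n * rayDecay ρ s := by
  rw [rayDecay, rayDecay, ← Real.exp_nat_mul, ← Real.exp_add]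
  refine Real.exp_le_exp.2 ?_
  have h1 := two_le_add_inv hs
  have h2 : (0 : ℝ) ≤ n * ρ := by positivity
  nlinarith

lemma exp_neg_two_mul_lt_one {ρ : ℝ} (hρ : 0 < ρ) : Real.exp (-(2 * ρ)) < 1 := by
  rw [← Real.exp_zero]
  exact Real.exp_lt_exp.2 (by linarith)

section

/-- A weight bounded by the powers of `s` occurring along the rays. -/
structure RayWeight (w : ℝ → ℝ) : Prop where
  cont : ContinuousOn w (Ioi 0)
  nonneg : ∀ s > 0, 0 ≤ w s
  le : ∀ s > 0, w s ≤ 1 / s ^ 2 + 1 / s + 1 + s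

lemma rayWeight_one : RayWeight fun _ => 1 :=
  ⟨continuousOn_const, fun _ _ => zero_le_one, fun s hs => by
    have : 0 < 1 / s ^ 2 + 1 / s + s := by positivity
    linarith⟩

lemma rayWeight_inv : RayWeight fun s => 1 / s :=
  ⟨continuousOn_const.div continuousOn_id fun v hv => (ne_of_gt hv), fun s hs => by positivity,
    fun s hs => by
    have : 0 < 1 / s ^ 2 + 1 + s := by positivity
    linarith⟩

variable {w : ℝ → ℝ} (hw : RayWeight w)
include hw

lemma integrableOn_weight_rayDecay {c : ℝ} (hc : 0 < c) :
    IntegrableOn (fun s => w s * rayDecay c s) (Ioi 0) := by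
  refine integrableOn_of_rayDecay_bound (C := 1) hc
    ((hw.cont.mul (continuousOn_rayDecay c)).aestronglyMeasurable measurableSet_Ioi) fun s hs => ?_
  rw [norm_mul, Real.norm_eq_abs, Real.norm_eq_abs, abs_of_nonneg (hw.nonneg s hs),
    abs_of_pos (rayDecay_pos _ _), one_mul]
  exact mul_le_mul_of_nonneg_right (hw.le s hs) (rayDecay_pos _ _).le

lemma integral_weight_rayDecay_le {ρ : ℝ} (hρ : 0 < ρ) (n : ℕ) :
    ∫ s in Ioi (0 : ℝ), w s * rayDecay ((n + 1) * ρ) s ≤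
      Real.exp (-(2 * ρ)) ^ n * ∫ s in Ioi (0 : ℝ), w s * rayDecay ρ s := by
  rw [← integral_const_mul]
  refine setIntegral_mono_on (integrableOn_weight_rayDecay hw (by positivity))
    ((integrableOn_weight_rayDecay hw hρ).const_mul _) measurableSet_Ioi fun s hs => ?_
  calc w s * rayDecay ((n + 1) * ρ) s ≤ w s * (Real.exp (-(2 * ρ)) ^ n * rayDecay ρ s) :=
        mul_le_mul_of_nonneg_left (rayDecay_le hρ hs n) (hw.nonneg s hs)
    _ = _ := by ring

lemma integral_weight_rayDecay_nonneg (c : ℝ) : 0 ≤ ∫ s in Ioi (0 : ℝ), w s * rayDecay c s :=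
  setIntegral_nonneg measurableSet_Ioi fun s hs =>
    mul_nonneg (hw.nonneg s hs) (rayDecay_pos _ _).le

/-- The Fourier expansion of the integrals of the occupation number. -/
lemma hasSum_integral_bpsQ {ρ : ℝ} (hρ : 0 < ρ) (t : ℝ) :
    HasSum (fun n : ℕ => ((∫ s in Ioi (0 : ℝ), w s * rayDecay ((n + 1) * ρ) s : ℝ) : ℂ) *
      Complex.exp (((n + 1) * t : ℝ) * Complex.I))
      (∫ s in Ioi (0 : ℝ), (w s : ℂ) * bpsQ ρ t s) := by
  have h := hasSum_integral_of_summable_integral_norm (μ := volume.restrict (Ioi (0 : ℝ)))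
    (F := fun (n : ℕ) s => ((w s * rayDecay ((n + 1) * ρ) s : ℝ) : ℂ) *
      Complex.exp (((n + 1) * t : ℝ) * Complex.I))
    (fun n => ((integrableOn_weight_rayDecay hw (by positivity :
      0 < (n + 1 : ℝ) * ρ)).ofReal.mul_const _)) (by
      have h1 : ∀ n : ℕ, ∫ s in Ioi (0 : ℝ), ‖((w s * rayDecay ((n + 1) * ρ) s : ℝ) : ℂ) *
          Complex.exp (((n + 1) * t : ℝ) * Complex.I)‖ =
          ∫ s in Ioi (0 : ℝ), w s * rayDecay ((n + 1) * ρ) s := fun n => by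
        refine setIntegral_congr_fun measurableSet_Ioi fun s hs => ?_
        rw [norm_mul, Complex.norm_exp_ofReal_mul_I, mul_one, Complex.norm_real, Real.norm_eq_abs,
          abs_of_nonneg (mul_nonneg (hw.nonneg s hs) (rayDecay_pos _ _).le)]
      simp only [h1]
      exact Summable.of_nonneg_of_le (fun n => integral_weight_rayDecay_nonneg hw _)
        (fun n => integral_weight_rayDecay_le hw hρ n)
        ((summable_geometric_of_lt_one (Real.exp_pos _).le
          (exp_neg_two_mul_lt_one hρ)).mul_right _))
  have h2 : ∀ s ∈ Ioi (0 : ℝ), ∑' n : ℕ, ((w s * rayDecay ((n + 1) * ρ) s : ℝ) : ℂ) *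
      Complex.exp (((n + 1) * t : ℝ) * Complex.I) = (w s : ℂ) * bpsQ ρ t s := fun s hs => by
    rw [← (hasSum_bpsQ hρ hs t).tsum_eq, ← tsum_mul_left]
    refine tsum_congr fun n => ?_
    push_cast
    ring
  rw [setIntegral_congr_fun measurableSet_Ioi h2] at h
  refine h.congr_fun fun n => ?_
  rw [integral_mul_const, integral_complex_ofReal]

end

/-- The integral `∫ ds/s X/(1-X)` along the BPS ray. -/
def bpsA0 (ρ t : ℝ) : ℂ := ∫ s in Ioi (0 : ℝ), ((1 / s : ℝ) : ℂ) * bpsQ ρ t s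

/-- The integral `∫ ds X/(1-X)` along the BPS ray. -/
def bpsA1 (ρ t : ℝ) : ℂ := ∫ s in Ioi (0 : ℝ), ((1 : ℝ) : ℂ) * bpsQ ρ t s

/-- The Bessel functions `2 K_0(2(n+1)ρ)` and `2 K_1(2(n+1)ρ)`, as integrals along rays. -/
def besselK0 (ρ : ℝ) (n : ℕ) : ℝ := ∫ s in Ioi (0 : ℝ), 1 / s * rayDecay ((n + 1) * ρ) s

/-- See `besselK0`. -/
def besselK1 (ρ : ℝ) (n : ℕ) : ℝ := ∫ s in Ioi (0 : ℝ), 1 * rayDecay ((n + 1) * ρ) s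

lemma hasSum_bpsA0_re {ρ : ℝ} (hρ : 0 < ρ) (t : ℝ) :
    HasSum (fun n : ℕ => besselK0 ρ n * Real.cos ((n + 1) * t)) (bpsA0 ρ t).re := by
  have h := Complex.hasSum_re (hasSum_integral_bpsQ rayWeight_inv hρ t)
  refine h.congr_fun fun n => ?_
  rw [Complex.re_ofReal_mul, Complex.exp_ofReal_mul_I_re, besselK0]

lemma hasSum_bpsA1_im {ρ : ℝ} (hρ : 0 < ρ) (t : ℝ) :
    HasSum (fun n : ℕ => besselK1 ρ n * Real.sin ((n + 1) * t)) (bpsA1 ρ t).im := by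
  have h := Complex.hasSum_im (hasSum_integral_bpsQ rayWeight_one hρ t)
  refine h.congr_fun fun n => ?_
  rw [Complex.im_ofReal_mul, Complex.exp_ofReal_mul_I_im, besselK1]

lemma besselK0_eq {ρ : ℝ} (hρ : 0 < ρ) (n : ℕ) : besselK0 ρ n =
    ∫ v in Ioi (0 : ℝ), 1 / v * Real.exp (-(ρ ^ 2 * v)) * Real.exp (-((n + 1) ^ 2 / v)) := by
  have hb : 0 < ρ / (n + 1) := by positivity
  have h := integral_comp_mul_left_Ioi' (fun s => 1 / s * rayDecay ((n + 1) * ρ) s) 0 hb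
  rw [mul_zero, ← integral_smul] at h
  rw [besselK0, ← h]
  refine setIntegral_congr_fun measurableSet_Ioi fun v hv => ?_
  have hv : 0 < v := hv
  simp only [smul_eq_mul]
  rw [mul_assoc (1 / v), ← Real.exp_add, rayDecay, ← mul_assoc]
  congr 1
  · field_simp
  · congr 1
    field_simp
    ring

lemma besselK1_eq {ρ : ℝ} (hρ : 0 < ρ) (n : ℕ) : (n + 1) / ρ * besselK1 ρ n =
    ∫ v in Ioi (0 : ℝ), Real.exp (-(ρ ^ 2 * v)) * Real.exp (-((n + 1) ^ 2 / v)) := by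
  have hb : 0 < ρ / (n + 1) := by positivity
  have h := integral_comp_mul_left_Ioi (fun s => 1 * rayDecay ((n + 1) * ρ) s) 0 hb
  rw [mul_zero, inv_div, smul_eq_mul] at h
  rw [besselK1, ← h]
  refine setIntegral_congr_fun measurableSet_Ioi fun v hv => ?_
  have hv : 0 < v := hv
  rw [← Real.exp_add, rayDecay, one_mul]
  congr 1
  field_simp
  ring

end ModelGeometry

namespace ModelGeometry

open Set MeasureTheory

/-! ### The connection coefficient -/

/-- Termwise integration of a series, with an additional integrable term. -/
lemma integral_add_hasSum {f₀ G : ℝ → ℝ} {F : ℕ → ℝ → ℝ} {b : ℕ → ℝ}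
    (h0 : IntegrableOn f₀ (Ioi 0)) (hF : ∀ n, IntegrableOn (F n) (Ioi 0))
    (hb : Summable b) (hFb : ∀ n, ∫ v in Ioi (0 : ℝ), ‖F n v‖ ≤ b n)
    (hG : ∀ v > 0, HasSum (fun n => F n v) (G v)) :
    Summable (fun n => ∫ v in Ioi (0 : ℝ), F n v) ∧
    ∫ v in Ioi (0 : ℝ), (f₀ v + G v) =
      (∫ v in Ioi (0 : ℝ), f₀ v) + ∑' n, ∫ v in Ioi (0 : ℝ), F n v := by
  let H : ℕ → ℝ → ℝ := fun n => n.casesOn f₀ F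
  have hs : Summable fun n => ∫ v in Ioi (0 : ℝ), ‖F n v‖ :=
    Summable.of_nonneg_of_le (fun n => integral_nonneg fun v => norm_nonneg _) hFb hb
  have hH : Summable fun n => ∫ v in Ioi (0 : ℝ), ‖H n v‖ := (summable_nat_add_iff 1).1 hs
  have h := hasSum_integral_of_summable_integral_norm (μ := volume.restrict (Ioi (0 : ℝ))) (F := H)
    (fun n => by cases n with
      | zero => exact h0
      | succ n => exact hF n) hH
  have h2 : ∀ v ∈ Ioi (0 : ℝ), ∑' n, H n v = f₀ v + G v := fun v hv => by
    have h3 : HasSum (fun n => H n v) (f₀ v + G v) := by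
      refine (hasSum_nat_add_iff' 1).1 ?_
      rw [Finset.sum_range_one]
      have : f₀ v + G v - H 0 v = G v := by
        change f₀ v + G v - f₀ v = G v
        ring
      rw [this]
      exact hG v hv
    exact h3.tsum_eq
  rw [setIntegral_congr_fun measurableSet_Ioi h2] at h
  refine ⟨(summable_nat_add_iff 1).2 h.summable, ?_⟩
  rw [← h.tsum_eq, h.summable.tsum_eq_zero_add]
  rfl

/-- The distance to a charge at `τ` on the axis. -/
def dist3 (ρ τ : ℝ) : ℝ := Real.sqrt (4 * ρ ^ 2 + τ ^ 2)

lemma dist3_pos {ρ : ℝ} (hρ : 0 < ρ) (τ : ℝ) : 0 < dist3 ρ τ := Real.sqrt_pos.2 (by positivity)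

lemma dist3_sq (ρ τ : ℝ) : dist3 ρ τ ^ 2 = 4 * ρ ^ 2 + τ ^ 2 := Real.sq_sqrt (by positivity)

lemma abs_le_dist3 (ρ τ : ℝ) : |τ| ≤ dist3 ρ τ := by
  rw [dist3, ← Real.sqrt_sq_eq_abs]
  exact Real.sqrt_le_sqrt (by nlinarith [sq_nonneg ρ])

lemma exp_mul_gaussPole (ρ τ v : ℝ) :
    Real.exp (-(ρ ^ 2 * v)) * gaussPole v τ = Real.exp (-(dist3 ρ τ ^ 2 / 4 * v)) := by
  rw [gaussPole, ← Real.exp_add, dist3_sq]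
  congr 1
  ring

lemma sqrt_dist3_sq {ρ : ℝ} (hρ : 0 < ρ) (τ : ℝ) : Real.sqrt (dist3 ρ τ ^ 2 / 4) = dist3 ρ τ / 2 := by
  have h : dist3 ρ τ ^ 2 / 4 = (dist3 ρ τ / 2) ^ 2 := by ring
  rw [h, Real.sqrt_sq (half_pos (dist3_pos hρ τ)).le]

lemma pole_add_ge (t : ℝ) (n : ℕ) :
    (2 * Real.pi - |t|) * (n + 1) ≤ pole n + t := by
  have h1 := neg_abs_le t
  have h2 : (0 : ℝ) ≤ n := n.cast_nonneg
  rw [pole]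
  nlinarith [abs_nonneg t]

lemma dist3_ge (ρ t : ℝ) (n : ℕ) :
    (2 * Real.pi - |t|) * (n + 1) ≤ dist3 ρ (pole n + t) :=
  (pole_add_ge t n).trans ((le_abs_self _).trans (abs_le_dist3 _ _))

lemma integral_gaussPole {ρ : ℝ} (hρ : 0 < ρ) (τ : ℝ) :
    ∫ v in Ioi (0 : ℝ), Real.sqrt (Real.pi * v) * (Real.exp (-(ρ ^ 2 * v)) * gaussPole v τ) =
      4 * Real.pi / dist3 ρ τ ^ 3 := by
  have h := dist3_pos hρ τ
  simp only [exp_mul_gaussPole]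
  rw [integral_gauss (by positivity), sqrt_dist3_sq hρ]
  field_simp
  norm_num

lemma integrableOn_gaussPole {ρ : ℝ} (hρ : 0 < ρ) (τ : ℝ) :
    IntegrableOn (fun v => Real.sqrt (Real.pi * v) * (Real.exp (-(ρ ^ 2 * v)) * gaussPole v τ))
      (Ioi 0) := by
  have h := dist3_pos hρ τ
  simp only [exp_mul_gaussPole]
  exact integrableOn_gauss (by positivity)

lemma summable_inv_dist3_cube {ρ t : ℝ} (hρ : 0 < ρ) (ht : |t| < 2 * Real.pi) :
    Summable fun n => 4 * Real.pi / dist3 ρ (pole n + t) ^ 3 := by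
  have hδ : 0 < 2 * Real.pi - |t| := by linarith
  have hpi := Real.pi_pos
  refine Summable.of_nonneg_of_le (fun n => ?_) (fun n => ?_)
    (summable_inv_sq.mul_left (4 * Real.pi / (2 * Real.pi - |t|) ^ 3))
  · have := dist3_pos hρ (pole n + t)
    positivity
  · have h1 := dist3_ge ρ t n
    have h2 : (0 : ℝ) ≤ n := n.cast_nonneg
    have h3 : ((n : ℝ) + 1) ^ 2 ≤ (n + 1) ^ 3 := pow_le_pow_right₀ (by linarith) (by norm_num)
    calc 4 * Real.pi / dist3 ρ (pole n + t) ^ 3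
        ≤ 4 * Real.pi / ((2 * Real.pi - |t|) * (n + 1)) ^ 3 := by gcongr
      _ = 4 * Real.pi / (2 * Real.pi - |t|) ^ 3 * (1 / (n + 1) ^ 3) := by
        rw [mul_pow]
        field_simp
      _ ≤ _ := by gcongr

lemma summable_mul_besselK1 {ρ : ℝ} (hρ : 0 < ρ) : Summable fun n : ℕ => (n + 1) / ρ * besselK1 ρ n := by
  have hr := exp_neg_two_mul_lt_one hρ
  have h0 : ‖Real.exp (-(2 * ρ))‖ < 1 := by rwa [Real.norm_eq_abs, Real.abs_exp]
  have h1 := (summable_pow_mul_geometric_of_norm_lt_one 1 h0)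
  have h2 := summable_geometric_of_lt_one (Real.exp_pos _).le hr
  have h3 := ((h1.add h2).mul_right (∫ s in Ioi (0 : ℝ), 1 * rayDecay ρ s)).mul_left (1 / ρ)
  refine Summable.of_nonneg_of_le (fun n => mul_nonneg (by positivity)
    (integral_weight_rayDecay_nonneg rayWeight_one _)) (fun n => ?_) h3
  calc (n + 1) / ρ * besselK1 ρ n ≤ (n + 1) / ρ *
        (Real.exp (-(2 * ρ)) ^ n * ∫ s in Ioi (0 : ℝ), 1 * rayDecay ρ s) := by
        gcongr
        exact integral_weight_rayDecay_le rayWeight_one hρ n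
    _ = _ := by ring

/-- The derivative of the connection coefficient, as a sum over its charges. -/
lemma tsum_besselK1_cos {ρ t : ℝ} (hρ : 0 < ρ) (ht : |t| < 2 * Real.pi) :
    1 / (2 * Real.pi) + ρ / Real.pi * ∑' n : ℕ, (n + 1) * besselK1 ρ n * Real.cos ((n + 1) * t) =
      2 * ρ ^ 2 * (1 / dist3 ρ t ^ 3 + ∑' n : ℕ, (1 / dist3 ρ (pole n + t) ^ 3 +
        1 / dist3 ρ (pole n - t) ^ 3)) := by
  have hpi := Real.pi_pos
  have ht' : |-t| < 2 * Real.pi := by rwa [abs_neg]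
  have hρ2 : 0 < ρ ^ 2 := by positivity
  have hexp := exp_neg_integrableOn_Ioi 0 hρ2
  have hexpint : ∫ v in Ioi (0 : ℝ), Real.exp (-(ρ ^ 2 * v)) = 1 / ρ ^ 2 := by
    have := Real.integral_rpow_mul_exp_neg_mul_Ioi (a := 1) one_pos hρ2
    simpa using this
  -- integrate the theta function in its two forms
  have hmeas : ∀ n : ℕ, IntegrableOn (fun v => Real.exp (-(ρ ^ 2 * v)) *
      Real.exp (-((n + 1 : ℝ) ^ 2 / v))) (Ioi 0) := fun n => by
    apply integrableOn_of_integral_ne_zero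
    rw [← besselK1_eq hρ]
    have : 0 < besselK1 ρ n := by
      rw [besselK1, setIntegral_pos_iff_support_of_nonneg_ae
        (Filter.Eventually.of_forall fun s => by
          have := (rayDecay_pos ((n + 1) * ρ) s).le
          simpa using this)
        (integrableOn_weight_rayDecay rayWeight_one (by positivity))]
      have : Function.support (fun s => rayDecay ((n + 1) * ρ) s) = univ := by
        ext s
        simpa using (rayDecay_pos ((n + 1) * ρ) s).ne'
      simp only [one_mul, this]
      simp
    positivity
  have hL := integral_add_hasSum (f₀ := fun v => Real.exp (-(ρ ^ 2 * v)))
    (G := fun v => 2 * (Real.exp (-(ρ ^ 2 * v)) * ∑' n, thetaCos v t n))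
    (F := fun n v => 2 * Real.cos ((n + 1) * t) * (Real.exp (-(ρ ^ 2 * v)) *
      Real.exp (-((n + 1 : ℝ) ^ 2 / v))))
    (by simpa using hexp) (fun n => (hmeas n).const_mul _)
    ((summable_mul_besselK1 hρ).mul_left 2) (fun n => by
      rw [besselK1_eq hρ, ← integral_const_mul]
      refine setIntegral_mono_on ((hmeas n).const_mul _).norm ((hmeas n).const_mul _)
        measurableSet_Ioi fun v _ => ?_
      rw [norm_mul, norm_mul, norm_mul, Real.norm_eq_abs, Real.norm_eq_abs, Real.norm_eq_abs,
        Real.norm_eq_abs, Real.abs_exp, Real.abs_exp, abs_two]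
      have := Real.abs_cos_le_one ((n + 1) * t)
      have h1 := Real.exp_pos (-(ρ ^ 2 * v))
      have h2 := Real.exp_pos (-((n + 1 : ℝ) ^ 2 / v))
      have h3 := mul_pos h1 h2
      nlinarith)
    (fun v hv => by
      have := ((summable_thetaCos hv t).hasSum.mul_left (Real.exp (-(ρ ^ 2 * v)))).mul_left 2
      refine this.congr_fun fun n => ?_
      rw [thetaCos]
      ring)
  -- the dual form, a sum of Gaussians centred at the poles
  have hR := integral_add_hasSum
    (f₀ := fun v => Real.sqrt (Real.pi * v) * (Real.exp (-(ρ ^ 2 * v)) * gaussPole v t))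
    (G := fun v => Real.sqrt (Real.pi * v) * (Real.exp (-(ρ ^ 2 * v)) *
      (∑' n, gaussPole v (pole n + t) + ∑' n, gaussPole v (pole n - t))))
    (F := fun n v => Real.sqrt (Real.pi * v) * (Real.exp (-(ρ ^ 2 * v)) * gaussPole v (pole n + t)) +
      Real.sqrt (Real.pi * v) * (Real.exp (-(ρ ^ 2 * v)) * gaussPole v (pole n - t)))
    (b := fun n => 4 * Real.pi / dist3 ρ (pole n + t) ^ 3 + 4 * Real.pi / dist3 ρ (pole n - t) ^ 3)
    (integrableOn_gaussPole hρ t)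
    (fun n => (integrableOn_gaussPole hρ _).add (integrableOn_gaussPole hρ _))
    ((summable_inv_dist3_cube hρ ht).add (summable_inv_dist3_cube hρ ht'))
    (fun n => by
      rw [← integral_gaussPole hρ, ← integral_gaussPole hρ,
        ← integral_add (integrableOn_gaussPole hρ _) (integrableOn_gaussPole hρ _)]
      refine le_of_eq (setIntegral_congr_fun measurableSet_Ioi fun v _ => ?_)
      simp only [gaussPole]
      rw [Real.norm_eq_abs, abs_of_nonneg (by positivity)])
    (fun v hv => by
      have h1 := (summable_gaussPole hv t).hasSum
      have h2 := (summable_gaussPole hv (-t)).hasSum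
      have := ((h1.add h2).mul_left (Real.exp (-(ρ ^ 2 * v)))).mul_left (Real.sqrt (Real.pi * v))
      simp only [← sub_eq_add_neg] at this
      refine this.congr_fun fun n => ?_
      ring)
  -- the two forms agree by Poisson resummation
  have hLR : ∫ v in Ioi (0 : ℝ), (Real.exp (-(ρ ^ 2 * v)) +
      2 * (Real.exp (-(ρ ^ 2 * v)) * ∑' n, thetaCos v t n)) =
      ∫ v in Ioi (0 : ℝ), (Real.sqrt (Real.pi * v) * (Real.exp (-(ρ ^ 2 * v)) * gaussPole v t) +
      Real.sqrt (Real.pi * v) * (Real.exp (-(ρ ^ 2 * v)) *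
      (∑' n, gaussPole v (pole n + t) + ∑' n, gaussPole v (pole n - t)))) := by
    refine setIntegral_congr_fun measurableSet_Ioi fun v hv => ?_
    have := theta_inversion hv t
    linear_combination (Real.exp (-(ρ ^ 2 * v))) * this
  rw [hL.2, hR.2, hexpint, integral_gaussPole hρ] at hLR
  have h1 : ∀ n : ℕ, ∫ v in Ioi (0 : ℝ), 2 * Real.cos ((n + 1) * t) * (Real.exp (-(ρ ^ 2 * v)) *
      Real.exp (-((n + 1 : ℝ) ^ 2 / v))) =
      2 / ρ * ((n + 1) * besselK1 ρ n * Real.cos ((n + 1) * t)) := fun n => by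
    rw [integral_const_mul, ← besselK1_eq hρ]
    ring
  have h2 : ∀ n : ℕ, ∫ v in Ioi (0 : ℝ), (Real.sqrt (Real.pi * v) * (Real.exp (-(ρ ^ 2 * v)) *
      gaussPole v (pole n + t)) +
      Real.sqrt (Real.pi * v) * (Real.exp (-(ρ ^ 2 * v)) * gaussPole v (pole n - t))) =
      4 * Real.pi * (1 / dist3 ρ (pole n + t) ^ 3 + 1 / dist3 ρ (pole n - t) ^ 3) := fun n => by
    rw [integral_add (integrableOn_gaussPole hρ _) (integrableOn_gaussPole hρ _),
      integral_gaussPole hρ, integral_gaussPole hρ]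
    ring
  simp only [h1, h2] at hLR
  rw [tsum_mul_left, tsum_mul_left] at hLR
  have h3 : ρ ^ 2 / (2 * Real.pi) * (1 / ρ ^ 2 + 2 / ρ *
      ∑' n : ℕ, (n + 1) * besselK1 ρ n * Real.cos ((n + 1) * t)) = 1 / (2 * Real.pi) +
      ρ / Real.pi * ∑' n : ℕ, (n + 1) * besselK1 ρ n * Real.cos ((n + 1) * t) := by
    generalize (∑' n : ℕ, (n + 1) * besselK1 ρ n * Real.cos ((n + 1) * t)) = S
    field_simp
  rw [← h3, hLR]
  field_simp
  ring

lemma hasDerivAt_bpsA1_im {ρ : ℝ} (hρ : 0 < ρ) (t : ℝ) :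
    HasDerivAt (fun t => (bpsA1 ρ t).im)
      (∑' n : ℕ, (n + 1) * besselK1 ρ n * Real.cos ((n + 1) * t)) t := by
  have h : (fun t => (bpsA1 ρ t).im) = fun t => ∑' n : ℕ, besselK1 ρ n * Real.sin ((n + 1) * t) :=
    funext fun t => (hasSum_bpsA1_im hρ t).tsum_eq.symm
  rw [h]
  have hs : Summable fun n : ℕ => (n + 1) * besselK1 ρ n := by
    refine ((summable_mul_besselK1 hρ).mul_left ρ).congr fun n => ?_
    field_simp
  refine hasDerivAt_tsum (u := fun n : ℕ => (n + 1) * besselK1 ρ n)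
    (g := fun (n : ℕ) t => besselK1 ρ n * Real.sin ((n + 1) * t))
    (g' := fun (n : ℕ) t => (n + 1) * besselK1 ρ n * Real.cos ((n + 1) * t)) (y₀ := 0) hs
    (fun n y => ?_) (fun n y => ?_) (by simp [summable_zero]) t
  · have h1 : HasDerivAt (fun t : ℝ => ((n : ℝ) + 1) * t) (n + 1) y := by
      simpa using (hasDerivAt_id y).const_mul ((n : ℝ) + 1)
    refine (h1.sin.const_mul _).congr_deriv ?_
    ring
  · have h0 : 0 ≤ besselK1 ρ n := integral_weight_rayDecay_nonneg rayWeight_one _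
    rw [norm_mul, Real.norm_eq_abs, Real.norm_eq_abs, abs_of_nonneg (by positivity)]
    exact mul_le_of_le_one_right (by positivity) (Real.abs_cos_le_one _)

lemma rad_ofReal (ρ τ : ℝ) : rad ((ρ ^ 2 : ℝ) : ℂ) τ = dist3 ρ τ := by
  rw [rad, dist3, ← csq_ofReal (by positivity)]
  push_cast
  rfl

/-- The coefficient `W` of the connection, given by the instanton sum. -/
def instW (ρ t : ℝ) : ℝ := (t - Real.pi) / (2 * Real.pi) + ρ / Real.pi * (bpsA1 ρ t).im

lemma gReg_neg (a t : ℂ) : gReg (a, -t) = -gReg (a, t) := by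
  rw [gReg, gReg, ← tsum_neg]
  refine tsum_congr fun n => ?_
  simp only [gTerm, sub_neg_eq_add, ← sub_eq_add_neg]
  ring

lemma gReg_zero_right (a : ℂ) : gReg (a, 0) = 0 := by
  have h := gReg_neg a 0
  rw [neg_zero] at h
  linear_combination (1 / 2 : ℂ) * h

/-- The connection coefficient is that of a unit charge at the origin up to a smooth remainder. -/
theorem instW_eq {ρ t : ℝ} (hρ : 0 < ρ) (ht : |t| < 2 * Real.pi) :
    (instW ρ t : ℂ) = ((t / dist3 ρ t - 1) / 2 : ℝ) + ((ρ ^ 2 : ℝ) : ℂ) * gReg ((ρ ^ 2 : ℝ), t) := by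
  -- the difference of the two sides has derivative zero in `t`, by the resummed series, and
  -- vanishes at `t = 0`, where all terms but the constant `-1/2` are odd
  set f : ℝ → ℂ := fun t => (instW ρ t : ℂ) - ((t / dist3 ρ t - 1) / 2 : ℝ) -
    ((ρ ^ 2 : ℝ) : ℂ) * gReg ((ρ ^ 2 : ℝ), t) with hf
  have hderiv : ∀ t ∈ Ioo (-(2 * Real.pi)) (2 * Real.pi), HasDerivAt f 0 t := by
    intro t ht
    have ht : |t| < 2 * Real.pi := abs_lt.2 ht
    obtain ⟨δ, hδ, hδ1, hp⟩ := exists_mem_regDomain (sq_nonneg ρ) ht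
    have h1 : HasDerivAt (fun t => (instW ρ t : ℂ)) ((1 / (2 * Real.pi) + ρ / Real.pi *
        ∑' n : ℕ, (n + 1) * besselK1 ρ n * Real.cos ((n + 1) * t) : ℝ) : ℂ) t := by
      refine HasDerivAt.ofReal_comp ?_
      exact (((hasDerivAt_id t).sub_const _).div_const _).add
        ((hasDerivAt_bpsA1_im hρ t).const_mul _)
    have hd := dist3_pos hρ t
    have h2 : HasDerivAt (dist3 ρ) (t / dist3 ρ t) t := by
      have h3 : HasDerivAt (fun τ : ℝ => 4 * ρ ^ 2 + τ ^ 2) (2 * t) t := by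
        simpa using (hasDerivAt_pow 2 t).const_add (4 * ρ ^ 2)
      refine (h3.sqrt (by positivity)).congr_deriv ?_
      rw [dist3]
      ring
    have h4 : HasDerivAt (fun t : ℝ => (((t / dist3 ρ t - 1) / 2 : ℝ) : ℂ))
        ((2 * ρ ^ 2 / dist3 ρ t ^ 3 : ℝ) : ℂ) t := by
      refine HasDerivAt.ofReal_comp ?_
      refine ((((hasDerivAt_id t).div h2 hd.ne').sub_const 1).div_const 2).congr_deriv ?_
      have := dist3_sq ρ t
      simp only [id]
      field_simp
      rw [this]
      ring
    have h5 : HasDerivAt (fun t : ℝ => gReg ((ρ ^ 2 : ℝ), (t : ℂ)))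
        (-2 * ∑' n, uTermA n ((ρ ^ 2 : ℝ), (t : ℂ))) t := by
      have h6 : HasDerivAt (fun t : ℝ => ((((ρ ^ 2 : ℝ) : ℂ), (t : ℂ)) : ℂ × ℂ)) (0, 1) t :=
        (hasDerivAt_const t _).prodMk (HasDerivAt.ofReal_comp (hasDerivAt_id t))
      have h7 := ((hasFDerivAt_gReg hδ hδ1 hp).restrictScalars ℝ).comp_hasDerivAt t h6
      refine h7.congr_deriv ?_
      simp
    refine ((h1.sub h4).sub (h5.const_mul _)).congr_deriv ?_
    rw [tsum_besselK1_cos hρ ht]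
    have h8 : ∀ n, uTermA n ((ρ ^ 2 : ℝ), (t : ℂ)) =
        ((-(1 / dist3 ρ (pole n + t) ^ 3 + 1 / dist3 ρ (pole n - t) ^ 3) : ℝ) : ℂ) := fun n => by
      rw [uTermA]
      simp only []
      rw [← Complex.ofReal_add, ← Complex.ofReal_sub, rad_ofReal, rad_ofReal]
      push_cast
      ring
    rw [tsum_congr h8, ← Complex.ofReal_tsum, tsum_neg]
    push_cast
    ring
  have h0 : f 0 = 0 := by
    have h1 : (bpsA1 ρ 0).im = 0 := by
      rw [← (hasSum_bpsA1_im hρ 0).tsum_eq]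
      simp
    have hpi := Real.pi_ne_zero
    have hpi' : (Real.pi : ℂ) ≠ 0 := by exact_mod_cast hpi
    simp only [hf, instW, h1, Complex.ofReal_zero, gReg_zero_right]
    push_cast
    field_simp
    ring
  have hconst := (convex_Ioo (-(2 * Real.pi)) (2 * Real.pi)).is_const_of_fderivWithin_eq_zero
    (f := f) (𝕜 := ℝ) (fun t ht => (hderiv t ht).differentiableAt.differentiableWithinAt)
    (fun t ht => by
      rw [fderivWithin_of_isOpen isOpen_Ioo ht, (hderiv t ht).hasFDerivAt.fderiv]
      ext
      simp) (abs_lt.1 ht)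
    (show (0 : ℝ) ∈ Ioo (-(2 * Real.pi)) (2 * Real.pi) from
      ⟨by linarith [Real.pi_pos], by linarith [Real.pi_pos]⟩)
  rw [h0] at hconst
  simp only [hf] at hconst
  linear_combination hconst

end ModelGeometry

namespace ModelGeometry

open Set MeasureTheory

/-! ### The potential -/

lemma integral_abs_gauss_inv_sub {a b : ℝ} (ha : 0 < a) (hb : 0 < b) :
    ∫ v in Ioi (0 : ℝ), ‖1 / v * Real.sqrt (Real.pi * v) * Real.exp (-(a * v)) -
      1 / v * Real.sqrt (Real.pi * v) * Real.exp (-(b * v))‖ =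
      |Real.pi / Real.sqrt a - Real.pi / Real.sqrt b| := by
  rw [← integral_gauss_inv ha, ← integral_gauss_inv hb,
    ← integral_sub (integrableOn_gauss_inv ha) (integrableOn_gauss_inv hb)]
  have key : ∀ {a b : ℝ}, a ≤ b → ∀ v ∈ Ioi (0 : ℝ),
      0 ≤ 1 / v * Real.sqrt (Real.pi * v) * Real.exp (-(a * v)) -
      1 / v * Real.sqrt (Real.pi * v) * Real.exp (-(b * v)) := fun {a b} hab v hv => by
    have hv : 0 < v := hv
    have h1 : Real.exp (-(b * v)) ≤ Real.exp (-(a * v)) := Real.exp_le_exp.2 (by nlinarith)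
    rw [← mul_sub]
    exact mul_nonneg (by positivity) (sub_nonneg.2 h1)
  rcases le_total a b with h | h
  · rw [abs_of_nonneg (setIntegral_nonneg measurableSet_Ioi (key h))]
    exact setIntegral_congr_fun measurableSet_Ioi fun v hv => by
      rw [Real.norm_eq_abs, abs_of_nonneg (key h v hv)]
  · rw [abs_of_nonpos (setIntegral_nonpos measurableSet_Ioi fun v hv => by
      linarith [key h v hv]), ← integral_neg]
    exact setIntegral_congr_fun measurableSet_Ioi fun v hv => by
      rw [Real.norm_eq_abs, abs_of_nonpos (by linarith [key h v hv])]

/-- The difference of the Gaussian integrals that represent the potentials of a charge at `τ` and of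
a charge at `τ'`. -/
def gaussDiff (ρ τ τ' v : ℝ) : ℝ :=
  1 / v * Real.sqrt (Real.pi * v) * Real.exp (-(dist3 ρ τ ^ 2 / 4 * v)) -
    1 / v * Real.sqrt (Real.pi * v) * Real.exp (-(dist3 1 τ' ^ 2 / 4 * v))

lemma integrableOn_gaussDiff {ρ : ℝ} (hρ : 0 < ρ) (τ τ' : ℝ) :
    IntegrableOn (gaussDiff ρ τ τ') (Ioi 0) := by
  have h := dist3_pos hρ τ
  have h' := dist3_pos one_pos τ'
  exact (integrableOn_gauss_inv (by positivity)).sub (integrableOn_gauss_inv (by positivity))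

lemma integral_gaussDiff {ρ : ℝ} (hρ : 0 < ρ) (τ τ' : ℝ) :
    ∫ v in Ioi (0 : ℝ), gaussDiff ρ τ τ' v =
      2 * Real.pi * (1 / dist3 ρ τ - 1 / dist3 1 τ') := by
  have h := dist3_pos hρ τ
  have h' := dist3_pos one_pos τ'
  unfold gaussDiff
  rw [integral_sub (integrableOn_gauss_inv (by positivity))
    (integrableOn_gauss_inv (by positivity)), integral_gauss_inv (by positivity),
    integral_gauss_inv (by positivity), sqrt_dist3_sq hρ, sqrt_dist3_sq one_pos]
  field_simp

lemma integral_norm_gaussDiff {ρ : ℝ} (hρ : 0 < ρ) (τ τ' : ℝ) :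
    ∫ v in Ioi (0 : ℝ), ‖gaussDiff ρ τ τ' v‖ =
      2 * Real.pi * |1 / dist3 ρ τ - 1 / dist3 1 τ'| := by
  have h := dist3_pos hρ τ
  have h' := dist3_pos one_pos τ'
  unfold gaussDiff
  rw [integral_abs_gauss_inv_sub (by positivity) (by positivity), sqrt_dist3_sq hρ,
    sqrt_dist3_sq one_pos, ← abs_of_pos (by positivity : (0:ℝ) < 2 * Real.pi), ← abs_mul]
  congr 1
  field_simp

/-- The potentials of the poles decay only like `1/n`, but their differences from the values at a
reference point decay like `1/n²`. -/
lemma summable_gaussDiff {ρ t : ℝ} (hρ : 0 < ρ) (ht : |t| < 2 * Real.pi) :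
    Summable fun n => 2 * Real.pi * |1 / dist3 ρ (pole n + t) - 1 / dist3 1 (pole n)| := by
  have hδ : 0 < 2 * Real.pi - |t| := by linarith
  have hpi := Real.pi_pos
  set δ := 2 * Real.pi - |t| with hδ'
  have hδ1 : δ ≤ 2 * Real.pi := by
    have := abs_nonneg t
    linarith
  refine (Summable.of_nonneg_of_le (fun n => abs_nonneg _) (fun n => ?_)
    (summable_inv_sq.mul_left (4 * |ρ ^ 2 - 1| / (δ ^ 2 * (2 * δ)) + |t| / δ ^ 2))).mul_left
      (2 * Real.pi)
  have hR := dist3_pos hρ (pole n + t)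
  have hR1 := dist3_pos one_pos (pole n)
  have h1 : δ * (n + 1) ≤ dist3 ρ (pole n + t) := dist3_ge ρ t n
  have h2 : δ * (n + 1) ≤ dist3 1 (pole n) := by
    have h3 := dist3_ge 1 0 n
    rw [add_zero, abs_zero, sub_zero] at h3
    refine le_trans ?_ h3
    have : (0 : ℝ) ≤ n := n.cast_nonneg
    gcongr
  have e1 := dist3_sq ρ (pole n + t)
  have e2 := dist3_sq 1 (pole n)
  have a1 := abs_le_dist3 ρ (pole n + t)
  have a2 := abs_le_dist3 1 (pole n)
  set R := dist3 ρ (pole n + t)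
  set R1 := dist3 1 (pole n)
  have hn : (1 : ℝ) ≤ n + 1 := by
    have : (0 : ℝ) ≤ n := n.cast_nonneg
    linarith
  have e3 : 1 / R - 1 / R1 = -(4 * (ρ ^ 2 - 1) + t * ((pole n + t) + pole n)) / (R * R1 * (R + R1)) := by
    field_simp
    linear_combination e2 - e1
  have hnum : |-(4 * (ρ ^ 2 - 1) + t * ((pole n + t) + pole n))| ≤
      4 * |ρ ^ 2 - 1| + |t| * (R + R1) := by
    rw [abs_neg]
    refine (abs_add_le _ _).trans ?_
    rw [abs_mul, abs_mul, abs_of_pos (by norm_num : (0:ℝ) < 4)]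
    gcongr
    exact (abs_add_le _ _).trans (add_le_add a1 a2)
  rw [e3, abs_div, abs_of_pos (by positivity : 0 < R * R1 * (R + R1))]
  have hd : 0 < δ * (n + 1) := by positivity
  calc _ ≤ (4 * |ρ ^ 2 - 1| + |t| * (R + R1)) / (R * R1 * (R + R1)) := by gcongr
    _ = 4 * |ρ ^ 2 - 1| / (R * R1 * (R + R1)) + |t| / (R * R1) := by field_simp
    _ ≤ 4 * |ρ ^ 2 - 1| / ((δ * (n + 1)) * (δ * (n + 1)) * (δ * 1 + δ * 1)) +
        |t| / ((δ * (n + 1)) * (δ * (n + 1))) := by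
      have h4 : δ * 1 ≤ δ * (n + 1) := by gcongr
      gcongr <;> linarith
    _ = _ := by
      field_simp
      ring

lemma besselK0_pos {ρ : ℝ} (hρ : 0 < ρ) (n : ℕ) : 0 < besselK0 ρ n := by
  rw [besselK0, setIntegral_pos_iff_support_of_nonneg_ae
    ((ae_restrict_iff' measurableSet_Ioi).2 (Filter.Eventually.of_forall fun s hs => by
      have hs : 0 < s := hs
      have := (rayDecay_pos ((n + 1) * ρ) s).le
      simp only [Pi.zero_apply]
      positivity))
    (integrableOn_weight_rayDecay rayWeight_inv (by positivity))]
  have : Function.support (fun s => 1 / s * rayDecay ((n + 1) * ρ) s) ∩ Ioi 0 = Ioi 0 := by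
    refine inter_eq_right.2 fun s hs => ?_
    have hs : 0 < s := hs
    have := rayDecay_pos ((n + 1) * ρ) s
    simp only [Function.mem_support]
    positivity
  rw [this]
  simp

lemma integrableOn_besselK0 {ρ : ℝ} (hρ : 0 < ρ) (n : ℕ) :
    IntegrableOn (fun v => 1 / v * Real.exp (-(ρ ^ 2 * v)) * Real.exp (-((n + 1 : ℝ) ^ 2 / v)))
      (Ioi 0) := by
  apply integrableOn_of_integral_ne_zero
  rw [← besselK0_eq hρ]
  exact (besselK0_pos hρ n).ne'

lemma summable_besselK0 {ρ : ℝ} (hρ : 0 < ρ) : Summable (besselK0 ρ) := by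
  simpa using (hasSum_bpsA0_re hρ 0).summable

/-- The potential `U`, given by the instanton sum. -/
def instU (ρ t : ℝ) : ℝ := 1 / (2 * Real.pi) * ((bpsA0 ρ t).re - Real.log (ρ / Real.pi))

/-- Comparison of the two forms of the potential, by termwise integration of the inversion formula
for the theta function; the differences of potentials, unlike the potentials, are integrals. -/
lemma instU_sub {ρ t : ℝ} (hρ : 0 < ρ) (ht : |t| < 2 * Real.pi) :
    4 * Real.pi * (instU ρ t - instU 1 0) = 2 * Real.pi * (1 / dist3 ρ t - 1 / dist3 1 0) +
      ∑' n, 2 * Real.pi * ((1 / dist3 ρ (pole n + t) - 1 / dist3 1 (pole n)) +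
        (1 / dist3 ρ (pole n - t) - 1 / dist3 1 (pole n))) := by
  have hpi := Real.pi_pos
  have ht' : |-t| < 2 * Real.pi := by rwa [abs_neg]
  have hρ2 : 0 < ρ ^ 2 := by positivity
  have hL := integral_add_hasSum
    (f₀ := fun v => 1 / v * (Real.exp (-(ρ ^ 2 * v)) - Real.exp (-(1 ^ 2 * v))))
    (G := fun v => 2 * (1 / v * (Real.exp (-(ρ ^ 2 * v)) * ∑' n, thetaCos v t n -
      Real.exp (-(1 ^ 2 * v)) * ∑' n, thetaCos v 0 n)))
    (F := fun n v => 2 * (Real.cos ((n + 1) * t) * (1 / v * Real.exp (-(ρ ^ 2 * v)) *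
      Real.exp (-((n + 1 : ℝ) ^ 2 / v))) - 1 / v * Real.exp (-(1 ^ 2 * v)) *
      Real.exp (-((n + 1 : ℝ) ^ 2 / v))))
    (integrableOn_frullani hρ2 (by norm_num))
    (fun n => (((integrableOn_besselK0 hρ n).const_mul _).sub
      (integrableOn_besselK0 one_pos n)).const_mul _)
    (((summable_besselK0 hρ).add (summable_besselK0 one_pos)).mul_left 2) (fun n => by
      rw [besselK0_eq hρ, besselK0_eq one_pos, ← integral_add (integrableOn_besselK0 hρ n)
        (integrableOn_besselK0 one_pos n), ← integral_const_mul]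
      refine setIntegral_mono_on ((((integrableOn_besselK0 hρ n).const_mul _).sub
        (integrableOn_besselK0 one_pos n)).const_mul _).norm (((integrableOn_besselK0 hρ n).add
          (integrableOn_besselK0 one_pos n)).const_mul _)
        measurableSet_Ioi fun v hv => ?_
      have hv : 0 < v := hv
      have h1 : 0 < 1 / v * Real.exp (-(ρ ^ 2 * v)) * Real.exp (-((n + 1 : ℝ) ^ 2 / v)) := by
        positivity
      have h2 : 0 < 1 / v * Real.exp (-(1 ^ 2 * v)) * Real.exp (-((n + 1 : ℝ) ^ 2 / v)) := by
        positivity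
      have h3 := Real.abs_cos_le_one ((n + 1) * t)
      rw [Real.norm_eq_abs, abs_mul, abs_two]
      gcongr
      refine (abs_sub _ _).trans ?_
      rw [abs_mul, abs_of_pos h1, abs_of_pos h2]
      exact add_le_add (mul_le_of_le_one_left h1.le h3) le_rfl)
    (fun v hv => by
      have h1 := ((summable_thetaCos hv t).hasSum.mul_left (Real.exp (-(ρ ^ 2 * v))))
      have h2 := ((summable_thetaCos hv 0).hasSum.mul_left (Real.exp (-(1 ^ 2 * v))))
      refine (((h1.sub h2).mul_left (1 / v)).mul_left 2).congr_fun fun n => ?_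
      rw [thetaCos, thetaCos, mul_zero, Real.cos_zero]
      ring)
  -- the Gaussian form; only the differences from the reference point `ρ = 1`, `t = 0` converge
  have hR := integral_add_hasSum
    (f₀ := gaussDiff ρ t 0)
    (G := fun v => 1 / v * Real.sqrt (Real.pi * v) * (Real.exp (-(ρ ^ 2 * v)) *
      (∑' n, gaussPole v (pole n + t) + ∑' n, gaussPole v (pole n - t)) -
      Real.exp (-(1 ^ 2 * v)) *
      (∑' n, gaussPole v (pole n + 0) + ∑' n, gaussPole v (pole n - 0))))
    (F := fun n v => gaussDiff ρ (pole n + t) (pole n) v + gaussDiff ρ (pole n - t) (pole n) v)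
    (b := fun n => 2 * Real.pi * |1 / dist3 ρ (pole n + t) - 1 / dist3 1 (pole n)| +
      2 * Real.pi * |1 / dist3 ρ (pole n - t) - 1 / dist3 1 (pole n)|)
    (integrableOn_gaussDiff hρ t 0)
    (fun n => (integrableOn_gaussDiff hρ _ _).add (integrableOn_gaussDiff hρ _ _))
    ((summable_gaussDiff hρ ht).add (summable_gaussDiff hρ ht'))
    (fun n => by
      rw [← integral_norm_gaussDiff hρ, ← integral_norm_gaussDiff hρ,
        ← integral_add (integrableOn_gaussDiff hρ _ _).norm (integrableOn_gaussDiff hρ _ _).norm]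
      exact setIntegral_mono_on
        ((integrableOn_gaussDiff hρ _ _).add (integrableOn_gaussDiff hρ _ _)).norm
        ((integrableOn_gaussDiff hρ _ _).norm.add (integrableOn_gaussDiff hρ _ _).norm)
        measurableSet_Ioi fun v _ => norm_add_le _ _)
    (fun v hv => by
      have h1 := (summable_gaussPole hv t).hasSum
      have h2 := (summable_gaussPole hv (-t)).hasSum
      have h3 := (summable_gaussPole hv 0).hasSum
      have h4 := (summable_gaussPole hv (-0)).hasSum
      have := (((h1.add h2).mul_left (Real.exp (-(ρ ^ 2 * v)))).sub
        ((h3.add h4).mul_left (Real.exp (-(1 ^ 2 * v))))).mul_left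
          (1 / v * Real.sqrt (Real.pi * v))
      simp only [← sub_eq_add_neg] at this
      refine this.congr_fun fun n => ?_
      simp only [gaussDiff, ← exp_mul_gaussPole, add_zero, sub_zero]
      ring)
  -- Poisson resummation at `(ρ, t)` and at the reference point
  have hLR : ∫ v in Ioi (0 : ℝ), (1 / v * (Real.exp (-(ρ ^ 2 * v)) - Real.exp (-(1 ^ 2 * v))) +
      2 * (1 / v * (Real.exp (-(ρ ^ 2 * v)) * ∑' n, thetaCos v t n -
      Real.exp (-(1 ^ 2 * v)) * ∑' n, thetaCos v 0 n))) =
      ∫ v in Ioi (0 : ℝ), (gaussDiff ρ t 0 v +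
      1 / v * Real.sqrt (Real.pi * v) * (Real.exp (-(ρ ^ 2 * v)) *
      (∑' n, gaussPole v (pole n + t) + ∑' n, gaussPole v (pole n - t)) -
      Real.exp (-(1 ^ 2 * v)) *
      (∑' n, gaussPole v (pole n + 0) + ∑' n, gaussPole v (pole n - 0)))) := by
    refine setIntegral_congr_fun measurableSet_Ioi fun v hv => ?_
    have h1 := theta_inversion hv t
    have h2 := theta_inversion hv 0
    simp only [gaussDiff, ← exp_mul_gaussPole]
    linear_combination (1 / v * Real.exp (-(ρ ^ 2 * v))) * h1 -
      (1 / v * Real.exp (-(1 ^ 2 * v))) * h2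
  -- the zero mode is a Frullani integral and gives the logarithm in `instU`
  rw [hL.2, hR.2, integral_frullani hρ2 (by norm_num), integral_gaussDiff hρ] at hLR
  have h1 : ∀ n : ℕ, ∫ v in Ioi (0 : ℝ), 2 * (Real.cos ((n + 1) * t) *
      (1 / v * Real.exp (-(ρ ^ 2 * v)) *
      Real.exp (-((n + 1 : ℝ) ^ 2 / v))) - 1 / v * Real.exp (-(1 ^ 2 * v)) *
      Real.exp (-((n + 1 : ℝ) ^ 2 / v))) =
      2 * (besselK0 ρ n * Real.cos ((n + 1) * t) - besselK0 1 n * Real.cos ((n + 1) * 0)) :=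
    fun n => by
    rw [integral_const_mul, integral_sub ((integrableOn_besselK0 hρ n).const_mul _)
      (integrableOn_besselK0 one_pos n), integral_const_mul, ← besselK0_eq hρ,
      ← besselK0_eq one_pos, mul_zero, Real.cos_zero]
    ring
  have h2 : ∀ n : ℕ, ∫ v in Ioi (0 : ℝ), (gaussDiff ρ (pole n + t) (pole n) v +
      gaussDiff ρ (pole n - t) (pole n) v) =
      2 * Real.pi * ((1 / dist3 ρ (pole n + t) - 1 / dist3 1 (pole n)) +
        (1 / dist3 ρ (pole n - t) - 1 / dist3 1 (pole n))) := fun n => by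
    rw [integral_add (integrableOn_gaussDiff hρ _ _) (integrableOn_gaussDiff hρ _ _),
      integral_gaussDiff hρ, integral_gaussDiff hρ]
    ring
  simp only [h1, h2] at hLR
  rw [← hLR, (((hasSum_bpsA0_re hρ t).sub (hasSum_bpsA0_re one_pos 0)).mul_left 2).tsum_eq,
    instU, instU, one_pow, Real.log_div one_ne_zero hρ2.ne', Real.log_pow,
    Real.log_div hρ.ne' hpi.ne', Real.log_div one_ne_zero hpi.ne', Real.log_one]
  field_simp
  push_cast
  ring

lemma uTerm_ofReal (n : ℕ) (ρ t : ℝ) : uTerm n ((ρ ^ 2 : ℝ), (t : ℂ)) =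
    (((1 / dist3 ρ (pole n + t) + 1 / dist3 ρ (pole n - t)) / 2 - 1 / pole n : ℝ) : ℂ) := by
  rw [uTerm]
  simp only []
  rw [← Complex.ofReal_add, ← Complex.ofReal_sub, rad_ofReal, rad_ofReal]
  push_cast
  ring

/-- The regular part of the potential, as a function of `(|Z|², t)`. -/
def uReg (p : ℝ × ℝ) : ℝ :=
  (uSum (p.1, p.2)).re + (instU 1 0 - 1 / 4 - (uSum ((1 : ℝ), (0 : ℝ))).re)

/-- The regular part of the connection, as a function of `(|Z|², t)`. -/
def wReg (p : ℝ × ℝ) : ℝ := (gReg (p.1, p.2)).re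

/-- The potential is that of a unit charge at the origin up to a smooth remainder. -/
theorem instU_eq {ρ t : ℝ} (hρ : 0 < ρ) (ht : |t| < 2 * Real.pi) :
    instU ρ t = 1 / (2 * dist3 ρ t) + uReg (ρ ^ 2, t) := by
  have hpi := Real.pi_pos
  have hre : ∀ (ρ t : ℝ), |t| < 2 * Real.pi →
      HasSum (fun n => (1 / dist3 ρ (pole n + t) + 1 / dist3 ρ (pole n - t)) / 2 - 1 / pole n)
        (uSum ((ρ ^ 2 : ℝ), (t : ℂ))).re := fun ρ t ht => by
    obtain ⟨δ, hδ, hδ1, hp⟩ := exists_mem_regDomain (sq_nonneg ρ) ht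
    have := Complex.hasSum_re (summable_uTerm hδ hδ1 hp).hasSum
    refine this.congr_fun fun n => ?_
    rw [uTerm_ofReal, Complex.ofReal_re]
  have h0 : |(0 : ℝ)| < 2 * Real.pi := by simpa using hpi
  have h := instU_sub hρ ht
  have h1 := ((hre ρ t ht).sub (hre 1 0 h0)).mul_left (4 * Real.pi)
  have h2 : dist3 1 0 = 2 := by
    rw [dist3, show (4 * 1 ^ 2 + 0 ^ 2 : ℝ) = 2 ^ 2 by norm_num, Real.sqrt_sq (by norm_num)]
  rw [show (∑' n, 2 * Real.pi * ((1 / dist3 ρ (pole n + t) - 1 / dist3 1 (pole n)) +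
        (1 / dist3 ρ (pole n - t) - 1 / dist3 1 (pole n)))) = _ from
      (h1.congr_fun fun n => by rw [add_zero, sub_zero]; ring).tsum_eq, h2] at h
  have hR := dist3_pos hρ t
  rw [uReg]
  rw [one_pow] at h
  have h3 : (4 * Real.pi) * (instU ρ t - (1 / (2 * dist3 ρ t) + ((uSum ((ρ ^ 2 : ℝ), (t : ℂ))).re +
      (instU 1 0 - 1 / 4 - (uSum ((1 : ℝ), (0 : ℝ))).re)))) = 0 := by
    have h4 : 2 * Real.pi * (1 / dist3 ρ t) = 4 * Real.pi * (1 / (2 * dist3 ρ t)) := by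
      field_simp
      norm_num
    linear_combination h + h4
  linarith [(mul_eq_zero.1 h3).resolve_left (by positivity)]

theorem instW_eq' {ρ t : ℝ} (hρ : 0 < ρ) (ht : |t| < 2 * Real.pi) :
    instW ρ t = (t / dist3 ρ t - 1) / 2 + ρ ^ 2 * wReg (ρ ^ 2, t) := by
  have h := congrArg Complex.re (instW_eq hρ ht)
  rwa [Complex.ofReal_re, Complex.add_re, Complex.ofReal_re, Complex.re_ofReal_mul] at h

/-- The regular parts are smooth near the real points with `a ≥ 0`, `|t| < 2π`, and satisfy the
monopole equations there. -/
theorem uReg_wReg {a t : ℝ} (ha : 0 ≤ a) (ht : |t| < 2 * Real.pi) :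
    ContDiffAt ℝ ∞ uReg (a, t) ∧ ContDiffAt ℝ ∞ wReg (a, t) ∧
      ∃ ua ut ga : ℝ,
        HasFDerivAt uReg (ua • ContinuousLinearMap.fst ℝ ℝ ℝ + ut • ContinuousLinearMap.snd ℝ ℝ ℝ)
          (a, t) ∧
        HasFDerivAt wReg (ga • ContinuousLinearMap.fst ℝ ℝ ℝ +
          (-2 * ua) • ContinuousLinearMap.snd ℝ ℝ ℝ) (a, t) ∧
        2 * a * ga + 2 * wReg (a, t) = 4 * ut := by
  obtain ⟨h1, h2, ua, ut, ga, h3, h4, h5⟩ := regular_parts ha ht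
  let J : ℝ × ℝ →L[ℝ] ℂ × ℂ := Complex.ofRealCLM.prodMap Complex.ofRealCLM
  have hJ : ∀ p : ℝ × ℝ, J p = ((p.1 : ℂ), (p.2 : ℂ)) := fun p => rfl
  refine ⟨?_, ?_, ua.re, ut.re, ga.re, ?_, ?_, ?_⟩
  · exact (Complex.reCLM.contDiff.contDiffAt.comp (a, t) ((h1.restrict_scalars ℝ).comp (a, t)
      (f := J) J.contDiff.contDiffAt)).add contDiffAt_const
  · exact (Complex.reCLM.contDiff.contDiffAt.comp (a, t) ((h2.restrict_scalars ℝ).comp (a, t)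
      (f := J) J.contDiff.contDiffAt))
  · refine ((Complex.reCLM.hasFDerivAt.comp (a, t) ((h3.restrictScalars ℝ).comp (a, t)
      (f := J) J.hasFDerivAt)).add_const _).congr_fderiv ?_
    ext <;> simp [J]
  · refine (Complex.reCLM.hasFDerivAt.comp (a, t) ((h4.restrictScalars ℝ).comp (a, t)
      (f := J) J.hasFDerivAt)).congr_fderiv ?_
    ext <;> simp [J]
  · have h := congrArg Complex.re h5
    rw [wReg]
    simpa using h

lemma bpsQ_add_two_pi (ρ t s : ℝ) : bpsQ ρ (t + 2 * Real.pi) s = bpsQ ρ t s := by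
  have : bpsX ρ (t + 2 * Real.pi) s = bpsX ρ t s := by
    rw [bpsX, bpsX]
    push_cast
    rw [add_mul, Complex.exp_add, Complex.exp_two_pi_mul_I, mul_one]
  rw [bpsQ, bpsQ, this]

lemma instU_add_two_pi (ρ t : ℝ) : instU ρ (t + 2 * Real.pi) = instU ρ t := by
  simp only [instU, bpsA0, bpsQ_add_two_pi]

lemma instW_add_two_pi (ρ t : ℝ) : instW ρ (t + 2 * Real.pi) = instW ρ t + 1 := by
  have := Real.pi_pos
  simp only [instW, bpsA1, bpsQ_add_two_pi]
  field_simp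
  ring

end ModelGeometry

namespace ModelGeometry

open Set MeasureTheory Filter

/-! ### Rotation of rays -/

/-- A point of the ray with angle `ψ`. -/
def rayPt (ψ s : ℝ) : ℂ := s * Complex.exp (ψ * Complex.I)

lemma rayPt_ne_zero {s : ℝ} (hs : 0 < s) (ψ : ℝ) : rayPt ψ s ≠ 0 :=
  mul_ne_zero (by exact_mod_cast hs.ne') (Complex.exp_ne_zero _)

lemma norm_rayPt {s : ℝ} (hs : 0 < s) (ψ : ℝ) : ‖rayPt ψ s‖ = s := by
  rw [rayPt, norm_mul, Complex.norm_exp_ofReal_mul_I, mul_one, Complex.norm_real,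
    Real.norm_eq_abs, abs_of_pos hs]

lemma continuous_rayPt (ψ : ℝ) : Continuous (rayPt ψ) := by
  unfold rayPt
  fun_prop

lemma exp_add_mul_I (x ψ : ℝ) : Complex.exp (x + ψ * Complex.I) = rayPt ψ (Real.exp x) := by
  rw [Complex.exp_add, rayPt, Complex.ofReal_exp]

lemma tendsto_rayDecay_exp {c : ℝ} (hc : 0 < c) {l : Filter ℝ}
    (hl : Tendsto (fun x => Real.exp x + 1 / Real.exp x) l atTop) :
    Tendsto (fun x => (1 / Real.exp x + 1 + Real.exp x) * rayDecay c (Real.exp x)) l (𝓝 0) := by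
  have h1 : Tendsto (fun y : ℝ => (y + 1) * Real.exp (-(c * y))) atTop (𝓝 0) := by
    have h2 : Tendsto (fun y : ℝ => c * y) atTop atTop := tendsto_id.const_mul_atTop hc
    have h3 := (Real.tendsto_pow_mul_exp_neg_atTop_nhds_zero 1).comp h2
    have h4 := (Real.tendsto_pow_mul_exp_neg_atTop_nhds_zero 0).comp h2
    have h5 := (h3.const_mul (1 / c)).add h4
    simp only [Function.comp_def, mul_zero, add_zero, pow_one, pow_zero, one_mul] at h5
    refine h5.congr fun y => ?_
    field_simp
  refine (h1.comp hl).congr fun x => ?_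
  simp only [Function.comp_def, rayDecay]
  ring

/-- Rotation of the ray of integration. -/
theorem integral_ray_eq {G : ℂ → ℂ} {a b c C : ℝ} (hab : a ≤ b) (hc : 0 < c)
    (hG : ∀ ψ ∈ Icc a b, ∀ s > 0, DifferentiableAt ℂ G (rayPt ψ s))
    (hb : ∀ ψ ∈ Icc a b, ∀ s > 0, ‖G (rayPt ψ s)‖ ≤ C * ((1 / s + 1 + s) * rayDecay c s)) :
    ∫ s in Ioi (0 : ℝ), (1 / s : ℂ) * G (rayPt a s) =
      ∫ s in Ioi (0 : ℝ), (1 / s : ℂ) * G (rayPt b s) := by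
  have hcont : ∀ ψ ∈ Icc a b, ContinuousOn (fun s => G (rayPt ψ s)) (Ioi 0) := fun ψ hψ s hs =>
    ((hG ψ hψ s hs).continuousAt.comp (continuous_rayPt ψ).continuousAt).continuousWithinAt
  have hint : ∀ ψ ∈ Icc a b, IntegrableOn (fun s : ℝ => (1 / s : ℂ) * G (rayPt ψ s)) (Ioi 0) := by
    intro ψ hψ
    refine integrableOn_of_rayDecay_bound (C := C) hc (ContinuousOn.aestronglyMeasurable
      ((continuousOn_const.div Complex.continuous_ofReal.continuousOn fun s hs =>
        by exact_mod_cast (ne_of_gt hs)).mul (hcont ψ hψ)) measurableSet_Ioi) fun s hs => ?_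
    have hC : 0 ≤ C * ((1 / s + 1 + s) * rayDecay c s) := (norm_nonneg _).trans (hb ψ hψ s hs)
    have h1 := rayDecay_pos c s
    have hC' : 0 ≤ C := by
      by_contra hneg
      have : 0 < (1 / s + 1 + s) * rayDecay c s := by positivity
      nlinarith
    rw [norm_mul, norm_div, norm_one, Complex.norm_real, Real.norm_eq_abs, abs_of_pos hs]
    calc 1 / s * ‖G (rayPt ψ s)‖ ≤ 1 / s * (C * ((1 / s + 1 + s) * rayDecay c s)) := by
          gcongr
          exact hb ψ hψ s hs
      _ = C * ((1 / s ^ 2 + 1 / s + 1) * rayDecay c s) := by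
          field_simp
      _ ≤ _ := mul_le_mul_of_nonneg_left
          (mul_le_mul_of_nonneg_right (le_add_of_nonneg_right hs.le) h1.le) hC'
  -- in the coordinate `x = log s` the rays are horizontal lines
  have hsub : ∀ ψ ∈ Icc a b, Integrable (fun x : ℝ => G (Complex.exp (x + ψ * Complex.I))) ∧
      ∫ s in Ioi (0 : ℝ), (1 / s : ℂ) * G (rayPt ψ s) =
        ∫ x : ℝ, G (Complex.exp (x + ψ * Complex.I)) := by
    intro ψ hψ
    have himg : Real.exp '' univ = Ioi 0 := by rw [image_univ, Real.range_exp]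
    have hd : ∀ x ∈ (univ : Set ℝ), HasDerivWithinAt Real.exp (Real.exp x) univ x :=
      fun x _ => (Real.hasDerivAt_exp x).hasDerivWithinAt
    have heq : (fun x : ℝ => |Real.exp x| • ((1 / (Real.exp x : ℝ) : ℂ) * G (rayPt ψ (Real.exp x)))) =
        fun x : ℝ => G (Complex.exp (x + ψ * Complex.I)) := by
      funext x
      have : (Real.exp x : ℂ) ≠ 0 := by exact_mod_cast (Real.exp_pos x).ne'
      rw [Real.abs_exp, exp_add_mul_I, Complex.real_smul]
      field_simp
    have h1 := integral_image_eq_integral_abs_deriv_smul MeasurableSet.univ hd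
      Real.exp_injective.injOn (fun s : ℝ => (1 / s : ℂ) * G (rayPt ψ s))
    have h2 := (integrableOn_image_iff_integrableOn_abs_deriv_smul MeasurableSet.univ hd
      Real.exp_injective.injOn (fun s : ℝ => (1 / s : ℂ) * G (rayPt ψ s))).1
        (by rw [himg]; exact hint ψ hψ)
    rw [himg, heq, setIntegral_univ] at h1
    rw [heq, integrableOn_univ] at h2
    exact ⟨h2, h1⟩
  have ha := hsub a ⟨le_rfl, hab⟩
  have hb' := hsub b ⟨hab, le_rfl⟩
  rw [ha.2, hb'.2]
  have hbound : ∀ x : ℝ, ∀ ψ ∈ Icc a b, ‖G (Complex.exp (x + ψ * Complex.I))‖ ≤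
      C * ((1 / Real.exp x + 1 + Real.exp x) * rayDecay c (Real.exp x)) := fun x ψ hψ => by
    rw [exp_add_mul_I]
    exact hb ψ hψ _ (Real.exp_pos x)
  -- Cauchy's theorem on a rectangle between the two lines
  have hrect : ∀ R : ℝ, (∫ x in (-R)..R, G (Complex.exp (x + a * Complex.I))) -
      (∫ x in (-R)..R, G (Complex.exp (x + b * Complex.I))) =
      -(Complex.I * ∫ y in a..b, G (Complex.exp ((R : ℝ) + y * Complex.I))) +
        Complex.I * ∫ y in a..b, G (Complex.exp ((-R : ℝ) + y * Complex.I)) := by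
    intro R
    have h := Complex.integral_boundary_rect_eq_zero_of_differentiableOn
      (fun w => G (Complex.exp w)) ((-R : ℝ) + a * Complex.I) ((R : ℝ) + b * Complex.I) ?_
    · simp only [Complex.add_re, Complex.ofReal_re, Complex.mul_re, Complex.I_re, mul_zero,
        Complex.ofReal_im, Complex.I_im, sub_zero, add_zero, Complex.add_im, Complex.mul_im,
        mul_one, zero_add, smul_eq_mul] at h
      linear_combination h
    · rintro w ⟨-, hw⟩
      simp only [Complex.add_im, Complex.ofReal_im, Complex.mul_im, Complex.ofReal_re,
        Complex.I_im, mul_one, Complex.I_re, mul_zero, zero_add, add_zero, uIcc_of_le hab] at hw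
      have hw : w.im ∈ Icc a b := hw
      have h1 := hG w.im hw (Real.exp w.re) (Real.exp_pos _)
      rw [← exp_add_mul_I, Complex.re_add_im] at h1
      exact (h1.comp w Complex.differentiable_exp.differentiableAt).differentiableWithinAt
  -- the vertical sides do not contribute in the limit
  have hvert : ∀ {f : ℝ → ℝ}, Tendsto (fun R => Real.exp (f R) + 1 / Real.exp (f R)) atTop atTop →
      Tendsto (fun R => ∫ y in a..b, G (Complex.exp ((f R : ℝ) + y * Complex.I))) atTop (𝓝 0) := by
    intro f hf
    have h1 : Tendsto (fun R => C * ((1 / Real.exp (f R) + 1 + Real.exp (f R)) *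
        rayDecay c (Real.exp (f R))) * |b - a|) atTop (𝓝 0) := by
      have := ((tendsto_rayDecay_exp (l := map f atTop) hc (tendsto_map'_iff.2 hf)).comp
        tendsto_map)
      simpa using (this.const_mul C).mul_const |b - a|
    refine squeeze_zero_norm (fun R => ?_) h1
    refine intervalIntegral.norm_integral_le_of_norm_le_const fun y hy => ?_
    rw [uIoc_of_le hab] at hy
    exact hbound _ y ⟨hy.1.le, hy.2⟩
  have hp : Tendsto (fun R : ℝ => Real.exp R + 1 / Real.exp R) atTop atTop :=
    tendsto_atTop_mono (fun R => le_add_of_nonneg_right (by positivity)) Real.tendsto_exp_atTop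
  have hm : Tendsto (fun R : ℝ => Real.exp (-R) + 1 / Real.exp (-R)) atTop atTop := by
    refine hp.congr fun R => ?_
    rw [Real.exp_neg]
    field_simp
    ring
  have hlim := (((hvert (f := fun R => R) hp).const_mul Complex.I).neg).add
    ((hvert (f := fun R => -R) hm).const_mul Complex.I)
  simp only [mul_zero, neg_zero, add_zero] at hlim
  have hlim2 := (intervalIntegral_tendsto_integral ha.1 tendsto_neg_atTop_atBot tendsto_id).sub
    (intervalIntegral_tendsto_integral hb'.1 tendsto_neg_atTop_atBot tendsto_id)
  have := tendsto_nhds_unique (hlim2.congr hrect) hlim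
  exact sub_eq_zero.1 this

end ModelGeometry

namespace ModelGeometry

open Set MeasureTheory Filter

/-! ### Ray integrals and their derivatives -/

/-- The exponent `z / ζ + ζ conj(z) + i t` of the semi-flat twisted character, as a real linear
function of `(z, t)`. It is also its own differential. -/
def sfExp (ζ : ℂ) : ℂ × ℝ →L[ℝ] ℂ :=
  ζ⁻¹ • ContinuousLinearMap.fst ℝ ℂ ℝ +
    ζ • (Complex.conjCLE : ℂ →L[ℝ] ℂ).comp (ContinuousLinearMap.fst ℝ ℂ ℝ) +
    Complex.I • Complex.ofRealCLM.comp (ContinuousLinearMap.snd ℝ ℂ ℝ)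

lemma sfExp_apply (ζ : ℂ) (p : ℂ × ℝ) :
    sfExp ζ p = p.1 / ζ + ζ * (starRingEnd ℂ) p.1 + Complex.I * p.2 := by
  simp [sfExp, div_eq_inv_mul]

/-- The semi-flat twisted character. -/
def sfX (p : ℂ × ℝ) (ζ : ℂ) : ℂ := Complex.exp (sfExp ζ p)

/-- The occupation number `X / (1 - X)`. -/
def sfQ (p : ℂ × ℝ) (ζ : ℂ) : ℂ := sfX p ζ / (1 - sfX p ζ)

lemma sfExp_rayPt_re (s : ℝ) (p : ℂ × ℝ) (ψ : ℝ) :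
    (sfExp (rayPt ψ s) p).re = (s + 1 / s) * (p.1 * Complex.exp (-(ψ * Complex.I))).re := by
  have h1 : (rayPt ψ s)⁻¹ = ((1 / s : ℝ) : ℂ) * Complex.exp (-(ψ * Complex.I)) := by
    rw [rayPt, mul_inv, Complex.exp_neg]
    push_cast
    ring
  have h2 : rayPt ψ s * (starRingEnd ℂ) p.1 =
      (s : ℂ) * (starRingEnd ℂ) (p.1 * Complex.exp (-(ψ * Complex.I))) := by
    rw [rayPt, map_mul, ← Complex.exp_conj]
    simp
    ring
  rw [sfExp_apply, div_eq_inv_mul, h1, h2, mul_assoc, Complex.add_re, Complex.add_re,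
    Complex.re_ofReal_mul, Complex.re_ofReal_mul, Complex.conj_re, mul_comm _ p.1]
  simp
  ring

lemma norm_sfX_rayPt (s : ℝ) (p : ℂ × ℝ) (ψ : ℝ) :
    ‖sfX p (rayPt ψ s)‖ = rayDecay (-(p.1 * Complex.exp (-(ψ * Complex.I))).re) s := by
  rw [sfX, Complex.norm_exp, sfExp_rayPt_re, rayDecay]
  congr 1
  ring

lemma rayDecay_mono {c c' s : ℝ} (hs : 0 < s) (h : c ≤ c') : rayDecay c' s ≤ rayDecay c s := by
  have := two_le_add_inv hs
  refine Real.exp_le_exp.2 (neg_le_neg ?_)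
  gcongr

lemma rayDecay_le_exp {c s : ℝ} (hc : 0 < c) (hs : 0 < s) : rayDecay c s ≤ Real.exp (-(2 * c)) := by
  have := two_le_add_inv hs
  refine Real.exp_le_exp.2 (neg_le_neg ?_)
  nlinarith

/-- On a ray on which `Re (z / ζ)` is negative, `X` decays at both ends. -/
lemma norm_sfX_le {p : ℂ × ℝ} {ψ c s : ℝ} (hs : 0 < s)
    (hp : (p.1 * Complex.exp (-(ψ * Complex.I))).re ≤ -c) :
    ‖sfX p (rayPt ψ s)‖ ≤ rayDecay c s := by
  rw [norm_sfX_rayPt]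
  exact rayDecay_mono hs (by linarith)

lemma norm_sfQ_le {p : ℂ × ℝ} {ψ c s : ℝ} (hc : 0 < c) (hs : 0 < s)
    (hp : (p.1 * Complex.exp (-(ψ * Complex.I))).re ≤ -c) :
    ‖sfQ p (rayPt ψ s)‖ ≤ 1 / (1 - Real.exp (-(2 * c))) * rayDecay c s := by
  have h1 := norm_sfX_le hs hp
  have h2 := rayDecay_le_exp hc hs
  have h3 := exp_neg_two_mul_lt_one hc
  have h4 := norm_sub_norm_le 1 (sfX p (rayPt ψ s))
  rw [norm_one] at h4
  have h5 := rayDecay_pos c s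
  rw [sfQ, norm_div, one_div_mul_eq_div]
  gcongr
  linarith

lemma norm_sfX_lt_one {p : ℂ × ℝ} {ψ c s : ℝ} (hc : 0 < c) (hs : 0 < s)
    (hp : (p.1 * Complex.exp (-(ψ * Complex.I))).re ≤ -c) :
    ‖sfX p (rayPt ψ s)‖ < 1 :=
  (norm_sfX_le hs hp).trans_lt (rayDecay_lt_one hc hs)

lemma norm_log_sfX_le {p : ℂ × ℝ} {ψ c s : ℝ} (hc : 0 < c) (hs : 0 < s)
    (hp : (p.1 * Complex.exp (-(ψ * Complex.I))).re ≤ -c) :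
    ‖Complex.log (1 - sfX p (rayPt ψ s))‖ ≤
      (1 / (1 - Real.exp (-(2 * c))) + 1) * rayDecay c s := by
  have h1 := norm_sfX_le hs hp
  have h2 := rayDecay_le_exp hc hs
  have h3 := exp_neg_two_mul_lt_one hc
  have h4 : ‖-sfX p (rayPt ψ s)‖ < 1 := by
    rw [norm_neg]
    exact norm_sfX_lt_one hc hs hp
  have h6 := Complex.norm_log_one_add_le h4
  rw [norm_neg, ← sub_eq_add_neg] at h6
  rw [norm_neg] at h4
  set x := ‖sfX p (rayPt ψ s)‖
  have hx : 0 ≤ x := norm_nonneg _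
  have h7 : (1 - x)⁻¹ ≤ 1 / (1 - Real.exp (-(2 * c))) := by
    rw [← one_div]
    exact one_div_le_one_div_of_le (by linarith) (by linarith)
  have h8 : 0 ≤ (1 - x)⁻¹ := inv_nonneg.2 (by linarith)
  calc _ ≤ x ^ 2 * (1 - x)⁻¹ / 2 + x := h6
    _ ≤ x * (1 - x)⁻¹ + x := by
      have : x ^ 2 * (1 - x)⁻¹ ≤ x * (1 - x)⁻¹ := mul_le_mul_of_nonneg_right (by nlinarith) h8
      have : 0 ≤ x ^ 2 * (1 - x)⁻¹ := by positivity
      linarith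
    _ = ((1 - x)⁻¹ + 1) * x := by ring
    _ ≤ _ := by gcongr

/-- The Cauchy kernel is bounded along a ray, uniformly in terms of the cosine of the angle between
the ray and `ζ`. -/
lemma kernel_bound {ζ : ℂ} {ψ κ s : ℝ} (hζ : ζ ≠ 0) (hs : 0 < s) (hκ : 0 ≤ κ) (hκ1 : κ < 1)
    (h : (ζ * Complex.exp (-(ψ * Complex.I))).re ≤ κ * ‖ζ‖) :
    rayPt ψ s - ζ ≠ 0 ∧ ‖(rayPt ψ s + ζ) / (rayPt ψ s - ζ)‖ ≤ 2 / (1 - κ) := by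
  set z := ζ * Complex.exp (-(ψ * Complex.I)) with hz
  have hζz : ζ = z * Complex.exp (ψ * Complex.I) := by
    rw [hz, mul_assoc, ← Complex.exp_add, neg_add_cancel, Complex.exp_zero, mul_one]
  have hn : ‖ζ‖ = ‖z‖ := by rw [hζz, norm_mul, Complex.norm_exp_ofReal_mul_I, mul_one]
  have hz0 : 0 < ‖z‖ := hn ▸ norm_pos_iff.2 hζ
  have e1 : ‖rayPt ψ s - ζ‖ = ‖(s : ℂ) - z‖ := by
    rw [hζz, rayPt, ← sub_mul, norm_mul, Complex.norm_exp_ofReal_mul_I, mul_one]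
  have e2 : ‖rayPt ψ s + ζ‖ = ‖(s : ℂ) + z‖ := by
    rw [hζz, rayPt, ← add_mul, norm_mul, Complex.norm_exp_ofReal_mul_I, mul_one]
  have e3 : ‖z‖ ^ 2 = z.re ^ 2 + z.im ^ 2 := by rw [Complex.sq_norm, Complex.normSq_apply]; ring
  have e4 : ‖(s : ℂ) - z‖ ^ 2 = s ^ 2 + ‖z‖ ^ 2 - 2 * s * z.re := by
    rw [e3, Complex.sq_norm, Complex.normSq_apply]
    simp
    ring
  have e5 : ‖(s : ℂ) + z‖ ^ 2 = s ^ 2 + ‖z‖ ^ 2 + 2 * s * z.re := by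
    rw [e3, Complex.sq_norm, Complex.normSq_apply]
    simp
    ring
  rw [hn] at h
  have h1 : (1 - κ) * (s ^ 2 + ‖z‖ ^ 2) ≤ ‖(s : ℂ) - z‖ ^ 2 := by
    rw [e4]
    have : 2 * s * z.re ≤ 2 * s * (κ * ‖z‖) := by gcongr
    nlinarith [mul_nonneg hκ (sq_nonneg (s - ‖z‖))]
  have h2 : ‖(s : ℂ) + z‖ ^ 2 ≤ 2 * (s ^ 2 + ‖z‖ ^ 2) := by
    rw [e5]
    have : z.re ≤ ‖z‖ := Complex.re_le_norm z
    nlinarith [sq_nonneg (s - ‖z‖)]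
  have h3 : 0 < ‖(s : ℂ) - z‖ := by
    have : 0 < ‖(s : ℂ) - z‖ ^ 2 := lt_of_lt_of_le (by
      have : 0 < 1 - κ := by linarith
      positivity) h1
    exact lt_of_le_of_ne (norm_nonneg _) fun h => by rw [← h] at this; simp at this
  refine ⟨norm_pos_iff.1 (e1 ▸ h3), ?_⟩
  have h4 : 0 < 1 - κ := by linarith
  rw [norm_div, e1, e2, div_le_div_iff₀ h3 h4]
  refine abs_le_of_sq_le_sq' ?_ (by positivity) |>.2
  rw [mul_pow, mul_pow]
  calc ‖(s : ℂ) + z‖ ^ 2 * (1 - κ) ^ 2 ≤ 2 * (s ^ 2 + ‖z‖ ^ 2) * (1 - κ) ^ 2 := by gcongr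
    _ = (2 * (1 - κ)) * ((1 - κ) * (s ^ 2 + ‖z‖ ^ 2)) := by ring
    _ ≤ 2 ^ 2 * ‖(s : ℂ) - z‖ ^ 2 := by
      gcongr
      linarith

/-- The ray integral, as a function of `(z, t)`. -/
def rayLog (ζ : ℂ) (ψ : ℝ) (p : ℂ × ℝ) : ℂ :=
  ∫ s in Ioi (0 : ℝ), (1 / s : ℂ) * ((rayPt ψ s + ζ) / (rayPt ψ s - ζ)) *
    Complex.log (1 - sfX p (rayPt ψ s))

lemma continuousOn_sfExp_rayPt (ψ : ℝ) : ContinuousOn (fun s => sfExp (rayPt ψ s)) (Ioi 0) := by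
  have h1 := (continuous_rayPt ψ).continuousOn (s := Ioi 0)
  have h2 : ContinuousOn (fun s => (rayPt ψ s)⁻¹) (Ioi 0) :=
    h1.inv₀ fun s hs => rayPt_ne_zero hs ψ
  unfold sfExp
  exact ((h2.smul continuousOn_const).add (h1.smul continuousOn_const)).add continuousOn_const

lemma continuousOn_sfX_rayPt (p : ℂ × ℝ) (ψ : ℝ) :
    ContinuousOn (fun s => sfX p (rayPt ψ s)) (Ioi 0) :=
  Complex.continuous_exp.comp_continuousOn ((continuousOn_sfExp_rayPt ψ).clm_apply continuousOn_const)

lemma norm_sfExp_rayPt_le {s : ℝ} (hs : 0 < s) (ψ : ℝ) :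
    ‖sfExp (rayPt ψ s)‖ ≤ 1 / s + 1 + s := by
  refine ContinuousLinearMap.opNorm_le_bound _ (by positivity) fun v => ?_
  rw [sfExp_apply]
  have h1 : ‖v.1‖ ≤ ‖v‖ := norm_fst_le v
  have h2 : ‖v.2‖ ≤ ‖v‖ := norm_snd_le v
  refine (norm_add₃_le).trans ?_
  rw [norm_div, norm_mul, norm_mul, norm_rayPt hs, RCLike.norm_conj, Complex.norm_I,
    Complex.norm_real]
  calc ‖v.1‖ / s + s * ‖v.1‖ + 1 * ‖v.2‖ ≤ ‖v‖ / s + s * ‖v‖ + 1 * ‖v‖ := by gcongr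
    _ = _ := by ring

lemma continuousOn_inv_ofReal : ContinuousOn (fun s : ℝ => (1 / s : ℂ)) (Ioi 0) :=
  continuousOn_const.div Complex.continuous_ofReal.continuousOn fun s hs => by
    exact_mod_cast (ne_of_gt hs)

lemma one_sub_sfX_mem_slitPlane {p : ℂ × ℝ} {ψ c s : ℝ} (hc : 0 < c) (hs : 0 < s)
    (hp : (p.1 * Complex.exp (-(ψ * Complex.I))).re ≤ -c) :
    1 - sfX p (rayPt ψ s) ∈ Complex.slitPlane := by
  rw [sub_eq_add_neg]
  exact Complex.mem_slitPlane_of_norm_lt_one (by rw [norm_neg]; exact norm_sfX_lt_one hc hs hp)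

/-- The integrand of the differential of the ray integral. -/
def rayForm (ζ : ℂ) (ψ : ℝ) (p : ℂ × ℝ) (s : ℝ) : ℂ × ℝ →L[ℝ] ℂ :=
  -((1 / s : ℂ) * ((rayPt ψ s + ζ) / (rayPt ψ s - ζ)) * sfQ p (rayPt ψ s)) • sfExp (rayPt ψ s)

lemma continuousOn_sfQ_rayPt {p : ℂ × ℝ} {ψ c : ℝ} (hc : 0 < c)
    (hp : (p.1 * Complex.exp (-(ψ * Complex.I))).re ≤ -c) :
    ContinuousOn (fun s => sfQ p (rayPt ψ s)) (Ioi 0) :=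
  (continuousOn_sfX_rayPt p ψ).div (continuousOn_const.sub (continuousOn_sfX_rayPt p ψ))
    fun _ hs => Complex.slitPlane_ne_zero (one_sub_sfX_mem_slitPlane hc hs hp)

section

variable {ζ : ℂ} {ψ κ c : ℝ} (hζ : ζ ≠ 0) (hκ : 0 ≤ κ) (hκ1 : κ < 1)
  (h : (ζ * Complex.exp (-(ψ * Complex.I))).re ≤ κ * ‖ζ‖)
include hζ hκ hκ1 h

lemma continuousOn_kernel :
    ContinuousOn (fun s : ℝ => (1 / s : ℂ) * ((rayPt ψ s + ζ) / (rayPt ψ s - ζ))) (Ioi 0) :=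
  continuousOn_inv_ofReal.mul
    (((continuous_rayPt ψ).continuousOn.add continuousOn_const).div
      ((continuous_rayPt ψ).continuousOn.sub continuousOn_const)
      fun _ hs => (kernel_bound hζ hs hκ hκ1 h).1)

variable (hc : 0 < c)
include hc

lemma norm_rayForm_le {p : ℂ × ℝ} (hp : (p.1 * Complex.exp (-(ψ * Complex.I))).re ≤ -c) {s : ℝ}
    (hs : 0 < s) : ‖rayForm ζ ψ p s‖ ≤ 2 / (1 - κ) * (1 / (1 - Real.exp (-(2 * c)))) *
      ((1 / s ^ 2 + 1 / s + 1 + s) * rayDecay c s) := by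
  have h1 := (kernel_bound hζ hs hκ hκ1 h).2
  have h2 := norm_sfQ_le hc hs hp
  have h3 := norm_sfExp_rayPt_le hs ψ
  have h4 : 0 < 1 - κ := by linarith
  have h5 : 0 < 1 - Real.exp (-(2 * c)) := by linarith [exp_neg_two_mul_lt_one hc]
  have h6 := rayDecay_pos c s
  rw [rayForm, norm_smul, norm_neg, norm_mul, norm_mul, norm_div, norm_one, Complex.norm_real,
    Real.norm_eq_abs, abs_of_pos hs]
  calc 1 / s * ‖(rayPt ψ s + ζ) / (rayPt ψ s - ζ)‖ * ‖sfQ p (rayPt ψ s)‖ * ‖sfExp (rayPt ψ s)‖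
      ≤ 1 / s * (2 / (1 - κ)) * (1 / (1 - Real.exp (-(2 * c))) * rayDecay c s) *
        (1 / s + 1 + s) := by gcongr
    _ = 2 / (1 - κ) * (1 / (1 - Real.exp (-(2 * c)))) *
      ((1 / s ^ 2 + 1 / s + 1) * rayDecay c s) := by
      field_simp
    _ ≤ _ := by
      refine mul_le_mul_of_nonneg_left (mul_le_mul_of_nonneg_right
        (le_add_of_nonneg_right hs.le) h6.le) (by positivity)

lemma integrableOn_rayForm {p : ℂ × ℝ} (hp : (p.1 * Complex.exp (-(ψ * Complex.I))).re ≤ -c) :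
    IntegrableOn (rayForm ζ ψ p) (Ioi 0) :=
  integrableOn_of_rayDecay_bound hc (ContinuousOn.aestronglyMeasurable
    ((((continuousOn_kernel hζ hκ hκ1 h).mul (continuousOn_sfQ_rayPt hc hp)).neg).smul
      (continuousOn_sfExp_rayPt ψ)) measurableSet_Ioi)
    fun _ hs => norm_rayForm_le hζ hκ hκ1 h hc hp hs

/-- Differentiation of the ray integral in `(z, t)`. -/
lemma hasFDerivAt_rayLog {p : ℂ × ℝ} (hp : (p.1 * Complex.exp (-(ψ * Complex.I))).re < -c) :
    HasFDerivAt (rayLog ζ ψ) (∫ s in Ioi (0 : ℝ), rayForm ζ ψ p s) p := by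
  have h1κ : 0 < 1 - κ := by linarith
  set V : Set (ℂ × ℝ) := {p | (p.1 * Complex.exp (-(ψ * Complex.I))).re < -c}
  have hV : IsOpen V := isOpen_lt (by fun_prop) continuous_const
  have hmeas : ∀ p ∈ V, AEStronglyMeasurable (fun s : ℝ => (1 / s : ℂ) *
      ((rayPt ψ s + ζ) / (rayPt ψ s - ζ)) * Complex.log (1 - sfX p (rayPt ψ s)))
      (volume.restrict (Ioi 0)) := fun p hp =>
    ContinuousOn.aestronglyMeasurable ((continuousOn_kernel hζ hκ hκ1 h).mul
      ((continuousOn_const.sub (continuousOn_sfX_rayPt p ψ)).clog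
        fun _ hs => one_sub_sfX_mem_slitPlane hc hs (le_of_lt hp))) measurableSet_Ioi
  refine hasFDerivAt_integral_of_dominated_of_fderiv_le (hV.mem_nhds hp)
    (bound := fun s => 2 / (1 - κ) * (1 / (1 - Real.exp (-(2 * c)))) *
      ((1 / s ^ 2 + 1 / s + 1 + s) * rayDecay c s)) ?_ ?_ ?_ ?_ ?_ ?_
  · filter_upwards [hV.mem_nhds hp] with p hp using hmeas p hp
  · refine integrableOn_of_rayDecay_bound
      (C := 2 / (1 - κ) * (1 / (1 - Real.exp (-(2 * c))) + 1)) hc (hmeas p hp) fun s hs => ?_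
    have h1 := (kernel_bound hζ hs hκ hκ1 h).2
    have h2 := norm_log_sfX_le hc hs hp.le
    have h5 : 0 < 1 - Real.exp (-(2 * c)) := by linarith [exp_neg_two_mul_lt_one hc]
    have h6 := rayDecay_pos c s
    rw [norm_mul, norm_mul, norm_div, norm_one, Complex.norm_real, Real.norm_eq_abs,
      abs_of_pos hs]
    calc 1 / s * ‖(rayPt ψ s + ζ) / (rayPt ψ s - ζ)‖ * ‖Complex.log (1 - sfX p (rayPt ψ s))‖
        ≤ 1 / s * (2 / (1 - κ)) * ((1 / (1 - Real.exp (-(2 * c))) + 1) * rayDecay c s) := by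
          gcongr
      _ = 2 / (1 - κ) * (1 / (1 - Real.exp (-(2 * c))) + 1) * ((1 / s) * rayDecay c s) := by ring
      _ ≤ _ := by
        refine mul_le_mul_of_nonneg_left (mul_le_mul_of_nonneg_right ?_ h6.le) (by positivity)
        have : 0 < 1 / s ^ 2 + 1 + s := by positivity
        linarith
  · exact (integrableOn_rayForm hζ hκ hκ1 h hc hp.le).aestronglyMeasurable
  · exact (ae_restrict_iff' measurableSet_Ioi).2 (Eventually.of_forall fun s hs p hp =>
      norm_rayForm_le hζ hκ hκ1 h hc (le_of_lt hp) hs)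
  · exact (integrableOn_rayDecay_mul hc).const_mul _
  · refine (ae_restrict_iff' measurableSet_Ioi).2 (Eventually.of_forall fun s hs p hp => ?_)
    have h1 : HasFDerivAt (fun p => 1 - sfX p (rayPt ψ s))
        (-(sfX p (rayPt ψ s) • sfExp (rayPt ψ s))) p := by
      have h2 := ((sfExp (rayPt ψ s)).hasFDerivAt (x := p)).cexp
      exact h2.const_sub 1
    have h3 := ((Complex.hasDerivAt_log (one_sub_sfX_mem_slitPlane hc hs
      (le_of_lt hp))).hasFDerivAt.restrictScalars ℝ).comp p h1
    refine (h3.const_mul _).congr_fderiv ?_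
    ext <;> simp [rayForm, sfQ] <;> ring

end

end ModelGeometry

namespace ModelGeometry

open Set MeasureTheory Filter

/-! ### Wedge products of ray integrals -/

lemma differentiableAt_sfX (p : ℂ × ℝ) {ζ : ℂ} (hζ : ζ ≠ 0) :
    DifferentiableAt ℂ (sfX p) ζ := by
  unfold sfX
  simp only [sfExp_apply]
  exact ((((differentiableAt_const _).div differentiableAt_id hζ).add
    (differentiableAt_id.mul_const _)).add_const _).cexp

/-- The ray integral does not change when the ray is rotated within a sector that contains neither
`ζ` nor a direction in which the integrand grows. -/
lemma rayLog_eq {p : ℂ × ℝ} {ζ : ℂ} {a b c κ : ℝ} (hab : a ≤ b) (hζ : ζ ≠ 0) (hκ : 0 ≤ κ)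
    (hκ1 : κ < 1) (hc : 0 < c)
    (h : ∀ ψ ∈ Icc a b, (ζ * Complex.exp (-(ψ * Complex.I))).re ≤ κ * ‖ζ‖)
    (hp : ∀ ψ ∈ Icc a b, (p.1 * Complex.exp (-(ψ * Complex.I))).re ≤ -c) :
    rayLog ζ a p = rayLog ζ b p := by
  have := integral_ray_eq (G := fun w => (w + ζ) / (w - ζ) * Complex.log (1 - sfX p w))
    (C := 2 / (1 - κ) * (1 / (1 - Real.exp (-(2 * c))) + 1)) hab hc
    (fun ψ hψ s hs => ((differentiableAt_id.add_const ζ).div (differentiableAt_id.sub_const ζ)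
      (kernel_bound hζ hs hκ hκ1 (h ψ hψ)).1).mul
        (((differentiableAt_sfX p (rayPt_ne_zero hs ψ)).const_sub 1).clog
          (one_sub_sfX_mem_slitPlane hc hs (hp ψ hψ))))
    (fun ψ hψ s hs => by
      have h1 := (kernel_bound hζ hs hκ hκ1 (h ψ hψ)).2
      have h2 := norm_log_sfX_le hc hs (hp ψ hψ)
      have h5 : 0 < 1 - Real.exp (-(2 * c)) := by linarith [exp_neg_two_mul_lt_one hc]
      have h6 := rayDecay_pos c s
      have h7 : 0 < 1 - κ := by linarith
      rw [norm_mul]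
      calc ‖(rayPt ψ s + ζ) / (rayPt ψ s - ζ)‖ * ‖Complex.log (1 - sfX p (rayPt ψ s))‖
          ≤ 2 / (1 - κ) * ((1 / (1 - Real.exp (-(2 * c))) + 1) * rayDecay c s) := by gcongr
        _ = 2 / (1 - κ) * (1 / (1 - Real.exp (-(2 * c))) + 1) * (1 * rayDecay c s) := by ring
        _ ≤ _ := by
          refine mul_le_mul_of_nonneg_left (mul_le_mul_of_nonneg_right ?_ h6.le) (by positivity)
          have : 0 < 1 / s + s := by positivity
          linarith)
  simpa only [rayLog, mul_assoc] using this

/-- The moments of the occupation number along a ray. -/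
def rayMoment (k : ℤ) (ψ : ℝ) (p : ℂ × ℝ) : ℂ :=
  ∫ s in Ioi (0 : ℝ), (1 / s : ℂ) * (sfQ p (rayPt ψ s) * rayPt ψ s ^ k)

lemma norm_rayPt_zpow_le {k : ℤ} (hk : k = -1 ∨ k = 0 ∨ k = 1) {s : ℝ} (hs : 0 < s) (ψ : ℝ) :
    ‖rayPt ψ s ^ k‖ ≤ 1 / s + 1 + s := by
  have h1 : 0 < 1 / s := by positivity
  rw [norm_zpow, norm_rayPt hs]
  rcases hk with rfl | rfl | rfl
  · rw [zpow_neg_one, ← one_div]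
    linarith
  · rw [zpow_zero]
    linarith
  · rw [zpow_one]
    linarith

lemma norm_sfQ_mul_zpow_le {p : ℂ × ℝ} {ψ c s : ℝ} {k : ℤ} (hk : k = -1 ∨ k = 0 ∨ k = 1)
    (hc : 0 < c) (hs : 0 < s) (hp : (p.1 * Complex.exp (-(ψ * Complex.I))).re ≤ -c) :
    ‖sfQ p (rayPt ψ s) * rayPt ψ s ^ k‖ ≤
      1 / (1 - Real.exp (-(2 * c))) * ((1 / s + 1 + s) * rayDecay c s) := by
  have h1 := norm_sfQ_le hc hs hp
  have h2 := norm_rayPt_zpow_le hk hs ψ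
  have h5 : 0 < 1 - Real.exp (-(2 * c)) := by linarith [exp_neg_two_mul_lt_one hc]
  have h6 := rayDecay_pos c s
  rw [norm_mul]
  calc _ ≤ 1 / (1 - Real.exp (-(2 * c))) * rayDecay c s * (1 / s + 1 + s) := by gcongr
    _ = _ := by ring

lemma rayMoment_eq {p : ℂ × ℝ} {a b c : ℝ} {k : ℤ} (hk : k = -1 ∨ k = 0 ∨ k = 1) (hab : a ≤ b)
    (hc : 0 < c) (hp : ∀ ψ ∈ Icc a b, (p.1 * Complex.exp (-(ψ * Complex.I))).re ≤ -c) :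
    rayMoment k a p = rayMoment k b p := by
  refine integral_ray_eq (G := fun w => sfQ p w * w ^ k) hab hc (fun ψ hψ s hs => ?_)
    fun ψ hψ s hs => norm_sfQ_mul_zpow_le hk hc hs (hp ψ hψ)
  have h0 := rayPt_ne_zero hs ψ
  have h1 := differentiableAt_sfX p h0
  exact (h1.div (h1.const_sub 1) (Complex.slitPlane_ne_zero
    (one_sub_sfX_mem_slitPlane hc hs (hp ψ hψ)))).mul (differentiableAt_zpow.2 (Or.inl h0))

lemma integrableOn_moment {p : ℂ × ℝ} {ψ c : ℝ} {k : ℤ} (hk : k = -1 ∨ k = 0 ∨ k = 1)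
    (hc : 0 < c) (hp : (p.1 * Complex.exp (-(ψ * Complex.I))).re ≤ -c) :
    IntegrableOn (fun s : ℝ => (1 / s : ℂ) * (sfQ p (rayPt ψ s) * rayPt ψ s ^ k)) (Ioi 0) := by
  refine integrableOn_of_rayDecay_bound (C := 1 / (1 - Real.exp (-(2 * c)))) hc
    (ContinuousOn.aestronglyMeasurable (continuousOn_inv_ofReal.mul
    ((continuousOn_sfQ_rayPt hc hp).mul ((continuous_rayPt ψ).continuousOn.zpow₀ k fun s hs =>
      Or.inl (rayPt_ne_zero hs ψ)))) measurableSet_Ioi) fun s hs => ?_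
  have h1 := norm_sfQ_mul_zpow_le hk hc hs hp
  have h5 : 0 < 1 - Real.exp (-(2 * c)) := by linarith [exp_neg_two_mul_lt_one hc]
  have h6 := rayDecay_pos c s
  rw [norm_mul, norm_div, norm_one, Complex.norm_real, Real.norm_eq_abs, abs_of_pos hs]
  calc _ ≤ 1 / s * (1 / (1 - Real.exp (-(2 * c))) * ((1 / s + 1 + s) * rayDecay c s)) := by gcongr
    _ = 1 / (1 - Real.exp (-(2 * c))) * ((1 / s ^ 2 + 1 / s + 1) * rayDecay c s) := by
      field_simp
    _ ≤ _ := mul_le_mul_of_nonneg_left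
          (mul_le_mul_of_nonneg_right (le_add_of_nonneg_right hs.le) h6.le) (by positivity)

/-- On the BPS ray the character is the one of the instanton sums. -/
lemma sfX_bps {ρ φ t s : ℝ} (hs : 0 < s) :
    sfX (-(ρ * Complex.exp (φ * Complex.I)), t) (rayPt φ s) = bpsX ρ t s := by
  have h0 : (s : ℂ) ≠ 0 := by exact_mod_cast hs.ne'
  have h1 := Complex.exp_ne_zero (φ * Complex.I)
  have h2 : Complex.exp (φ * Complex.I) * (starRingEnd ℂ) (Complex.exp (φ * Complex.I)) = 1 := by
    rw [← Complex.exp_conj, ← Complex.exp_add]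
    simp
  have h3 : sfExp (rayPt φ s) (-(ρ * Complex.exp (φ * Complex.I)), t) =
      ((-(ρ * (s + 1 / s)) : ℝ) : ℂ) + t * Complex.I := by
    rw [sfExp_apply, rayPt]
    simp only [map_neg, map_mul, Complex.conj_ofReal]
    push_cast
    have h4 : -((ρ : ℂ) * Complex.exp (φ * Complex.I)) / (s * Complex.exp (φ * Complex.I)) =
        -(ρ * (1 / s)) := by
      field_simp
    rw [h4]
    linear_combination (-(s : ℂ) * ρ) * h2
  rw [sfX, h3, Complex.exp_add, bpsX, rayDecay, Complex.ofReal_exp]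

lemma sfQ_bps {ρ φ t s : ℝ} (hs : 0 < s) :
    sfQ (-(ρ * Complex.exp (φ * Complex.I)), t) (rayPt φ s) = bpsQ ρ t s := by
  rw [sfQ, bpsQ, sfX_bps hs]

lemma rayMoment_zero_bps (ρ φ t : ℝ) :
    rayMoment 0 φ (-(ρ * Complex.exp (φ * Complex.I)), t) = bpsA0 ρ t := by
  refine setIntegral_congr_fun measurableSet_Ioi fun s hs => ?_
  simp only [sfQ_bps hs, zpow_zero, mul_one]
  push_cast
  rfl

lemma rayMoment_one_bps (ρ φ t : ℝ) :
    rayMoment 1 φ (-(ρ * Complex.exp (φ * Complex.I)), t) =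
      Complex.exp (φ * Complex.I) * bpsA1 ρ t := by
  rw [bpsA1, ← integral_const_mul]
  refine setIntegral_congr_fun measurableSet_Ioi fun s hs => ?_
  have h0 : (s : ℂ) ≠ 0 := by exact_mod_cast (ne_of_gt hs)
  simp only [sfQ_bps hs, zpow_one]
  rw [rayPt]
  push_cast
  field_simp

lemma integral_inv_sq_bpsQ (ρ t : ℝ) :
    ∫ s in Ioi (0 : ℝ), ((1 / s ^ 2 : ℝ) : ℂ) * bpsQ ρ t s = bpsA1 ρ t := by
  have h := integral_comp_rpow_Ioi (fun s => bpsQ ρ t s) (p := -1) (by norm_num)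
  rw [bpsA1]
  simp only [Complex.ofReal_one, one_mul]
  rw [← h]
  refine setIntegral_congr_fun measurableSet_Ioi fun s hs => ?_
  have hs : 0 < s := hs
  have h1 : bpsQ ρ t (s ^ (-1 : ℝ)) = bpsQ ρ t s := by
    rw [Real.rpow_neg_one, bpsQ, bpsQ, bpsX, bpsX, rayDecay, rayDecay, one_div, inv_inv, one_div,
      add_comm]
  have h2 : s ^ ((-1 : ℝ) - 1) = 1 / s ^ 2 := by
    rw [show (-1 : ℝ) - 1 = -(2 : ℕ) by norm_num, Real.rpow_neg hs.le, Real.rpow_natCast, one_div]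
  simp only [h1, h2, abs_neg, abs_one, one_mul, Complex.real_smul]

lemma rayMoment_neg_one_bps (ρ φ t : ℝ) :
    rayMoment (-1) φ (-(ρ * Complex.exp (φ * Complex.I)), t) =
      Complex.exp (-(φ * Complex.I)) * bpsA1 ρ t := by
  rw [← integral_inv_sq_bpsQ, ← integral_const_mul]
  refine setIntegral_congr_fun measurableSet_Ioi fun s hs => ?_
  have h0 : (s : ℂ) ≠ 0 := by exact_mod_cast (ne_of_gt hs)
  simp only [sfQ_bps hs, zpow_neg_one, Complex.exp_neg]
  rw [rayPt]
  push_cast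
  have := Complex.exp_ne_zero (φ * Complex.I)
  field_simp

lemma integral_linear_combination₃ {μ : Measure ℝ} {f g h : ℝ → ℂ} (hf : Integrable f μ)
    (hg : Integrable g μ) (hh : Integrable h μ) (a b c : ℂ) :
    ∫ s, (a * f s + b * g s + c * h s) ∂μ =
      a * ∫ s, f s ∂μ + b * ∫ s, g s ∂μ + c * ∫ s, h s ∂μ := by
  rw [integral_add (f := fun s => a * f s + b * g s) ((hf.const_mul a).add (hg.const_mul b))
    (hh.const_mul c), integral_add (hf.const_mul a) (hg.const_mul b), integral_const_mul,
    integral_const_mul, integral_const_mul]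

/-- The wedge product of the differential of the ray integral at `ζ` with the differential of
`log X^sf(ζ)`. The pole of the kernel at `ζ` cancels, so that the integral can be evaluated on the
BPS ray. -/
theorem rayForm_wedge {ζ : ℂ} {ρ φ ψ κ t : ℝ} (hζ : ζ ≠ 0) (hκ : 0 ≤ κ) (hκ1 : κ < 1)
    (h : (ζ * Complex.exp (-(ψ * Complex.I))).re ≤ κ * ‖ζ‖) (hρ : 0 < ρ) (hφ : φ ≤ ψ)
    (hψ : ψ < φ + Real.pi / 2) (v w : ℂ × ℝ) :
    let p : ℂ × ℝ := (-(ρ * Complex.exp (φ * Complex.I)), t)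
    (∫ s in Ioi (0 : ℝ), rayForm ζ ψ p s) v * sfExp ζ w -
        (∫ s in Ioi (0 : ℝ), rayForm ζ ψ p s) w * sfExp ζ v =
      Complex.I * (v.1 * w.2 - w.1 * v.2) *
          (bpsA0 ρ t / ζ + Complex.exp (-(φ * Complex.I)) * bpsA1 ρ t) +
        (v.1 * (starRingEnd ℂ) w.1 - w.1 * (starRingEnd ℂ) v.1) *
          (Complex.exp (φ * Complex.I) * bpsA1 ρ t / ζ + 2 * bpsA0 ρ t +
            ζ * (Complex.exp (-(φ * Complex.I)) * bpsA1 ρ t)) +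
        Complex.I * (v.2 * (starRingEnd ℂ) w.1 - w.2 * (starRingEnd ℂ) v.1) *
          (Complex.exp (φ * Complex.I) * bpsA1 ρ t + ζ * bpsA0 ρ t) := by
  intro p
  set c := ρ * Real.cos (ψ - φ) with hcdef
  have hc : 0 < c := mul_pos hρ (Real.cos_pos_of_mem_Ioo ⟨by linarith [Real.pi_pos], by linarith⟩)
  have hp : ∀ ψ' ∈ Icc φ ψ, (p.1 * Complex.exp (-(ψ' * Complex.I))).re ≤ -c := by
    intro ψ' hψ'
    have h1 : p.1 * Complex.exp (-(ψ' * Complex.I)) =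
        ((-ρ : ℝ) : ℂ) * Complex.exp ((φ - ψ' : ℝ) * Complex.I) := by
      change -((ρ : ℂ) * Complex.exp (φ * Complex.I)) * _ = _
      rw [neg_mul, mul_assoc, ← Complex.exp_add]
      push_cast
      ring_nf
    rw [h1, Complex.re_ofReal_mul, Complex.exp_ofReal_mul_I_re, hcdef, neg_mul, neg_le_neg_iff,
      show Real.cos (φ - ψ') = Real.cos (ψ' - φ) by rw [← Real.cos_neg, neg_sub]]
    refine mul_le_mul_of_nonneg_left ?_ hρ.le
    exact Real.cos_le_cos_of_nonneg_of_le_pi (by linarith [hψ'.1])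
      (by linarith [Real.pi_pos]) (by linarith [hψ'.2])
  have hpψ := hp ψ ⟨hφ, le_rfl⟩
  have hint := integrableOn_rayForm hζ hκ hκ1 h hc hpψ
  have hm : ∀ k : ℤ, k = -1 ∨ k = 0 ∨ k = 1 → rayMoment k ψ p = rayMoment k φ p := fun k hk =>
    (rayMoment_eq hk hφ hc hp).symm
  rw [← rayMoment_zero_bps ρ φ t, ← rayMoment_one_bps ρ φ t, ← rayMoment_neg_one_bps ρ φ t]
  change _ = _ * (rayMoment 0 φ p / ζ + rayMoment (-1) φ p) + _ * (rayMoment 1 φ p / ζ +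
    2 * rayMoment 0 φ p + ζ * rayMoment (-1) φ p) + _ * (rayMoment 1 φ p + ζ * rayMoment 0 φ p)
  rw [← hm 0 (by simp), ← hm 1 (by simp), ← hm (-1) (by simp),
    ContinuousLinearMap.integral_apply hint, ContinuousLinearMap.integral_apply hint,
    ← integral_mul_const, ← integral_mul_const, ← integral_sub
      ((hint.apply_continuousLinearMap v).mul_const _)
      ((hint.apply_continuousLinearMap w).mul_const _)]
  have i0 := integrableOn_moment (k := 0) (by simp) hc hpψ
  have i1 := integrableOn_moment (k := 1) (by simp) hc hpψ
  have im := integrableOn_moment (k := -1) (by simp) hc hpψ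
  -- the difference of `sfExp` at `rayPt ψ s` and at `ζ` is divisible by `rayPt ψ s - ζ`, so the
  -- pole of the kernel cancels and only the moments of orders `-1`, `0`, `1` remain
  have hpt : ∀ s ∈ Ioi (0 : ℝ), rayForm ζ ψ p s v * sfExp ζ w - rayForm ζ ψ p s w * sfExp ζ v =
      (Complex.I * (v.1 * w.2 - w.1 * v.2) / ζ +
        (v.1 * (starRingEnd ℂ) w.1 - w.1 * (starRingEnd ℂ) v.1) * 2 +
        Complex.I * (v.2 * (starRingEnd ℂ) w.1 - w.2 * (starRingEnd ℂ) v.1) * ζ) *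
          ((1 / s : ℂ) * (sfQ p (rayPt ψ s) * rayPt ψ s ^ (0 : ℤ))) +
      ((v.1 * (starRingEnd ℂ) w.1 - w.1 * (starRingEnd ℂ) v.1) / ζ +
        Complex.I * (v.2 * (starRingEnd ℂ) w.1 - w.2 * (starRingEnd ℂ) v.1)) *
          ((1 / s : ℂ) * (sfQ p (rayPt ψ s) * rayPt ψ s ^ (1 : ℤ))) +
      (Complex.I * (v.1 * w.2 - w.1 * v.2) +
        (v.1 * (starRingEnd ℂ) w.1 - w.1 * (starRingEnd ℂ) v.1) * ζ) *
          ((1 / s : ℂ) * (sfQ p (rayPt ψ s) * rayPt ψ s ^ (-1 : ℤ))) := by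
    intro s hs
    have hs : 0 < s := hs
    have h0 : (s : ℂ) ≠ 0 := by exact_mod_cast hs.ne'
    have h1 := (kernel_bound hζ hs hκ hκ1 h).1
    have h2 := rayPt_ne_zero hs ψ
    simp only [rayForm, smul_apply, smul_eq_mul, sfExp_apply, zpow_zero,
      zpow_one, zpow_neg_one]
    field_simp
    ring
  refine (setIntegral_congr_fun measurableSet_Ioi hpt).trans
    ((integral_linear_combination₃ i0 i1 im _ _ _).trans ?_)
  simp only [rayMoment]
  ring

end ModelGeometry

namespace ModelGeometry

open Set MeasureTheory Filter

/-! ### Sectorial decompositions -/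

lemma rayPt_add_two_pi (ψ s : ℝ) (k : ℤ) : rayPt (ψ + 2 * Real.pi * k) s = rayPt ψ s := by
  rw [rayPt, rayPt]
  congr 1
  push_cast
  rw [add_mul, Complex.exp_add, show (2 * Real.pi * k * Complex.I : ℂ) =
    k * (2 * Real.pi * Complex.I) by ring, Complex.exp_int_mul_two_pi_mul_I, mul_one]

lemma rayLog_add_two_pi (ζ : ℂ) (ψ : ℝ) (p : ℂ × ℝ) (k : ℤ) :
    rayLog ζ (ψ + 2 * Real.pi * k) p = rayLog ζ ψ p := by
  simp only [rayLog, rayPt_add_two_pi]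

lemma re_mul_exp_neg (ζ : ℂ) (ψ : ℝ) :
    (ζ * Complex.exp (-(ψ * Complex.I))).re = ‖ζ‖ * Real.cos (ζ.arg - ψ) := by
  have h1 : ζ * Complex.exp (-(ψ * Complex.I)) =
      (‖ζ‖ : ℂ) * Complex.exp ((ζ.arg - ψ : ℝ) * Complex.I) := by
    conv_lhs => rw [← Complex.norm_mul_exp_arg_mul_I ζ]
    rw [mul_assoc, ← Complex.exp_add]
    push_cast
    ring_nf
  rw [h1, Complex.re_ofReal_mul, Complex.exp_ofReal_mul_I_re]

/-- Every angle has a sector on its clockwise side that does not contain `ζ`. -/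
lemma exists_sector_avoiding (ζ : ℂ) (b : ℝ) :
    ∃ a < b, ∀ a' ∈ Ico a b, ∀ b' ∈ Ico a' b, ∃ κ : ℝ, 0 ≤ κ ∧ κ < 1 ∧
      ∀ ψ ∈ Icc a' b', (ζ * Complex.exp (-(ψ * Complex.I))).re ≤ κ * ‖ζ‖ := by
  have hpi := Real.pi_pos
  set β := toIcoMod Real.two_pi_pos (b - 2 * Real.pi) ζ.arg with hβ
  have hβmem : β ∈ Ico (b - 2 * Real.pi) (b - 2 * Real.pi + 2 * Real.pi) :=
    toIcoMod_mem_Ico Real.two_pi_pos _ _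
  rw [sub_add_cancel] at hβmem
  have hβeq : ∃ k : ℤ, ζ.arg = β + k * (2 * Real.pi) :=
    ⟨toIcoDiv Real.two_pi_pos (b - 2 * Real.pi) ζ.arg, by
      have := toIcoMod_add_toIcoDiv_zsmul Real.two_pi_pos (b - 2 * Real.pi) ζ.arg
      rw [zsmul_eq_mul] at this
      linarith⟩
  obtain ⟨k, hk⟩ := hβeq
  refine ⟨(β + b) / 2, by linarith [hβmem.2], fun a' ha' b' hb' => ?_⟩
  have hlt : ∀ ψ ∈ Icc a' b', Real.cos (ζ.arg - ψ) < 1 := by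
    intro ψ hψ
    refine lt_of_le_of_ne (Real.cos_le_one _) fun h => ?_
    obtain ⟨m, hm⟩ := (Real.cos_eq_one_iff _).1 h
    have h1 : β < ψ := by linarith [hψ.1, ha'.1, hβmem.2]
    have h2 : ψ < b := lt_of_le_of_lt hψ.2 hb'.2
    have h3 : ψ - β = (k - m : ℤ) * (2 * Real.pi) := by
      push_cast
      linarith
    have h4 : (0 : ℝ) < (k - m : ℤ) := by
      by_contra hneg
      push Not at hneg
      nlinarith
    have h5 : ((k - m : ℤ) : ℝ) < 1 := by
      by_contra hneg
      push Not at hneg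
      nlinarith [hβmem.1]
    have h6 : 0 < k - m := by exact_mod_cast h4
    have h7 : k - m < 1 := by exact_mod_cast h5
    omega
  obtain ⟨ψ0, hψ0, hmax⟩ := isCompact_Icc.exists_isMaxOn (nonempty_Icc.2 hb'.1)
    (f := fun ψ => Real.cos (ζ.arg - ψ)) (by fun_prop)
  refine ⟨max 0 (Real.cos (ζ.arg - ψ0)), le_max_left _ _, max_lt one_pos (hlt ψ0 hψ0),
    fun ψ hψ => ?_⟩
  rw [re_mul_exp_neg, mul_comm]
  gcongr
  exact le_max_of_le_right (hmax hψ)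

/-- The limit that defines the integral over the ray infinitesimally clockwise of the angle `b`
is attained. -/
lemma limUnder_rayLog {p : ℂ × ℝ} {ζ : ℂ} {a b c : ℝ} (hab : a < b) (hζ : ζ ≠ 0) (hc : 0 < c)
    (h : ∀ b' ∈ Ico a b, ∃ κ : ℝ, 0 ≤ κ ∧ κ < 1 ∧
      ∀ ψ ∈ Icc a b', (ζ * Complex.exp (-(ψ * Complex.I))).re ≤ κ * ‖ζ‖)
    (hp : ∀ ψ ∈ Icc a b, (p.1 * Complex.exp (-(ψ * Complex.I))).re ≤ -c) :
    limUnder (𝓝[>] (0 : ℝ)) (fun δ => rayLog ζ (b - δ) p) = rayLog ζ a p := by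
  refine Tendsto.limUnder_eq (tendsto_const_nhds.congr' ?_)
  filter_upwards [Ioc_mem_nhdsGT (sub_pos.2 hab)] with δ hδ
  have hb : b - δ ∈ Ico a b := ⟨by linarith [hδ.2], by linarith [hδ.1]⟩
  obtain ⟨κ, h0, h1, h2⟩ := h _ hb
  exact rayLog_eq hb.1 hζ h0 h1 hc h2 fun ψ hψ => hp ψ ⟨hψ.1, hψ.2.trans hb.2.le⟩

/-- If `z` is on no boundary ray, the counterclockwise boundary of its sector is at a positive acute
angle from `z`, and it is locally constant. -/
lemma Sectors.endAngle_spec (V : Sectors) {z : ℂ} (hz : z ≠ 0)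
    (hgood : ∀ A : ℤ, z ∉ ray (V.angle A)) :
    z.arg < V.endAngle z ∧ V.endAngle z < z.arg + Real.pi / 2 ∧
      ∀ᶠ z' in 𝓝 z, ∃ k : ℤ, V.endAngle z' = V.endAngle z + 2 * Real.pi * k := by
  have hpi := Real.pi_pos
  have hK : (5 : ℝ) ≤ V.K := by exact_mod_cast V.five_le
  have hK0 : (0 : ℝ) < V.K := by linarith
  -- the position of `arg z` in units of the opening angle; `endAngle` rounds it up
  set x : ℂ → ℝ := fun z => (z.arg - V.offset) * V.K / Real.pi with hx
  have hfl : ∀ z, V.endAngle z = V.offset + (⌊x z⌋ + 1) * Real.pi / V.K := fun z => by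
    rw [Sectors.endAngle, Sectors.angle]
    push_cast
    rfl
  have harg : ∀ z, z.arg = V.offset + x z * Real.pi / V.K := fun z => by
    simp only [hx]
    field_simp
    ring
  have hne : (⌊x z⌋ : ℝ) ≠ x z := by
    intro h
    refine hgood ⌊x z⌋ ⟨‖z‖, norm_pos_iff.2 hz, ?_⟩
    rw [Sectors.angle, h, ← harg, Complex.norm_mul_exp_arg_mul_I]
  have hlt : (⌊x z⌋ : ℝ) < x z := lt_of_le_of_ne (Int.floor_le _) hne
  have hlt' := Int.lt_floor_add_one (x z)
  have hstep : Real.pi / V.K ≤ Real.pi / 5 := by gcongr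
  refine ⟨?_, ?_, ?_⟩
  · rw [hfl, harg z]
    gcongr
  · rw [hfl, harg z]
    have h1 : (⌊x z⌋ + 1 : ℝ) * Real.pi / V.K = ⌊x z⌋ * Real.pi / V.K + Real.pi / V.K := by ring
    have h2 : ⌊x z⌋ * Real.pi / V.K ≤ x z * Real.pi / V.K := by gcongr
    linarith
  -- `arg` may jump by `2π` near `z`, so compare through the argument of the quotient `z' / z`
  · have hcont : ContinuousAt (fun z' => x z + (z' / z).arg * V.K / Real.pi) z := by
      have h1 : ContinuousAt (fun z' : ℂ => (z' / z).arg) z := by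
        refine ContinuousAt.comp (g := Complex.arg) (f := fun z' => z' / z) ?_ (by fun_prop)
        rw [div_self hz]
        exact Complex.continuousAt_arg Complex.one_mem_slitPlane
      exact continuousAt_const.add ((h1.mul continuousAt_const).div_const _)
    have hval : x z + (z / z).arg * V.K / Real.pi = x z := by
      rw [div_self hz, Complex.arg_one]
      simp
    have hev := hcont.eventually_mem (s := Ioo (⌊x z⌋ : ℝ) (⌊x z⌋ + 1))
      (by rw [hval]; exact Ioo_mem_nhds hlt hlt')
    filter_upwards [hev, isOpen_ne.mem_nhds hz] with z' hz' hz'0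
    have h1 : ∃ k : ℤ, z'.arg = z.arg + (z' / z).arg + k * (2 * Real.pi) := by
      have h2 : ((z' / z * z).arg : Real.Angle) = (z' / z).arg + z.arg :=
        Complex.arg_mul_coe_angle (div_ne_zero hz'0 hz) hz
      rw [div_mul_cancel₀ _ hz, ← Real.Angle.coe_add, Real.Angle.angle_eq_iff_two_pi_dvd_sub] at h2
      obtain ⟨k, hk⟩ := h2
      exact ⟨k, by linarith⟩
    obtain ⟨k, hk⟩ := h1
    have h3 : x z' = x z + (z' / z).arg * V.K / Real.pi + (2 * V.K * k : ℤ) := by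
      simp only [hx, hk]
      push_cast
      field_simp
      ring
    have h4 : ⌊x z'⌋ = ⌊x z⌋ + 2 * V.K * k := by
      rw [h3, Int.floor_add_intCast]
      congr 1
      rw [Int.floor_eq_iff]
      exact ⟨hz'.1.le, hz'.2⟩
    refine ⟨k, ?_⟩
    rw [hfl, hfl, h4]
    push_cast
    field_simp
    ring

end ModelGeometry

namespace ModelGeometry

/-! ### Forms `f dg ∧ dh` and their exterior derivatives -/

section Wedge

variable {E F : Type*} [NormedAddCommGroup E] [NormedSpace ℝ E] [NormedAddCommGroup F]
  [NormedSpace ℝ F]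

/-- The wedge product of complex-valued 1-forms. -/
def wedge (α β : E →L[ℝ] ℂ) : E [⋀^Fin 2]→L[ℝ] ℂ :=
  ContinuousAlternatingMap.alternatizeUncurryFinCLM ℝ E ℂ
    (((ContinuousLinearMap.lsmul ℝ ℂ).flip
      (ContinuousAlternatingMap.ofSubsingletonLIE (𝕜 := ℝ) (E := E) (F := ℂ) (0 : Fin 1) β)).comp α)

lemma wedge_apply (α β : E →L[ℝ] ℂ) (v : Fin 2 → E) :
    wedge α β v = α (v 0) * β (v 1) - α (v 1) * β (v 0) := by
  simp [wedge, ContinuousAlternatingMap.alternatizeUncurryFin_apply, Fin.sum_univ_two,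
    Fin.removeNth, sub_eq_add_neg]

lemma contDiffAt_wedge {n : ℕ∞ω} {s : F} {α β : F → E →L[ℝ] ℂ} (hα : ContDiffAt ℝ n α s)
    (hβ : ContDiffAt ℝ n β s) : ContDiffAt ℝ n (fun s => wedge (α s) (β s)) s := by
  unfold wedge
  refine contDiffAt_const.clm_apply (ContDiffAt.clm_comp ?_ hα)
  exact contDiffAt_const.clm_apply
    ((ContinuousAlternatingMap.ofSubsingletonLIE (𝕜 := ℝ) (E := E) (F := ℂ)
      (0 : Fin 1)).contDiff.contDiffAt.comp s hβ)

lemma wedge_comp (α β : F →L[ℝ] ℂ) (L : E →L[ℝ] F) :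
    (wedge α β).compContinuousLinearMap L = wedge (α.comp L) (β.comp L) := by
  ext v
  simp [wedge_apply]

/-- The 2-form `f dg ∧ dh`. -/
def formOf (f g h : E → ℂ) (s : E) : E [⋀^Fin 2]→L[ℝ] ℂ :=
  f s • wedge (fderiv ℝ g s) (fderiv ℝ h s)

lemma formOf_apply (f g h : E → ℂ) (s : E) (v : Fin 2 → E) :
    formOf f g h s v = f s * (fderiv ℝ g s (v 0) * fderiv ℝ h s (v 1) -
      fderiv ℝ g s (v 1) * fderiv ℝ h s (v 0)) := by
  rw [formOf, ← wedge_apply]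
  rfl

lemma contDiffAt_formOf {s : E} {f g h : E → ℂ} (hf : ContDiffAt ℝ ∞ f s)
    (hg : ContDiffAt ℝ ∞ g s) (hh : ContDiffAt ℝ ∞ h s) : ContDiffAt ℝ ∞ (formOf f g h) s :=
  hf.smul (contDiffAt_wedge (hg.fderiv_right (by simp)) (hh.fderiv_right (by simp)))

lemma formOf_comp {f g h : F → ℂ} {φ : E → F} {s : E} (hg : DifferentiableAt ℝ g (φ s))
    (hh : DifferentiableAt ℝ h (φ s)) (hφ : DifferentiableAt ℝ φ s) :
    formOf (f ∘ φ) (g ∘ φ) (h ∘ φ) s =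
      (formOf f g h (φ s)).compContinuousLinearMap (fderiv ℝ φ s) := by
  rw [formOf, fderiv_comp s hg hφ, fderiv_comp s hh hφ, ← wedge_comp]
  rfl

/-- The value of the 3-form `α ∧ β ∧ γ`. -/
def wedge₃ (α β γ : E →L[ℝ] ℂ) (v : Fin 3 → E) : ℂ :=
  α (v 0) * (β (v 1) * γ (v 2) - β (v 2) * γ (v 1)) -
    α (v 1) * (β (v 0) * γ (v 2) - β (v 2) * γ (v 0)) +
    α (v 2) * (β (v 0) * γ (v 1) - β (v 1) * γ (v 0))

lemma fderiv_fderiv_apply {g : E → ℂ} {s : E} (hg : ContDiffAt ℝ ∞ g s) (v w : E) :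
    DifferentiableAt ℝ (fun s => fderiv ℝ g s v) s ∧
    fderiv ℝ (fun s => fderiv ℝ g s v) s w = fderiv ℝ (fderiv ℝ g) s w v := by
  have h : DifferentiableAt ℝ (fderiv ℝ g) s :=
    (hg.fderiv_right (m := ∞) (by simp)).differentiableAt (by simp)
  have h1 := h.hasFDerivAt.clm_apply (hasFDerivAt_const v s)
  exact ⟨h1.differentiableAt, by rw [h1.fderiv]; simp⟩

/-- `d(f dg ∧ dh) = df ∧ dg ∧ dh`: the second derivatives of `g` and `h` are symmetric. -/
lemma extDeriv_formOf {f g h : E → ℂ} {s : E} (hf : ContDiffAt ℝ ∞ f s)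
    (hg : ContDiffAt ℝ ∞ g s) (hh : ContDiffAt ℝ ∞ h s) (v : Fin 3 → E) :
    extDeriv (formOf f g h) s v = wedge₃ (fderiv ℝ f s) (fderiv ℝ g s) (fderiv ℝ h s) v := by
  have hd : DifferentiableAt ℝ (formOf f g h) s :=
    (contDiffAt_formOf hf hg hh).differentiableAt (by simp)
  rw [extDeriv_apply hd, Fin.sum_univ_three]
  have key : ∀ u v w : E, fderiv ℝ (fun s => formOf f g h s ![v, w]) s u =
      fderiv ℝ f s u * (fderiv ℝ g s v * fderiv ℝ h s w - fderiv ℝ g s w * fderiv ℝ h s v) +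
      f s * (fderiv ℝ (fderiv ℝ g) s u v * fderiv ℝ h s w +
        fderiv ℝ g s v * fderiv ℝ (fderiv ℝ h) s u w -
        fderiv ℝ (fderiv ℝ g) s u w * fderiv ℝ h s v -
        fderiv ℝ g s w * fderiv ℝ (fderiv ℝ h) s u v) := by
    intro u v w
    simp only [formOf_apply]
    have e1 := (hf.differentiableAt (by simp)).hasFDerivAt
    have gv := (fderiv_fderiv_apply hg v u)
    have gw := (fderiv_fderiv_apply hg w u)
    have hv := (fderiv_fderiv_apply hh v u)
    have hw := (fderiv_fderiv_apply hh w u)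
    have := e1.mul (((gv.1.hasFDerivAt).mul hw.1.hasFDerivAt).sub
      ((gw.1.hasFDerivAt).mul hv.1.hasFDerivAt))
    rw [show (fun s => f s * (fderiv ℝ g s (![v, w] 0) * fderiv ℝ h s (![v, w] 1) -
      fderiv ℝ g s (![v, w] 1) * fderiv ℝ h s (![v, w] 0))) = _ from rfl]
    refine (congrArg (fun L => L u) this.fderiv).trans ?_
    simp [gv.2, gw.2, hv.2, hw.2]
    ring
  have r0 : (0 : Fin 3).removeNth v = ![v 1, v 2] := by
    ext i; fin_cases i <;> rfl
  have r1 : (1 : Fin 3).removeNth v = ![v 0, v 2] := by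
    ext i; fin_cases i <;> rfl
  have r2 : (2 : Fin 3).removeNth v = ![v 0, v 1] := by
    ext i; fin_cases i <;> rfl
  have sg : ∀ u v, fderiv ℝ (fderiv ℝ g) s u v = fderiv ℝ (fderiv ℝ g) s v u := fun u v =>
    (hg.isSymmSndFDerivAt (by simpa using ENat.LEInfty.out)) u v
  have sh : ∀ u v, fderiv ℝ (fderiv ℝ h) s u v = fderiv ℝ (fderiv ℝ h) s v u := fun u v =>
    (hh.isSymmSndFDerivAt (by simpa using ENat.LEInfty.out)) u v
  rw [r0, r1, r2, key, key, key, wedge₃, sg (v 1) (v 0), sg (v 2) (v 0), sg (v 2) (v 1),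
    sh (v 1) (v 0), sh (v 2) (v 0), sh (v 2) (v 1)]
  simp
  ring

end Wedge

end ModelGeometry

namespace ModelGeometry

open Set Filter

variable {r : ℕ} {B : Type} [TopologicalSpace B] [ChartedSpace (CSpace r) B]

/-! ### Holomorphic functions along smooth maps -/

section Chart

variable {E : Type*} [NormedAddCommGroup E] [NormedSpace ℝ E] {u : E → B} {s : E}

lemma contDiffAt_chart_comp (hu : ContMDiffAt 𝓘(ℝ, E) 𝓘(ℝ, CSpace r) ∞ u s) :
    ContDiffAt ℝ ∞ (chartAt (CSpace r) (u s) ∘ u) s := by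
  have h := contMDiffAt_iff_contDiffAt.1 (contMDiffAt_iff_target.1 hu).2
  simpa only [mfld_simps] using h

omit [NormedSpace ℝ E] in
lemma eventually_mem_chart_source (hu : ContinuousAt u s) :
    ∀ᶠ s' in 𝓝 s, u s' ∈ (chartAt (CSpace r) (u s)).source :=
  hu ((chartAt (CSpace r) (u s)).open_source.mem_nhds (mem_chart_source _ _))

/-- A holomorphic function on `B` is smooth along smooth maps to `B`. -/
lemma contDiffAt_comp_of_mdifferentiableOn [IsManifold 𝓘(ℂ, CSpace r) ∞ B] {f : B → ℂ} {U : Set B}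
    (hU : IsOpen U) (hf : MDifferentiableOn 𝓘(ℂ, CSpace r) 𝓘(ℂ) f U)
    (hu : ContMDiffAt 𝓘(ℝ, E) 𝓘(ℝ, CSpace r) ∞ u s) (hs : u s ∈ U) :
    ContDiffAt ℝ ∞ (fun s => f (u s)) s := by
  set e := chartAt (CSpace r) (u s) with he
  have h1 := contDiffAt_chart_comp hu
  have hopen : IsOpen (e.target ∩ e.symm ⁻¹' U) := e.isOpen_inter_preimage_symm hU
  have : IsManifold 𝓘(ℂ, CSpace r) 1 B := IsManifold.of_le (n := ∞) (by simp)
  have h2 : DifferentiableOn ℂ (f ∘ e.symm) (e.target ∩ e.symm ⁻¹' U) := by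
    rw [← mdifferentiableOn_iff_differentiableOn]
    refine hf.comp ((mdifferentiableOn_atlas_symm (I := 𝓘(ℂ, CSpace r))
      (chart_mem_atlas (CSpace r) (u s))).mono inter_subset_left) fun x hx => hx.2
  have h3 := contDiffOn_of_differentiableOn_complex hopen h2
  have hmem : e (u s) ∈ e.target ∩ e.symm ⁻¹' U :=
    ⟨mem_chart_target _ _, by simpa [he] using hs⟩
  have h4 := ((h3.contDiffAt (hopen.mem_nhds hmem)).restrict_scalars ℝ).comp s h1
  refine h4.congr_of_eventuallyEq ?_
  filter_upwards [eventually_mem_chart_source (r := r) hu.continuousAt] with s' hs'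
  simp [he, hs']

/-- The chain rule for a holomorphic function along a smooth map, in the preferred chart. -/
lemma hasFDerivAt_comp_holo {f : B → ℂ}
    (hf : MDifferentiableAt 𝓘(ℂ, CSpace r) 𝓘(ℂ) f (u s))
    (hu : ContMDiffAt 𝓘(ℝ, E) 𝓘(ℝ, CSpace r) ∞ u s) :
    HasFDerivAt (fun s => f (u s)) ((ContinuousLinearMap.restrictScalars ℝ
      (show CSpace r →L[ℂ] ℂ from holoDiff f (u s))).comp
        (fderiv ℝ (chartAt (CSpace r) (u s) ∘ u) s)) s := by
  set e := chartAt (CSpace r) (u s) with he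
  have h1 := ((contDiffAt_chart_comp hu).differentiableAt (by simp)).hasFDerivAt
  have h2 : HasFDerivWithinAt (f ∘ e.symm) (show CSpace r →L[ℂ] ℂ from holoDiff f (u s)) univ
      (e (u s)) := by
    have h := hf.hasMFDerivAt.2
    simp only [mfld_simps] at h
    exact h
  have h3 := ((hasFDerivWithinAt_univ.1 h2).restrictScalars ℝ).comp s h1
  refine h3.congr_of_eventuallyEq ?_
  filter_upwards [eventually_mem_chart_source (r := r) hu.continuousAt] with s' hs'
  simp [he, hs']

end Chart

end ModelGeometry

namespace ModelGeometry

open Set Filter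

/-! ### Smooth coordinates on the extended space -/

section Branch

variable {E : Type*} [NormedAddCommGroup E] [NormedSpace ℝ E]

/-- A smooth choice of the argument of a nonvanishing function near a point. -/
lemma exists_smooth_arg {f : E → ℂ} {V : Set E} (hV : IsOpen V) (hf : ContDiffOn ℝ ∞ f V) {s₀ : E}
    (hs₀ : s₀ ∈ V) (h0 : f s₀ ≠ 0) :
    ∃ (W : Set E) (β : E → ℝ), IsOpen W ∧ s₀ ∈ W ∧ W ⊆ V ∧ ContDiffOn ℝ ∞ β W ∧ ∀ s ∈ W,
      f s ≠ 0 ∧ f s = (‖f s‖ : ℂ) * Complex.exp (β s * Complex.I) ∧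
      ∀ v, fderiv ℝ β s v = (fderiv ℝ f s v / f s).im := by
  set g : E → ℂ := fun s => f s / f s₀ with hg
  have hgc : ContDiffOn ℝ ∞ g V := hf.div_const _
  set W := V ∩ g ⁻¹' Complex.slitPlane with hW
  have hWo : IsOpen W := hgc.continuousOn.isOpen_inter_preimage hV Complex.isOpen_slitPlane
  have hgW : ∀ s ∈ W, g s ∈ Complex.slitPlane := fun s hs => hs.2
  have hlog : ∀ s ∈ W, ContDiffAt ℝ ∞ (fun s => Complex.log (g s)) s := fun s hs =>
    ((Complex.contDiffAt_log (hgW s hs)).restrict_scalars ℝ).comp s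
      (hgc.contDiffAt (hV.mem_nhds hs.1))
  refine ⟨W, fun s => (Complex.log (g s)).im + (f s₀).arg, hWo, ⟨hs₀, ?_⟩, inter_subset_left,
    fun s hs => ((Complex.imCLM.contDiff.contDiffAt.comp s (hlog s hs)).add
      contDiffAt_const).contDiffWithinAt, fun s hs => ?_⟩
  · rw [mem_preimage, hg]
    simp only [div_self h0]
    exact Complex.one_mem_slitPlane
  · have hgs : g s ≠ 0 := Complex.slitPlane_ne_zero (hgW s hs)
    have hfs : f s = g s * f s₀ := (div_mul_cancel₀ _ h0).symm
    refine ⟨by rw [hfs]; exact mul_ne_zero hgs h0, ?_, fun v => ?_⟩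
    · beta_reduce
      rw [Complex.log_im, hfs, norm_mul]
      push_cast
      rw [add_mul, Complex.exp_add]
      calc g s * f s₀ = (‖g s‖ * Complex.exp ((g s).arg * Complex.I)) *
            (‖f s₀‖ * Complex.exp ((f s₀).arg * Complex.I)) := by
            rw [Complex.norm_mul_exp_arg_mul_I, Complex.norm_mul_exp_arg_mul_I]
        _ = _ := by ring
    · have hd := ((hgc.contDiffAt (hV.mem_nhds hs.1)).differentiableAt (by simp)).hasFDerivAt
      have hdf := ((hf.contDiffAt (hV.mem_nhds hs.1)).differentiableAt (by simp)).hasFDerivAt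
      have h1 := ((Complex.hasDerivAt_log (hgW s hs)).hasFDerivAt.restrictScalars ℝ).comp s hd
      have h2 := (Complex.imCLM.hasFDerivAt.comp s h1).add_const (f s₀).arg
      have h3 : fderiv ℝ g s v = fderiv ℝ f s v / f s₀ := by
        have h4 : HasFDerivAt g ((f s₀)⁻¹ • fderiv ℝ f s) s := by
          refine (hdf.const_smul (f s₀)⁻¹).congr_of_eventuallyEq (Eventually.of_forall fun s => ?_)
          simp [hg, div_eq_inv_mul]
        rw [h4.fderiv]
        simp [div_eq_inv_mul]
      refine (congrArg (fun L => L v) h2.fderiv).trans ?_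
      simp only [ContinuousLinearMap.comp_apply, ContinuousLinearMap.coe_restrictScalars',
        ContinuousLinearMap.toSpanSingleton_apply, Complex.imCLM_apply, smul_eq_mul, h3]
      congr 1
      rw [hg]
      field_simp

end Branch

variable {r : ℕ} {B : Type} [TopologicalSpace B] [ChartedSpace (CSpace r) B]
  {C : CoulombData r B}

/-- Smooth coordinates `(u, ϑ, t, w₁, w₂)` of a map to `M_U` near a point, in which the coordinates
`w₁, w₂` are used for all light charges. -/
structure Coords (N : SingularNbhd C) {n : ℕ} (p : RSpace n → N.Total) where
  V : Set (RSpace n)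
  isOpen : IsOpen V
  u : RSpace n → B
  ϑ : N.L → RSpace n → ℝ
  t : N.pos → RSpace n → ℝ
  w₁ : N.pos → RSpace n → ℂ
  w₂ : N.pos → RSpace n → ℂ
  u_smooth : ContMDiffOn 𝓘(ℝ, RSpace n) 𝓘(ℝ, CSpace r) ∞ u V
  ϑ_smooth : ∀ x, ContDiffOn ℝ ∞ (ϑ x) V
  t_smooth : ∀ γ, ContDiffOn ℝ ∞ (t γ) V
  w₁_smooth : ∀ γ, ContDiffOn ℝ ∞ (w₁ γ) V
  w₂_smooth : ∀ γ, ContDiffOn ℝ ∞ (w₂ γ) V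
  coords : ∀ s ∈ V, ∃ P : N.PrePoint, p s = Quotient.mk N.totalSetoid P ∧
    N.HasCoords P univ (u s) (fun x => ϑ x s) (fun γ => t γ s) (fun γ => w₁ γ s) (fun γ => w₂ γ s)

variable {N : SingularNbhd C}

lemma contDiffOn_Zt [IsManifold 𝓘(ℂ, CSpace r) ∞ B] {E : Type*} [NormedAddCommGroup E]
    [NormedSpace ℝ E] {V : Set E} (hV : IsOpen V) {u : E → B}
    (hu : ContMDiffOn 𝓘(ℝ, E) 𝓘(ℝ, CSpace r) ∞ u V) (hU : ∀ s ∈ V, u s ∈ N.U) (x : N.L) :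
    ContDiffOn ℝ ∞ (fun s => N.Zt x (u s)) V := fun s hs =>
  (contDiffAt_comp_of_mdifferentiableOn N.U_open (N.Zt_holomorphic x)
    (hu.contMDiffAt (hV.mem_nhds hs)) (hU s hs)).contDiffWithinAt

lemma contDiffOn_dist3 {E : Type*} [NormedAddCommGroup E] [NormedSpace ℝ E] {V : Set E}
    {z : E → ℂ} {t : E → ℝ} (hz : ContDiffOn ℝ ∞ z V) (ht : ContDiffOn ℝ ∞ t V)
    (h : ∀ s ∈ V, 4 * ‖z s‖ ^ 2 + t s ^ 2 ≠ 0) :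
    ContDiffOn ℝ ∞ (fun s => dist3 ‖z s‖ (t s)) V :=
  ((contDiffOn_const.mul (hz.norm_sq ℝ)).add (ht.pow 2)).sqrt h

/-- A light charge without coordinates `w₁, w₂` can be given ones, after the angle is shifted by a
multiple of `2π`. -/
lemma exists_shift {E : Type*} [NormedAddCommGroup E] [NormedSpace ℝ E] {V : Set E}
    (hV : IsOpen V) {z : E → ℂ} {t : E → ℝ} (hz : ContDiffOn ℝ ∞ z V) (ht : ContDiffOn ℝ ∞ t V)
    {s₀ : E} (hs₀ : s₀ ∈ V) (h0 : z s₀ = 0 → 0 < t s₀ ∧ t s₀ < 2 * Real.pi) :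
    ∃ (k : ℤ) (a : E → ℝ) (W : Set E), IsOpen W ∧ s₀ ∈ W ∧ W ⊆ V ∧ ContDiffOn ℝ ∞ a W ∧
      ∀ s ∈ W, |t s + 2 * Real.pi * k| < 2 * Real.pi ∧
        0 < dist3 ‖z s‖ (t s + 2 * Real.pi * k) + (t s + 2 * Real.pi * k) ∧
        4 * ‖z s‖ ^ 2 + (t s + 2 * Real.pi * k) ^ 2 ≠ 0 ∧
        (k ≠ 0 → z s ≠ 0 ∧ z s = (‖z s‖ : ℂ) * Complex.exp (a s * Complex.I)) := by
  have hpi := Real.pi_pos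
  by_cases hz0 : z s₀ = 0
  · obtain ⟨h1, h2⟩ := h0 hz0
    refine ⟨0, fun _ => 0, V ∩ t ⁻¹' Ioo 0 (2 * Real.pi),
      ht.continuousOn.isOpen_inter_preimage hV isOpen_Ioo, ⟨hs₀, h1, h2⟩, inter_subset_left,
      contDiffOn_const, fun s hs => ?_⟩
    have h3 : 0 < t s := hs.2.1
    have h4 : t s < 2 * Real.pi := hs.2.2
    simp only [Int.cast_zero, mul_zero, add_zero]
    exact ⟨by rwa [abs_of_pos h3], add_pos_of_nonneg_of_pos (Real.sqrt_nonneg _) h3,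
      by positivity, fun h => absurd rfl h⟩
  · obtain ⟨W, β, hW, hsW, hWV, hβ, hW'⟩ := exists_smooth_arg hV hz hs₀ hz0
    set k : ℤ := -toIcoDiv Real.two_pi_pos 0 (t s₀) with hk
    have h1 : t s₀ + 2 * Real.pi * k ∈ Ico 0 (2 * Real.pi) := by
      have h2 := sub_toIcoDiv_zsmul_mem_Ico Real.two_pi_pos 0 (t s₀)
      rw [zero_add, zsmul_eq_mul] at h2
      have h3 : t s₀ + 2 * Real.pi * k =
          t s₀ - (toIcoDiv Real.two_pi_pos 0 (t s₀) : ℤ) * (2 * Real.pi) := by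
        rw [hk]
        push_cast
        ring
      rw [h3]
      exact h2
    refine ⟨k, β, W ∩ (fun s => t s + 2 * Real.pi * k) ⁻¹' Ioo (-(2 * Real.pi)) (2 * Real.pi),
      ((ht.mono hWV).continuousOn.add continuousOn_const).isOpen_inter_preimage hW isOpen_Ioo,
      ⟨hsW, by linarith [h1.1], h1.2⟩, inter_subset_left.trans hWV, hβ.mono inter_subset_left,
      fun s hs => ?_⟩
    have hzs : 0 < ‖z s‖ := norm_pos_iff.2 (hW' s hs.1).1
    have hlt : |t s + 2 * Real.pi * k| < dist3 ‖z s‖ (t s + 2 * Real.pi * k) := by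
      rw [← Real.sqrt_sq_eq_abs, dist3]
      exact Real.sqrt_lt_sqrt (sq_nonneg _) (by nlinarith)
    have := neg_abs_le (t s + 2 * Real.pi * k)
    exact ⟨abs_lt.2 hs.2, by linarith, by positivity,
      fun _ => ⟨(hW' s hs.1).1, (hW' s hs.1).2.1⟩⟩

/-- The coordinates `w₁ = -2iz/w₂`, `w₂ > 0`, determined by `z` and `t`. -/
lemma polar_coords {z : ℂ} {t α : ℝ} (hz : z = (‖z‖ : ℂ) * Complex.exp (α * Complex.I))
    (hpos : 0 < dist3 ‖z‖ t + t) {b : ℝ} (hb : b = √(dist3 ‖z‖ t + t)) :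
    -2 * Complex.I * z / b =
        (‖-2 * Complex.I * z / b‖ : ℂ) * Complex.exp ((α - Real.pi / 2 : ℝ) * Complex.I) ∧
      (b : ℂ) = (‖(b : ℂ)‖ : ℂ) * Complex.exp ((0 : ℝ) * Complex.I) ∧
      t = (‖(b : ℂ)‖ ^ 2 - ‖-2 * Complex.I * z / b‖ ^ 2) / 2 ∧
      z = Complex.I / 2 * (-2 * Complex.I * z / b) * b := by
  have hb0 : 0 < b := hb ▸ Real.sqrt_pos.2 hpos
  have hbc : (b : ℂ) ≠ 0 := by exact_mod_cast hb0.ne'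
  have hb2 : b ^ 2 = dist3 ‖z‖ t + t := by rw [hb, Real.sq_sqrt hpos.le]
  have hnb : ‖(b : ℂ)‖ = b := by simp [abs_of_pos hb0]
  have hn : ‖-2 * Complex.I * z / b‖ = 2 * ‖z‖ / b := by simp [abs_of_pos hb0]
  refine ⟨?_, by rw [hnb]; simp, ?_, ?_⟩
  · rw [hn]
    push_cast
    rw [sub_mul, Complex.exp_sub,
      show ((Real.pi : ℂ) / 2 * Complex.I) = (Real.pi : ℂ) / 2 * Complex.I from rfl,
      Complex.exp_pi_div_two_mul_I]
    conv_lhs => rw [hz]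
    rw [Complex.div_I]
    ring
  · rw [hnb, hn, div_pow, mul_pow, hb2]
    have h := dist3_sq ‖z‖ t
    field_simp
    nlinarith
  · field_simp
    rw [Complex.I_sq]
    ring

/-- Every smooth map has, near each point, coordinates in which `w₁, w₂` are used for all light
charges. For a charge outside the given set `K`, the angle `t` is moved by `2πk` so that `R + t >
0`, where `R = √(4|Z|² + t²)`; then `w₂ = √(R + t)` and `w₁ = -2iZ / w₂` are smooth. The shift is
absorbed into `ϑ`, with a smooth branch of `arg Z`; it is needed only where `Z` does not vanish. -/
lemma exists_coords [IsManifold 𝓘(ℂ, CSpace r) ∞ B] {n : ℕ} {p : RSpace n → N.Total}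
    (hp : N.SmoothOn univ p) (s₀ : RSpace n) : ∃ D : Coords N p, s₀ ∈ D.V := by
  classical
  obtain ⟨V, hV, hs₀, -, K, u, ϑ, t, w₁, w₂, hu, hϑ, ht, hw₁, hw₂, hc⟩ := hp s₀ (mem_univ _)
  have hU : ∀ s ∈ V, u s ∈ N.U := fun s hs => by
    obtain ⟨P, -, h, -⟩ := hc s hs
    exact h ▸ P.mem
  have hZ := contDiffOn_Zt (N := N) hV hu hU
  have key : ∀ γ : N.pos, ∃ (k : ℤ) (a : RSpace n → ℝ) (W : Set (RSpace n)), IsOpen W ∧ s₀ ∈ W ∧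
      W ⊆ V ∧ ContDiffOn ℝ ∞ a W ∧ (γ ∈ K → k = 0) ∧ (γ ∉ K → ∀ s ∈ W,
        |t γ s + 2 * Real.pi * k| < 2 * Real.pi ∧
        0 < dist3 ‖N.Zt γ (u s)‖ (t γ s + 2 * Real.pi * k) + (t γ s + 2 * Real.pi * k) ∧
        4 * ‖N.Zt γ (u s)‖ ^ 2 + (t γ s + 2 * Real.pi * k) ^ 2 ≠ 0 ∧
        (k ≠ 0 → N.Zt γ (u s) ≠ 0 ∧
          N.Zt γ (u s) = (‖N.Zt γ (u s)‖ : ℂ) * Complex.exp (a s * Complex.I))) := by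
    intro γ
    by_cases hγ : γ ∈ K
    · exact ⟨0, fun _ => 0, V, hV, hs₀, subset_rfl, contDiffOn_const, fun _ => rfl,
        fun h => absurd hγ h⟩
    · obtain ⟨k, a, W, h1, h2, h3, h4, h5⟩ := exists_shift hV (hZ γ) (ht γ) hs₀ fun h0 => by
        obtain ⟨P, -, -, β₁, β₂, -, -, h, -⟩ := hc s₀ hs₀
        exact h γ hγ h0
      exact ⟨k, a, W, h1, h2, h3, h4, fun h => absurd h hγ, fun _ => h5⟩
  choose k a W hWo hsW hWV ha hk hW using key
  set V' := V ∩ ⋂ γ, W γ with hV'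
  have hV'W : ∀ γ, V' ⊆ W γ := fun γ => inter_subset_right.trans (iInter_subset _ γ)
  have hV'V : V' ⊆ V := inter_subset_left
  set t' : N.pos → RSpace n → ℝ := fun γ s => t γ s + 2 * Real.pi * k γ with ht'
  set b : N.pos → RSpace n → ℝ := fun γ s => √(dist3 ‖N.Zt γ (u s)‖ (t' γ s) + t' γ s) with hb
  have ht's : ∀ γ, ContDiffOn ℝ ∞ (t' γ) V := fun γ => (ht γ).add contDiffOn_const
  have hbs : ∀ γ ∉ K, ContDiffOn ℝ ∞ (fun s => (b γ s : ℂ)) V' := fun γ hγ => by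
    refine Complex.ofRealCLM.contDiff.comp_contDiffOn ?_
    refine ContDiffOn.sqrt ((contDiffOn_dist3 ((hZ γ).mono hV'V) ((ht's γ).mono hV'V)
      fun s hs => ?_).add ((ht's γ).mono hV'V)) fun s hs => ?_
    · exact (hW γ hγ s (hV'W γ hs)).2.2.1
    · exact (hW γ hγ s (hV'W γ hs)).2.1.ne'
  have hb0 : ∀ γ ∉ K, ∀ s ∈ V', (b γ s : ℂ) ≠ 0 := fun γ hγ s hs => by
    exact_mod_cast (Real.sqrt_pos.2 (hW γ hγ s (hV'W γ hs)).2.1).ne'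
  refine ⟨{
    V := V'
    isOpen := hV.inter (isOpen_iInter_of_finite hWo)
    u := u
    ϑ := fun x s => ϑ x s - ∑ γ : N.pos, (N.pairL x γ : ℝ) * (k γ * a γ s)
    t := t'
    w₁ := fun γ s => if γ ∈ K then w₁ γ s else -2 * Complex.I * N.Zt γ (u s) / b γ s
    w₂ := fun γ s => if γ ∈ K then w₂ γ s else b γ s
    u_smooth := hu.mono hV'V
    ϑ_smooth := fun x => ((hϑ x).mono hV'V).sub (ContDiffOn.sum fun γ _ =>
      contDiffOn_const.mul (contDiffOn_const.mul ((ha γ).mono (hV'W γ))))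
    t_smooth := fun γ => (ht's γ).mono hV'V
    w₁_smooth := fun γ => by
      by_cases hγ : γ ∈ K
      · simpa only [hγ, if_true] using (hw₁ γ).mono hV'V
      · simp only [hγ, if_false]
        exact (contDiffOn_const.mul ((hZ γ).mono hV'V)).mul ((hbs γ hγ).inv (hb0 γ hγ))
    w₂_smooth := fun γ => by
      by_cases hγ : γ ∈ K
      · simpa only [hγ, if_true] using (hw₂ γ).mono hV'V
      · simpa only [hγ, if_false] using hbs γ hγ
    coords := fun s hs => ?_ }, hs₀, mem_iInter.2 hsW⟩
  obtain ⟨P, hpP, hPu, β₁, β₂, h1, h2, -, h4⟩ := hc s (hV'V hs)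
  have hα : ∀ γ : N.pos, N.Zt γ (u s) =
      (‖N.Zt γ (u s)‖ : ℂ) * Complex.exp (P.α γ * Complex.I) := fun γ => hPu ▸ P.branch γ
  refine ⟨P, hpP, hPu, fun γ => if γ ∈ K then β₁ γ else P.α γ - Real.pi / 2,
    fun γ => if γ ∈ K then β₂ γ else 0, fun γ => ?_, fun γ _ => ?_, fun γ h => absurd (mem_univ _) h,
    fun x => ?_⟩
  · have h5 : t' γ s = t γ s + (k γ : ℝ) * (2 * Real.pi) := by simp only [ht']; ring
    beta_reduce
    rw [h1 γ, h5, Real.Angle.angle_eq_iff_two_pi_dvd_sub]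
    exact ⟨-k γ, by push_cast; ring⟩
  · by_cases hγ : γ ∈ K
    · simpa only [hγ, if_true, ht', hk γ hγ, Int.cast_zero, mul_zero, add_zero] using h2 γ hγ
    · simp only [hγ, if_false]
      obtain ⟨h6, h7, h8, -⟩ := hW γ hγ s (hV'W γ hs)
      obtain ⟨h9, h10, h11, h12⟩ := polar_coords (hα γ) h7 rfl
      exact ⟨h9, h10, by ring, h11, h6, h12⟩
  -- the chosen argument of `Z` and the smooth branch `a` differ by a multiple of `2π`
  · have h5 : ∀ γ : N.pos, ∃ m : ℤ, k γ * (P.α γ - a γ s) = 2 * Real.pi * m := by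
      intro γ
      by_cases hkγ : k γ = 0
      · exact ⟨0, by simp [hkγ]⟩
      · obtain ⟨hz, h6⟩ := (hW γ (fun h => hkγ (hk γ h)) s (hV'W γ hs)).2.2.2 hkγ
        have h7 := (hα γ).symm.trans h6
        have h8 : (‖N.Zt γ (u s)‖ : ℂ) ≠ 0 := by exact_mod_cast norm_ne_zero_iff.2 hz
        obtain ⟨m, hm⟩ := Complex.exp_eq_exp_iff_exists_int.1 (mul_left_cancel₀ h8 h7)
        refine ⟨k γ * m, ?_⟩
        have h9 : (P.α γ : ℂ) = a γ s + m * (2 * Real.pi) := by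
          refine mul_right_cancel₀ Complex.I_ne_zero ?_
          rw [hm]
          ring
        have h10 : P.α γ = a γ s + m * (2 * Real.pi) := by exact_mod_cast h9
        rw [h10]
        push_cast
        ring
    choose m hm using h5
    rw [h4 x, Real.Angle.angle_eq_iff_two_pi_dvd_sub]
    refine ⟨-∑ γ : N.pos, N.pairL x γ * m γ, ?_⟩
    push_cast
    rw [mul_neg, Finset.mul_sum, ← sub_eq_zero]
    rw [show ∀ A S1 S2 S3 S4 : ℝ, A + S1 - (A - S2 + S3) - -S4 = S1 + S2 - S3 + S4 from
      fun _ _ _ _ _ => by ring, ← Finset.sum_add_distrib, ← Finset.sum_sub_distrib,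
      ← Finset.sum_add_distrib]
    refine Finset.sum_eq_zero fun γ _ => ?_
    have h6 : K.indicator β₂ γ = if γ ∈ K then β₂ γ else 0 := by
      simp [indicator_apply]
    have h7 : P.α γ / (2 * Real.pi) * (2 * Real.pi * k γ) = P.α γ * k γ := by
      field_simp
    simp only [h6, mem_univ, indicator_of_mem, ht']
    have h8 := hm γ
    linear_combination (-(N.pairL x γ : ℝ)) * (h7 + h8)

end ModelGeometry

namespace ModelGeometry

open Set Filter

open scoped ComplexConjugate

/-! ### The forms of one light charge in the coordinates `w₁, w₂` -/

section LocalModel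

variable {E : Type*} [NormedAddCommGroup E] [NormedSpace ℝ E]

lemma contDiffAt_conj {f : E → ℂ} {s : E} (hf : ContDiffAt ℝ ∞ f s) :
    ContDiffAt ℝ ∞ (fun s => conj (f s)) s :=
  Complex.conjCLE.contDiff.contDiffAt.comp s hf

lemma contDiffAt_ofReal {f : E → ℝ} {s : E} (hf : ContDiffAt ℝ ∞ f s) :
    ContDiffAt ℝ ∞ (fun s => (f s : ℂ)) s :=
  Complex.ofRealCLM.contDiff.contDiffAt.comp s hf

lemma fderiv_conj {f : E → ℂ} {s : E} (hf : DifferentiableAt ℝ f s) (v : E) :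
    fderiv ℝ (fun s => conj (f s)) s v = conj (fderiv ℝ f s v) := by
  have h : HasFDerivAt (fun s => conj (f s))
      ((Complex.conjCLE : ℂ →L[ℝ] ℂ).comp (fderiv ℝ f s)) s :=
    (Complex.conjCLE : ℂ →L[ℝ] ℂ).hasFDerivAt.comp s hf.hasFDerivAt
  rw [h.fderiv]
  rfl

lemma fderiv_ofReal {f : E → ℝ} {s : E} (hf : DifferentiableAt ℝ f s) (v : E) :
    fderiv ℝ (fun s => (f s : ℂ)) s v = (fderiv ℝ f s v : ℂ) := by
  have h : HasFDerivAt (fun s => (f s : ℂ)) (Complex.ofRealCLM.comp (fderiv ℝ f s)) s :=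
    Complex.ofRealCLM.hasFDerivAt.comp s hf.hasFDerivAt
  rw [h.fderiv]
  rfl

/-- The derivatives of the regular parts of the instanton corrections, along smooth functions. -/
lemma uReg_wReg_comp {z : E → ℂ} {t : E → ℝ} {s : E} (hz : ContDiffAt ℝ ∞ z s)
    (ht : ContDiffAt ℝ ∞ t s) (hlt : |t s| < 2 * Real.pi) :
    ContDiffAt ℝ ∞ (fun s => uReg (‖z s‖ ^ 2, t s)) s ∧
    ContDiffAt ℝ ∞ (fun s => wReg (‖z s‖ ^ 2, t s)) s ∧
    ∃ ua ut ga : ℝ, (∀ v, (fderiv ℝ (fun s => uReg (‖z s‖ ^ 2, t s)) s v : ℂ) =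
        ua * (fderiv ℝ z s v * conj (z s) + z s * conj (fderiv ℝ z s v)) + ut * fderiv ℝ t s v) ∧
      (∀ v, (fderiv ℝ (fun s => wReg (‖z s‖ ^ 2, t s)) s v : ℂ) =
        ga * (fderiv ℝ z s v * conj (z s) + z s * conj (fderiv ℝ z s v)) +
          (-2 * ua) * fderiv ℝ t s v) ∧
      2 * (z s * conj (z s)) * ga + 2 * wReg (‖z s‖ ^ 2, t s) = (4 * ut : ℂ) := by
  obtain ⟨hu, hw, ua, ut, ga, h1, h2, h3⟩ := uReg_wReg (a := ‖z s‖ ^ 2) (by positivity) hlt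
  have hp : ContDiffAt ℝ ∞ (fun s => (‖z s‖ ^ 2, t s)) s := (hz.norm_sq ℝ).prodMk ht
  have hzd := (hz.differentiableAt (by simp)).hasFDerivAt
  have hpd := hzd.norm_sq.prodMk (ht.differentiableAt (by simp)).hasFDerivAt
  have hn : ∀ v, ((2 * inner ℝ (z s) (fderiv ℝ z s v) : ℝ) : ℂ) =
      fderiv ℝ z s v * conj (z s) + z s * conj (fderiv ℝ z s v) := fun v => by
    have h := Complex.add_conj (fderiv ℝ z s v * conj (z s))
    rw [map_mul, Complex.conj_conj] at h
    rw [Complex.inner]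
    push_cast at h ⊢
    linear_combination -h
  refine ⟨ContDiffAt.comp (g := uReg) s hu hp, ContDiffAt.comp (g := wReg) s hw hp, ua, ut, ga, fun v => ?_, fun v => ?_, ?_⟩
  · have h : HasFDerivAt (fun s => uReg (‖z s‖ ^ 2, t s)) _ s := HasFDerivAt.comp (g := uReg) s h1 hpd
    rw [h.fderiv, ← hn]
    simp
    left
    ring
  · have h : HasFDerivAt (fun s => wReg (‖z s‖ ^ 2, t s)) _ s := HasFDerivAt.comp (g := wReg) s h2 hpd
    rw [h.fderiv, ← hn]
    simp
    left
    ring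
  · rw [Complex.mul_conj, Complex.normSq_eq_norm_sq]
    exact_mod_cast h3

variable (w₁ w₂ : E → ℂ)

/-- The central charge `(i/2) w₁ w₂`. -/
def zOf (s : E) : ℂ := Complex.I / 2 * w₁ s * w₂ s

/-- The angle `(|w₂|² - |w₁|²)/2`. -/
def tOf (s : E) : ℝ := (‖w₂ s‖ ^ 2 - ‖w₁ s‖ ^ 2) / 2

/-- `uReg` along `w₁, w₂`. -/
def uOf (s : E) : ℝ := uReg (‖zOf w₁ w₂ s‖ ^ 2, tOf w₁ w₂ s)

/-- `wReg` along `w₁, w₂`. -/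
def gOf (s : E) : ℝ := wReg (‖zOf w₁ w₂ s‖ ^ 2, tOf w₁ w₂ s)

/-- The contribution of a light charge to `ω₊`, up to a factor:
`½ dw₁ ∧ dw₂ + (i/2) g Z dZ ∧ dZ̄ - i u dZ ∧ dt`. -/
def lightPlus : E → E [⋀^Fin 2]→L[ℝ] ℂ :=
  formOf (fun _ => 1 / 2) w₁ w₂ +
  formOf (fun s => Complex.I / 2 * (gOf w₁ w₂ s * zOf w₁ w₂ s)) (zOf w₁ w₂)
    (fun s => conj (zOf w₁ w₂ s)) +
  formOf (fun s => -Complex.I * uOf w₁ w₂ s) (zOf w₁ w₂) (fun s => (tOf w₁ w₂ s : ℂ))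

/-- The contribution of a light charge to `ω₃`, up to a factor:
`(i/2)(dw₁ ∧ dw̄₁ + dw₂ ∧ dw̄₂) - (i/2) g (Z̄ dt ∧ dZ - Z dt ∧ dZ̄) + 2i u dZ ∧ dZ̄`. -/
def lightZero : E → E [⋀^Fin 2]→L[ℝ] ℂ :=
  formOf (fun _ => Complex.I / 2) w₁ (fun s => conj (w₁ s)) +
  formOf (fun _ => Complex.I / 2) w₂ (fun s => conj (w₂ s)) +
  formOf (fun s => -(Complex.I / 2) * (gOf w₁ w₂ s * conj (zOf w₁ w₂ s)))
    (fun s => (tOf w₁ w₂ s : ℂ)) (zOf w₁ w₂) +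
  formOf (fun s => Complex.I / 2 * (gOf w₁ w₂ s * zOf w₁ w₂ s))
    (fun s => (tOf w₁ w₂ s : ℂ)) (fun s => conj (zOf w₁ w₂ s)) +
  formOf (fun s => 2 * Complex.I * uOf w₁ w₂ s) (zOf w₁ w₂) (fun s => conj (zOf w₁ w₂ s))

variable {w₁ w₂} {s : E}

lemma contDiffAt_zOf (h₁ : ContDiffAt ℝ ∞ w₁ s) (h₂ : ContDiffAt ℝ ∞ w₂ s) :
    ContDiffAt ℝ ∞ (zOf w₁ w₂) s := (contDiffAt_const.mul h₁).mul h₂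

lemma contDiffAt_tOf (h₁ : ContDiffAt ℝ ∞ w₁ s) (h₂ : ContDiffAt ℝ ∞ w₂ s) :
    ContDiffAt ℝ ∞ (tOf w₁ w₂) s := ((h₂.norm_sq ℝ).sub (h₁.norm_sq ℝ)).div_const 2

lemma contDiffAt_light (h₁ : ContDiffAt ℝ ∞ w₁ s) (h₂ : ContDiffAt ℝ ∞ w₂ s)
    (ht : |tOf w₁ w₂ s| < 2 * Real.pi) :
    ContDiffAt ℝ ∞ (lightPlus w₁ w₂) s ∧ ContDiffAt ℝ ∞ (lightZero w₁ w₂) s := by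
  have hz := contDiffAt_zOf h₁ h₂
  have hz' := contDiffAt_conj hz
  have ht' := contDiffAt_tOf h₁ h₂
  obtain ⟨hu, hg, -⟩ := uReg_wReg_comp hz ht' ht
  have hu' := contDiffAt_ofReal hu
  have hg' := contDiffAt_ofReal hg
  have ht'' := contDiffAt_ofReal ht'
  exact ⟨((contDiffAt_formOf contDiffAt_const h₁ h₂).add
    (contDiffAt_formOf (contDiffAt_const.mul (hg'.mul hz)) hz hz')).add
    (contDiffAt_formOf (contDiffAt_const.mul hu') hz ht''),
    ((((contDiffAt_formOf contDiffAt_const h₁ (contDiffAt_conj h₁)).add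
    (contDiffAt_formOf contDiffAt_const h₂ (contDiffAt_conj h₂))).add
    (contDiffAt_formOf (contDiffAt_const.mul (hg'.mul hz')) ht'' hz)).add
    (contDiffAt_formOf (contDiffAt_const.mul (hg'.mul hz)) ht'' hz')).add
    (contDiffAt_formOf (contDiffAt_const.mul hu') hz hz')⟩

/-- The forms are closed by the monopole equations for the regular parts: `∂g/∂t = -2 ∂u/∂a` and `a
∂g/∂a + g = 2 ∂u/∂t`, where `a = |Z|²`. -/
lemma extDeriv_light (h₁ : ContDiffAt ℝ ∞ w₁ s) (h₂ : ContDiffAt ℝ ∞ w₂ s)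
    (ht : |tOf w₁ w₂ s| < 2 * Real.pi) :
    extDeriv (lightPlus w₁ w₂) s = 0 ∧ extDeriv (lightZero w₁ w₂) s = 0 := by
  have hz := contDiffAt_zOf h₁ h₂
  have hz' := contDiffAt_conj hz
  have ht' := contDiffAt_tOf h₁ h₂
  obtain ⟨hu, hg, ua, ut, ga, hdu, hdg, hpde⟩ := uReg_wReg_comp hz ht' ht
  have hu' : ContDiffAt ℝ ∞ (fun s => (uOf w₁ w₂ s : ℂ)) s := contDiffAt_ofReal hu
  have hg' : ContDiffAt ℝ ∞ (fun s => (gOf w₁ w₂ s : ℂ)) s := contDiffAt_ofReal hg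
  have ht'' := contDiffAt_ofReal ht'
  have D : ∀ {f g h : E → ℂ}, ContDiffAt ℝ ∞ f s → ContDiffAt ℝ ∞ g s → ContDiffAt ℝ ∞ h s →
      DifferentiableAt ℝ (formOf f g h) s := fun hf hg hh =>
    (contDiffAt_formOf hf hg hh).differentiableAt (by simp)
  have df : ∀ {f : E → ℂ}, ContDiffAt ℝ ∞ f s → HasFDerivAt f (fderiv ℝ f s) s := fun hf =>
    (hf.differentiableAt (by simp)).hasFDerivAt
  have dconj : ∀ v, fderiv ℝ (fun s => conj (zOf w₁ w₂ s)) s v = conj (fderiv ℝ (zOf w₁ w₂) s v) :=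
    fderiv_conj (hz.differentiableAt (by simp))
  have dt : ∀ v, fderiv ℝ (fun s => (tOf w₁ w₂ s : ℂ)) s v = (fderiv ℝ (tOf w₁ w₂) s v : ℂ) :=
    fderiv_ofReal (ht'.differentiableAt (by simp))
  have du : ∀ v, fderiv ℝ (fun s => (uOf w₁ w₂ s : ℂ)) s v = _ := fun v =>
    (fderiv_ofReal (hu.differentiableAt (by simp)) v).trans (hdu v)
  have dg : ∀ v, fderiv ℝ (fun s => (gOf w₁ w₂ s : ℂ)) s v = _ := fun v =>
    (fderiv_ofReal (hg.differentiableAt (by simp)) v).trans (hdg v)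
  have e1 : ∀ c : ℂ, ∀ v, fderiv ℝ (fun s => c * (gOf w₁ w₂ s * zOf w₁ w₂ s)) s v =
      c * (gOf w₁ w₂ s * fderiv ℝ (zOf w₁ w₂) s v +
        fderiv ℝ (fun s => (gOf w₁ w₂ s : ℂ)) s v * zOf w₁ w₂ s) := fun c v => by
    refine (congrArg (fun L => L v) (((df hg').mul (df hz)).const_mul c).fderiv).trans ?_
    simp
    ring
  have e2 : ∀ c : ℂ, ∀ v, fderiv ℝ (fun s => c * (gOf w₁ w₂ s * conj (zOf w₁ w₂ s))) s v =
      c * (gOf w₁ w₂ s * conj (fderiv ℝ (zOf w₁ w₂) s v) +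
        fderiv ℝ (fun s => (gOf w₁ w₂ s : ℂ)) s v * conj (zOf w₁ w₂ s)) := fun c v => by
    refine (congrArg (fun L => L v) (((df hg').mul (df hz')).const_mul c).fderiv).trans ?_
    simp [dconj]
    ring
  have e3 : ∀ c : ℂ, ∀ v, fderiv ℝ (fun s => c * (uOf w₁ w₂ s : ℂ)) s v =
      c * fderiv ℝ (fun s => (uOf w₁ w₂ s : ℂ)) s v := fun c v => by
    rw [((df hu').const_mul c).fderiv]
    simp
  have e0 : ∀ c : ℂ, fderiv ℝ (fun _ : E => c) s = 0 := fun c => fderiv_const_apply c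
  have hpde' : 2 * (zOf w₁ w₂ s * conj (zOf w₁ w₂ s)) * ga + 2 * gOf w₁ w₂ s = (4 * ut : ℂ) := hpde
  constructor
  · ext v
    rw [show (0 : E [⋀^Fin 3]→L[ℝ] ℂ) v = 0 from rfl]
    have i1 := D (contDiffAt_const (c := (1 / 2 : ℂ))) h₁ h₂
    have i2 := D (contDiffAt_const.mul (hg'.mul hz)) hz hz' (f := fun s =>
      Complex.I / 2 * (gOf w₁ w₂ s * zOf w₁ w₂ s))
    have i3 := D (contDiffAt_const.mul hu') hz ht'' (f := fun s => -Complex.I * uOf w₁ w₂ s)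
    rw [lightPlus, extDeriv_add (i1.add i2) i3, extDeriv_add i1 i2]
    simp only [ContinuousAlternatingMap.add_apply]
    rw [extDeriv_formOf contDiffAt_const h₁ h₂,
      extDeriv_formOf (contDiffAt_const.mul (hg'.mul hz)) hz hz',
      extDeriv_formOf (contDiffAt_const.mul hu') hz ht'']
    simp only [wedge₃, e0, e1, e3, dconj, dt, du, dg, zero_apply]
    ring
  · ext v
    rw [show (0 : E [⋀^Fin 3]→L[ℝ] ℂ) v = 0 from rfl]
    have i1 := D (contDiffAt_const (c := (Complex.I / 2 : ℂ))) h₁ (contDiffAt_conj h₁)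
    have i2 := D (contDiffAt_const (c := (Complex.I / 2 : ℂ))) h₂ (contDiffAt_conj h₂)
    have i3 := D (contDiffAt_const.mul (hg'.mul hz')) ht'' hz (f := fun s =>
      -(Complex.I / 2) * (gOf w₁ w₂ s * conj (zOf w₁ w₂ s)))
    have i4 := D (contDiffAt_const.mul (hg'.mul hz)) ht'' hz' (f := fun s =>
      Complex.I / 2 * (gOf w₁ w₂ s * zOf w₁ w₂ s))
    have i5 := D (contDiffAt_const.mul hu') hz hz' (f := fun s => 2 * Complex.I * uOf w₁ w₂ s)
    rw [lightZero, extDeriv_add (((i1.add i2).add i3).add i4) i5,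
      extDeriv_add ((i1.add i2).add i3) i4, extDeriv_add (i1.add i2) i3, extDeriv_add i1 i2]
    simp only [ContinuousAlternatingMap.add_apply]
    rw [extDeriv_formOf contDiffAt_const h₁ (contDiffAt_conj h₁),
      extDeriv_formOf contDiffAt_const h₂ (contDiffAt_conj h₂),
      extDeriv_formOf (contDiffAt_const.mul (hg'.mul hz')) ht'' hz,
      extDeriv_formOf (contDiffAt_const.mul (hg'.mul hz)) ht'' hz',
      extDeriv_formOf (contDiffAt_const.mul hu') hz hz']
    simp only [wedge₃, e0, e1, e2, e3, dconj, dt, du, dg, zero_apply]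
    have hut : (ut : ℂ) = zOf w₁ w₂ s * conj (zOf w₁ w₂ s) * ga / 2 + gOf w₁ w₂ s / 2 := by
      linear_combination -hpde' / 4
    rw [hut]
    ring

end LocalModel

end ModelGeometry

namespace ModelGeometry

open Set Filter

open scoped ComplexConjugate

section LocalModel

set_option linter.unusedSectionVars false

variable {E : Type*} [NormedAddCommGroup E] [NormedSpace ℝ E] {w₁ w₂ : E → ℂ} {s : E}

lemma dist3_zOf : dist3 ‖zOf w₁ w₂ s‖ (tOf w₁ w₂ s) = (‖w₁ s‖ ^ 2 + ‖w₂ s‖ ^ 2) / 2 := by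
  rw [dist3, zOf, tOf, Real.sqrt_eq_iff_mul_self_eq (by positivity) (by positivity)]
  simp
  ring

lemma ofReal_tOf : (tOf w₁ w₂ s : ℂ) = (w₂ s * conj (w₂ s) - w₁ s * conj (w₁ s)) / 2 := by
  rw [Complex.mul_conj, Complex.mul_conj, Complex.normSq_eq_norm_sq, Complex.normSq_eq_norm_sq, tOf]
  push_cast
  ring

lemma fderiv_zOf (h₁ : DifferentiableAt ℝ w₁ s) (h₂ : DifferentiableAt ℝ w₂ s) (v : E) :
    fderiv ℝ (zOf w₁ w₂) s v =
      Complex.I / 2 * (fderiv ℝ w₁ s v * w₂ s + w₁ s * fderiv ℝ w₂ s v) := by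
  have h := ((h₁.hasFDerivAt.const_mul (Complex.I / 2)).mul h₂.hasFDerivAt)
  refine (congrArg (fun L => L v) h.fderiv).trans ?_
  simp
  ring

lemma fderiv_tOf (h₁ : ContDiffAt ℝ ∞ w₁ s) (h₂ : ContDiffAt ℝ ∞ w₂ s) (v : E) :
    (fderiv ℝ (tOf w₁ w₂) s v : ℂ) =
      (fderiv ℝ w₂ s v * conj (w₂ s) + w₂ s * conj (fderiv ℝ w₂ s v) -
        (fderiv ℝ w₁ s v * conj (w₁ s) + w₁ s * conj (fderiv ℝ w₁ s v))) / 2 := by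
  rw [← fderiv_ofReal ((contDiffAt_tOf h₁ h₂).differentiableAt (by simp))]
  have d1 := (h₁.differentiableAt (by simp))
  have d2 := (h₂.differentiableAt (by simp))
  have c1 := ((contDiffAt_conj h₁).differentiableAt (by simp)).hasFDerivAt
  have c2 := ((contDiffAt_conj h₂).differentiableAt (by simp)).hasFDerivAt
  have h := (((d2.hasFDerivAt.mul c2).sub (d1.hasFDerivAt.mul c1)).mul_const (1 / 2 : ℂ))
  have h' : HasFDerivAt (fun s => (tOf w₁ w₂ s : ℂ)) _ s :=
    h.congr_of_eventuallyEq (Eventually.of_forall fun s => by simp [ofReal_tOf]; ring)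
  rw [h'.fderiv]
  simp [fderiv_conj d1, fderiv_conj d2]
  ring

lemma lightPlus_apply (h₁ : ContDiffAt ℝ ∞ w₁ s) (h₂ : ContDiffAt ℝ ∞ w₂ s) (v w : E) :
    lightPlus w₁ w₂ s ![v, w] =
      1 / 2 * (fderiv ℝ w₁ s v * fderiv ℝ w₂ s w - fderiv ℝ w₁ s w * fderiv ℝ w₂ s v) +
      Complex.I / 2 * (gOf w₁ w₂ s * zOf w₁ w₂ s) *
        (fderiv ℝ (zOf w₁ w₂) s v * conj (fderiv ℝ (zOf w₁ w₂) s w) -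
          fderiv ℝ (zOf w₁ w₂) s w * conj (fderiv ℝ (zOf w₁ w₂) s v)) -
      Complex.I * uOf w₁ w₂ s * (fderiv ℝ (zOf w₁ w₂) s v * fderiv ℝ (tOf w₁ w₂) s w -
          fderiv ℝ (zOf w₁ w₂) s w * fderiv ℝ (tOf w₁ w₂) s v) := by
  have hz := (contDiffAt_zOf h₁ h₂).differentiableAt (by simp)
  have ht := (contDiffAt_tOf h₁ h₂).differentiableAt (by simp)
  simp only [lightPlus, Pi.add_apply, ContinuousAlternatingMap.add_apply, formOf_apply,
    fderiv_conj hz, fderiv_ofReal ht, Matrix.cons_val_zero, Matrix.cons_val_one]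
  ring

lemma lightZero_apply (h₁ : ContDiffAt ℝ ∞ w₁ s) (h₂ : ContDiffAt ℝ ∞ w₂ s) (v w : E) :
    lightZero w₁ w₂ s ![v, w] =
      Complex.I / 2 * (fderiv ℝ w₁ s v * conj (fderiv ℝ w₁ s w) -
        fderiv ℝ w₁ s w * conj (fderiv ℝ w₁ s v)) +
      Complex.I / 2 * (fderiv ℝ w₂ s v * conj (fderiv ℝ w₂ s w) -
        fderiv ℝ w₂ s w * conj (fderiv ℝ w₂ s v)) -
      Complex.I / 2 * gOf w₁ w₂ s * conj (zOf w₁ w₂ s) *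
        (fderiv ℝ (tOf w₁ w₂) s v * fderiv ℝ (zOf w₁ w₂) s w -
          fderiv ℝ (tOf w₁ w₂) s w * fderiv ℝ (zOf w₁ w₂) s v) +
      Complex.I / 2 * gOf w₁ w₂ s * zOf w₁ w₂ s *
        (fderiv ℝ (tOf w₁ w₂) s v * conj (fderiv ℝ (zOf w₁ w₂) s w) -
          fderiv ℝ (tOf w₁ w₂) s w * conj (fderiv ℝ (zOf w₁ w₂) s v)) +
      2 * Complex.I * uOf w₁ w₂ s * (fderiv ℝ (zOf w₁ w₂) s v * conj (fderiv ℝ (zOf w₁ w₂) s w) -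
          fderiv ℝ (zOf w₁ w₂) s w * conj (fderiv ℝ (zOf w₁ w₂) s v)) := by
  have hz := (contDiffAt_zOf h₁ h₂).differentiableAt (by simp)
  have ht := (contDiffAt_tOf h₁ h₂).differentiableAt (by simp)
  have d1 := (h₁.differentiableAt (by simp))
  have d2 := (h₂.differentiableAt (by simp))
  simp only [lightZero, Pi.add_apply, ContinuousAlternatingMap.add_apply, formOf_apply,
    fderiv_conj hz, fderiv_conj d1, fderiv_conj d2, fderiv_ofReal ht, Matrix.cons_val_zero,
    Matrix.cons_val_one]
  ring

lemma conj_lightZero (h₁ : ContDiffAt ℝ ∞ w₁ s) (h₂ : ContDiffAt ℝ ∞ w₂ s) (v w : E) :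
    conj (lightZero w₁ w₂ s ![v, w]) = lightZero w₁ w₂ s ![v, w] := by
  rw [lightZero_apply h₁ h₂]
  simp only [map_add, map_sub, map_mul, map_div₀, Complex.conj_I, Complex.conj_conj,
    Complex.conj_ofReal, map_ofNat]
  ring

/-- The forms of a light charge commute with pullback along reparametrisations. -/
lemma light_comp {F : Type*} [NormedAddCommGroup F] [NormedSpace ℝ F] {φ : F → E} {x : F}
    (hφ : DifferentiableAt ℝ φ x) (h₁ : ContDiffAt ℝ ∞ w₁ (φ x)) (h₂ : ContDiffAt ℝ ∞ w₂ (φ x)) :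
    lightPlus (w₁ ∘ φ) (w₂ ∘ φ) x =
        (lightPlus w₁ w₂ (φ x)).compContinuousLinearMap (fderiv ℝ φ x) ∧
      lightZero (w₁ ∘ φ) (w₂ ∘ φ) x =
        (lightZero w₁ w₂ (φ x)).compContinuousLinearMap (fderiv ℝ φ x) := by
  have hz := (contDiffAt_zOf h₁ h₂).differentiableAt (by simp)
  have hz' := (contDiffAt_conj (contDiffAt_zOf h₁ h₂)).differentiableAt (by simp)
  have ht := (contDiffAt_ofReal (contDiffAt_tOf h₁ h₂)).differentiableAt (by simp)
  have d1 := (h₁.differentiableAt (by simp))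
  have d2 := (h₂.differentiableAt (by simp))
  have c1 := ((contDiffAt_conj h₁).differentiableAt (by simp))
  have c2 := ((contDiffAt_conj h₂).differentiableAt (by simp))
  constructor
  · ext v
    simp only [lightPlus, Pi.add_apply, ContinuousAlternatingMap.add_apply,
      ContinuousAlternatingMap.compContinuousLinearMap_apply]
    have e1 := congrArg (fun A => A v) (formOf_comp (f := fun _ => (1 / 2 : ℂ)) d1 d2 hφ)
    have e2 := congrArg (fun A => A v) (formOf_comp
      (f := fun s => Complex.I / 2 * (gOf w₁ w₂ s * zOf w₁ w₂ s)) hz hz' hφ)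
    have e3 := congrArg (fun A => A v) (formOf_comp (f := fun s => -Complex.I * uOf w₁ w₂ s)
      hz ht hφ)
    exact congrArg₂ (· + ·) (congrArg₂ (· + ·) e1 e2) e3
  · ext v
    simp only [lightZero, Pi.add_apply, ContinuousAlternatingMap.add_apply,
      ContinuousAlternatingMap.compContinuousLinearMap_apply]
    have e1 := congrArg (fun A => A v) (formOf_comp (f := fun _ => Complex.I / 2) d1 c1 hφ)
    have e2 := congrArg (fun A => A v) (formOf_comp (f := fun _ => Complex.I / 2) d2 c2 hφ)
    have e3 := congrArg (fun A => A v) (formOf_comp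
      (f := fun s => -(Complex.I / 2) * (gOf w₁ w₂ s * conj (zOf w₁ w₂ s))) ht hz hφ)
    have e4 := congrArg (fun A => A v) (formOf_comp
      (f := fun s => Complex.I / 2 * (gOf w₁ w₂ s * zOf w₁ w₂ s)) ht hz' hφ)
    have e5 := congrArg (fun A => A v) (formOf_comp (f := fun s => 2 * Complex.I * uOf w₁ w₂ s)
      hz hz' hφ)
    exact congrArg₂ (· + ·) (congrArg₂ (· + ·) (congrArg₂ (· + ·) (congrArg₂ (· + ·) e1 e2) e3) e4)
      e5

/-- `Im (x / y)`, as a complex number. -/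
lemma ofReal_im_div (x y : ℂ) : ((x / y).im : ℂ) =
    (x / y - conj x / conj y) / (2 * Complex.I) := by
  rw [← map_div₀, Complex.sub_conj]
  field_simp
  push_cast
  ring

/-- The algebraic identity relating the smooth coordinates and the instanton corrections: `b` is the
derivative of the argument of `w₂`, and `j` may be added to the instanton correction `W` if it is
subtracted from the coefficient of the derivative of the argument of `Z`. -/
lemma light_eq_of_ne_zero (h₁ : ContDiffAt ℝ ∞ w₁ s) (h₂ : ContDiffAt ℝ ∞ w₂ s)
    (ht : |tOf w₁ w₂ s| < 2 * Real.pi) (hz : zOf w₁ w₂ s ≠ 0) {b : E → ℂ} {j : ℂ}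
    (hb : ∀ v, b v = ((fderiv ℝ w₂ s v / w₂ s).im : ℂ) -
      j * ((fderiv ℝ (zOf w₁ w₂) s v / zOf w₁ w₂ s).im : ℂ)) (v w : E) :
    lightPlus w₁ w₂ s ![v, w] =
      (fderiv ℝ (zOf w₁ w₂) s v * b w - fderiv ℝ (zOf w₁ w₂) s w * b v) -
      (instW ‖zOf w₁ w₂ s‖ (tOf w₁ w₂ s) + j) / (2 * Complex.I * conj (zOf w₁ w₂ s)) *
        (fderiv ℝ (zOf w₁ w₂) s v * conj (fderiv ℝ (zOf w₁ w₂) s w) -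
          fderiv ℝ (zOf w₁ w₂) s w * conj (fderiv ℝ (zOf w₁ w₂) s v)) -
      Complex.I * instU ‖zOf w₁ w₂ s‖ (tOf w₁ w₂ s) *
        (fderiv ℝ (zOf w₁ w₂) s v * fderiv ℝ (tOf w₁ w₂) s w -
          fderiv ℝ (zOf w₁ w₂) s w * fderiv ℝ (tOf w₁ w₂) s v) ∧
    lightZero w₁ w₂ s ![v, w] =
      (fderiv ℝ (tOf w₁ w₂) s v * b w - fderiv ℝ (tOf w₁ w₂) s w * b v) +
      (instW ‖zOf w₁ w₂ s‖ (tOf w₁ w₂ s) + j) / (2 * Complex.I) *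
        ((fderiv ℝ (tOf w₁ w₂) s v * fderiv ℝ (zOf w₁ w₂) s w -
          fderiv ℝ (tOf w₁ w₂) s w * fderiv ℝ (zOf w₁ w₂) s v) / zOf w₁ w₂ s -
        (fderiv ℝ (tOf w₁ w₂) s v * conj (fderiv ℝ (zOf w₁ w₂) s w) -
          fderiv ℝ (tOf w₁ w₂) s w * conj (fderiv ℝ (zOf w₁ w₂) s v)) / conj (zOf w₁ w₂ s)) +
      2 * Complex.I * instU ‖zOf w₁ w₂ s‖ (tOf w₁ w₂ s) *
        (fderiv ℝ (zOf w₁ w₂) s v * conj (fderiv ℝ (zOf w₁ w₂) s w) -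
          fderiv ℝ (zOf w₁ w₂) s w * conj (fderiv ℝ (zOf w₁ w₂) s v)) := by
  have d1 := (h₁.differentiableAt (by simp))
  have d2 := (h₂.differentiableAt (by simp))
  have hρ : 0 < ‖zOf w₁ w₂ s‖ := norm_pos_iff.2 hz
  -- with `R = |w₁|² + |w₂|²` twice the distance to the pole, the singular parts of the instanton
  -- corrections are rational in `w₁, w₂` and their conjugates, which become independent variables
  have hU : (instU ‖zOf w₁ w₂ s‖ (tOf w₁ w₂ s) : ℂ) =
      1 / (w₁ s * conj (w₁ s) + w₂ s * conj (w₂ s)) + uOf w₁ w₂ s := by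
    rw [instU_eq hρ ht, dist3_zOf, Complex.mul_conj, Complex.mul_conj, Complex.normSq_eq_norm_sq,
      Complex.normSq_eq_norm_sq, uOf]
    push_cast
    congr 2
    ring
  have hW : (instW ‖zOf w₁ w₂ s‖ (tOf w₁ w₂ s) : ℂ) =
      ((w₂ s * conj (w₂ s) - w₁ s * conj (w₁ s)) / (w₁ s * conj (w₁ s) + w₂ s * conj (w₂ s)) - 1) / 2
        + zOf w₁ w₂ s * conj (zOf w₁ w₂ s) * gOf w₁ w₂ s := by
    rw [instW_eq' hρ ht, dist3_zOf, Complex.mul_conj, Complex.mul_conj, Complex.mul_conj,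
      Complex.normSq_eq_norm_sq, Complex.normSq_eq_norm_sq, Complex.normSq_eq_norm_sq, gOf, tOf]
    push_cast
    congr 3
    rw [div_div_div_cancel_right₀ two_ne_zero]
  have hw₁ : w₁ s ≠ 0 := fun h => hz (by simp [zOf, h])
  have hw₂ : w₂ s ≠ 0 := fun h => hz (by simp [zOf, h])
  have hR : w₁ s * conj (w₁ s) + w₂ s * conj (w₂ s) ≠ 0 := by
    rw [Complex.mul_conj, Complex.mul_conj, ← Complex.ofReal_add, Complex.ofReal_ne_zero]
    have := Complex.normSq_pos.2 hw₁
    have := Complex.normSq_nonneg (w₂ s)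
    positivity
  have hc₁ : conj (w₁ s) ≠ 0 := (map_ne_zero _).2 hw₁
  have hc₂ : conj (w₂ s) ≠ 0 := (map_ne_zero _).2 hw₂
  rw [lightPlus_apply h₁ h₂, lightZero_apply h₁ h₂, hU, hW, hb, hb]
  simp only [ofReal_im_div, fderiv_zOf d1 d2, fderiv_tOf h₁ h₂, zOf, map_mul, map_add, map_div₀,
    Complex.conj_I, map_ofNat]
  generalize conj (w₁ s) = x₁ at *
  generalize conj (w₂ s) = x₂ at *
  generalize conj (fderiv ℝ w₁ s v) = y₁ at *
  generalize conj (fderiv ℝ w₂ s v) = y₂ at *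
  generalize conj (fderiv ℝ w₁ s w) = z₁ at *
  generalize conj (fderiv ℝ w₂ s w) = z₂ at *
  generalize fderiv ℝ w₁ s v = a₁ at *
  generalize fderiv ℝ w₂ s v = a₂ at *
  generalize fderiv ℝ w₁ s w = b₁ at *
  generalize fderiv ℝ w₂ s w = b₂ at *
  generalize w₁ s = p₁ at *
  generalize w₂ s = p₂ at *
  generalize (gOf w₁ w₂ s : ℂ) = g at *
  generalize (uOf w₁ w₂ s : ℂ) = u at *
  clear hU hW hz hρ d1 d2 hb
  have hI := Complex.I_sq
  have hI4 : Complex.I ^ 4 = 1 := Complex.I_pow_four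
  constructor
  · field_simp
    ring_nf
    simp only [hI, hI4]
    ring
  · have lift : ∀ {p : ℂ}, p ≠ 0 → ∀ a, ∃ A, a = p * A := fun hp a => ⟨_ / _, (mul_div_cancel₀ a hp).symm⟩
    obtain ⟨A₁, rfl⟩ := lift hw₁ a₁
    obtain ⟨A₂, rfl⟩ := lift hw₂ a₂
    obtain ⟨B₁, rfl⟩ := lift hw₁ b₁
    obtain ⟨B₂, rfl⟩ := lift hw₂ b₂
    obtain ⟨Y₁, rfl⟩ := lift hc₁ y₁
    obtain ⟨Y₂, rfl⟩ := lift hc₂ y₂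
    obtain ⟨Z₁, rfl⟩ := lift hc₁ z₁
    obtain ⟨Z₂, rfl⟩ := lift hc₂ z₂
    have hq : ((p₂ * x₂ - p₁ * x₁) / (p₁ * x₁ + p₂ * x₂) - 1) / 2 =
        -(p₁ * x₁) / (p₁ * x₁ + p₂ * x₂) := by
      field_simp
      ring
    rw [hq]
    simp only [mul_div_cancel_left₀ _ hw₂,
      mul_div_cancel_left₀ _ hc₂]
    have hdz : ∀ c A B : ℂ, c * (Complex.I / 2 * (p₁ * A * p₂ + p₁ * (p₂ * B))) /
        (Complex.I / 2 * p₁ * p₂) = c * (A + B) := fun c A B => by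
      field_simp
    have hdz' : ∀ c A B : ℂ, c * (-Complex.I / 2 * (x₁ * A * x₂ + x₁ * (x₂ * B))) /
        (-Complex.I / 2 * x₁ * x₂) = c * (A + B) := fun c A B => by
      field_simp
    simp only [sub_div, hdz, hdz']
    field_simp
    ring_nf
    simp only [hI, hI4]
    ring

end LocalModel

end ModelGeometry

namespace ModelGeometry

open Set Filter

open scoped ComplexConjugate

/-! ### Arguments of the coordinates -/

section LocalModel

/-- The number of turns that moves an angle `t ∈ (-2π, 2π)` to `[0, 2π)`. -/
def turn (t : ℝ) : ℝ := if 0 ≤ t then 0 else 1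

/-- The instanton contribution of a light charge to `ω₊`, on two vectors on which `dZ` takes the
values `a, a'` and `dt` the values `c, c'`. -/
def instPlus (z : ℂ) (τ : ℝ) (a a' : ℂ) (c c' : ℝ) : ℂ :=
  -(instW ‖z‖ τ / (2 * Complex.I * conj z) * (a * conj a' - a' * conj a)) -
    Complex.I * instU ‖z‖ τ * (a * c' - a' * c)

/-- The instanton contribution of a light charge to `ω₃`, on two vectors on which `dZ` takes the
values `a, a'` and `dt` the values `c, c'`. -/
def instZero (z : ℂ) (τ : ℝ) (a a' : ℂ) (c c' : ℝ) : ℂ :=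
  instW ‖z‖ τ / (2 * Complex.I) * ((c * a' - c' * a) / z - (c * conj a' - c' * conj a) / conj z) +
    2 * Complex.I * instU ‖z‖ τ * (a * conj a' - a' * conj a)

lemma coe_eq_of_exp {z : ℂ} (hz : z ≠ 0) {a b : ℝ} (ha : z = (‖z‖ : ℂ) * Complex.exp (a * Complex.I))
    (hb : z = (‖z‖ : ℂ) * Complex.exp (b * Complex.I)) : (a : Real.Angle) = b := by
  have h8 : (‖z‖ : ℂ) ≠ 0 := by exact_mod_cast norm_ne_zero_iff.2 hz
  obtain ⟨m, hm⟩ := Complex.exp_eq_exp_iff_exists_int.1 (mul_left_cancel₀ h8 (ha.symm.trans hb))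
  rw [Real.Angle.angle_eq_iff_two_pi_dvd_sub]
  refine ⟨m, ?_⟩
  have h9 : (a : ℂ) = b + m * (2 * Real.pi) := by
    refine mul_right_cancel₀ Complex.I_ne_zero ?_
    rw [hm]
    ring
  have h10 : a = b + m * (2 * Real.pi) := by exact_mod_cast h9
  rw [h10]
  ring

variable {E : Type*} [NormedAddCommGroup E] [NormedSpace ℝ E] {w₁ w₂ : E → ℂ} {s : E} {V : Set E}

omit [NormedAddCommGroup E] [NormedSpace ℝ E] in
lemma w_eq_zero_of (hz : zOf w₁ w₂ s = 0) : (0 < tOf w₁ w₂ s → w₁ s = 0 ∧ w₂ s ≠ 0) ∧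
    (tOf w₁ w₂ s < 0 → w₁ s ≠ 0 ∧ w₂ s = 0) ∧ (tOf w₁ w₂ s = 0 → w₁ s = 0 ∧ w₂ s = 0) := by
  have h : w₁ s = 0 ∨ w₂ s = 0 := by
    simpa [zOf] using hz
  unfold tOf
  rcases h with h | h
  · rw [h, norm_zero]
    refine ⟨fun h' => ⟨rfl, fun h0 => ?_⟩, fun h' => ?_, fun h' => ⟨rfl, ?_⟩⟩
    · simp [h0] at h'
    · nlinarith [sq_nonneg ‖w₂ s‖]
    · simpa using h'
  · rw [h, norm_zero]
    refine ⟨fun h' => ?_, fun h' => ⟨fun h0 => ?_, rfl⟩, fun h' => ⟨?_, rfl⟩⟩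
    · nlinarith [sq_nonneg ‖w₁ s‖]
    · simp [h0] at h'
    · simpa using h'

omit [NormedAddCommGroup E] [NormedSpace ℝ E] in
lemma w_ne_zero_of (hz : zOf w₁ w₂ s ≠ 0) : w₁ s ≠ 0 ∧ w₂ s ≠ 0 :=
  ⟨fun h => hz (by simp [zOf, h]), fun h => hz (by simp [zOf, h])⟩

/-- Near a point at which `Z` and the angle are not both zero, and at which the angle is nonzero if
it does not vanish identically, there is a smooth argument: of `w₂` if the angle is not negative, and
of `-i w̄₁` if it is. -/
lemma exists_light_arg (hV : IsOpen V) (h₁ : ContDiffOn ℝ ∞ w₁ V) (h₂ : ContDiffOn ℝ ∞ w₂ V)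
    (hs : s ∈ V) (ht : tOf w₁ w₂ s ≠ 0 ∨ tOf w₁ w₂ =ᶠ[𝓝 s] 0)
    (h0 : ¬(zOf w₁ w₂ s = 0 ∧ tOf w₁ w₂ s = 0)) :
    ∃ b : E → ℝ, DifferentiableAt ℝ b s ∧
      (∀ v, fderiv ℝ b s v = if 0 ≤ tOf w₁ w₂ s then (fderiv ℝ w₂ s v / w₂ s).im else
        -(fderiv ℝ w₁ s v / w₁ s).im) ∧
      ∀ᶠ s' in 𝓝 s, ∀ β₁ β₂ : ℝ, w₁ s' = (‖w₁ s'‖ : ℂ) * Complex.exp (β₁ * Complex.I) →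
        w₂ s' = (‖w₂ s'‖ : ℂ) * Complex.exp (β₂ * Complex.I) →
        (b s' : Real.Angle) =
          ((β₂ - turn (tOf w₁ w₂ s') * (β₁ + β₂ + Real.pi / 2) : ℝ) : Real.Angle) := by
  have c1 := h₁.contDiffAt (hV.mem_nhds hs)
  have c2 := h₂.contDiffAt (hV.mem_nhds hs)
  have htc : ContinuousAt (tOf w₁ w₂) s := (contDiffAt_tOf c1 c2).continuousAt
  by_cases hpos : 0 ≤ tOf w₁ w₂ s
  · have hw : w₂ s ≠ 0 := by
      by_cases hz : zOf w₁ w₂ s = 0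
      · exact ((w_eq_zero_of hz).1 (lt_of_le_of_ne hpos fun h => h0 ⟨hz, h.symm⟩)).2
      · exact (w_ne_zero_of hz).2
    obtain ⟨W, b, hW, hsW, -, hb, hW'⟩ := exists_smooth_arg hV h₂ hs hw
    have hev : ∀ᶠ s' in 𝓝 s, 0 ≤ tOf w₁ w₂ s' := by
      rcases ht with h | h
      · exact (htc.eventually (lt_mem_nhds (lt_of_le_of_ne hpos h.symm))).mono fun _ h => le_of_lt h
      · exact h.mono fun _ h => h.ge
    refine ⟨b, (hb.contDiffAt (hW.mem_nhds hsW)).differentiableAt (by simp), fun v => ?_, ?_⟩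
    · rw [if_pos hpos, (hW' s hsW).2.2]
    · filter_upwards [hW.mem_nhds hsW, hev] with s' hs' hp β₁ β₂ _ e2
      obtain ⟨hne, e, -⟩ := hW' s' hs'
      rw [turn, if_pos hp, zero_mul, sub_zero]
      exact coe_eq_of_exp hne e e2
  · have hlt := not_le.1 hpos
    have hw : w₁ s ≠ 0 := by
      by_cases hz : zOf w₁ w₂ s = 0
      · exact ((w_eq_zero_of hz).2.1 hlt).1
      · exact (w_ne_zero_of hz).1
    -- for `t < 0` the combination `β₂ - (β₁ + β₂ + π/2)` is the argument of `-i conj(w₁)`, smooth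
    -- as `w₁ ≠ 0`
    set f : E → ℂ := fun s => -Complex.I * conj (w₁ s) with hf
    have hfc : ContDiffOn ℝ ∞ f V := contDiffOn_const.mul fun x hx =>
      (contDiffAt_conj (h₁.contDiffAt (hV.mem_nhds hx))).contDiffWithinAt
    have hfs : f s ≠ 0 := mul_ne_zero (neg_ne_zero.2 Complex.I_ne_zero) ((map_ne_zero _).2 hw)
    obtain ⟨W, b, hW, hsW, -, hb, hW'⟩ := exists_smooth_arg hV hfc hs hfs
    have d1 := c1.differentiableAt (by simp)
    refine ⟨b, (hb.contDiffAt (hW.mem_nhds hsW)).differentiableAt (by simp), fun v => ?_, ?_⟩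
    · have hfd : fderiv ℝ f s v = -Complex.I * conj (fderiv ℝ w₁ s v) := by
        rw [← fderiv_conj d1]
        have h := (((contDiffAt_conj c1).differentiableAt (by simp)).hasFDerivAt).const_mul
          (-Complex.I)
        exact congrArg (fun L => L v) h.fderiv
      rw [if_neg hpos, (hW' s hsW).2.2, hfd, hf, mul_div_mul_left _ _ (neg_ne_zero.2 Complex.I_ne_zero),
        ← map_div₀, Complex.conj_im]
    · filter_upwards [hW.mem_nhds hsW, htc.eventually (gt_mem_nhds hlt)] with s' hs' hp β₁ β₂ e1 _
      obtain ⟨hne, e, -⟩ := hW' s' hs'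
      rw [turn, if_neg (not_le.2 hp)]
      refine coe_eq_of_exp hne e ?_
      have hn : ‖f s'‖ = ‖w₁ s'‖ := by simp [hf]
      rw [hn]
      simp only [hf]
      conv_lhs => rw [e1]
      rw [map_mul, Complex.conj_ofReal, ← Complex.exp_conj, map_mul, Complex.conj_I,
        Complex.conj_ofReal, show ((β₂ - 1 * (β₁ + β₂ + Real.pi / 2) : ℝ) : ℂ) * Complex.I =
          (β₁ : ℂ) * -Complex.I + -(Real.pi / 2 * Complex.I) by push_cast; ring, Complex.exp_add,
        Complex.exp_neg (Real.pi / 2 * Complex.I), Complex.exp_pi_div_two_mul_I, Complex.inv_I]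
      ring

/-- The contributions of a light charge, in terms of the argument `b` and the instanton
corrections. -/
lemma light_eq (h₁ : ContDiffAt ℝ ∞ w₁ s) (h₂ : ContDiffAt ℝ ∞ w₂ s)
    (htl : |tOf w₁ w₂ s| < 2 * Real.pi) (hz : zOf w₁ w₂ s ≠ 0 ∨ zOf w₁ w₂ =ᶠ[𝓝 s] 0)
    (ht : tOf w₁ w₂ s ≠ 0 ∨ tOf w₁ w₂ =ᶠ[𝓝 s] 0) {b : E → ℝ}
    (hb : ¬(zOf w₁ w₂ s = 0 ∧ tOf w₁ w₂ s = 0) →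
      ∀ v, fderiv ℝ b s v = if 0 ≤ tOf w₁ w₂ s then (fderiv ℝ w₂ s v / w₂ s).im else
        -(fderiv ℝ w₁ s v / w₁ s).im) (v w : E) :
    lightPlus w₁ w₂ s ![v, w] =
      (fderiv ℝ (zOf w₁ w₂) s v * fderiv ℝ b s w - fderiv ℝ (zOf w₁ w₂) s w * fderiv ℝ b s v) +
      instPlus (zOf w₁ w₂ s) (tOf w₁ w₂ s + 2 * Real.pi * turn (tOf w₁ w₂ s))
        (fderiv ℝ (zOf w₁ w₂) s v) (fderiv ℝ (zOf w₁ w₂) s w) (fderiv ℝ (tOf w₁ w₂) s v)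
        (fderiv ℝ (tOf w₁ w₂) s w) ∧
    lightZero w₁ w₂ s ![v, w] =
      (fderiv ℝ (tOf w₁ w₂) s v * fderiv ℝ b s w - fderiv ℝ (tOf w₁ w₂) s w * fderiv ℝ b s v) +
      instZero (zOf w₁ w₂ s) (tOf w₁ w₂ s + 2 * Real.pi * turn (tOf w₁ w₂ s))
        (fderiv ℝ (zOf w₁ w₂) s v) (fderiv ℝ (zOf w₁ w₂) s w) (fderiv ℝ (tOf w₁ w₂) s v)
        (fderiv ℝ (tOf w₁ w₂) s w) := by
  have d1 := h₁.differentiableAt (by simp)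
  have d2 := h₂.differentiableAt (by simp)
  by_cases hz0 : zOf w₁ w₂ s = 0
  -- `Z` vanishes near `s`, hence so does `w₁` if `t > 0`, `w₂` if `t < 0`, and both if `t` vanishes
  -- near `s`
  · have hze : zOf w₁ w₂ =ᶠ[𝓝 s] 0 := hz.resolve_left (not_not.2 hz0)
    have hdz : fderiv ℝ (zOf w₁ w₂) s = 0 := by
      rw [hze.fderiv_eq]
      exact fderiv_const_apply 0
    have htc : ContinuousAt (tOf w₁ w₂) s := (contDiffAt_tOf h₁ h₂).continuousAt
    have hzero : ∀ {f : E → ℂ}, (∀ᶠ s' in 𝓝 s, f s' = 0) → fderiv ℝ f s = 0 := fun {f} h => by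
      have h' : f =ᶠ[𝓝 s] fun _ => 0 := h
      rw [h'.fderiv_eq]
      exact fderiv_const_apply 0
    have hcon : lightPlus w₁ w₂ s ![v, w] =
          1 / 2 * (fderiv ℝ w₁ s v * fderiv ℝ w₂ s w - fderiv ℝ w₁ s w * fderiv ℝ w₂ s v) ∧
        lightZero w₁ w₂ s ![v, w] =
          Complex.I / 2 * (fderiv ℝ w₁ s v * conj (fderiv ℝ w₁ s w) -
            fderiv ℝ w₁ s w * conj (fderiv ℝ w₁ s v)) +
          Complex.I / 2 * (fderiv ℝ w₂ s v * conj (fderiv ℝ w₂ s w) -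
            fderiv ℝ w₂ s w * conj (fderiv ℝ w₂ s v)) := by
      constructor
      · rw [lightPlus_apply h₁ h₂, hdz, hz0]
        simp
      · rw [lightZero_apply h₁ h₂, hdz, hz0]
        simp
    rw [hcon.1, hcon.2, hdz, hz0, instPlus, instZero]
    simp only [zero_apply, map_zero, mul_zero, zero_mul, sub_zero, div_zero, add_zero,
      neg_zero, fderiv_tOf h₁ h₂]
    rcases lt_trichotomy (tOf w₁ w₂ s) 0 with hlt | heq | hgt
    · have hw₂ : fderiv ℝ w₂ s = 0 := hzero (by
        filter_upwards [hze, htc.eventually (gt_mem_nhds hlt)] with s' e1 e2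
        exact ((w_eq_zero_of e1).2.1 e2).2)
      obtain ⟨hne, h0⟩ := (w_eq_zero_of hz0).2.1 hlt
      rw [hb (fun h => hlt.ne h.2), hb (fun h => hlt.ne h.2), if_neg (not_le.2 hlt),
        if_neg (not_le.2 hlt)]
      have hc := (map_ne_zero (starRingEnd ℂ)).2 hne
      push_cast
      rw [ofReal_im_div, ofReal_im_div, hw₂, h0]
      simp only [zero_apply, map_zero, mul_zero, sub_zero, add_zero, true_and]
      field_simp
      rw [Complex.I_sq]
      ring
    · have hte : tOf w₁ w₂ =ᶠ[𝓝 s] 0 := ht.resolve_left (not_not.2 heq)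
      have hw : ∀ᶠ s' in 𝓝 s, w₁ s' = 0 ∧ w₂ s' = 0 := by
        filter_upwards [hze, hte] with s' e1 e2
        exact (w_eq_zero_of e1).2.2 e2
      rw [hzero (hw.mono fun _ h => h.1), hzero (hw.mono fun _ h => h.2)]
      simp
    · have hw₁ : fderiv ℝ w₁ s = 0 := hzero (by
        filter_upwards [hze, htc.eventually (lt_mem_nhds hgt)] with s' e1 e2
        exact ((w_eq_zero_of e1).1 e2).1)
      obtain ⟨h0, hne⟩ := (w_eq_zero_of hz0).1 hgt
      rw [hb (fun h => hgt.ne' h.2), hb (fun h => hgt.ne' h.2), if_pos hgt.le,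
        if_pos hgt.le]
      have hc := (map_ne_zero (starRingEnd ℂ)).2 hne
      rw [ofReal_im_div, ofReal_im_div, hw₁, h0]
      simp only [zero_apply, map_zero, mul_zero, zero_mul, sub_zero, add_zero, zero_add, true_and]
      field_simp
      rw [Complex.I_sq]
      ring
  · have hρ : 0 < ‖zOf w₁ w₂ s‖ := norm_pos_iff.2 hz0
    obtain ⟨hne₁, hne₂⟩ := w_ne_zero_of hz0
    have hlog : ∀ v, fderiv ℝ (zOf w₁ w₂) s v / zOf w₁ w₂ s =
        fderiv ℝ w₁ s v / w₁ s + fderiv ℝ w₂ s v / w₂ s := fun v => by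
      rw [fderiv_zOf d1 d2, zOf]
      field_simp
    have hb' : ∀ v, (fderiv ℝ b s v : ℂ) = ((fderiv ℝ w₂ s v / w₂ s).im : ℂ) -
        (turn (tOf w₁ w₂ s) : ℂ) * ((fderiv ℝ (zOf w₁ w₂) s v / zOf w₁ w₂ s).im : ℂ) := by
      intro v
      rw [hb (fun h => hz0 h.1), hlog, Complex.add_im, turn]
      split_ifs
      · simp
      · push_cast
        ring
    have hper : instU ‖zOf w₁ w₂ s‖ (tOf w₁ w₂ s + 2 * Real.pi * turn (tOf w₁ w₂ s)) =
          instU ‖zOf w₁ w₂ s‖ (tOf w₁ w₂ s) ∧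
        instW ‖zOf w₁ w₂ s‖ (tOf w₁ w₂ s + 2 * Real.pi * turn (tOf w₁ w₂ s)) =
          instW ‖zOf w₁ w₂ s‖ (tOf w₁ w₂ s) + turn (tOf w₁ w₂ s) := by
      rw [turn]
      split_ifs
      · simp
      · rw [mul_one, instU_add_two_pi, instW_add_two_pi]
        exact ⟨rfl, rfl⟩
    -- moving `t` to `[0, 2π)` adds `turn t` to `instW`; this compensates the multiple of `d arg Z`
    -- in `db`
    obtain ⟨e1, e2⟩ := light_eq_of_ne_zero h₁ h₂ htl hz0 hb' v w
    rw [e1, e2, instPlus, instZero, hper.1, hper.2]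
    push_cast
    exact ⟨by ring, by ring⟩

end LocalModel

end ModelGeometry

namespace ModelGeometry

open Set Filter

open scoped ComplexConjugate

/-! ### First consequences of the coordinates -/

variable {r : ℕ} {B : Type} [TopologicalSpace B] [ChartedSpace (CSpace r) B]
  {C : CoulombData r B} (N : SingularNbhd C)

section Lattice

lemma regular_dense {u : B} (hu : u ∈ N.U) : u ∈ closure (N.U \ C.disc) := by
  rw [sdiff_eq]
  refine (interior_eq_empty_iff_dense_compl.1 C.disc_interior).open_subset_closure_inter N.U_open hu

lemma exists_regular : ∃ u, u ∈ N.U \ C.disc := by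
  by_contra! h
  have := regular_dense N N.center_mem
  rw [eq_empty_of_forall_notMem h, closure_empty] at this
  exact this

lemma pairL_antisymm (x y : N.L) : N.pairL x y = -N.pairL y x := by
  obtain ⟨u, hu⟩ := exists_regular N
  have hb := N.argBranch_isBranch u
  rw [← N.frame_pair u hu _ hb, ← N.frame_pair u hu _ hb]
  exact C.pair_antisymm u hu.2 _ _

lemma pairL_flavor (f : C.Flavor) (y : N.L) : N.pairL (N.flavorL f) y = 0 := by
  obtain ⟨u, hu⟩ := exists_regular N
  have hb := N.argBranch_isBranch u
  rw [← N.frame_pair u hu _ hb, N.frame_flavor u hu _ hb]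
  exact (C.pair_radical u hu.2 _).2 ⟨f, rfl⟩ _

lemma exists_flavor_of_radical {x : N.L} (hx : ∀ y, N.pairL x y = 0) : ∃ f, N.flavorL f = x := by
  obtain ⟨u, hu⟩ := exists_regular N
  have hb := N.argBranch_isBranch u
  have hbij := N.frame_bijective u hu _ hb
  obtain ⟨f, hf⟩ := (C.pair_radical u hu.2 (N.frame u (N.argBranch u) x)).1 fun γ' => by
    obtain ⟨y, rfl⟩ := hbij.2 γ'
    rw [N.frame_pair u hu _ hb, hx]
  exact ⟨f, hbij.1 (by rw [N.frame_flavor u hu _ hb, hf])⟩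

lemma finite_lattice : Module.Finite ℤ N.L := by
  obtain ⟨u, hu⟩ := exists_regular N
  have := C.charge_finite u hu.2
  have hbij := N.frame_bijective u hu _ (N.argBranch_isBranch u)
  exact Module.Finite.equiv
    (AddEquiv.ofBijective (N.frame u (N.argBranch u)) hbij).toIntLinearEquiv.symm

lemma vanishesOnRadical_iff {K : Type} [AddCommGroup K] {a : N.L →+ K} :
    VanishesOnRadical N.pairL a ↔ ∀ f, a (N.flavorL f) = 0 :=
  ⟨fun h f => h _ fun y => by rw [pairL_antisymm, pairL_flavor, neg_zero], fun h x hx => by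
    obtain ⟨f, rfl⟩ := exists_flavor_of_radical N fun y => by rw [pairL_antisymm, hx, neg_zero]
    exact h f⟩

lemma Zt_flavor (f : C.Flavor) : ∃ c : ℂ, ∀ u ∈ N.U, N.Zt (N.flavorL f) u = c := by
  obtain ⟨u₀, hu₀⟩ := exists_regular N
  refine ⟨C.Z u₀ (C.flavorIncl u₀ f), fun u hu => ?_⟩
  have hreg : ∀ w ∈ N.U \ C.disc, N.Zt (N.flavorL f) w = C.Z u₀ (C.flavorIncl u₀ f) := by
    intro w hw
    have hb := N.argBranch_isBranch w
    have h := N.central_charge w hw _ hb (N.flavorL f)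
    rw [N.frame_flavor w hw _ hb] at h
    simp only [pairL_flavor, Int.cast_zero, zero_mul, Finset.sum_const_zero, mul_zero, add_zero] at h
    rw [← h]
    exact C.Z_flavor w hw.2 u₀ hu₀.2 f
  have hcont : ContinuousWithinAt (N.Zt (N.flavorL f)) (N.U \ C.disc) u :=
    ((N.Zt_holomorphic _).continuousOn u hu).mono sdiff_subset
  have hne : (𝓝[N.U \ C.disc] u).NeBot := mem_closure_iff_nhdsWithin_neBot.1 (regular_dense N hu)
  refine tendsto_nhds_unique hcont (tendsto_const_nhds.congr' ?_)
  filter_upwards [self_mem_nhdsWithin] with w hw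
  exact (hreg w hw).symm

end Lattice

/-- A continuous function that is constant modulo `2π` is locally constant. -/
lemma eventuallyEq_of_angle {X : Type*} [TopologicalSpace X] {f : X → ℝ} {s : X}
    (hf : ContinuousAt f s) (h : ∀ᶠ s' in 𝓝 s, (f s' : Real.Angle) = f s) :
    f =ᶠ[𝓝 s] fun _ => f s := by
  have hpi := Real.pi_pos
  filter_upwards [h, hf.eventually (Metric.ball_mem_nhds (f s) Real.pi_pos)] with s' h1 h2
  obtain ⟨k, hk⟩ := Real.Angle.angle_eq_iff_two_pi_dvd_sub.1 h1
  rw [Real.dist_eq, hk] at h2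
  rcases eq_or_ne k 0 with rfl | hk0
  · simp only [Int.cast_zero, mul_zero] at hk
    linarith
  · have h3 : (1 : ℝ) ≤ |(k : ℝ)| := by exact_mod_cast Int.one_le_abs hk0
    rw [abs_mul, abs_of_pos (by positivity : (0 : ℝ) < 2 * Real.pi)] at h2
    nlinarith

lemma fderiv_eq_zero_of_angle {E : Type*} [NormedAddCommGroup E] [NormedSpace ℝ E] {f : E → ℝ}
    {s : E} (hf : ContinuousAt f s) (h : ∀ᶠ s' in 𝓝 s, (f s' : Real.Angle) = f s) :
    fderiv ℝ f s = 0 := by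
  rw [(eventuallyEq_of_angle hf h).fderiv_eq]
  exact fderiv_const_apply _

namespace Coords

variable {N} {n : ℕ} {p : RSpace n → N.Total} (D : Coords N p) {s : RSpace n}

lemma mem_U (hs : s ∈ D.V) : D.u s ∈ N.U := by
  obtain ⟨P, -, h, -⟩ := D.coords s hs
  exact h ▸ P.mem

lemma spec (hs : s ∈ D.V) (γ : N.pos) : N.Zt γ (D.u s) = zOf (D.w₁ γ) (D.w₂ γ) s ∧
    D.t γ s = tOf (D.w₁ γ) (D.w₂ γ) s ∧ |tOf (D.w₁ γ) (D.w₂ γ) s| < 2 * Real.pi := by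
  obtain ⟨P, -, -, β₁, β₂, -, h, -⟩ := D.coords s hs
  obtain ⟨-, -, -, h1, h2, h3⟩ := h γ (mem_univ _)
  have h1' : D.t γ s = tOf (D.w₁ γ) (D.w₂ γ) s := h1
  exact ⟨h3, h1', h1' ▸ h2⟩

lemma mem_nhds (hs : s ∈ D.V) : D.V ∈ 𝓝 s := D.isOpen.mem_nhds hs

lemma contDiffAt_w₁ (hs : s ∈ D.V) (γ : N.pos) : ContDiffAt ℝ ∞ (D.w₁ γ) s :=
  (D.w₁_smooth γ).contDiffAt (D.mem_nhds hs)

lemma contDiffAt_w₂ (hs : s ∈ D.V) (γ : N.pos) : ContDiffAt ℝ ∞ (D.w₂ γ) s :=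
  (D.w₂_smooth γ).contDiffAt (D.mem_nhds hs)

lemma contDiffAt_ϑ (hs : s ∈ D.V) (x : N.L) : ContDiffAt ℝ ∞ (D.ϑ x) s :=
  (D.ϑ_smooth x).contDiffAt (D.mem_nhds hs)

lemma differentiableAt_ϑ (hs : s ∈ D.V) (x : N.L) : DifferentiableAt ℝ (D.ϑ x) s :=
  (D.contDiffAt_ϑ hs x).differentiableAt (by simp)

/-- The function `Z̃_x` along the coordinates. -/
def z (x : N.L) (s : RSpace n) : ℂ := N.Zt x (D.u s)

lemma contDiffAt_z [IsManifold 𝓘(ℂ, CSpace r) ∞ B] (hs : s ∈ D.V) (x : N.L) :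
    ContDiffAt ℝ ∞ (D.z x) s :=
  (contDiffOn_Zt D.isOpen D.u_smooth (fun _ h => D.mem_U h) x).contDiffAt (D.mem_nhds hs)

lemma differentiableAt_z [IsManifold 𝓘(ℂ, CSpace r) ∞ B] (hs : s ∈ D.V) (x : N.L) :
    DifferentiableAt ℝ (D.z x) s := (D.contDiffAt_z hs x).differentiableAt (by simp)

lemma z_eventuallyEq (hs : s ∈ D.V) (γ : N.pos) : D.z γ =ᶠ[𝓝 s] zOf (D.w₁ γ) (D.w₂ γ) := by
  filter_upwards [D.mem_nhds hs] with s' hs'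
  exact (D.spec hs' γ).1

lemma t_eventuallyEq (hs : s ∈ D.V) (γ : N.pos) : D.t γ =ᶠ[𝓝 s] tOf (D.w₁ γ) (D.w₂ γ) := by
  filter_upwards [D.mem_nhds hs] with s' hs'
  exact (D.spec hs' γ).2.1

lemma pair_light (γ γ' : N.pos) : N.pairL γ γ' = 0 :=
  N.light_isotropic _ (N.pos_light _ γ.2) _ (N.pos_light _ γ'.2)

/-- `ϑ` has the additivity of a twisted character, extends `θ_f` and restricts to the angles of the
light charges. -/
lemma ϑ_spec (hs : s ∈ D.V) :
    (∀ x y, (D.ϑ (x + y) s : Real.Angle) =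
      ((D.ϑ x s + D.ϑ y s + Real.pi * N.pairL x y : ℝ) : Real.Angle)) ∧
    (∀ f, (D.ϑ (N.flavorL f) s : Real.Angle) = C.θf f) ∧
    ∀ γ : N.pos, (D.ϑ γ s : Real.Angle) = D.t γ s := by
  obtain ⟨P, -, -, β₁, β₂, h1, -, -, h⟩ := D.coords s hs
  refine ⟨fun x y => ?_, fun f => ?_, fun γ => ?_⟩
  · have hxy := P.twisted x y
    rw [h, h, h] at hxy
    simp only [map_add, AddMonoidHom.add_apply, Int.cast_add, add_mul, Finset.sum_add_distrib] at hxy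
    have h2 : ∀ a b c d e : ℝ, ((a + (d + e) : ℝ) : Real.Angle) =
        ((b + d : ℝ) : Real.Angle) + ((c + e : ℝ) : Real.Angle) + ((Real.pi * N.pairL x y : ℝ) : Real.Angle) →
        (a : Real.Angle) = ((b + c + Real.pi * N.pairL x y : ℝ) : Real.Angle) := fun a b c d e h => by
      rw [← Real.Angle.coe_add, ← Real.Angle.coe_add] at h
      have h3 := congrArg (fun z => z - ((d + e : ℝ) : Real.Angle)) h
      simp only [← Real.Angle.coe_sub] at h3
      rwa [add_sub_cancel_right, show b + d + (c + e) + Real.pi * N.pairL x y - (d + e) =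
        b + c + Real.pi * N.pairL x y by ring] at h3
    exact h2 _ _ _ _ _ hxy
  · have hf := P.flavor f
    rw [h] at hf
    simpa [pairL_flavor] using hf
  · have hγ := h1 γ
    rw [h] at hγ
    simpa [pair_light] using hγ

/-- The differential of `ϑ` on a vector, as a homomorphism. -/
def dϑ (hs : s ∈ D.V) (v : RSpace n) : N.L →+ ℂ where
  toFun x := (fderiv ℝ (D.ϑ x) s v : ℂ)
  map_zero' := by
    have h : fderiv ℝ (D.ϑ 0) s = 0 := by
      refine fderiv_eq_zero_of_angle (D.contDiffAt_ϑ hs 0).continuousAt ?_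
      have key : ∀ s' ∈ D.V, (D.ϑ 0 s' : Real.Angle) = 0 := fun s' hs' => by
        have h := (D.ϑ_spec hs').1 0 0
        simpa using h
      filter_upwards [D.mem_nhds hs] with s' hs'
      rw [key s' hs', key s hs]
    rw [h]
    simp
  map_add' x y := by
    have hc := D.contDiffAt_ϑ hs
    have hd := D.differentiableAt_ϑ hs
    have h : fderiv ℝ (fun s => D.ϑ (x + y) s - (D.ϑ x s + D.ϑ y s)) s = 0 := by
      refine fderiv_eq_zero_of_angle
        ((hc _).continuousAt.sub ((hc x).continuousAt.add (hc y).continuousAt)) ?_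
      have key : ∀ s' ∈ D.V, ((D.ϑ (x + y) s' - (D.ϑ x s' + D.ϑ y s') : ℝ) : Real.Angle) =
          ((Real.pi * N.pairL x y : ℝ) : Real.Angle) := fun s' hs' => by
        rw [Real.Angle.coe_sub, (D.ϑ_spec hs').1, ← Real.Angle.coe_sub, add_sub_cancel_left]
      filter_upwards [D.mem_nhds hs] with s' hs'
      rw [key s' hs', key s hs]
    have h2 := ((hd (x + y)).hasFDerivAt.sub ((hd x).hasFDerivAt.add (hd y).hasFDerivAt)).fderiv.symm.trans h
    have h3 := congrArg (fun L => L v) h2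
    simp only [sub_apply, add_apply, zero_apply] at h3
    rw [sub_eq_zero.1 h3]
    push_cast
    rfl

/-- The differential of `Z̃` on a vector, as a homomorphism. -/
def dz [IsManifold 𝓘(ℂ, CSpace r) ∞ B] (hs : s ∈ D.V) (v : RSpace n) : N.L →+ ℂ where
  toFun x := fderiv ℝ (D.z x) s v
  map_zero' := by
    have h : D.z 0 = fun _ => 0 := by
      funext s
      simp [z]
    rw [h]
    simp
  map_add' x y := by
    have h : D.z (x + y) = D.z x + D.z y := by
      funext s
      simp [z]
    rw [h, ((D.differentiableAt_z hs x).hasFDerivAt.add (D.differentiableAt_z hs y).hasFDerivAt).fderiv]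
    rfl

lemma dϑ_vanishes (hs : s ∈ D.V) (v : RSpace n) : VanishesOnRadical N.pairL (D.dϑ hs v) := by
  refine (vanishesOnRadical_iff N).2 fun f => ?_
  have h : fderiv ℝ (D.ϑ (N.flavorL f)) s = 0 := by
    refine fderiv_eq_zero_of_angle (D.contDiffAt_ϑ hs _).continuousAt ?_
    filter_upwards [D.mem_nhds hs] with s' hs'
    rw [(D.ϑ_spec hs').2.1, (D.ϑ_spec hs).2.1]
  change (fderiv ℝ (D.ϑ (N.flavorL f)) s v : ℂ) = 0
  rw [h]
  simp

lemma dz_vanishes [IsManifold 𝓘(ℂ, CSpace r) ∞ B] (hs : s ∈ D.V) (v : RSpace n) :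
    VanishesOnRadical N.pairL (D.dz hs v) := by
  refine (vanishesOnRadical_iff N).2 fun f => ?_
  obtain ⟨c, hc⟩ := Zt_flavor N f
  have h : D.z (N.flavorL f) =ᶠ[𝓝 s] fun _ => c := by
    filter_upwards [D.mem_nhds hs] with s' hs'
    exact hc _ (D.mem_U hs')
  change fderiv ℝ (D.z (N.flavorL f)) s v = 0
  rw [h.fderiv_eq]
  simp

lemma dϑ_light (hs : s ∈ D.V) (v : RSpace n) (γ : N.pos) :
    D.dϑ hs v γ = (fderiv ℝ (tOf (D.w₁ γ) (D.w₂ γ)) s v : ℂ) := by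
  have hd := D.differentiableAt_ϑ hs γ
  have ht : DifferentiableAt ℝ (tOf (D.w₁ γ) (D.w₂ γ)) s :=
    (contDiffAt_tOf (D.contDiffAt_w₁ hs γ) (D.contDiffAt_w₂ hs γ)).differentiableAt (by simp)
  have h : fderiv ℝ (fun s => D.ϑ γ s - tOf (D.w₁ γ) (D.w₂ γ) s) s = 0 := by
    refine fderiv_eq_zero_of_angle (hd.continuousAt.sub ht.continuousAt) ?_
    have key : ∀ s' ∈ D.V, ((D.ϑ γ s' - tOf (D.w₁ γ) (D.w₂ γ) s' : ℝ) : Real.Angle) = 0 :=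
      fun s' hs' => by
        rw [Real.Angle.coe_sub, (D.ϑ_spec hs').2.2, (D.spec hs' γ).2.1, sub_self]
    filter_upwards [D.mem_nhds hs] with s' hs'
    rw [key s' hs', key s hs]
  have h2 := (hd.hasFDerivAt.sub ht.hasFDerivAt).fderiv.symm.trans h
  have h3 := congrArg (fun L => L v) h2
  simp only [sub_apply, zero_apply] at h3
  change (fderiv ℝ (D.ϑ γ) s v : ℂ) = _
  rw [sub_eq_zero.1 h3]

lemma dz_light [IsManifold 𝓘(ℂ, CSpace r) ∞ B] (hs : s ∈ D.V) (v : RSpace n) (γ : N.pos) :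
    D.dz hs v γ = fderiv ℝ (zOf (D.w₁ γ) (D.w₂ γ)) s v := by
  change fderiv ℝ (D.z γ) s v = _
  rw [(D.z_eventuallyEq hs γ).fderiv_eq]

end Coords

end ModelGeometry

namespace ModelGeometry

open Set Filter

open scoped ComplexConjugate

/-! ### The forms in coordinates -/

section SmoothClosed

variable {E : Type*} [NormedAddCommGroup E] [NormedSpace ℝ E]

/-- A 2-form is smooth and closed at a point. -/
def SmoothClosedAt (η : E → E [⋀^Fin 2]→L[ℝ] ℂ) (s : E) : Prop :=
  ContDiffAt ℝ ∞ η s ∧ extDeriv η s = 0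

variable {η η' : E → E [⋀^Fin 2]→L[ℝ] ℂ} {s : E}

lemma SmoothClosedAt.differentiableAt (h : SmoothClosedAt η s) : DifferentiableAt ℝ η s :=
  h.1.differentiableAt (by simp)

lemma SmoothClosedAt.add (h : SmoothClosedAt η s) (h' : SmoothClosedAt η' s) :
    SmoothClosedAt (η + η') s :=
  ⟨h.1.add h'.1, by rw [extDeriv_add h.differentiableAt h'.differentiableAt, h.2, h'.2, add_zero]⟩

lemma SmoothClosedAt.smul (h : SmoothClosedAt η s) (c : ℝ) : SmoothClosedAt (c • η) s :=
  ⟨h.1.const_smul c, by rw [extDeriv_smul, h.2, smul_zero]⟩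

lemma SmoothClosedAt.sum {ι : Type*} (F : Finset ι) {η : ι → E → E [⋀^Fin 2]→L[ℝ] ℂ}
    (h : ∀ i ∈ F, SmoothClosedAt (η i) s) : SmoothClosedAt (∑ i ∈ F, η i) s := by
  classical
  induction F using Finset.induction_on with
  | empty =>
    rw [Finset.sum_empty]
    refine ⟨contDiffAt_const, ?_⟩
    have := extDeriv_smul (𝕜 := ℝ) (x := s) (0 : ℝ) (0 : E → E [⋀^Fin 2]→L[ℝ] ℂ)
    rwa [zero_smul, zero_smul] at this
  | insert i F hi ih =>
    rw [Finset.sum_insert hi]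
    exact (h i (Finset.mem_insert_self i F)).add
      (ih fun j hj => h j (Finset.mem_insert_of_mem hj))

lemma smoothClosedAt_formOf_const (c : ℂ) {g h : E → ℂ} (hg : ContDiffAt ℝ ∞ g s)
    (hh : ContDiffAt ℝ ∞ h s) : SmoothClosedAt (formOf (fun _ => c) g h) s := by
  refine ⟨contDiffAt_formOf contDiffAt_const hg hh, ContinuousAlternatingMap.ext fun v => ?_⟩
  rw [extDeriv_formOf contDiffAt_const hg hh, wedge₃, fderiv_const_apply]
  simp

end SmoothClosed

namespace Coords

variable {r : ℕ} {B : Type} [TopologicalSpace B] [ChartedSpace (CSpace r) B]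
  {C : CoulombData r B} {N : SingularNbhd C} {n : ℕ} {p : RSpace n → N.Total} (D : Coords N p)
  {s : RSpace n} (M : InverseMatrix N.pairL)

/-- The form `ω₊`, in smooth coordinates. -/
def formPlus : RSpace n → RSpace n [⋀^Fin 2]→L[ℝ] ℂ :=
  (∑ i, ∑ j, formOf (fun _ => -(1 / (2 * Real.pi)) * (M.c i j : ℂ)) (D.z (M.e i))
    (fun s => (D.ϑ (M.e j) s : ℂ))) +
  (1 / (2 * Real.pi)) • ∑ γ : N.pos, lightPlus (D.w₁ γ) (D.w₂ γ)

/-- The form `ω₃`, in smooth coordinates. -/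
def formZero : RSpace n → RSpace n [⋀^Fin 2]→L[ℝ] ℂ :=
  (∑ i, ∑ j, (formOf (fun _ => -(1 / (8 * Real.pi)) * (M.c i j : ℂ))
      (fun s => (D.ϑ (M.e i) s : ℂ)) (fun s => (D.ϑ (M.e j) s : ℂ)) +
    formOf (fun _ => 1 / (4 * Real.pi) * (M.c i j : ℂ)) (D.z (M.e i))
      (fun s => conj (D.z (M.e j) s)))) +
  (1 / (4 * Real.pi)) • ∑ γ : N.pos, lightZero (D.w₁ γ) (D.w₂ γ)

variable [IsManifold 𝓘(ℂ, CSpace r) ∞ B]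

lemma smoothClosedAt (hs : s ∈ D.V) :
    SmoothClosedAt (D.formPlus M) s ∧ SmoothClosedAt (D.formZero M) s := by
  have hz := fun x => D.contDiffAt_z hs x
  have hϑ := fun x => contDiffAt_ofReal (D.contDiffAt_ϑ hs x)
  have hl := fun γ : N.pos =>
    contDiffAt_light (D.contDiffAt_w₁ hs γ) (D.contDiffAt_w₂ hs γ) (D.spec hs γ).2.2
  have hl' := fun γ : N.pos =>
    extDeriv_light (D.contDiffAt_w₁ hs γ) (D.contDiffAt_w₂ hs γ) (D.spec hs γ).2.2
  exact ⟨(SmoothClosedAt.sum _ fun i _ => SmoothClosedAt.sum _ fun j _ =>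
      smoothClosedAt_formOf_const _ (hz _) (hϑ _)).add
      ((SmoothClosedAt.sum _ fun γ _ => ⟨(hl γ).1, (hl' γ).1⟩).smul _),
    (SmoothClosedAt.sum _ fun i _ => SmoothClosedAt.sum _ fun j _ =>
      (smoothClosedAt_formOf_const _ (hϑ _) (hϑ _)).add
      (smoothClosedAt_formOf_const _ (hz _) (contDiffAt_conj (hz _)))).add
      ((SmoothClosedAt.sum _ fun γ _ => ⟨(hl γ).2, (hl' γ).2⟩).smul _)⟩

lemma formPlus_apply (hs : s ∈ D.V) (v w : RSpace n) : D.formPlus M s ![v, w] =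
    -(1 / (2 * Real.pi)) * (M.form (D.dz hs v) (D.dϑ hs w) - M.form (D.dz hs w) (D.dϑ hs v)) +
      1 / (2 * Real.pi) * ∑ γ : N.pos, lightPlus (D.w₁ γ) (D.w₂ γ) s ![v, w] := by
  rw [formPlus, InverseMatrix.form, InverseMatrix.form, Pi.add_apply,
    ContinuousAlternatingMap.add_apply]
  congr 1
  · simp only [Finset.sum_apply, ContinuousAlternatingMap.sum_apply]
    rw [← Finset.sum_sub_distrib, Finset.mul_sum]
    refine Finset.sum_congr rfl fun i _ => ?_
    rw [← Finset.sum_sub_distrib, Finset.mul_sum]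
    refine Finset.sum_congr rfl fun j _ => ?_
    rw [formOf_apply]
    simp only [fderiv_ofReal (D.differentiableAt_ϑ hs _), Matrix.cons_val_zero, Matrix.cons_val_one,
      dz, dϑ, AddMonoidHom.coe_mk, ZeroHom.coe_mk]
    ring
  · simp only [Pi.smul_apply, Finset.sum_apply, ContinuousAlternatingMap.smul_apply,
      ContinuousAlternatingMap.sum_apply, Complex.real_smul]
    push_cast
    rfl

/-- The complex conjugate of a homomorphism. -/
def conjHom {G : Type} [AddCommGroup G] (a : G →+ ℂ) : G →+ ℂ :=
  (starRingEnd ℂ).toAddMonoidHom.comp a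

lemma conjHom_apply {G : Type} [AddCommGroup G] (a : G →+ ℂ) (x : G) :
    conjHom a x = conj (a x) := rfl

lemma formZero_apply (hs : s ∈ D.V) (v w : RSpace n) : D.formZero M s ![v, w] =
    -(1 / (8 * Real.pi)) * (M.form (D.dϑ hs v) (D.dϑ hs w) - M.form (D.dϑ hs w) (D.dϑ hs v)) +
    1 / (4 * Real.pi) * (M.form (D.dz hs v) (conjHom (D.dz hs w)) -
      M.form (D.dz hs w) (conjHom (D.dz hs v))) +
      1 / (4 * Real.pi) * ∑ γ : N.pos, lightZero (D.w₁ γ) (D.w₂ γ) s ![v, w] := by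
  rw [formZero, InverseMatrix.form, InverseMatrix.form, InverseMatrix.form, InverseMatrix.form,
    Pi.add_apply, ContinuousAlternatingMap.add_apply]
  congr 1
  · simp only [Finset.sum_apply, ContinuousAlternatingMap.sum_apply]
    rw [← Finset.sum_sub_distrib, Finset.mul_sum, ← Finset.sum_sub_distrib, Finset.mul_sum,
      ← Finset.sum_add_distrib]
    refine Finset.sum_congr rfl fun i _ => ?_
    rw [← Finset.sum_sub_distrib, Finset.mul_sum, ← Finset.sum_sub_distrib, Finset.mul_sum,
      ← Finset.sum_add_distrib]
    refine Finset.sum_congr rfl fun j _ => ?_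
    rw [Pi.add_apply, ContinuousAlternatingMap.add_apply, formOf_apply, formOf_apply]
    simp only [fderiv_ofReal (D.differentiableAt_ϑ hs _), fderiv_conj (D.differentiableAt_z hs _),
      Matrix.cons_val_zero, Matrix.cons_val_one, conjHom_apply,
      dz, dϑ, AddMonoidHom.coe_mk, ZeroHom.coe_mk]
    ring
  · simp only [Pi.smul_apply, Finset.sum_apply, ContinuousAlternatingMap.smul_apply,
      ContinuousAlternatingMap.sum_apply, Complex.real_smul]
    push_cast
    rfl

omit [IsManifold 𝓘(ℂ, CSpace r) ∞ B] in
lemma conj_form {G : Type} [AddCommGroup G] {P : G →+ G →+ ℤ} (M : InverseMatrix P) (a b : G →+ ℂ) :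
    conj (M.form a b) = M.form (conjHom a) (conjHom b) := by
  simp [InverseMatrix.form, map_sum, conjHom_apply]

lemma conjHom_vanishes {G : Type} [AddCommGroup G] {P : G →+ G →+ ℤ} {a : G →+ ℂ}
    (h : VanishesOnRadical P a) : VanishesOnRadical P (conjHom a) := fun x hx => by
  rw [conjHom_apply, h x hx, map_zero]

lemma conj_formZero (hs : s ∈ D.V) (v w : RSpace n) :
    conj (D.formZero M s ![v, w]) = D.formZero M s ![v, w] := by
  have hP := pairL_antisymm N
  have hϑ : ∀ v, conjHom (D.dϑ hs v) = D.dϑ hs v := fun v => by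
    ext x
    exact Complex.conj_ofReal _
  have hzz : ∀ v, conjHom (conjHom (D.dz hs v)) = D.dz hs v := fun v => by
    ext x
    exact Complex.conj_conj _
  rw [D.formZero_apply M hs]
  simp only [map_add, map_mul, map_neg, map_sub, map_sum, conj_form, hϑ, hzz,
    conj_lightZero (D.contDiffAt_w₁ hs _) (D.contDiffAt_w₂ hs _), map_div₀, map_one, map_ofNat,
    Complex.conj_ofReal]
  rw [M.form_antisymm hP (conjHom_vanishes (D.dz_vanishes hs v)) (D.dz_vanishes hs w),
    M.form_antisymm hP (conjHom_vanishes (D.dz_vanishes hs w)) (D.dz_vanishes hs v)]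
  ring

/-- The reparametrisation of smooth coordinates along a smooth map. -/
def comp {m : ℕ} {f : RSpace m → RSpace n} (hf : ContDiff ℝ ∞ f) : Coords N (p ∘ f) where
  V := f ⁻¹' D.V
  isOpen := D.isOpen.preimage hf.continuous
  u := D.u ∘ f
  ϑ x := D.ϑ x ∘ f
  t γ := D.t γ ∘ f
  w₁ γ := D.w₁ γ ∘ f
  w₂ γ := D.w₂ γ ∘ f
  u_smooth := D.u_smooth.comp hf.contMDiff.contMDiffOn fun _ h => h
  ϑ_smooth x := (D.ϑ_smooth x).comp hf.contDiffOn fun _ h => h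
  t_smooth γ := (D.t_smooth γ).comp hf.contDiffOn fun _ h => h
  w₁_smooth γ := (D.w₁_smooth γ).comp hf.contDiffOn fun _ h => h
  w₂_smooth γ := (D.w₂_smooth γ).comp hf.contDiffOn fun _ h => h
  coords s hs := D.coords (f s) hs

/-- The coordinate forms commute with pullback along reparametrisations. -/
lemma form_comp {m : ℕ} {f : RSpace m → RSpace n} (hf : ContDiff ℝ ∞ f) {x : RSpace m}
    (hx : f x ∈ D.V) :
    (D.comp hf).formPlus M x = (D.formPlus M (f x)).compContinuousLinearMap (fderiv ℝ f x) ∧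
    (D.comp hf).formZero M x = (D.formZero M (f x)).compContinuousLinearMap (fderiv ℝ f x) := by
  have hfd : DifferentiableAt ℝ f x := hf.differentiable (by simp) x
  have hl := fun γ : N.pos => light_comp hfd (D.contDiffAt_w₁ hx γ) (D.contDiffAt_w₂ hx γ)
  have hz := fun x => D.differentiableAt_z hx x
  have hz' := fun x => (contDiffAt_conj (D.contDiffAt_z hx x)).differentiableAt (by simp)
  have hϑ := fun x => (contDiffAt_ofReal (D.contDiffAt_ϑ hx x)).differentiableAt (by simp)
  constructor
  · ext v
    simp only [formPlus, Pi.add_apply, Pi.smul_apply, Finset.sum_apply,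
      ContinuousAlternatingMap.add_apply, ContinuousAlternatingMap.smul_apply,
      ContinuousAlternatingMap.sum_apply, ContinuousAlternatingMap.compContinuousLinearMap_apply]
    refine congrArg₂ (· + ·) (Finset.sum_congr rfl fun i _ => Finset.sum_congr rfl fun j _ => ?_)
      (congrArg _ (Finset.sum_congr rfl fun γ _ => ?_))
    · exact congrArg (fun A => A v) (formOf_comp (f := fun _ => -(1 / (2 * Real.pi)) * (M.c i j : ℂ))
        (hz (M.e i)) (hϑ (M.e j)) hfd)
    · exact congrArg (fun A => A v) (hl γ).1
  · ext v
    simp only [formZero, Pi.add_apply, Pi.smul_apply, Finset.sum_apply,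
      ContinuousAlternatingMap.add_apply, ContinuousAlternatingMap.smul_apply,
      ContinuousAlternatingMap.sum_apply, ContinuousAlternatingMap.compContinuousLinearMap_apply]
    refine congrArg₂ (· + ·) (Finset.sum_congr rfl fun i _ => Finset.sum_congr rfl fun j _ =>
      congrArg₂ (· + ·) ?_ ?_) (congrArg _ (Finset.sum_congr rfl fun γ _ => ?_))
    · exact congrArg (fun A => A v) (formOf_comp (f := fun _ => -(1 / (8 * Real.pi)) * (M.c i j : ℂ))
        (hϑ (M.e i)) (hϑ (M.e j)) hfd)
    · exact congrArg (fun A => A v) (formOf_comp (f := fun _ => 1 / (4 * Real.pi) * (M.c i j : ℂ))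
        (hz (M.e i)) (hz' (M.e j)) hfd)
    · exact congrArg (fun A => A v) (hl γ).2

end Coords

end ModelGeometry

namespace ModelGeometry

open Set Filter

open scoped ComplexConjugate

/-! ### Change of coordinates -/

/-- A finite family of continuous functions on an open set has a nonempty open subset on which each
of them has no zero or vanishes identically. -/
lemma exists_open_of_family {X ι : Type*} [TopologicalSpace X] (F : Finset ι) {f : ι → X → ℂ}
    {O : Set X} (hO : IsOpen O) (hne : O.Nonempty) (hf : ∀ i ∈ F, ContinuousOn (f i) O) :
    ∃ O' ⊆ O, IsOpen O' ∧ O'.Nonempty ∧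
      ∀ i ∈ F, (∀ s ∈ O', f i s ≠ 0) ∨ ∀ s ∈ O', f i s = 0 := by
  classical
  induction F using Finset.induction_on with
  | empty => exact ⟨O, subset_rfl, hO, hne, by simp⟩
  | insert i F hi ih =>
    obtain ⟨O', h1, h2, h3, h4⟩ := ih fun j hj => hf j (Finset.mem_insert_of_mem hj)
    by_cases h : ∀ s ∈ O', f i s = 0
    · refine ⟨O', h1, h2, h3, fun j hj => ?_⟩
      rcases Finset.mem_insert.1 hj with rfl | hj
      · exact Or.inr h
      · exact h4 j hj
    · push Not at h
      obtain ⟨s, hs, hs0⟩ := h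
      have hc := (hf i (Finset.mem_insert_self i F)).mono h1
      refine ⟨O' ∩ f i ⁻¹' {0}ᶜ, inter_subset_left.trans h1,
        hc.isOpen_inter_preimage h2 isOpen_compl_singleton, ⟨s, hs, hs0⟩, fun j hj => ?_⟩
      rcases Finset.mem_insert.1 hj with rfl | hj
      · exact Or.inl fun s hs => hs.2
      · exact (h4 j hj).imp (fun h s hs => h s hs.1) fun h s hs => h s hs.1

lemma turn_mem {t : ℝ} (ht : |t| < 2 * Real.pi) : 0 ≤ t + 2 * Real.pi * turn t ∧
    t + 2 * Real.pi * turn t < 2 * Real.pi := by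
  obtain ⟨h1, h2⟩ := abs_lt.1 ht
  rw [turn]
  split_ifs with h
  · exact ⟨by simpa using h, by simpa using h2⟩
  · rw [mul_one]
    exact ⟨by linarith, by linarith⟩

lemma coe_add_turn (t : ℝ) : ((t + 2 * Real.pi * turn t : ℝ) : Real.Angle) = t := by
  rw [turn]
  split_ifs <;> simp

lemma eq_of_coe_eq {a b : ℝ} (ha : 0 ≤ a ∧ a < 2 * Real.pi) (hb : 0 ≤ b ∧ b < 2 * Real.pi)
    (h : (a : Real.Angle) = b) : a = b := by
  obtain ⟨k, hk⟩ := Real.Angle.angle_eq_iff_two_pi_dvd_sub.1 h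
  have hpi := Real.pi_pos
  have h1 : (k : ℝ) < 1 := by
    by_contra hc
    nlinarith [not_lt.1 hc]
  have h2 : (-1 : ℝ) < k := by
    by_contra hc
    nlinarith [not_lt.1 hc]
  have h3 : k = 0 := by
    have : k < 1 := by exact_mod_cast h1
    have : -1 < k := by exact_mod_cast h2
    omega
  rw [h3] at hk
  simp only [Int.cast_zero, mul_zero] at hk
  linarith

lemma liftAngle_of_abs_lt {t : ℝ} (ht : |t| < 2 * Real.pi) :
    liftAngle (t : Real.Angle) = t + 2 * Real.pi * turn t :=
  eq_of_coe_eq ⟨liftAngle_nonneg _, liftAngle_lt _⟩ (turn_mem ht)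
    (by rw [liftAngle_coe, coe_add_turn])

lemma coe_eq_zero_iff {t : ℝ} (ht : |t| < 2 * Real.pi) : (t : Real.Angle) = 0 ↔ t = 0 := by
  refine ⟨fun h => ?_, fun h => by simp [h]⟩
  have h1 : t + 2 * Real.pi * turn t = 0 :=
    eq_of_coe_eq (turn_mem ht) ⟨le_rfl, by positivity⟩ (by rw [coe_add_turn, h, Real.Angle.coe_zero])
  have h2 := abs_lt.1 ht
  rw [turn] at h1
  split_ifs at h1 with h0
  · simpa using h1
  · linarith

lemma coe_int_mul_congr (k : ℤ) {a b : ℝ} (h : (a : Real.Angle) = b) :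
    ((k * a : ℝ) : Real.Angle) = ((k * b : ℝ) : Real.Angle) := by
  rw [← zsmul_eq_mul, ← zsmul_eq_mul, Real.Angle.coe_zsmul, Real.Angle.coe_zsmul, h]

lemma coe_sum_congr {ι : Type*} (F : Finset ι) {a b : ι → ℝ}
    (h : ∀ i ∈ F, (a i : Real.Angle) = b i) :
    ((∑ i ∈ F, a i : ℝ) : Real.Angle) = ((∑ i ∈ F, b i : ℝ) : Real.Angle) := by
  have e : ∀ c : ι → ℝ, ((∑ i ∈ F, c i : ℝ) : Real.Angle) = ∑ i ∈ F, (c i : Real.Angle) := fun c =>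
    map_sum Real.Angle.coeHom c F
  rw [e, e]
  exact Finset.sum_congr rfl h

namespace Coords

open InverseMatrix (pairRight pairRight_apply)

variable {r : ℕ} {B : Type} [TopologicalSpace B] [ChartedSpace (CSpace r) B]
  {C : CoulombData r B} {N : SingularNbhd C} {n : ℕ} {p : RSpace n → N.Total}
  {s : RSpace n}

/-- A light charge that is collapsed at a point: its central charge and its angle vanish. -/
def Collapsed (D : Coords N p) (s : RSpace n) (γ : N.pos) : Prop :=
  zOf (D.w₁ γ) (D.w₂ γ) s = 0 ∧ tOf (D.w₁ γ) (D.w₂ γ) s = 0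

/-- Two systems of coordinates of a point have the same central charges and angles, and the
difference of the coordinates `ϑ` on the charges orthogonal to the collapsed ones is determined by
the arguments of the coordinates `w₁, w₂`. -/
lemma compare (D D' : Coords N p) (hs : s ∈ D.V) (hs' : s ∈ D'.V) :
    D'.u s = D.u s ∧
    (∀ γ, tOf (D'.w₁ γ) (D'.w₂ γ) s + 2 * Real.pi * turn (tOf (D'.w₁ γ) (D'.w₂ γ) s) =
      tOf (D.w₁ γ) (D.w₂ γ) s + 2 * Real.pi * turn (tOf (D.w₁ γ) (D.w₂ γ) s)) ∧
    ∃ β₁ β₂ β₁' β₂' : N.pos → ℝ,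
      (∀ γ, D.w₁ γ s = (‖D.w₁ γ s‖ : ℂ) * Complex.exp (β₁ γ * Complex.I) ∧
        D.w₂ γ s = (‖D.w₂ γ s‖ : ℂ) * Complex.exp (β₂ γ * Complex.I) ∧
        D'.w₁ γ s = (‖D'.w₁ γ s‖ : ℂ) * Complex.exp (β₁' γ * Complex.I) ∧
        D'.w₂ γ s = (‖D'.w₂ γ s‖ : ℂ) * Complex.exp (β₂' γ * Complex.I)) ∧
      ∀ x, (∀ γ : N.pos, D.Collapsed s γ → N.pairL x γ = 0) →
        ((D'.ϑ x s - D.ϑ x s : ℝ) : Real.Angle) = ((∑ γ : N.pos, (N.pairL x γ : ℝ) *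
          ((β₂ γ - turn (tOf (D.w₁ γ) (D.w₂ γ) s) * (β₁ γ + β₂ γ + Real.pi / 2)) -
            (β₂' γ - turn (tOf (D'.w₁ γ) (D'.w₂ γ) s) * (β₁' γ + β₂' γ + Real.pi / 2))) : ℝ) :
              Real.Angle) := by
  obtain ⟨P, hP, hPu, β₁, β₂, h1, h2, -, h4⟩ := D.coords s hs
  obtain ⟨P', hP', hPu', β₁', β₂', h1', h2', -, h4'⟩ := D'.coords s hs'
  have hrel : N.rel P P' := Quotient.exact (hP.symm.trans hP')
  have hl := N.rel_light hrel
  obtain ⟨hu, ε, hθ, hε⟩ := hrel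
  have hsp := D.spec hs
  have hsp' := D'.spec hs'
  have hT : ∀ γ : N.pos, liftAngle (P.θ γ) =
      tOf (D.w₁ γ) (D.w₂ γ) s + 2 * Real.pi * turn (tOf (D.w₁ γ) (D.w₂ γ) s) := fun γ => by
    rw [h1 γ]
    beta_reduce
    rw [(hsp γ).2.1, liftAngle_of_abs_lt (hsp γ).2.2]
  have hT' : ∀ γ : N.pos, liftAngle (P.θ γ) =
      tOf (D'.w₁ γ) (D'.w₂ γ) s + 2 * Real.pi * turn (tOf (D'.w₁ γ) (D'.w₂ γ) s) := fun γ => by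
    rw [← hl γ, h1' γ]
    beta_reduce
    rw [(hsp' γ).2.1, liftAngle_of_abs_lt (hsp' γ).2.2]
  refine ⟨by rw [← hPu, ← hPu', hu], fun γ => (hT' γ).symm.trans (hT γ), β₁, β₂, β₁', β₂',
    fun γ => ?_, fun x hx => ?_⟩
  · obtain ⟨a1, a2, -⟩ := h2 γ (mem_univ _)
    obtain ⟨a1', a2', -⟩ := h2' γ (mem_univ _)
    exact ⟨a1, a2, a1', a2'⟩
  · have e := hθ x
    rw [h4, h4', ← Real.Angle.coe_add] at e
    simp only [mem_univ, indicator_of_mem] at e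
    have e2 : ∀ a b c d f : ℝ, ((a + b : ℝ) : Real.Angle) = ((c + d + f : ℝ) : Real.Angle) →
        ((a - c : ℝ) : Real.Angle) = ((d + f - b : ℝ) : Real.Angle) := fun a b c d f h => by
      have h3 := congrArg (fun z => z - ((b + c : ℝ) : Real.Angle)) h
      simp only [← Real.Angle.coe_sub] at h3
      rwa [show a + b - (b + c) = a - c by ring, show c + d + f - (b + c) = d + f - b by ring] at h3
    rw [e2 _ _ _ _ _ e, ← Finset.sum_add_distrib, ← Finset.sum_sub_distrib]
    congr 1
    refine Finset.sum_congr rfl fun γ _ => ?_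
    by_cases hx0 : N.pairL x γ = 0
    · simp [hx0]
    -- the relation determines `ε` for a charge that is not collapsed; collapsed charges drop out
    -- since `⟨x, γ⟩ = 0`
    · have hS : ¬(N.Zt γ P.u = 0 ∧ P.θ γ = 0) := by
        rintro ⟨a1, a2⟩
        refine hx0 (hx γ ⟨?_, ?_⟩)
        · rw [← (hsp γ).1, ← hPu, a1]
        · rw [h1 γ] at a2
          beta_reduce at a2
          rw [(hsp γ).2.1] at a2
          exact (coe_eq_zero_iff (hsp γ).2.2).1 a2
      have hεγ := (hε γ).resolve_left hS
      have hα := (h2 γ (mem_univ _)).2.2.1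
      have hα' := (h2' γ (mem_univ _)).2.2.1
      have i1 := hT γ
      have i2 := hT' γ
      rw [hεγ, (hsp γ).2.1, (hsp' γ).2.1, ← mul_add, ← mul_sub]
      congr 1
      set T := liftAngle (P.θ γ) with hTdef
      have j1 : tOf (D.w₁ γ) (D.w₂ γ) s = T - 2 * Real.pi * turn (tOf (D.w₁ γ) (D.w₂ γ) s) := by
        linarith
      have j2 : tOf (D'.w₁ γ) (D'.w₂ γ) s =
          T - 2 * Real.pi * turn (tOf (D'.w₁ γ) (D'.w₂ γ) s) := by
        linarith
      rw [← hα, ← hα']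
      generalize turn (tOf (D.w₁ γ) (D.w₂ γ) s) = k at *
      generalize turn (tOf (D'.w₁ γ) (D'.w₂ γ) s) = k' at *
      rw [j1, j2]
      have hpi := Real.pi_ne_zero
      field_simp
      ring

/-- The point is generic: the central charges and the angles of the light charges that vanish there
vanish in a neighborhood. -/
def Generic (D : Coords N p) (s : RSpace n) : Prop :=
  ∀ γ, (zOf (D.w₁ γ) (D.w₂ γ) s ≠ 0 ∨ zOf (D.w₁ γ) (D.w₂ γ) =ᶠ[𝓝 s] 0) ∧
    (tOf (D.w₁ γ) (D.w₂ γ) s ≠ 0 ∨ tOf (D.w₁ γ) (D.w₂ γ) =ᶠ[𝓝 s] 0)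

lemma exists_generic (D : Coords N p) {O : Set (RSpace n)} (hO : IsOpen O) (hne : O.Nonempty)
    (hOV : O ⊆ D.V) : ∃ s ∈ O, D.Generic s := by
  obtain ⟨O₁, h1, h2, h3, h4⟩ := exists_open_of_family (Finset.univ : Finset N.pos) hO hne
    (f := fun γ => zOf (D.w₁ γ) (D.w₂ γ)) fun γ _ s hs =>
      (contDiffAt_zOf (D.contDiffAt_w₁ (hOV hs) γ)
        (D.contDiffAt_w₂ (hOV hs) γ)).continuousAt.continuousWithinAt
  obtain ⟨O₂, i1, i2, ⟨s, hs⟩, i4⟩ := exists_open_of_family (Finset.univ : Finset N.pos) h2 h3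
    (f := fun γ s => (tOf (D.w₁ γ) (D.w₂ γ) s : ℂ)) fun γ _ s hs =>
      (contDiffAt_ofReal (contDiffAt_tOf (D.contDiffAt_w₁ (hOV (h1 hs)) γ)
        (D.contDiffAt_w₂ (hOV (h1 hs)) γ))).continuousAt.continuousWithinAt
  refine ⟨s, h1 (i1 hs), fun γ => ⟨?_, ?_⟩⟩
  · refine (h4 γ (Finset.mem_univ _)).imp (fun h => h s (i1 hs)) fun h => ?_
    filter_upwards [h2.mem_nhds (i1 hs)] with s' hs'
    exact h s' hs'
  · refine (i4 γ (Finset.mem_univ _)).imp (fun h h0 => h s hs (by simp [h0])) fun h => ?_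
    filter_upwards [i2.mem_nhds hs] with s' hs'
    exact Complex.ofReal_eq_zero.1 (h s' hs')

lemma tOf_eq_zero_iff (D D' : Coords N p) (hs : s ∈ D.V) (hs' : s ∈ D'.V) (γ : N.pos) :
    tOf (D'.w₁ γ) (D'.w₂ γ) s = 0 ↔ tOf (D.w₁ γ) (D.w₂ γ) s = 0 := by
  have h := congrArg (fun t : ℝ => (t : Real.Angle)) ((compare D D' hs hs').2.1 γ)
  simp only [coe_add_turn] at h
  rw [← coe_eq_zero_iff (D.spec hs γ).2.2, ← coe_eq_zero_iff (D'.spec hs' γ).2.2, h]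

lemma zOf_eq (D D' : Coords N p) (hs : s ∈ D.V) (hs' : s ∈ D'.V) (γ : N.pos) :
    zOf (D'.w₁ γ) (D'.w₂ γ) s = zOf (D.w₁ γ) (D.w₂ γ) s := by
  rw [← (D.spec hs γ).1, ← (D'.spec hs' γ).1, (compare D D' hs hs').1]

lemma Generic.congr {D : Coords N p} (h : D.Generic s) (D' : Coords N p) (hs : s ∈ D.V)
    (hs' : s ∈ D'.V) : D'.Generic s := by
  intro γ
  constructor
  · refine (h γ).1.imp (fun h0 => by rwa [zOf_eq D D' hs hs']) fun h0 => ?_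
    filter_upwards [h0, D.mem_nhds hs, D'.mem_nhds hs'] with s' e h1 h2
    rw [zOf_eq D D' h1 h2, e]
  · refine (h γ).2.imp (fun h0 => by rwa [ne_eq, tOf_eq_zero_iff D D' hs hs']) fun h0 => ?_
    filter_upwards [h0, D.mem_nhds hs, D'.mem_nhds hs'] with s' e h1 h2
    exact (tOf_eq_zero_iff D D' h1 h2 γ).2 e

/-- The differentials of the coordinates `ϑ` of two systems differ by a
combination of the light charges; the coefficient of a charge that is not collapsed is the
difference of the differentials of its arguments. -/
lemma exists_dϑ_eq (D D' : Coords N p) (hs : s ∈ D.V) (hs' : s ∈ D'.V)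
    {b b' : N.pos → RSpace n → ℝ} (hb : ∀ γ, DifferentiableAt ℝ (b γ) s)
    (hb' : ∀ γ, DifferentiableAt ℝ (b' γ) s)
    (ha : ∀ γ, ¬D.Collapsed s γ → ∀ᶠ s' in 𝓝 s, ∀ β₁ β₂ : ℝ,
      D.w₁ γ s' = (‖D.w₁ γ s'‖ : ℂ) * Complex.exp (β₁ * Complex.I) →
      D.w₂ γ s' = (‖D.w₂ γ s'‖ : ℂ) * Complex.exp (β₂ * Complex.I) →
      (b γ s' : Real.Angle) = ((β₂ - turn (tOf (D.w₁ γ) (D.w₂ γ) s') *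
        (β₁ + β₂ + Real.pi / 2) : ℝ) : Real.Angle))
    (ha' : ∀ γ, ¬D.Collapsed s γ → ∀ᶠ s' in 𝓝 s, ∀ β₁ β₂ : ℝ,
      D'.w₁ γ s' = (‖D'.w₁ γ s'‖ : ℂ) * Complex.exp (β₁ * Complex.I) →
      D'.w₂ γ s' = (‖D'.w₂ γ s'‖ : ℂ) * Complex.exp (β₂ * Complex.I) →
      (b' γ s' : Real.Angle) = ((β₂ - turn (tOf (D'.w₁ γ) (D'.w₂ γ) s') *
        (β₁ + β₂ + Real.pi / 2) : ℝ) : Real.Angle)) (v : RSpace n) :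
    ∃ κ : N.pos → ℂ, D'.dϑ hs' v = D.dϑ hs v + ∑ γ, κ γ • pairRight N.pairL (γ : N.L) ∧
      ∀ γ, ¬D.Collapsed s γ → κ γ = fderiv ℝ (b γ) s v - fderiv ℝ (b' γ) s v := by
  classical
  set κ₀ : N.pos → ℂ := fun γ => fderiv ℝ (b γ) s v - fderiv ℝ (b' γ) s v with hκ₀
  have hcol : ∀ᶠ s' in 𝓝 s, ∀ γ, D.Collapsed s' γ → D.Collapsed s γ := by
    refine eventually_all.2 fun γ => ?_
    by_cases hc : D.Collapsed s γ
    · exact Eventually.of_forall fun _ _ => hc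
    · have hz := (contDiffAt_zOf (D.contDiffAt_w₁ hs γ) (D.contDiffAt_w₂ hs γ)).continuousAt
      have ht := (contDiffAt_tOf (D.contDiffAt_w₁ hs γ) (D.contDiffAt_w₂ hs γ)).continuousAt
      rcases not_and_or.1 hc with h | h
      · filter_upwards [hz.eventually_ne h] with s' h1 h2
        exact absurd h2.1 h1
      · filter_upwards [ht.eventually_ne h] with s' h1 h2
        exact absurd h2.2 h1
  -- for `x` orthogonal to the collapsed charges the change of `ϑ_x` is known modulo `2π`
  have horth : ∀ x, (∀ γ : N.pos, D.Collapsed s γ → N.pairL x γ = 0) →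
      D'.dϑ hs' v x - D.dϑ hs v x - ∑ γ, κ₀ γ * (N.pairL x γ : ℂ) = 0 := by
    intro x hx
    set h : RSpace n → ℝ := fun s' => D'.ϑ x s' - D.ϑ x s' -
      ∑ γ : N.pos, (N.pairL x γ : ℝ) * (b γ s' - b' γ s') with hh
    have hd : HasFDerivAt h (fderiv ℝ (D'.ϑ x) s - fderiv ℝ (D.ϑ x) s -
        ∑ γ : N.pos, (N.pairL x γ : ℝ) • (fderiv ℝ (b γ) s - fderiv ℝ (b' γ) s)) s :=
      ((D'.differentiableAt_ϑ hs' x).hasFDerivAt.sub (D.differentiableAt_ϑ hs x).hasFDerivAt).sub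
        (HasFDerivAt.fun_sum fun γ _ => ((hb γ).hasFDerivAt.sub (hb' γ).hasFDerivAt).const_mul _)
    have hzero : ∀ᶠ s' in 𝓝 s, (h s' : Real.Angle) = 0 := by
      have hall := eventually_all.2 fun γ : N.pos =>
        (eventually_imp_distrib_left (p := ¬D.Collapsed s γ)).2 (ha γ)
      have hall' := eventually_all.2 fun γ : N.pos =>
        (eventually_imp_distrib_left (p := ¬D.Collapsed s γ)).2 (ha' γ)
      filter_upwards [hcol, hall, hall', D.mem_nhds hs, D'.mem_nhds hs'] with s' c1 c2 c3 c4 c5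
      obtain ⟨-, -, β₁, β₂, β₁', β₂', hβ, hϑ⟩ := compare D D' c4 c5
      simp only [hh]
      rw [Real.Angle.coe_sub, hϑ x fun γ hγ => hx γ (c1 γ hγ), sub_eq_zero]
      refine coe_sum_congr _ fun γ _ => ?_
      by_cases hγ : D.Collapsed s γ
      · simp [hx γ hγ]
      · refine coe_int_mul_congr _ ?_
        obtain ⟨i1, i2, i3, i4⟩ := hβ γ
        rw [Real.Angle.coe_sub, Real.Angle.coe_sub (b γ s'), c2 γ hγ _ _ i1 i2, c3 γ hγ _ _ i3 i4]
    have h0 : fderiv ℝ h s = 0 := by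
      refine fderiv_eq_zero_of_angle hd.continuousAt ?_
      filter_upwards [hzero] with s' e
      rw [e, hzero.self_of_nhds]
    have h1 := congrArg (fun L : RSpace n →L[ℝ] ℝ => ((L v : ℝ) : ℂ)) (hd.fderiv.symm.trans h0)
    simp only [sub_apply, sum_apply, smul_apply, zero_apply, smul_eq_mul] at h1
    push_cast at h1
    rw [← h1]
    congr 1
    refine Finset.sum_congr rfl fun γ _ => ?_
    rw [hκ₀]
    ring
  -- hence the difference is a combination of the pairings with the collapsed charges
  obtain ⟨c, hc⟩ := exists_eq_sum_of_vanish (K := ℂ)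
    (fun γ : N.pos => if D.Collapsed s γ then N.pairL.flip (γ : N.L) else 0)
    (D'.dϑ hs' v - D.dϑ hs v - ∑ γ, κ₀ γ • pairRight N.pairL (γ : N.L)) fun x hx => by
      have hx' : ∀ γ : N.pos, D.Collapsed s γ → N.pairL x γ = 0 := fun γ hγ => by
        have := hx γ
        rwa [if_pos hγ] at this
      have := horth x hx'
      simpa [AddMonoidHom.finsetSum_apply] using this
  refine ⟨fun γ => if D.Collapsed s γ then κ₀ γ + c γ else κ₀ γ, ?_, fun γ hγ => if_neg hγ⟩
  ext x
  have h := hc x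
  simp only [AddMonoidHom.sub_apply, AddMonoidHom.finsetSum_apply, AddMonoidHom.smul_apply,
    pairRight_apply, smul_eq_mul] at h
  simp only [AddMonoidHom.add_apply, AddMonoidHom.finsetSum_apply, AddMonoidHom.smul_apply,
    pairRight_apply, smul_eq_mul]
  rw [sub_sub, sub_eq_iff_eq_add] at h
  rw [h, add_comm, add_assoc, ← Finset.sum_add_distrib]
  congr 1
  refine Finset.sum_congr rfl fun γ _ => ?_
  split_ifs
  · rw [AddMonoidHom.flip_apply]
    ring
  · simp

end Coords

end ModelGeometry

namespace ModelGeometry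

open Set Filter

open scoped ComplexConjugate

/-! ### Independence of the coordinates and gluing -/

namespace Coords

variable {r : ℕ} {B : Type} [TopologicalSpace B] [ChartedSpace (CSpace r) B]
  [IsManifold 𝓘(ℂ, CSpace r) ∞ B]
  {C : CoulombData r B} {N : SingularNbhd C} {n : ℕ} {p : RSpace n → N.Total}
  {s : RSpace n} (M : InverseMatrix N.pairL)

open InverseMatrix (pairRight pairRight_apply pairRight_vanishes)

lemma dz_eq (D D' : Coords N p) (hs : s ∈ D.V) (hs' : s ∈ D'.V) (v : RSpace n) :
    D'.dz hs' v = D.dz hs v := by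
  ext x
  have h : D'.z x =ᶠ[𝓝 s] D.z x := by
    filter_upwards [D.mem_nhds hs, D'.mem_nhds hs'] with s' h1 h2
    rw [z, z, (compare D D' h1 h2).1]
  exact congrArg (fun L : RSpace n →L[ℝ] ℂ => L v) h.fderiv_eq

/-- A change of coordinates changes `dϑ` by a multiple `κ_γ` of `⟨·, γ⟩` for each light charge. In
the pairing this adds `κ_γ dZ_γ` or `κ_γ dt_γ`, which is the change of the form of the charge `γ`:
for a charge that is not collapsed, `κ_γ` is the change of the argument `b`, and for a collapsed one
`dZ_γ` and `dt_γ` vanish at a generic point. -/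
lemma form_eq_of_generic (D D' : Coords N p) (hs : s ∈ D.V) (hs' : s ∈ D'.V) (hg : D.Generic s) :
    D'.formPlus M s = D.formPlus M s ∧ D'.formZero M s = D.formZero M s := by
  have hP := pairL_antisymm N
  have hg' := hg.congr D' hs hs'
  have hargs : ∀ E : Coords N p, s ∈ E.V → E.Generic s → ∀ γ, ∃ b : RSpace n → ℝ,
      DifferentiableAt ℝ b s ∧ (¬E.Collapsed s γ →
        (∀ v, fderiv ℝ b s v = if 0 ≤ tOf (E.w₁ γ) (E.w₂ γ) s then
          (fderiv ℝ (E.w₂ γ) s v / E.w₂ γ s).im else -(fderiv ℝ (E.w₁ γ) s v / E.w₁ γ s).im) ∧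
        ∀ᶠ s' in 𝓝 s, ∀ β₁ β₂ : ℝ,
          E.w₁ γ s' = (‖E.w₁ γ s'‖ : ℂ) * Complex.exp (β₁ * Complex.I) →
          E.w₂ γ s' = (‖E.w₂ γ s'‖ : ℂ) * Complex.exp (β₂ * Complex.I) →
          (b s' : Real.Angle) = ((β₂ - turn (tOf (E.w₁ γ) (E.w₂ γ) s') *
            (β₁ + β₂ + Real.pi / 2) : ℝ) : Real.Angle)) := by
    intro E hE hgE γ
    by_cases hc : E.Collapsed s γ
    · exact ⟨fun _ => 0, differentiableAt_const _, fun h => absurd hc h⟩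
    · obtain ⟨b, h1, h2, h3⟩ := exists_light_arg E.isOpen (E.w₁_smooth γ) (E.w₂_smooth γ) hE
        (hgE γ).2 hc
      exact ⟨b, h1, fun _ => ⟨h2, h3⟩⟩
  choose b hb hba using hargs D hs hg
  choose b' hb' hba' using hargs D' hs' hg'
  have hcol : ∀ γ, D'.Collapsed s γ ↔ D.Collapsed s γ := fun γ => by
    rw [Collapsed, Collapsed, zOf_eq D D' hs hs', tOf_eq_zero_iff D D' hs hs']
  have hκ := fun v => exists_dϑ_eq D D' hs hs' hb hb' (fun γ hγ => (hba γ hγ).2)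
    (fun γ hγ => (hba' γ fun h => hγ ((hcol γ).1 h)).2) v
  choose κ hκ1 hκ2 using hκ
  have hdz := dz_eq D D' hs hs'
  have hdzl : ∀ (γ : N.pos) v, fderiv ℝ (zOf (D'.w₁ γ) (D'.w₂ γ)) s v =
      fderiv ℝ (zOf (D.w₁ γ) (D.w₂ γ)) s v := fun γ v => by
    rw [← D.dz_light hs, ← D'.dz_light hs', hdz]
  have hdt' : ∀ (γ : N.pos) v, D'.dϑ hs' v γ = D.dϑ hs v γ := fun γ v => by
    rw [hκ1]
    simp [AddMonoidHom.finsetSum_apply, pair_light]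
  have hdt : ∀ (γ : N.pos) v, fderiv ℝ (tOf (D'.w₁ γ) (D'.w₂ γ)) s v =
      fderiv ℝ (tOf (D.w₁ γ) (D.w₂ γ)) s v := fun γ v => by
    have h := hdt' γ v
    rw [D.dϑ_light hs, D'.dϑ_light hs'] at h
    exact_mod_cast h
  have hT := (compare D D' hs hs').2.1
  have hzero : ∀ γ, D.Collapsed s γ → ∀ v, fderiv ℝ (zOf (D.w₁ γ) (D.w₂ γ)) s v = 0 ∧
      fderiv ℝ (tOf (D.w₁ γ) (D.w₂ γ)) s v = 0 := fun γ hγ v => by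
    have h1 := (hg γ).1.resolve_left (not_not.2 hγ.1)
    have h2 := (hg γ).2.resolve_left (not_not.2 hγ.2)
    rw [h1.fderiv_eq, h2.fderiv_eq]
    constructor
    · rw [show (0 : RSpace n → ℂ) = fun _ => 0 from rfl, fderiv_const_apply]
      rfl
    · rw [show (0 : RSpace n → ℝ) = fun _ => 0 from rfl, fderiv_const_apply]
      rfl
  have hl := fun (γ : N.pos) v w => light_eq (D.contDiffAt_w₁ hs γ) (D.contDiffAt_w₂ hs γ)
    (D.spec hs γ).2.2 (hg γ).1 (hg γ).2 (b := b γ) (fun h => (hba γ h).1) v w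
  have hl' := fun (γ : N.pos) v w => light_eq (D'.contDiffAt_w₁ hs' γ) (D'.contDiffAt_w₂ hs' γ)
    (D'.spec hs' γ).2.2 (hg' γ).1 (hg' γ).2 (b := b' γ) (fun h => (hba' γ h).1) v w
  have hpair : ∀ (a : N.L →+ ℂ) (_ : VanishesOnRadical N.pairL a) (w : RSpace n),
      M.form a (D'.dϑ hs' w) = M.form a (D.dϑ hs w) - ∑ γ : N.pos, κ w γ * a γ := by
    intro a ha w
    rw [hκ1, M.form_add_right, M.form_sum_right, sub_eq_add_neg, ← Finset.sum_neg_distrib]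
    congr 1
    refine Finset.sum_congr rfl fun γ _ => ?_
    rw [M.form_smul_right, M.form_pairRight hP ha, mul_neg]
  constructor
  · ext v
    rw [show v = ![v 0, v 1] from by ext i; fin_cases i <;> rfl]
    generalize v 0 = x
    generalize v 1 = y
    rw [D'.formPlus_apply M hs', D.formPlus_apply M hs, hdz, hdz,
      hpair _ (D.dz_vanishes hs x), hpair _ (D.dz_vanishes hs y)]
    have key : ∑ γ : N.pos, lightPlus (D'.w₁ γ) (D'.w₂ γ) s ![x, y] =
        ∑ γ : N.pos, lightPlus (D.w₁ γ) (D.w₂ γ) s ![x, y] -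
          (∑ γ : N.pos, κ y γ * D.dz hs x γ - ∑ γ : N.pos, κ x γ * D.dz hs y γ) := by
      rw [← Finset.sum_sub_distrib, ← Finset.sum_sub_distrib]
      refine Finset.sum_congr rfl fun γ _ => ?_
      rw [(hl γ x y).1, (hl' γ x y).1, hT γ, zOf_eq D D' hs hs', hdzl, hdzl, hdt, hdt,
        D.dz_light hs, D.dz_light hs]
      by_cases hγ : D.Collapsed s γ
      · rw [(hzero γ hγ x).1, (hzero γ hγ y).1]
        ring
      · rw [hκ2 x γ hγ, hκ2 y γ hγ]
        ring
    rw [key]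
    ring
  · ext v
    rw [show v = ![v 0, v 1] from by ext i; fin_cases i <;> rfl]
    generalize v 0 = x
    generalize v 1 = y
    have hpair' : ∀ x y : RSpace n, M.form (D'.dϑ hs' x) (D'.dϑ hs' y) =
        M.form (D.dϑ hs x) (D.dϑ hs y) + ∑ γ : N.pos, κ x γ * D.dϑ hs y γ -
          ∑ γ : N.pos, κ y γ * D.dϑ hs x γ := by
      intro x y
      rw [hpair _ (D'.dϑ_vanishes hs' x)]
      simp only [hdt']
      congr 1
      rw [hκ1, M.form_add_left, M.form_sum_left]
      congr 1
      refine Finset.sum_congr rfl fun γ _ => ?_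
      rw [M.form_smul_left, M.pairRight_form hP (D.dϑ_vanishes hs y)]
    rw [D'.formZero_apply M hs', D.formZero_apply M hs, hdz, hdz, hpair', hpair']
    have key : ∑ γ : N.pos, lightZero (D'.w₁ γ) (D'.w₂ γ) s ![x, y] =
        ∑ γ : N.pos, lightZero (D.w₁ γ) (D.w₂ γ) s ![x, y] -
          (∑ γ : N.pos, κ y γ * D.dϑ hs x γ - ∑ γ : N.pos, κ x γ * D.dϑ hs y γ) := by
      rw [← Finset.sum_sub_distrib, ← Finset.sum_sub_distrib]
      refine Finset.sum_congr rfl fun γ _ => ?_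
      rw [(hl γ x y).2, (hl' γ x y).2, hT γ, zOf_eq D D' hs hs', hdzl, hdzl, hdt, hdt,
        D.dϑ_light hs, D.dϑ_light hs]
      by_cases hγ : D.Collapsed s γ
      · rw [(hzero γ hγ x).2, (hzero γ hγ y).2]
        push_cast
        ring
      · rw [hκ2 x γ hγ, hκ2 y γ hγ]
        ring
    rw [key]
    ring

/-- The forms do not depend on the coordinates: generic points are dense. -/
theorem form_eq (D D' : Coords N p) (hs : s ∈ D.V) (hs' : s ∈ D'.V) :
    D'.formPlus M s = D.formPlus M s ∧ D'.formZero M s = D.formZero M s := by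
  have key : ∀ Φ Φ' : RSpace n → RSpace n [⋀^Fin 2]→L[ℝ] ℂ,
      ContinuousOn Φ (D.V ∩ D'.V) → ContinuousOn Φ' (D.V ∩ D'.V) →
      (∀ x ∈ D.V, x ∈ D'.V → D.Generic x → Φ' x = Φ x) → Φ' s = Φ s := by
    intro Φ Φ' hΦ hΦ' h
    by_contra hne
    have hO : IsOpen ((D.V ∩ D'.V) ∩ (fun x => Φ' x - Φ x) ⁻¹' {0}ᶜ) :=
      (hΦ'.sub hΦ).isOpen_inter_preimage (D.isOpen.inter D'.isOpen) isOpen_compl_singleton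
    -- if the continuous forms differed at `s`, they would differ at a generic point nearby
    obtain ⟨x, hx, hgx⟩ := D.exists_generic hO ⟨s, ⟨hs, hs'⟩, sub_ne_zero.2 hne⟩
      fun x hx => hx.1.1
    exact hx.2 (sub_eq_zero.2 (h x hx.1.1 hx.1.2 hgx))
  have hc := fun x (hx : x ∈ D.V ∩ D'.V) => D.smoothClosedAt M hx.1
  have hc' := fun x (hx : x ∈ D.V ∩ D'.V) => D'.smoothClosedAt M hx.2
  exact ⟨key _ _ (fun x hx => (hc x hx).1.1.continuousAt.continuousWithinAt)
      (fun x hx => (hc' x hx).1.1.continuousAt.continuousWithinAt)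
      fun x h1 h2 h3 => (form_eq_of_generic M D D' h1 h2 h3).1,
    key _ _ (fun x hx => (hc x hx).2.1.continuousAt.continuousWithinAt)
      (fun x hx => (hc' x hx).2.1.continuousAt.continuousWithinAt)
      fun x h1 h2 h3 => (form_eq_of_generic M D D' h1 h2 h3).2⟩

end Coords

section Glue

variable {r : ℕ} {B : Type} [TopologicalSpace B] [ChartedSpace (CSpace r) B]
  [IsManifold 𝓘(ℂ, CSpace r) ∞ B] {C : CoulombData r B} (N : SingularNbhd C)

/-- A smooth closed 2-form in each system of smooth coordinates, independent of the coordinates and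
compatible with reparametrisations. -/
structure CoordForm where
  form : ∀ {n : ℕ} {p : RSpace n → N.Total}, Coords N p → RSpace n → RSpace n [⋀^Fin 2]→L[ℝ] ℂ
  unique : ∀ {n : ℕ} {p : RSpace n → N.Total} (D D' : Coords N p) {s : RSpace n}, s ∈ D.V →
    s ∈ D'.V → form D' s = form D s
  smoothClosed : ∀ {n : ℕ} {p : RSpace n → N.Total} (D : Coords N p) {s : RSpace n}, s ∈ D.V →
    SmoothClosedAt (form D) s
  comp : ∀ {n m : ℕ} {p : RSpace n → N.Total} (D : Coords N p) {f : RSpace m → RSpace n}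
    (hf : ContDiff ℝ ∞ f) {x : RSpace m}, f x ∈ D.V →
    form (D.comp hf) x = (form D (f x)).compContinuousLinearMap (fderiv ℝ f x)

variable {N} (Φ : CoordForm N)

open Classical in
/-- The value of a form given in coordinates. -/
def CoordForm.toFun {n : ℕ} (p : RSpace n → N.Total) (s : RSpace n) :
    RSpace n [⋀^Fin 2]→L[ℝ] ℂ :=
  if h : ∃ D : Coords N p, s ∈ D.V then Φ.form h.choose s else 0

omit [IsManifold 𝓘(ℂ, CSpace r) ∞ B] in
lemma CoordForm.toFun_eq {n : ℕ} {p : RSpace n → N.Total} (D : Coords N p) {s : RSpace n}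
    (hs : s ∈ D.V) : Φ.toFun p s = Φ.form D s := by
  have h : ∃ D : Coords N p, s ∈ D.V := ⟨D, hs⟩
  rw [CoordForm.toFun, dif_pos h]
  exact Φ.unique _ _ hs h.choose_spec

omit [IsManifold 𝓘(ℂ, CSpace r) ∞ B] in
lemma CoordForm.smoothClosedAt_toFun {n : ℕ} {p : RSpace n → N.Total} (D : Coords N p)
    {s : RSpace n} (hs : s ∈ D.V) : SmoothClosedAt (Φ.toFun p) s := by
  have h : Φ.toFun p =ᶠ[𝓝 s] Φ.form D := by
    filter_upwards [D.mem_nhds hs] with s' hs'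
    exact Φ.toFun_eq D hs'
  have hD := Φ.smoothClosed D hs
  exact ⟨hD.1.congr_of_eventuallyEq h, by rw [h.extDeriv_eq, hD.2]⟩

lemma exists_coords_of_isPlot {n : ℕ} {p : RSpace n → N.Total} (hp : Diffeology.IsPlot p)
    (s : RSpace n) : ∃ D : Coords N p, s ∈ D.V :=
  exists_coords (show N.SmoothOn univ p from hp) s

/-- The form on `M_U` that is given by a form in coordinates. -/
def CoordForm.toDForm : DForm 2 N.Total where
  toFun p s := Φ.toFun p s
  contDiff p hp := contDiff_iff_contDiffAt.2 fun s => by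
    obtain ⟨D, hD⟩ := exists_coords_of_isPlot hp s
    exact (Φ.smoothClosedAt_toFun D hD).1
  pullback p hp f hf s := by
    obtain ⟨D, hD⟩ := exists_coords_of_isPlot hp (f s)
    rw [Φ.toFun_eq D hD, ← Φ.comp D hf hD]
    exact Φ.toFun_eq (D.comp hf) hD

lemma CoordForm.toDForm_closed : Φ.toDForm.IsClosed := fun _ _ hp s => by
  obtain ⟨D, hD⟩ := exists_coords_of_isPlot hp s
  exact (Φ.smoothClosedAt_toFun D hD).2

/-- The form `ω₊`. -/
def coordPlus (M : InverseMatrix N.pairL) : CoordForm N where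
  form D := D.formPlus M
  unique D D' _ hs hs' := (Coords.form_eq M D D' hs hs').1
  smoothClosed D _ hs := (D.smoothClosedAt M hs).1
  comp D _ hf _ hx := (D.form_comp M hf hx).1

/-- The form `ω₃`. -/
def coordZero (M : InverseMatrix N.pairL) : CoordForm N where
  form D := D.formZero M
  unique D D' _ hs hs' := (Coords.form_eq M D D' hs hs').2
  smoothClosed D _ hs := (D.smoothClosedAt M hs).2
  comp D _ hf _ hx := (D.form_comp M hf hx).2

/-- Complex conjugation of 2-forms. -/
def conjForm {E : Type*} [NormedAddCommGroup E] [NormedSpace ℝ E] :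
    (E [⋀^Fin 2]→L[ℝ] ℂ) →L[ℝ] E [⋀^Fin 2]→L[ℝ] ℂ :=
  ContinuousLinearMap.compContinuousAlternatingMapCLM (𝕜 := ℝ) (E := E) (ι := Fin 2) (F := ℂ) (G := ℂ)
    (Complex.conjCLE : ℂ →L[ℝ] ℂ)

lemma SmoothClosedAt.conj {E : Type*} [NormedAddCommGroup E] [NormedSpace ℝ E]
    {η : E → E [⋀^Fin 2]→L[ℝ] ℂ} {s : E} (h : SmoothClosedAt η s) :
    SmoothClosedAt (fun s => conjForm (η s)) s := by
  have h1 : ContDiffAt ℝ ∞ (fun s => conjForm (η s)) s :=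
    ContDiffAt.comp (g := conjForm) s (conjForm (E := E)).contDiff.contDiffAt h.1
  refine ⟨h1, ContinuousAlternatingMap.ext fun v => ?_⟩
  rw [extDeriv_apply (h1.differentiableAt (by simp))]
  have h2 : extDeriv η s v = 0 := by
    rw [h.2]
    rfl
  rw [extDeriv_apply h.differentiableAt] at h2
  have h3 := congrArg (starRingEnd ℂ) h2
  rw [map_sum] at h3
  have h4 : ∀ i : Fin 3, fderiv ℝ (fun x => conjForm (η x) (i.removeNth v)) s (v i) =
      (starRingEnd ℂ) (fderiv ℝ (fun x => η x (i.removeNth v)) s (v i)) := fun i => by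
    have hd : DifferentiableAt ℝ (fun x => η x (i.removeNth v)) s :=
      (ContinuousAlternatingMap.apply ℝ E ℂ (i.removeNth v)).differentiableAt.comp s
        h.differentiableAt
    exact fderiv_conj hd (v i)
  simp only [h4]
  refine Eq.trans (Finset.sum_congr rfl fun i _ => ?_) (h3.trans (map_zero _))
  simp

/-- The form `ω₋`. -/
def coordMinus (M : InverseMatrix N.pairL) : CoordForm N where
  form D s := conjForm (D.formPlus M s)
  unique D D' _ hs hs' := congrArg _ (Coords.form_eq M D D' hs hs').1
  smoothClosed D _ hs := (D.smoothClosedAt M hs).1.conj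
  comp D _ hf _ hx := by
    rw [(D.form_comp M hf hx).1]
    rfl

end Glue

end ModelGeometry

namespace ModelGeometry

open Set MeasureTheory Filter

/-! ### The contribution of a pair of opposite light charges -/

section LightMatching

open scoped ComplexConjugate

lemma bpsQ_neg (ρ t s : ℝ) : bpsQ ρ (-t) s = conj (bpsQ ρ t s) := by
  have h : bpsX ρ (-t) s = conj (bpsX ρ t s) := by
    rw [bpsX, bpsX, map_mul, Complex.conj_ofReal, ← Complex.exp_conj, map_mul, Complex.conj_I,
      Complex.conj_ofReal]
    push_cast
    ring_nf
  rw [bpsQ, bpsQ, h, map_div₀, map_sub, map_one]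

lemma bpsA0_neg (ρ t : ℝ) : bpsA0 ρ (-t) = conj (bpsA0 ρ t) := by
  rw [bpsA0, bpsA0, ← integral_conj]
  simp only [bpsQ_neg, map_mul, Complex.conj_ofReal]

lemma bpsA1_neg (ρ t : ℝ) : bpsA1 ρ (-t) = conj (bpsA1 ρ t) := by
  rw [bpsA1, bpsA1, ← integral_conj]
  simp only [bpsQ_neg, map_mul, Complex.conj_ofReal]

/-- The form of `rayForm_wedge` in which the central charge is the variable. -/
lemma rayForm_wedge_of_ne_zero {ζ z : ℂ} {ψ κ t : ℝ} (hζ : ζ ≠ 0) (hκ : 0 ≤ κ) (hκ1 : κ < 1)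
    (h : (ζ * Complex.exp (-(ψ * Complex.I))).re ≤ κ * ‖ζ‖) (hz : z ≠ 0) (hφ : (-z).arg ≤ ψ)
    (hψ : ψ < (-z).arg + Real.pi / 2) (v w : ℂ × ℝ) :
    (∫ s in Ioi (0 : ℝ), rayForm ζ ψ (z, t) s) v * sfExp ζ w -
        (∫ s in Ioi (0 : ℝ), rayForm ζ ψ (z, t) s) w * sfExp ζ v =
      Complex.I * (v.1 * w.2 - w.1 * v.2) *
          (bpsA0 ‖z‖ t / ζ - conj z / ‖z‖ * bpsA1 ‖z‖ t) +
        (v.1 * conj w.1 - w.1 * conj v.1) *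
          (-(z / ‖z‖) * bpsA1 ‖z‖ t / ζ + 2 * bpsA0 ‖z‖ t -
            ζ * (conj z / ‖z‖ * bpsA1 ‖z‖ t)) +
        Complex.I * (v.2 * conj w.1 - w.2 * conj v.1) *
          (-(z / ‖z‖) * bpsA1 ‖z‖ t + ζ * bpsA0 ‖z‖ t) := by
  have hρ : 0 < ‖z‖ := norm_pos_iff.2 hz
  have hρ' : (‖z‖ : ℂ) ≠ 0 := by exact_mod_cast hρ.ne'
  have h1 : -((‖z‖ : ℂ) * Complex.exp ((-z).arg * Complex.I)) = z := by
    rw [← norm_neg z, Complex.norm_mul_exp_arg_mul_I, neg_neg]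
  have h2 : Complex.exp ((-z).arg * Complex.I) = -(z / ‖z‖) := by
    rw [← neg_div, eq_div_iff hρ', mul_comm]
    linear_combination -h1
  have h3 : Complex.exp (-((-z).arg * Complex.I)) = -(conj z / ‖z‖) := by
    have : Complex.exp (-((-z).arg * Complex.I)) = conj (Complex.exp ((-z).arg * Complex.I)) := by
      rw [← Complex.exp_conj, map_mul, Complex.conj_I, Complex.conj_ofReal, mul_neg]
    rw [this, h2, map_neg, map_div₀, Complex.conj_ofReal]
  have := rayForm_wedge (t := t) hζ hκ hκ1 h hρ hφ hψ v w
  simp only [h1] at this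
  rw [this, h2, h3]
  ring

/-- The contributions of the light charges `±γ` together. -/
lemma rayForm_wedge_add_neg {ζ z : ℂ} {ψ ψ' κ t : ℝ} (hζ : ζ ≠ 0) (hκ : 0 ≤ κ) (hκ1 : κ < 1)
    (h : (ζ * Complex.exp (-(ψ * Complex.I))).re ≤ κ * ‖ζ‖)
    (h' : (ζ * Complex.exp (-(ψ' * Complex.I))).re ≤ κ * ‖ζ‖) (hz : z ≠ 0)
    (hψ : ψ ∈ Ico (-z).arg ((-z).arg + Real.pi / 2))
    (hψ' : ψ' ∈ Ico z.arg (z.arg + Real.pi / 2)) (v w : ℂ × ℝ) :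
    ((∫ s in Ioi (0 : ℝ), rayForm ζ ψ (z, t) s) v +
          (∫ s in Ioi (0 : ℝ), rayForm ζ ψ' (-z, -t) s) v) * sfExp ζ w -
        ((∫ s in Ioi (0 : ℝ), rayForm ζ ψ (z, t) s) w +
          (∫ s in Ioi (0 : ℝ), rayForm ζ ψ' (-z, -t) s) w) * sfExp ζ v =
      Complex.I * (v.1 * w.2 - w.1 * v.2) *
          (2 * (bpsA0 ‖z‖ t).re / ζ - conj z / ‖z‖ * (2 * (bpsA1 ‖z‖ t).im * Complex.I)) +
        (v.1 * conj w.1 - w.1 * conj v.1) *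
          (-(z / ‖z‖) * (2 * (bpsA1 ‖z‖ t).im * Complex.I) / ζ + 4 * (bpsA0 ‖z‖ t).re -
            ζ * (conj z / ‖z‖ * (2 * (bpsA1 ‖z‖ t).im * Complex.I))) +
        Complex.I * (v.2 * conj w.1 - w.2 * conj v.1) *
          (-(z / ‖z‖) * (2 * (bpsA1 ‖z‖ t).im * Complex.I) + ζ * (2 * (bpsA0 ‖z‖ t).re)) := by
  have h1 := rayForm_wedge_of_ne_zero (t := t) hζ hκ hκ1 h hz hψ.1 hψ.2 v w
  have h2 := rayForm_wedge_of_ne_zero (t := -t) hζ hκ hκ1 h' (neg_ne_zero.2 hz)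
    (by rw [neg_neg]; exact hψ'.1) (by rw [neg_neg]; exact hψ'.2) v w
  rw [norm_neg, bpsA0_neg, bpsA1_neg, map_neg] at h2
  have e0 : (2 * (bpsA0 ‖z‖ t).re : ℂ) = bpsA0 ‖z‖ t + conj (bpsA0 ‖z‖ t) := by
    rw [Complex.add_conj]
    push_cast
    ring
  have e1 : (2 * (bpsA1 ‖z‖ t).im * Complex.I : ℂ) = bpsA1 ‖z‖ t - conj (bpsA1 ‖z‖ t) := by
    rw [Complex.sub_conj]
    push_cast
    ring
  rw [show (4 * (bpsA0 ‖z‖ t).re : ℂ) = 2 * (2 * (bpsA0 ‖z‖ t).re) by ring, e0, e1]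
  linear_combination h1 + h2

/-- The coefficient of `⟨·, γ⟩` in `d log X^model(ζ)`, for a light charge `γ` with central charge `z`,
angle `t` and argument `α`: `b` is the derivative of the argument of `w₂`, and `Λ` the derivative of
the contributions of the rays of `γ` and `-γ`. -/
def lightCoeff (ζ z : ℂ) (t α : ℝ) (v : ℂ × ℝ) (b : ℝ) (Λ : ℂ) : ℂ :=
  Complex.I * (b + (v.1 / z).im * ((t - Real.pi) / (2 * Real.pi)) + α / (2 * Real.pi) * v.2) +
    1 / (2 * Real.pi * Complex.I) * ((Real.log (‖z‖ / Real.pi) + α * Complex.I) * v.1 / ζ -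
      ζ * ((Real.log (‖z‖ / Real.pi) - α * Complex.I) * conj v.1)) -
    1 / (4 * Real.pi * Complex.I) * Λ

/-- The instanton corrections of a pair of light charges agree with the local model: the choice of
the argument of the central charge drops out. -/
lemma lightCoeff_wedge {ζ z : ℂ} {t α : ℝ} (hζ : ζ ≠ 0) (hz : z ≠ 0) (v w : ℂ × ℝ) (b b' : ℝ)
    (Λ Λ' T T' : ℂ)
    (hΛ : Λ * sfExp ζ w - Λ' * sfExp ζ v =
      Complex.I * (v.1 * w.2 - w.1 * v.2) *
          (2 * (bpsA0 ‖z‖ t).re / ζ - conj z / ‖z‖ * (2 * (bpsA1 ‖z‖ t).im * Complex.I)) +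
        (v.1 * conj w.1 - w.1 * conj v.1) *
          (-(z / ‖z‖) * (2 * (bpsA1 ‖z‖ t).im * Complex.I) / ζ + 4 * (bpsA0 ‖z‖ t).re -
            ζ * (conj z / ‖z‖ * (2 * (bpsA1 ‖z‖ t).im * Complex.I))) +
        Complex.I * (v.2 * conj w.1 - w.2 * conj v.1) *
          (-(z / ‖z‖) * (2 * (bpsA1 ‖z‖ t).im * Complex.I) + ζ * (2 * (bpsA0 ‖z‖ t).re)))
    (hT : T = (v.1 * b' - w.1 * b) -
      instW ‖z‖ t / (2 * Complex.I * conj z) * (v.1 * conj w.1 - w.1 * conj v.1) -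
      Complex.I * instU ‖z‖ t * (v.1 * w.2 - w.1 * v.2))
    (hT' : T' = (v.2 * b' - w.2 * b) +
      instW ‖z‖ t / (2 * Complex.I) * ((v.2 * w.1 - w.2 * v.1) / z -
        (v.2 * conj w.1 - w.2 * conj v.1) / conj z) +
      2 * Complex.I * instU ‖z‖ t * (v.1 * conj w.1 - w.1 * conj v.1)) :
    -(Complex.I / ζ) * T + T' - Complex.I * ζ * conj T =
      lightCoeff ζ z t α v b Λ * sfExp ζ w - lightCoeff ζ z t α w b' Λ' * sfExp ζ v := by
  have hρ : (‖z‖ : ℂ) ≠ 0 := by exact_mod_cast (norm_ne_zero_iff.2 hz)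
  have hzc : conj z ≠ 0 := (map_ne_zero _).2 hz
  have hρ2 : z * conj z = (‖z‖ : ℂ) ^ 2 := by
    rw [Complex.mul_conj, Complex.normSq_eq_norm_sq]
    push_cast
    rfl
  have hpi : (Real.pi : ℂ) ≠ 0 := by exact_mod_cast Real.pi_ne_zero
  have hI := Complex.I_ne_zero
  have hI2 := Complex.I_sq
  have hr : ∀ x : ℂ, z / ‖z‖ * x = ‖z‖ * x / conj z := fun x => by
    field_simp
    linear_combination x * hρ2
  have hr' : ∀ x : ℂ, conj z / ‖z‖ * x = ‖z‖ * x / z := fun x => by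
    field_simp
    linear_combination x * hρ2
  have hsplit : lightCoeff ζ z t α v b Λ * sfExp ζ w - lightCoeff ζ z t α w b' Λ' * sfExp ζ v =
      lightCoeff ζ z t α v b 0 * sfExp ζ w - lightCoeff ζ z t α w b' 0 * sfExp ζ v -
        1 / (4 * Real.pi * Complex.I) * (Λ * sfExp ζ w - Λ' * sfExp ζ v) := by
    simp only [lightCoeff]
    ring
  rw [hsplit, hΛ, hT, hT']
  simp only [neg_mul, hr, hr']
  simp only [lightCoeff, sfExp_apply, ofReal_im_div, instU, instW, map_sub, map_mul, map_div₀,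
    Complex.conj_I, Complex.conj_ofReal, Complex.conj_conj, map_ofNat]
  push_cast
  -- the identity is rational once the conjugates and transcendental quantities are variables
  generalize conj z = x at *
  generalize conj v.1 = v₁ at *
  generalize conj w.1 = w₁ at *
  generalize (Real.log (‖z‖ / Real.pi) : ℂ) = L
  generalize ((bpsA0 ‖z‖ t).re : ℂ) = A
  generalize ((bpsA1 ‖z‖ t).im : ℂ) = A'
  generalize (‖z‖ : ℂ) = ρ at *
  generalize (Real.pi : ℂ) = π' at *
  clear hsplit hΛ hT hT' hr hr' hρ2
  have hI3 : Complex.I ^ 3 = -Complex.I := Complex.I_pow_three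
  field_simp
  ring_nf
  simp only [hI2, hI3]
  ring_nf

end LightMatching

end ModelGeometry

namespace ModelGeometry

open Set Filter

/-! ### Coordinates at regular points -/

section RegularPoint

variable {r : ℕ} {B : Type} [TopologicalSpace B] [ChartedSpace (CSpace r) B]
  {C : CoulombData r B} {N : SingularNbhd C}

lemma Zt_ne_zero {u : B} (hu : u ∈ N.U \ C.disc) (γ : N.pos) : N.Zt γ u ≠ 0 := fun h =>
  hu.2 ((N.disc_eq.symm ▸ (⟨hu.1, γ, h⟩ : u ∈ {u ∈ N.U | ∃ γ : N.pos, N.Zt γ u = 0}) :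
    u ∈ C.disc ∩ N.U)).1

lemma IsBranch.exists_int {ι : Type} {z : ι → ℂ} {α α' : ι → ℝ} (h : IsBranch z α)
    (h' : IsBranch z α') (hz : ∀ i, z i ≠ 0) : ∃ k : ι → ℤ, α' = fun i => α i + 2 * Real.pi * k i := by
  have key : ∀ i, ∃ k : ℤ, α' i = α i + 2 * Real.pi * k := fun i => by
    obtain ⟨k, hk⟩ := Real.Angle.angle_eq_iff_two_pi_dvd_sub.1 (coe_eq_of_exp (hz i) (h' i) (h i))
    exact ⟨k, by linarith⟩
  choose k hk using key
  exact ⟨k, funext hk⟩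

namespace SingularNbhd.Regular

variable (m : N.Regular)

lemma θ_zero : m.θ 0 = 0 := by
  have h := m.twisted 0 0
  simpa using h

/-- The restriction of a twisted character to the isotropic lattice of light charges is a
homomorphism. -/
lemma θ_frame_sum {α : N.pos → ℝ} (hα : IsBranch (fun γ : N.pos => N.Zt γ m.u) α) {T : N.pos → ℝ}
    (hT : ∀ γ : N.pos, (T γ : Real.Angle) = m.θ (N.frame m.u α γ)) (k : N.pos → ℤ) :
    m.θ (N.frame m.u α (∑ γ : N.pos, k γ • (γ : N.L))) =
      ((∑ γ : N.pos, k γ * T γ : ℝ) : Real.Angle) := by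
  have hadd : ∀ x ∈ N.light, ∀ y ∈ N.light, m.θ (N.frame m.u α (x + y)) =
      m.θ (N.frame m.u α x) + m.θ (N.frame m.u α y) := fun x hx y hy => by
    rw [map_add, m.twisted, N.frame_pair _ m.mem _ hα, N.light_isotropic x hx y hy]
    simp
  let F : N.light →+ Real.Angle :=
    { toFun := fun x => m.θ (N.frame m.u α x)
      map_zero' := by simpa using m.θ_zero
      map_add' := fun x y => hadd x x.2 y y.2 }
  have h : ∑ γ : N.pos, k γ • (γ : N.L) =
      ((∑ γ : N.pos, k γ • (⟨γ, N.pos_light _ γ.2⟩ : N.light) : N.light) : N.L) := by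
    simp
  rw [h]
  change F _ = _
  rw [map_sum, ← Real.Angle.coe_coeHom, map_sum]
  refine Finset.sum_congr rfl fun γ _ => ?_
  rw [map_zsmul, Real.Angle.coe_coeHom, ← zsmul_eq_mul, Real.Angle.coe_zsmul, hT]
  rfl

/-- The dependence of the angles of the charges `frame α x` on the arguments `α`. -/
lemma θ_frame_branch {α α' : N.pos → ℝ} (hα : IsBranch (fun γ : N.pos => N.Zt γ m.u) α)
    (hα' : IsBranch (fun γ : N.pos => N.Zt γ m.u) α') {T : N.pos → ℝ}
    (hT : ∀ γ : N.pos, (T γ : Real.Angle) = m.θ (N.frame m.u α γ)) (x : N.L) :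
    m.θ (N.frame m.u α' x) = m.θ (N.frame m.u α x) +
      ((∑ γ : N.pos, (N.pairL x γ : ℝ) * ((α' γ - α γ) / (2 * Real.pi) * (T γ - Real.pi)) : ℝ) :
        Real.Angle) := by
  have hpi := Real.pi_ne_zero
  obtain ⟨k, rfl⟩ := hα.exists_int hα' (Zt_ne_zero m.mem)
  rw [N.frame_monodromy _ m.mem _ hα, map_add, m.twisted, N.frame_pair _ m.mem _ hα,
    m.θ_frame_sum hα hT, add_assoc, ← Real.Angle.coe_add, map_sum]
  simp only [map_zsmul, smul_eq_mul]
  congr 1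
  rw [Real.Angle.angle_eq_iff_two_pi_dvd_sub]
  choose j hj using fun γ : N.pos => Int.even_mul_succ_self (N.pairL x γ)
  refine ⟨∑ γ : N.pos, k γ * j γ, ?_⟩
  push_cast
  rw [Finset.mul_sum, Finset.mul_sum, ← Finset.sum_add_distrib, ← Finset.sum_sub_distrib]
  refine Finset.sum_congr rfl fun γ _ => ?_
  have h1 : (N.pairL x γ : ℝ) * (N.pairL x γ + 1) = j γ + j γ := by exact_mod_cast hj γ
  field_simp
  linear_combination (2 * k γ * Real.pi ^ 2 : ℝ) * h1

end SingularNbhd.Regular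

namespace Coords

variable {n : ℕ} {q : RSpace n → N.Regular} (D : Coords N fun s => N.incl (q s)) {s : RSpace n}

lemma regular_u (hs : s ∈ D.V) : (q s).u = D.u s := by
  obtain ⟨P, hP, hPu, -⟩ := D.coords s hs
  have h : N.rel _ P := Quotient.exact hP
  exact h.1.trans hPu

/-- The angles of a point of `M'_U` in terms of its smooth coordinates. -/
lemma regular_θ (hs : s ∈ D.V) {β₁ β₂ : N.pos → ℝ}
    (h₁ : ∀ γ, D.w₁ γ s = (‖D.w₁ γ s‖ : ℂ) * Complex.exp (β₁ γ * Complex.I))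
    (h₂ : ∀ γ, D.w₂ γ s = (‖D.w₂ γ s‖ : ℂ) * Complex.exp (β₂ γ * Complex.I)) :
    IsBranch (fun γ : N.pos => N.Zt γ (q s).u) (fun γ => β₁ γ + β₂ γ + Real.pi / 2) ∧
    ∀ x, (q s).θ (N.frame (q s).u (fun γ => β₁ γ + β₂ γ + Real.pi / 2) x) =
      ((D.ϑ x s + ∑ γ : N.pos, (N.pairL x γ : ℝ) *
        (β₂ γ + (β₁ γ + β₂ γ + Real.pi / 2) / (2 * Real.pi) * (D.t γ s - Real.pi)) : ℝ) :
          Real.Angle) := by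
  have hu := D.regular_u hs
  have hz : ∀ γ : N.pos, N.Zt γ (q s).u ≠ 0 := Zt_ne_zero (q s).mem
  obtain ⟨P, hP, hPu, b₁, b₂, ht, hw, -, hθ⟩ := D.coords s hs
  -- at a regular point no charge is collapsed, so `ε` is determined and is the change of the frame
  -- under a change of arguments
  obtain ⟨-, ε, hε, hε'⟩ : N.rel _ P := Quotient.exact hP
  have hα : IsBranch (fun γ : N.pos => N.Zt γ (q s).u) P.α := by
    have := P.branch
    rwa [hPu, ← hu] at this
  have hPθ : ∀ x, P.θ x = (q s).θ (N.frame (q s).u P.α x) := fun x => by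
    rw [(q s).θ_frame_branch (N.argBranch_isBranch _) hα (fun γ => liftAngle_coe _), hε x]
    refine congrArg (fun a : ℝ => _ + (a : Real.Angle)) (Finset.sum_congr rfl fun γ _ => ?_)
    rcases hε' γ with h | h
    · exact absurd h.1 (hz γ)
    · rw [h]
  have hw0 : ∀ γ : N.pos, D.w₁ γ s ≠ 0 ∧ D.w₂ γ s ≠ 0 := fun γ => by
    refine w_ne_zero_of ?_
    rw [← (D.spec hs γ).1, ← hu]
    exact hz γ
  have e₁ : ∀ γ : N.pos, (β₁ γ : Real.Angle) = b₁ γ := fun γ =>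
    coe_eq_of_exp (hw0 γ).1 (h₁ γ) (hw γ (mem_univ _)).1
  have e₂ : ∀ γ : N.pos, (β₂ γ : Real.Angle) = b₂ γ := fun γ =>
    coe_eq_of_exp (hw0 γ).2 (h₂ γ) (hw γ (mem_univ _)).2.1
  choose k₁ hk₁ using fun γ => Real.Angle.angle_eq_iff_two_pi_dvd_sub.1 (e₁ γ)
  choose k₂ hk₂ using fun γ => Real.Angle.angle_eq_iff_two_pi_dvd_sub.1 (e₂ γ)
  have hbr : IsBranch (fun γ : N.pos => N.Zt γ (q s).u) (fun γ => β₁ γ + β₂ γ + Real.pi / 2) := by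
    intro γ
    have h3 : β₁ γ + β₂ γ + Real.pi / 2 = P.α γ + 2 * Real.pi * (k₁ γ + k₂ γ : ℤ) := by
      rw [(hw γ (mem_univ _)).2.2.1]
      push_cast
      linear_combination hk₁ γ + hk₂ γ
    have h4 : (((P.α γ + 2 * Real.pi * (k₁ γ + k₂ γ : ℤ) : ℝ) : ℂ) * Complex.I) =
        P.α γ * Complex.I + (k₁ γ + k₂ γ : ℤ) * (2 * Real.pi * Complex.I) := by
      push_cast
      ring
    beta_reduce
    rw [h3, h4, Complex.exp_add, Complex.exp_int_mul_two_pi_mul_I, mul_one]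
    exact hα γ
  refine ⟨hbr, fun x => ?_⟩
  rw [(q s).θ_frame_branch hα hbr (fun γ => by rw [← hPθ, ht]), ← hPθ, hθ, ← Real.Angle.coe_add,
    add_assoc, ← Finset.sum_add_distrib, Real.Angle.coe_add, Real.Angle.coe_add]
  congr 1
  refine (Real.Angle.angle_eq_iff_two_pi_dvd_sub.2 ⟨-∑ γ : N.pos, N.pairL x γ * k₂ γ, ?_⟩)
  push_cast
  rw [mul_neg, Finset.mul_sum, ← Finset.sum_sub_distrib, ← Finset.sum_neg_distrib]
  refine Finset.sum_congr rfl fun γ _ => ?_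
  simp only [mem_univ, indicator_of_mem]
  linear_combination -(N.pairL x γ : ℝ) * hk₂ γ

end Coords

end RegularPoint

end ModelGeometry

namespace ModelGeometry

open Set Filter

open scoped ComplexConjugate

/-! ### Model characters in the flat frame -/

/-- For a good sectorial decomposition the integral over the boundary ray is, locally in the central
charge, an integral over a fixed ray at an acute angle from the BPS ray, away from `ζ`. -/
lemma exists_ray (V : Sectors) {ζ z₀ : ℂ} (hζ : ζ ≠ 0) (hz : z₀ ≠ 0)
    (hgood : ∀ A : ℤ, -z₀ ∉ ray (V.angle A)) :
    ∃ a κ c : ℝ, a ∈ Ico (-z₀).arg ((-z₀).arg + Real.pi / 2) ∧ 0 ≤ κ ∧ κ < 1 ∧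
      (ζ * Complex.exp (-(a * Complex.I))).re ≤ κ * ‖ζ‖ ∧ 0 < c ∧
      (z₀ * Complex.exp (-(a * Complex.I))).re < -c ∧
      ∀ᶠ z in 𝓝 z₀, ∀ t : ℝ,
        limUnder (𝓝[>] (0 : ℝ)) (fun δ => rayLog ζ (V.endAngle (-z) - δ) (z, t)) =
          rayLog ζ a (z, t) := by
  have hpi := Real.pi_pos
  obtain ⟨h1, h2, h3⟩ := V.endAngle_spec (neg_ne_zero.2 hz) hgood
  set b := V.endAngle (-z₀)
  obtain ⟨a₀, ha₀, hav⟩ := exists_sector_avoiding ζ b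
  -- an angle between the BPS ray and the boundary ray, so close to the latter that `ζ` is at no
  -- angle from it up to, but excluding, the boundary ray
  set a := max a₀ (-z₀).arg with ha
  have hab : a < b := max_lt ha₀ h1
  have haI : a ∈ Ico a₀ b := ⟨le_max_left _ _, hab⟩
  obtain ⟨κ, hκ0, hκ1, hκ⟩ := hav a haI a ⟨le_rfl, hab⟩
  have hρ : 0 < ‖z₀‖ := norm_pos_iff.2 hz
  have hcos : 0 < Real.cos (b - (-z₀).arg) :=
    Real.cos_pos_of_mem_Ioo ⟨by linarith, by linarith⟩
  set c := ‖z₀‖ * Real.cos (b - (-z₀).arg) / 2 with hc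
  have hc0 : 0 < c := by positivity
  have hre : ∀ ψ ∈ Icc a b, (z₀ * Complex.exp (-(ψ * Complex.I))).re ≤ -(2 * c) := by
    intro ψ hψ
    have h4 := re_mul_exp_neg (-z₀) ψ
    rw [neg_mul, Complex.neg_re, norm_neg] at h4
    have h5 : Real.cos (b - (-z₀).arg) ≤ Real.cos ((-z₀).arg - ψ) := by
      rw [← Real.cos_neg ((-z₀).arg - ψ), neg_sub]
      have h6 : (-z₀).arg ≤ ψ := (le_max_right _ _).trans hψ.1
      exact Real.cos_le_cos_of_nonneg_of_le_pi (by linarith) (by linarith) (by linarith [hψ.2])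
    have h7 := mul_le_mul_of_nonneg_left h5 hρ.le
    rw [hc]
    linarith
  refine ⟨a, κ, c, ⟨le_max_right _ _, by linarith⟩, hκ0, hκ1, hκ a ⟨le_rfl, le_rfl⟩, hc0,
    lt_of_le_of_lt (hre a ⟨le_rfl, hab.le⟩) (by linarith), ?_⟩
  filter_upwards [(continuous_neg.tendsto z₀).eventually h3, Metric.ball_mem_nhds z₀ hc0]
    with z ⟨k, hk⟩ hzc t
  have h4 : ∀ δ : ℝ, rayLog ζ (V.endAngle (-z) - δ) (z, t) = rayLog ζ (b - δ) (z, t) := fun δ => by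
    rw [hk, show b + 2 * Real.pi * k - δ = b - δ + 2 * Real.pi * k by ring, rayLog_add_two_pi]
  simp only [h4]
  refine limUnder_rayLog hab hζ hc0 (fun b' hb' => hav a haI b' hb') fun ψ hψ => ?_
  have h5 : ((z - z₀) * Complex.exp (-(ψ * Complex.I))).re ≤ c := by
    refine (Complex.re_le_norm _).trans ?_
    rw [norm_mul, ← neg_mul, ← Complex.ofReal_neg, Complex.norm_exp_ofReal_mul_I, mul_one,
      ← dist_eq_norm]
    exact (Metric.mem_ball.1 hzc).le
  have h6 := hre ψ hψ
  rw [sub_mul, Complex.sub_re] at h5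
  change (z * _).re ≤ -c
  linarith

section Model

variable {r : ℕ} {B : Type} [TopologicalSpace B] [ChartedSpace (CSpace r) B]
  {C : CoulombData r B} {N : SingularNbhd C}

lemma sum_active {K : Type} [AddCommMonoid K] (f : N.L → K) :
    ∑ x ∈ N.active, f x = ∑ γ : N.pos, (f γ + f (-γ)) := by
  classical
  rw [SingularNbhd.active, Finset.sum_union, Finset.sum_image fun x _ y _ h => neg_injective h,
    ← Finset.sum_add_distrib, ← Finset.sum_coe_sort N.pos (fun γ => f γ + f (-γ))]
  rw [Finset.disjoint_left]
  intro x hx hx'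
  obtain ⟨y, hy, rfl⟩ := Finset.mem_image.1 hx'
  exact N.pos_neg y hy hx

lemma mem_active (γ : N.pos) : (γ : N.L) ∈ N.active ∧ -(γ : N.L) ∈ N.active := by
  classical
  exact ⟨Finset.mem_union_left _ γ.2,
    Finset.mem_union_right _ (Finset.mem_image_of_mem _ γ.2)⟩

variable {u : B} (hu : u ∈ N.U \ C.disc) {α α' : N.pos → ℝ}
  (hα : IsBranch (fun γ : N.pos => N.Zt γ u) α) (hα' : IsBranch (fun γ : N.pos => N.Zt γ u) α')

include hu hα in
/-- The frame is univalued on light charges. -/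
lemma frame_light {x : N.L} (hx : x ∈ N.light) (hα' : IsBranch (fun γ : N.pos => N.Zt γ u) α') :
    N.frame u α' x = N.frame u α x := by
  obtain ⟨k, rfl⟩ := hα.exists_int hα' (Zt_ne_zero hu)
  rw [N.frame_monodromy u hu α hα]
  congr 1
  simp [N.light_isotropic x hx _ (N.pos_light _ (Subtype.property _))]

include hu hα in
lemma Z_frame_light {x : N.L} (hx : x ∈ N.light) : C.Z u (N.frame u α x) = N.Zt x u := by
  rw [N.central_charge u hu α hα]
  simp [N.light_isotropic x hx _ (N.pos_light _ (Subtype.property _))]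

lemma Xsf_eq_sfX (m : N.Regular) (ζ : ℂ) (γ : C.charge.Fiber m.u) {T : ℝ}
    (hT : m.θ γ = (T : Real.Angle)) : N.Xsf m ζ γ = sfX (C.Z m.u γ, T) ζ := by
  rw [SingularNbhd.Xsf, sfX, sfExp_apply, hT, Real.Angle.toCircle_coe, Circle.coe_exp,
    ← Complex.exp_add, mul_comm Complex.I]

lemma rayIntegral_eq (m : N.Regular) (ζ : ℂ) (γ : C.charge.Fiber m.u) {T : ℝ}
    (hT : m.θ γ = (T : Real.Angle)) (φ : ℝ) :
    N.rayIntegral m ζ γ φ = rayLog ζ φ (C.Z m.u γ, T) := by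
  simp only [SingularNbhd.rayIntegral, rayLog, Xsf_eq_sfX m _ γ hT]
  rfl

/-- The model twisted character in the flat frame. -/
lemma Xmodel_frame (V : Sectors) (m : N.Regular) {ζ : ℂ}
    (hα : IsBranch (fun γ : N.pos => N.Zt γ m.u) α) {y : N.L} {Θ : ℝ} {t : N.pos → ℝ}
    (hΘ : m.θ (N.frame m.u α y) = (Θ : Real.Angle))
    (ht : ∀ γ : N.pos, m.θ (N.frame m.u α γ) = (t γ : Real.Angle)) :
    N.Xmodel V m ζ (N.frame m.u α y) =
      Complex.exp (sfExp ζ (C.Z m.u (N.frame m.u α y), Θ) + -(1 / (4 * Real.pi * Complex.I)) *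
        ∑ γ : N.pos, (N.pairL y γ : ℂ) *
          (limUnder (𝓝[>] (0 : ℝ)) (fun δ =>
              rayLog ζ (V.endAngle (-N.Zt γ m.u) - δ) (N.Zt γ m.u, t γ)) -
            limUnder (𝓝[>] (0 : ℝ)) (fun δ =>
              rayLog ζ (V.endAngle (N.Zt γ m.u) - δ) (-N.Zt γ m.u, -t γ)))) := by
  have hl : ∀ γ : N.pos, -(γ : N.L) ∈ N.light := fun γ => N.light.neg_mem (N.pos_light _ γ.2)
  have ht' : ∀ γ : N.pos, m.θ (N.frame m.u α (-γ)) = ((-t γ : ℝ) : Real.Angle) := fun γ => by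
    have h := m.twisted (N.frame m.u α γ) (N.frame m.u α (-γ))
    rw [N.frame_pair _ m.mem _ hα, N.light_isotropic _ (N.pos_light _ γ.2) _ (hl γ), ← map_add,
      add_neg_cancel, map_zero, m.θ_zero, ht] at h
    rw [Real.Angle.coe_neg]
    refine eq_neg_of_add_eq_zero_right ?_
    simpa using h.symm
  -- the frame is single-valued on the light charges, which are isotropic
  have hF : ∀ x ∈ N.light, N.frame m.u (N.argBranch m.u) x = N.frame m.u α x := fun x hx =>
    frame_light m.mem hα hx (N.argBranch_isBranch _)
  rw [SingularNbhd.Xmodel, Xsf_eq_sfX m _ _ hΘ, sfX, ← Complex.exp_add, sum_active]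
  congr 3
  refine Finset.sum_congr rfl fun γ _ => ?_
  have hΩ : ∀ x ∈ N.light, x ∈ N.pos ∨ -x ∈ N.pos → C.Ω m.u (N.frame m.u α x) = 1 :=
    fun x hx h => by rw [N.Ω_light _ m.mem _ hα x hx, if_pos h]
  simp only [hF _ (N.pos_light _ γ.2), hF _ (hl γ), hΩ _ (N.pos_light _ γ.2) (Or.inl γ.2),
    hΩ _ (hl γ) (Or.inr (by rw [neg_neg]; exact γ.2)), N.frame_pair _ m.mem _ hα,
    rayIntegral_eq m _ _ (ht γ), rayIntegral_eq m _ _ (ht' γ),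
    Z_frame_light m.mem hα (N.pos_light _ γ.2), Z_frame_light m.mem hα (hl γ)]
  have hneg : N.Zt (-(γ : N.L)) m.u = -N.Zt γ m.u := by
    rw [map_neg]
    rfl
  simp only [hneg, neg_neg, map_neg]
  push_cast
  ring

end Model

end ModelGeometry

namespace ModelGeometry

open Set Filter MeasureTheory

open scoped ComplexConjugate

/-! ### Derivatives in the flat frame -/

section Derivatives

variable {E : Type*} [NormedAddCommGroup E] [NormedSpace ℝ E] {s : E} {z : E → ℂ}
  {z' : E →L[ℝ] ℂ}

lemma hasFDerivAt_log_norm (hz : HasFDerivAt z z' s) (h0 : z s ≠ 0) :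
    HasFDerivAt (fun s => Real.log (‖z s‖ / Real.pi))
      (Complex.reCLM.comp ((z s)⁻¹ • z')) s := by
  have h1 : (fun s => Real.log (‖z s‖ / Real.pi)) =ᶠ[𝓝 s]
      fun s => 1 / 2 * Real.log (‖z s‖ ^ 2) - Real.log Real.pi := by
    filter_upwards [hz.continuousAt.eventually_ne h0] with s' hs'
    rw [Real.log_div (norm_ne_zero_iff.2 hs') Real.pi_ne_zero, Real.log_pow]
    push_cast
    ring
  have hn : ‖z s‖ ≠ 0 := norm_ne_zero_iff.2 h0
  refine HasFDerivAt.congr_of_eventuallyEq ?_ h1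
  refine (((hz.norm_sq).log (pow_ne_zero 2 hn)).const_mul (1 / 2) |>.sub_const _).congr_fderiv ?_
  ext v
  simp only [smul_apply, ContinuousLinearMap.comp_apply, innerSL_apply_apply, Complex.inner,
    Complex.reCLM_apply, smul_eq_mul, nsmul_eq_mul, Nat.cast_ofNat]
  have h2 : (z s)⁻¹ * z' v = ((‖z s‖ ^ 2)⁻¹ : ℝ) * (z' v * conj (z s)) := by
    rw [Complex.inv_def, Complex.normSq_eq_norm_sq]
    ring
  rw [h2, Complex.re_ofReal_mul]
  ring

/-- The derivative of `Z (log (Z / π) - 1)`. -/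
lemma hasFDerivAt_mul_log_sub_one {α : E → ℝ} {α' : E →L[ℝ] ℝ} (hz : HasFDerivAt z z' s)
    (h0 : z s ≠ 0) (hα : HasFDerivAt α α' s) (hα' : ∀ v, α' v = (z' v / z s).im) :
    HasFDerivAt (fun s => z s * ((Real.log (‖z s‖ / Real.pi) : ℂ) + α s * Complex.I - 1))
      (((Real.log (‖z s‖ / Real.pi) : ℂ) + α s * Complex.I) • z') s := by
  have h1 : HasFDerivAt (fun s => (Real.log (‖z s‖ / Real.pi) : ℂ)) _ s :=
    Complex.ofRealCLM.hasFDerivAt.comp s (hasFDerivAt_log_norm hz h0)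
  have h2 : HasFDerivAt (fun s => (α s : ℂ) * Complex.I) _ s :=
    (Complex.ofRealCLM.hasFDerivAt.comp s hα).mul_const Complex.I
  refine (hz.mul ((h1.add h2).sub_const 1)).congr_fderiv ?_
  ext v
  simp only [add_apply, smul_apply, smul_eq_mul, ContinuousLinearMap.comp_apply, Pi.add_apply,
    Complex.ofRealCLM_apply, Complex.reCLM_apply]
  have h3 := Complex.re_add_im (z' v / z s)
  rw [div_eq_inv_mul] at h3
  rw [hα', div_eq_inv_mul]
  have h4 : z s * ((z s)⁻¹ * z' v) = z' v := mul_inv_cancel_left₀ h0 _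
  linear_combination z s * h3 + h4

/-- The derivative of the ray integrals of a pair of opposite light charges. -/
lemma hasFDerivAt_rays {t : E → ℝ} {t' : E →L[ℝ] ℝ} {ζ : ℂ} {a a' κ κ' c c' : ℝ}
    (hz : HasFDerivAt z z' s) (ht : HasFDerivAt t t' s) (hζ : ζ ≠ 0)
    (hκ : 0 ≤ κ) (hκ1 : κ < 1) (h : (ζ * Complex.exp (-(a * Complex.I))).re ≤ κ * ‖ζ‖) (hc : 0 < c)
    (hp : (z s * Complex.exp (-(a * Complex.I))).re < -c)
    (hκ' : 0 ≤ κ') (hκ1' : κ' < 1) (h' : (ζ * Complex.exp (-(a' * Complex.I))).re ≤ κ' * ‖ζ‖)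
    (hc' : 0 < c') (hp' : (-z s * Complex.exp (-(a' * Complex.I))).re < -c') :
    HasFDerivAt (fun s => rayLog ζ a (z s, t s) - rayLog ζ a' (-z s, -t s))
      (((∫ x in Ioi (0 : ℝ), rayForm ζ a (z s, t s) x) +
        ∫ x in Ioi (0 : ℝ), rayForm ζ a' (-z s, -t s) x).comp (z'.prod t')) s := by
  have h1 : HasFDerivAt (fun s => rayLog ζ a (z s, t s)) _ s :=
    HasFDerivAt.comp (g := rayLog ζ a) s
      (hasFDerivAt_rayLog hζ hκ hκ1 h hc (p := (z s, t s)) hp) (hz.prodMk ht)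
  have h2 : HasFDerivAt (fun s => rayLog ζ a' (-z s, -t s)) _ s :=
    HasFDerivAt.comp (g := rayLog ζ a') s
      (hasFDerivAt_rayLog hζ hκ' hκ1' h' hc' (p := (-z s, -t s)) hp') (hz.neg.prodMk ht.neg)
  refine (h1.sub h2).congr_fderiv ?_
  ext v
  have h3 : ((-z').prod (-t')) v = -(z'.prod t') v := rfl
  simp only [sub_apply, ContinuousLinearMap.comp_apply, add_apply, h3, map_neg, sub_neg_eq_add]

end Derivatives

variable {r : ℕ} {B : Type} [TopologicalSpace B] [ChartedSpace (CSpace r) B]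
  {C : CoulombData r B} {N : SingularNbhd C}

namespace Coords

variable {n : ℕ} {q : RSpace n → N.Regular} (D : Coords N fun s => N.incl (q s)) {s : RSpace n}

/-- Smooth arguments of the coordinates `w₁, w₂` near a point that lies over `M'_U`. -/
structure Args (s : RSpace n) where
  W : Set (RSpace n)
  W_nhds : W ∈ 𝓝 s
  W_sub : W ⊆ D.V
  β₁ : N.pos → RSpace n → ℝ
  β₂ : N.pos → RSpace n → ℝ
  smooth₁ : ∀ γ, ContDiffAt ℝ ∞ (β₁ γ) s
  smooth₂ : ∀ γ, ContDiffAt ℝ ∞ (β₂ γ) s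
  polar₁ : ∀ s ∈ W, ∀ γ, D.w₁ γ s = (‖D.w₁ γ s‖ : ℂ) * Complex.exp (β₁ γ s * Complex.I)
  polar₂ : ∀ s ∈ W, ∀ γ, D.w₂ γ s = (‖D.w₂ γ s‖ : ℂ) * Complex.exp (β₂ γ s * Complex.I)
  fderiv₁ : ∀ γ v, fderiv ℝ (β₁ γ) s v = (fderiv ℝ (D.w₁ γ) s v / D.w₁ γ s).im
  fderiv₂ : ∀ γ v, fderiv ℝ (β₂ γ) s v = (fderiv ℝ (D.w₂ γ) s v / D.w₂ γ s).im

lemma z_ne_zero (hs : s ∈ D.V) (γ : N.pos) : D.z γ s ≠ 0 := by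
  rw [z, ← D.regular_u hs]
  exact Zt_ne_zero (q s).mem γ

lemma w_ne_zero (hs : s ∈ D.V) (γ : N.pos) : D.w₁ γ s ≠ 0 ∧ D.w₂ γ s ≠ 0 := by
  refine w_ne_zero_of ?_
  rw [← (D.spec hs γ).1]
  exact D.z_ne_zero hs γ

lemma nonempty_args (hs : s ∈ D.V) : Nonempty (D.Args s) := by
  choose W₁ β₁ hW₁ hs₁ _hW₁ hβ₁ h₁ using fun γ =>
    exists_smooth_arg D.isOpen (D.w₁_smooth γ) hs (D.w_ne_zero hs γ).1
  choose W₂ β₂ hW₂ hs₂ _hW₂ hβ₂ h₂ using fun γ =>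
    exists_smooth_arg D.isOpen (D.w₂_smooth γ) hs (D.w_ne_zero hs γ).2
  exact ⟨{
    W := D.V ∩ ⋂ γ, (W₁ γ ∩ W₂ γ)
    W_nhds := inter_mem (D.mem_nhds hs) (iInter_mem.2 fun γ =>
      inter_mem ((hW₁ γ).mem_nhds (hs₁ γ)) ((hW₂ γ).mem_nhds (hs₂ γ)))
    W_sub := inter_subset_left
    β₁ := β₁
    β₂ := β₂
    smooth₁ := fun γ => (hβ₁ γ).contDiffAt ((hW₁ γ).mem_nhds (hs₁ γ))
    smooth₂ := fun γ => (hβ₂ γ).contDiffAt ((hW₂ γ).mem_nhds (hs₂ γ))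
    polar₁ := fun s hs γ => (h₁ γ s (mem_iInter.1 hs.2 γ).1).2.1
    polar₂ := fun s hs γ => (h₂ γ s (mem_iInter.1 hs.2 γ).2).2.1
    fderiv₁ := fun γ => (h₁ γ s (hs₁ γ)).2.2
    fderiv₂ := fun γ => (h₂ γ s (hs₂ γ)).2.2 }⟩

namespace Args

variable {D} (A : D.Args s)

/-- The smooth choice of the arguments of the light central charges. -/
def α (s' : RSpace n) (γ : N.pos) : ℝ := A.β₁ γ s' + A.β₂ γ s' + Real.pi / 2

/-- The angles of the charges in the flat frame. -/
def Θ (x : N.L) (s' : RSpace n) : ℝ := D.ϑ x s' + ∑ γ : N.pos, (N.pairL x γ : ℝ) *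
  (A.β₂ γ s' + A.α s' γ / (2 * Real.pi) * (D.t γ s' - Real.pi))

/-- The central charges in the flat frame. -/
def Z (x : N.L) (s' : RSpace n) : ℂ := D.z x s' + 1 / (2 * Real.pi * Complex.I) *
  ∑ γ : N.pos, (N.pairL x γ : ℂ) *
    (D.z γ s' * ((Real.log (‖D.z γ s'‖ / Real.pi) : ℂ) + A.α s' γ * Complex.I - 1))

include A in
lemma mem : s ∈ D.V := A.W_sub (mem_of_mem_nhds A.W_nhds)

variable {s' : RSpace n}

lemma branch (hs' : s' ∈ A.W) : IsBranch (fun γ : N.pos => N.Zt γ (q s').u) (A.α s') :=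
  (D.regular_θ (A.W_sub hs') (A.polar₁ s' hs') (A.polar₂ s' hs')).1

lemma θ_frame (hs' : s' ∈ A.W) (x : N.L) :
    (q s').θ (N.frame (q s').u (A.α s') x) = (A.Θ x s' : Real.Angle) :=
  (D.regular_θ (A.W_sub hs') (A.polar₁ s' hs') (A.polar₂ s' hs')).2 x

lemma θ_light (hs' : s' ∈ A.W) (γ : N.pos) :
    (q s').θ (N.frame (q s').u (A.α s') γ) = (D.t γ s' : Real.Angle) := by
  rw [A.θ_frame hs', Θ, ← (D.ϑ_spec (A.W_sub hs')).2.2]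
  simp [pair_light]

lemma Z_frame (hs' : s' ∈ A.W) (x : N.L) :
    C.Z (q s').u (N.frame (q s').u (A.α s') x) = A.Z x s' := by
  rw [N.central_charge _ (q s').mem _ (A.branch hs'), Z, D.regular_u (A.W_sub hs')]
  simp only [mul_assoc]
  rfl

lemma continuousAt_α : ContinuousAt A.α s :=
  continuousAt_pi.2 fun γ => ((A.smooth₁ γ).continuousAt.add (A.smooth₂ γ).continuousAt).add
    continuousAt_const

/-- The frame defined by the smooth choice of the arguments is flat. -/
lemma transport_frame : ∀ᶠ s' in 𝓝 s, ∀ x,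
    C.charge.transport (q s).u (q s').u (N.frame (q s).u (A.α s) x) =
      N.frame (q s').u (A.α s') x := by
  have hsW := mem_of_mem_nhds A.W_nhds
  have hu : (q s).u = D.u s := D.regular_u A.mem
  have h0 : ∀ γ : N.pos, N.Zt γ (q s).u ≠ 0 := Zt_ne_zero (q s).mem
  -- the choice of arguments is continued to a neighborhood of the point of `B`
  set a : B → N.pos → ℝ := fun w γ => (N.Zt γ w / N.Zt γ (q s).u).arg + A.α s γ with ha
  have hcZ : ∀ γ : N.pos, ContinuousAt (N.Zt γ) (q s).u := fun γ =>
    (N.Zt_holomorphic _).continuousOn.continuousAt (N.U_open.mem_nhds (q s).mem.1)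
  have hac : ContinuousAt a (q s).u := continuousAt_pi.2 fun γ => by
    have h1 : ContinuousAt (fun w => N.Zt γ w / N.Zt γ (q s).u) (q s).u := (hcZ γ).div_const _
    refine ContinuousAt.add ?_ continuousAt_const
    refine ContinuousAt.comp (g := Complex.arg) ?_ h1
    rw [div_self (h0 γ)]
    exact Complex.continuousAt_arg Complex.one_mem_slitPlane
  have has : a (q s).u = A.α s := by
    funext γ
    simp only [ha, div_self (h0 γ), Complex.arg_one, zero_add]
  have hab : ∀ w, IsBranch (fun γ : N.pos => N.Zt γ w) (a w) := fun w γ => by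
    have h1 := Complex.norm_mul_exp_arg_mul_I (N.Zt γ w / N.Zt γ (q s).u)
    have h2 := A.branch hsW γ
    have h3 : (‖N.Zt γ (q s).u‖ : ℂ) ≠ 0 := by exact_mod_cast norm_ne_zero_iff.2 (h0 γ)
    beta_reduce at h2 ⊢
    rw [norm_div, Complex.ofReal_div] at h1
    simp only [ha]
    rw [Complex.ofReal_add, add_mul, Complex.exp_add]
    calc N.Zt γ w = N.Zt γ w / N.Zt γ (q s).u * N.Zt γ (q s).u := by field_simp [h0 γ]
      _ = (‖N.Zt γ w‖ : ℂ) / ‖N.Zt γ (q s).u‖ *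
            Complex.exp ((N.Zt γ w / N.Zt γ (q s).u).arg * Complex.I) *
          ((‖N.Zt γ (q s).u‖ : ℂ) * Complex.exp (A.α s γ * Complex.I)) := by rw [h1, ← h2]
      _ = _ := by field_simp
  have hflat := N.frame_flat _ (q s).mem a hac (Eventually.of_forall hab)
  rw [has] at hflat
  have hcu : ContinuousAt D.u s := (D.u_smooth.continuousOn).continuousAt (D.mem_nhds A.mem)
  rw [ContinuousAt, ← hu] at hcu
  -- the continued choice agrees with the given one along the curve
  have heq : ∀ᶠ s' in 𝓝 s, ∀ γ, a (D.u s') γ - A.α s' γ = 0 := by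
    refine eventually_all.2 fun γ => ?_
    have h1 : ContinuousAt (fun s' => a (D.u s') γ - A.α s' γ) s :=
      ((continuousAt_apply γ _).comp (ContinuousAt.comp (g := a) (hu ▸ hac)
        ((D.u_smooth.continuousOn).continuousAt (D.mem_nhds A.mem)))).sub
        ((continuousAt_apply γ _).comp A.continuousAt_α)
    have h2 : a (D.u s) γ - A.α s γ = 0 := by rw [← hu, has, sub_self]
    refine (eventuallyEq_of_angle h1 ?_).trans (Eventually.of_forall fun _ => h2)
    filter_upwards [A.W_nhds] with s' hs'
    have h3 := A.branch hs' γ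
    beta_reduce at h3
    rw [D.regular_u (A.W_sub hs')] at h3
    rw [h2, Real.Angle.coe_sub, coe_eq_of_exp (D.z_ne_zero (A.W_sub hs') γ) (hab _ γ) h3]
    simp
  filter_upwards [A.W_nhds, hcu.eventually hflat, heq] with s' hs' h1 h2 x
  have h3 : a (D.u s') = A.α s' := funext fun γ => sub_eq_zero.1 (h2 γ)
  rw [D.regular_u (A.W_sub hs')]
  rw [h1 x, h3]

end Args

end Coords

end ModelGeometry

namespace ModelGeometry

open Set Filter MeasureTheory

open scoped ComplexConjugate

/-! ### The logarithmic derivative of the model characters -/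

variable {r : ℕ} {B : Type} [TopologicalSpace B] [ChartedSpace (CSpace r) B]
  [IsManifold 𝓘(ℂ, CSpace r) ∞ B] {C : CoulombData r B} {N : SingularNbhd C}
  {n : ℕ} {q : RSpace n → N.Regular} {D : Coords N fun s => N.incl (q s)} {s : RSpace n}

namespace Coords.Args

variable (A : D.Args s)

include A in
omit [IsManifold 𝓘(ℂ, CSpace r) ∞ B] in
lemma hasFDerivAt_t (γ : N.pos) : HasFDerivAt (D.t γ) (fderiv ℝ (D.t γ) s) s :=
  (((D.t_smooth γ).contDiffAt (D.mem_nhds A.mem)).differentiableAt (by simp)).hasFDerivAt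

omit [IsManifold 𝓘(ℂ, CSpace r) ∞ B] in
lemma hasFDerivAt_α (γ : N.pos) : ∃ α' : RSpace n →L[ℝ] ℝ,
    HasFDerivAt (fun s' => A.α s' γ) α' s ∧ ∀ v, α' v = (fderiv ℝ (D.z γ) s v / D.z γ s).im := by
  have h1 := ((A.smooth₁ γ).differentiableAt (by simp)).hasFDerivAt
  have h2 := ((A.smooth₂ γ).differentiableAt (by simp)).hasFDerivAt
  refine ⟨_, (h1.add h2).add_const (Real.pi / 2), fun v => ?_⟩
  obtain ⟨hw₁, hw₂⟩ := D.w_ne_zero A.mem γ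
  have d1 := (D.contDiffAt_w₁ A.mem γ).differentiableAt (by simp)
  have d2 := (D.contDiffAt_w₂ A.mem γ).differentiableAt (by simp)
  rw [(D.z_eventuallyEq A.mem γ).fderiv_eq, (D.z_eventuallyEq A.mem γ).eq_of_nhds,
    fderiv_zOf d1 d2, add_apply, A.fderiv₁, A.fderiv₂, ← Complex.add_im, zOf]
  congr 1
  field_simp

lemma hasFDerivAt_Z (x : N.L) : HasFDerivAt (A.Z x) (fderiv ℝ (D.z x) s +
    (1 / (2 * Real.pi * Complex.I) : ℂ) • ∑ γ : N.pos, (N.pairL x γ : ℂ) •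
      (((Real.log (‖D.z γ s‖ / Real.pi) : ℂ) + A.α s γ * Complex.I) • fderiv ℝ (D.z γ) s)) s := by
  have hz := fun x => (D.differentiableAt_z A.mem x).hasFDerivAt
  refine (hz x).add ((HasFDerivAt.fun_sum fun γ _ => HasFDerivAt.const_mul ?_ _).const_mul _)
  obtain ⟨α', h1, h2⟩ := A.hasFDerivAt_α γ
  exact hasFDerivAt_mul_log_sub_one (hz γ) (D.z_ne_zero A.mem γ) h1 h2

omit [IsManifold 𝓘(ℂ, CSpace r) ∞ B] in
lemma hasFDerivAt_Θ (x : N.L) : ∃ Θ' : RSpace n →L[ℝ] ℝ, HasFDerivAt (A.Θ x) Θ' s ∧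
    ∀ v, Θ' v = fderiv ℝ (D.ϑ x) s v + ∑ γ : N.pos, (N.pairL x γ : ℝ) *
      (fderiv ℝ (A.β₂ γ) s v + (fderiv ℝ (D.z γ) s v / D.z γ s).im *
        ((D.t γ s - Real.pi) / (2 * Real.pi)) + A.α s γ / (2 * Real.pi) * fderiv ℝ (D.t γ) s v) := by
  choose α' hα hα' using fun γ => A.hasFDerivAt_α γ
  have h2 := fun γ => ((A.smooth₂ γ).differentiableAt (by simp)).hasFDerivAt
  refine ⟨_, (D.differentiableAt_ϑ A.mem x).hasFDerivAt.add (HasFDerivAt.fun_sum fun γ _ =>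
    ((h2 γ).add (((hα γ).mul_const (2 * Real.pi)⁻¹).mul
      ((A.hasFDerivAt_t γ).sub_const Real.pi))).const_mul _), fun v => ?_⟩
  simp only [add_apply, sum_apply, smul_apply, smul_eq_mul, hα']
  congr 1
  refine Finset.sum_congr rfl fun γ _ => ?_
  ring

/-- The differential of `log X^model(ζ)` in the flat frame. -/
theorem dlogXmodel_frame (V : Sectors) (hgood : N.IsGood V (q s).u) {ζ : ℂ} (hζ : ζ ≠ 0) :
    ∃ Λ : N.pos → ℂ × ℝ → ℂ,
      (∀ γ v w, Λ γ v * sfExp ζ w - Λ γ w * sfExp ζ v =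
        Complex.I * (v.1 * w.2 - w.1 * v.2) *
            (2 * (bpsA0 ‖D.z γ s‖ (D.t γ s)).re / ζ -
              conj (D.z γ s) / ‖D.z γ s‖ * (2 * (bpsA1 ‖D.z γ s‖ (D.t γ s)).im * Complex.I)) +
          (v.1 * conj w.1 - w.1 * conj v.1) *
            (-(D.z γ s / ‖D.z γ s‖) * (2 * (bpsA1 ‖D.z γ s‖ (D.t γ s)).im * Complex.I) / ζ +
              4 * (bpsA0 ‖D.z γ s‖ (D.t γ s)).re -
              ζ * (conj (D.z γ s) / ‖D.z γ s‖ *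
                (2 * (bpsA1 ‖D.z γ s‖ (D.t γ s)).im * Complex.I))) +
          Complex.I * (v.2 * conj w.1 - w.2 * conj v.1) *
            (-(D.z γ s / ‖D.z γ s‖) * (2 * (bpsA1 ‖D.z γ s‖ (D.t γ s)).im * Complex.I) +
              ζ * (2 * (bpsA0 ‖D.z γ s‖ (D.t γ s)).re))) ∧
      ∀ v y, N.dlogXmodel V ζ q s v (N.frame (q s).u (A.α s) y) =
        sfExp ζ (fderiv ℝ (D.z y) s v, fderiv ℝ (D.ϑ y) s v) +
          ∑ γ : N.pos, lightCoeff ζ (D.z γ s) (D.t γ s) (A.α s γ)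
            (fderiv ℝ (D.z γ) s v, fderiv ℝ (D.t γ) s v) (fderiv ℝ (A.β₂ γ) s v)
            (Λ γ (fderiv ℝ (D.z γ) s v, fderiv ℝ (D.t γ) s v)) * (N.pairL y γ : ℂ) := by
  have hsW := mem_of_mem_nhds A.W_nhds
  have hzu : ∀ s' ∈ A.W, ∀ γ : N.pos, N.Zt γ (q s').u = D.z γ s' := fun s' hs' γ => by
    rw [D.regular_u (A.W_sub hs')]
    rfl
  have hz0 := D.z_ne_zero A.mem
  have hg : ∀ (γ : N.pos) (j : ℤ), -D.z γ s ∉ ray (V.angle j) ∧ - -D.z γ s ∉ ray (V.angle j) :=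
    fun γ j => by
      have h1 := hgood _ (mem_active γ).1 j
      have h2 := hgood _ (mem_active γ).2 j
      have hb := N.argBranch_isBranch (q s).u
      rw [Z_frame_light (q s).mem hb (N.pos_light _ γ.2), hzu s hsW] at h1
      rw [Z_frame_light (q s).mem hb (N.light.neg_mem (N.pos_light _ γ.2)), map_neg,
        show (-N.Zt γ) (q s).u = -N.Zt γ (q s).u from rfl, hzu s hsW] at h2
      exact ⟨h1, h2⟩
  -- near `s` the integrals of all light charges are over fixed rays
  choose a κ c ha hκ hκ1 hκa hc hca hlim using fun γ =>
    exists_ray V hζ (hz0 γ) fun j => (hg γ j).1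
  choose a' κ' c' ha' hκ' hκ1' hκa' hc' hca' hlim' using fun γ =>
    exists_ray V hζ (neg_ne_zero.2 (hz0 γ)) fun j => (hg γ j).2
  have hcz : ∀ γ : N.pos, ContinuousAt (D.z γ) s := fun γ =>
    (D.differentiableAt_z A.mem γ).continuousAt
  set G : N.L → RSpace n → ℂ := fun y s' => sfExp ζ (A.Z y s', A.Θ y s') +
    -(1 / (4 * Real.pi * Complex.I)) * ∑ γ : N.pos, (N.pairL y γ : ℂ) *
      (rayLog ζ (a γ) (D.z γ s', D.t γ s') - rayLog ζ (a' γ) (-D.z γ s', -D.t γ s')) with hG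
  have hX : ∀ᶠ s' in 𝓝 s, ∀ y, N.Xmodel V (q s') ζ (N.frame (q s').u (A.α s') y) =
      Complex.exp (G y s') := by
    have h1 := eventually_all.2 fun γ => (hcz γ).eventually (hlim γ)
    have h2 := eventually_all.2 fun γ => (hcz γ).neg.eventually (hlim' γ)
    filter_upwards [A.W_nhds, h1, h2] with s' hs' h1 h2 y
    rw [Xmodel_frame V (q s') (A.branch hs') (A.θ_frame hs' y) (A.θ_light hs'), A.Z_frame hs']
    simp only [hzu s' hs']
    have h2' : ∀ (γ : N.pos) (t : ℝ),
        limUnder (𝓝[>] (0 : ℝ)) (fun δ => rayLog ζ (V.endAngle (D.z γ s') - δ) (-D.z γ s', t)) =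
          rayLog ζ (a' γ) (-D.z γ s', t) := fun γ t => by simpa only [Pi.neg_apply, neg_neg] using h2 γ t
    simp only [h1, h2']
    rfl
  set Λ : N.pos → ℂ × ℝ →L[ℝ] ℂ := fun γ =>
    (∫ x in Ioi (0 : ℝ), rayForm ζ (a γ) (D.z γ s, D.t γ s) x) +
      ∫ x in Ioi (0 : ℝ), rayForm ζ (a' γ) (-D.z γ s, -D.t γ s) x with hΛ
  refine ⟨fun γ => Λ γ, fun γ v w => ?_, fun v y => ?_⟩
  · have hκm : max (κ γ) (κ' γ) < 1 := max_lt (hκ1 γ) (hκ1' γ)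
    have hmem := ha' γ
    rw [neg_neg] at hmem
    exact rayForm_wedge_add_neg hζ ((hκ γ).trans (le_max_left _ _)) hκm
      ((hκa γ).trans (mul_le_mul_of_nonneg_right (le_max_left _ _) (norm_nonneg _)))
      ((hκa' γ).trans (mul_le_mul_of_nonneg_right (le_max_right _ _) (norm_nonneg _)))
      (hz0 γ) (ha γ) hmem v w
  · obtain ⟨Θ', hΘ, hΘ'⟩ := A.hasFDerivAt_Θ y
    have hr := fun γ : N.pos => (hasFDerivAt_rays
      (D.differentiableAt_z A.mem γ).hasFDerivAt (A.hasFDerivAt_t γ) hζ (hκ γ) (hκ1 γ) (hκa γ)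
      (hc γ) (hca γ) (hκ' γ) (hκ1' γ) (hκa' γ) (hc' γ) (hca' γ)).const_mul (N.pairL y γ : ℂ)
    have hGd : HasFDerivAt (G y) _ s :=
      ((sfExp ζ).hasFDerivAt.comp s ((A.hasFDerivAt_Z y).prodMk hΘ)).add
        (HasFDerivAt.const_mul (HasFDerivAt.fun_sum (u := Finset.univ) fun γ _ => hr γ)
          (-(1 / (4 * Real.pi * Complex.I))))
    -- parallel transport keeps the components in the flat frame
    have hXe : (fun s' => N.Xmodel V (q s') ζ
        (C.charge.transport (q s).u (q s').u (N.frame (q s).u (A.α s) y))) =ᶠ[𝓝 s]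
          fun s' => Complex.exp (G y s') := by
      filter_upwards [hX, A.transport_frame] with s' h1 h2
      rw [h2, h1]
    rw [SingularNbhd.dlogXmodel, hXe.fderiv_eq, hGd.cexp.fderiv, hX.self_of_nhds y, smul_apply, smul_eq_mul,
      mul_div_cancel_left₀ _ (Complex.exp_ne_zero _)]
    simp only [add_apply, ContinuousLinearMap.comp_apply, ContinuousLinearMap.prod_apply,
      sum_apply, smul_apply, smul_eq_mul, hΘ']
    rw [sfExp_apply, sfExp_apply]
    simp only [map_add, map_mul, map_sum, map_div₀, map_one, map_ofNat, Complex.conj_I,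
      Complex.conj_ofReal, Complex.ofReal_add, Complex.ofReal_sum, Complex.ofReal_mul,
      Complex.ofReal_intCast, map_intCast]
    have key : ∑ γ : N.pos, lightCoeff ζ (D.z γ s) (D.t γ s) (A.α s γ)
            (fderiv ℝ (D.z γ) s v, fderiv ℝ (D.t γ) s v) (fderiv ℝ (A.β₂ γ) s v)
            (Λ γ (fderiv ℝ (D.z γ) s v, fderiv ℝ (D.t γ) s v)) * (N.pairL y γ : ℂ) =
        (1 / (2 * Real.pi * Complex.I) * ∑ γ : N.pos, (N.pairL y γ : ℂ) *
          (((Real.log (‖D.z γ s‖ / Real.pi) : ℂ) + A.α s γ * Complex.I) *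
            fderiv ℝ (D.z γ) s v)) / ζ +
        ζ * (1 / (2 * Real.pi * -Complex.I) * ∑ γ : N.pos, (N.pairL y γ : ℂ) *
          (((Real.log (‖D.z γ s‖ / Real.pi) : ℂ) + A.α s γ * -Complex.I) *
            conj (fderiv ℝ (D.z γ) s v))) +
        Complex.I * ∑ γ : N.pos, (N.pairL y γ : ℂ) * (fderiv ℝ (A.β₂ γ) s v +
          (fderiv ℝ (D.z γ) s v / D.z γ s).im * ((D.t γ s - Real.pi) / (2 * Real.pi) : ℝ) +
          (A.α s γ / (2 * Real.pi) : ℝ) * fderiv ℝ (D.t γ) s v) +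
        -(1 / (4 * Real.pi * Complex.I)) * ∑ γ : N.pos, (N.pairL y γ : ℂ) *
          Λ γ (fderiv ℝ (D.z γ) s v, fderiv ℝ (D.t γ) s v) := by
      simp only [Finset.mul_sum, Finset.sum_div, ← Finset.sum_add_distrib]
      refine Finset.sum_congr rfl fun γ _ => ?_
      rw [lightCoeff]
      push_cast
      ring
    rw [key]
    simp only [hΛ, add_apply]
    ring

end Coords.Args

end ModelGeometry

namespace ModelGeometry

open Set Filter MeasureTheory

open scoped ComplexConjugate

/-! ### Matching with the model forms -/

section Pairing

open InverseMatrix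

variable {G : Type} [AddCommGroup G] {P : G →+ G →+ ℤ}

lemma vanishes_add_sum_pairRight (hP : ∀ x y, P x y = -P y x) {ι : Type} [Fintype ι] (γ : ι → G)
    {a : G →+ ℂ} (ha : VanishesOnRadical P a) (c : ι → ℂ) :
    VanishesOnRadical P (a + ∑ i, c i • pairRight P (γ i)) := fun x hx => by
  rw [AddMonoidHom.add_apply, ha x hx, AddMonoidHom.finsetSum_apply, zero_add]
  refine Finset.sum_eq_zero fun i _ => ?_
  rw [AddMonoidHom.smul_apply, pairRight_vanishes hP _ x hx, smul_zero]

/-- The inverse pairing of two functionals corrected by multiples of the functionals `⟨·, γ⟩`, for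
`γ` in an isotropic set. -/
lemma form_add_sum_pairRight (M : InverseMatrix P) (hP : ∀ x y, P x y = -P y x) {ι : Type}
    [Fintype ι] (γ : ι → G) (hγ : ∀ i j, P (γ i) (γ j) = 0) {a b : G →+ ℂ}
    (ha : VanishesOnRadical P a) (hb : VanishesOnRadical P b) (c d : ι → ℂ) :
    M.form (a + ∑ i, c i • pairRight P (γ i)) (b + ∑ i, d i • pairRight P (γ i)) =
      M.form a b + ∑ i, (c i * b (γ i) - d i * a (γ i)) := by
  rw [M.form_add_left, M.form_sum_left, M.form_add_right, M.form_sum_right, add_assoc,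
    Finset.sum_sub_distrib, sub_eq_add_neg, add_comm (∑ i, c i * b (γ i)), ← Finset.sum_neg_distrib]
  congr 2
  · refine Finset.sum_congr rfl fun i _ => ?_
    rw [M.form_smul_right, M.form_pairRight hP ha, mul_neg]
  · refine Finset.sum_congr rfl fun i _ => ?_
    rw [M.form_smul_left, M.pairRight_form hP (vanishes_add_sum_pairRight hP γ hb d)]
    simp [AddMonoidHom.finsetSum_apply, hγ]

end Pairing

variable {r : ℕ} {B : Type} [TopologicalSpace B] [ChartedSpace (CSpace r) B]
  [IsManifold 𝓘(ℂ, CSpace r) ∞ B] {C : CoulombData r B} {N : SingularNbhd C}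
  {n : ℕ} {q : RSpace n → N.Regular} {D : Coords N fun s => N.incl (q s)} {s : RSpace n}

namespace Coords.Args

variable (A : D.Args s) (M : InverseMatrix N.pairL)

include A in
/-- `⟨dZ ∧ dZ⟩ = 0` in the flat frame: the logarithmic terms do not contribute. -/
lemma form_dz_dz (v w : RSpace n) : M.form (D.dz A.mem v) (D.dz A.mem w) = 0 := by
  have hsW := mem_of_mem_nhds A.W_nhds
  have hmem := (q s).mem
  have hP := pairL_antisymm N
  have hu : ContMDiffAt 𝓘(ℝ, RSpace n) 𝓘(ℝ, CSpace r) ∞ (fun s' => (q s').u) s := by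
    refine (D.u_smooth.contMDiffAt (D.mem_nhds A.mem)).congr_of_eventuallyEq ?_
    filter_upwards [D.mem_nhds A.mem] with s' hs'
    exact D.regular_u hs'
  set F := N.frame (q s).u (A.α s)
  set k : RSpace n → N.pos → ℂ := fun v γ => 1 / (2 * Real.pi * Complex.I) *
    (((Real.log (‖D.z γ s‖ / Real.pi) : ℂ) + A.α s γ * Complex.I) * D.dz A.mem v γ) with hk
  set X : RSpace n → TangentSpace 𝓘(ℂ, CSpace r) (q s).u := fun v =>
    fderiv ℝ (chartAt (CSpace r) (q s).u ∘ fun s' => (q s').u) s v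
  -- `dZ` is `dz`, the differential of the regular part, plus multiples of `dZ_γ` along `⟨·, γ⟩`;
  -- these are symmetric and drop out of the pairing of `dZ` with itself
  have key : ∀ v y, holoDiff (fun w => C.Z w (C.charge.transport (q s).u w (F y))) (q s).u (X v) =
      (D.dz A.mem v + ∑ γ : N.pos, k v γ • InverseMatrix.pairRight N.pairL γ) y := by
    intro v y
    have h1 := hasFDerivAt_comp_holo (u := fun s' => (q s').u) (s := s)
      (C.Z_holomorphic _ hmem.2 (F y)) hu
    have h2 : A.Z y =ᶠ[𝓝 s] fun s' => C.Z (q s').u (C.charge.transport (q s).u (q s').u (F y)) := by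
      filter_upwards [A.W_nhds, A.transport_frame] with s' h3 h4
      rw [h4, A.Z_frame h3]
    have h3 := (h1.congr_of_eventuallyEq h2).unique (A.hasFDerivAt_Z y)
    refine (congrArg (fun L => L v) h3).trans ?_
    simp only [add_apply, smul_apply, sum_apply, smul_eq_mul, AddMonoidHom.add_apply,
      AddMonoidHom.finsetSum_apply, AddMonoidHom.smul_apply, InverseMatrix.pairRight_apply, hk,
      Finset.mul_sum]
    refine congrArg₂ (· + ·) rfl (Finset.sum_congr rfl fun γ _ => ?_)
    rw [mul_left_comm, mul_comm]
    rfl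
  have h := C.dZ_isotropic _ hmem.2 (X v) (X w)
  rw [M.dualPairing_eq F (N.frame_bijective _ hmem _ (A.branch hsW))
    (fun x y => N.frame_pair _ hmem _ (A.branch hsW) x y) hP _ _ _ _ (key v) (key w)
    (vanishes_add_sum_pairRight hP _ (D.dz_vanishes _ _) _)
    (vanishes_add_sum_pairRight hP _ (D.dz_vanishes _ _) _),
    form_add_sum_pairRight M hP _ pair_light (D.dz_vanishes _ _) (D.dz_vanishes _ _)] at h
  rw [← h, left_eq_add]
  refine Finset.sum_eq_zero fun γ _ => ?_
  simp only [hk]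
  ring

/-- The functional `d log X^sf(ζ)` in the coordinates `z, ϑ`. -/
def dlogSf (ζ : ℂ) (v : RSpace n) : N.L →+ ℂ :=
  ζ⁻¹ • D.dz A.mem v + ζ • conjHom (D.dz A.mem v) + Complex.I • D.dϑ A.mem v

lemma dlogSf_apply (ζ : ℂ) (v : RSpace n) (y : N.L) :
    A.dlogSf ζ v y = sfExp ζ (fderiv ℝ (D.z y) s v, fderiv ℝ (D.ϑ y) s v) := by
  rw [sfExp_apply, div_eq_inv_mul]
  rfl

lemma dlogSf_vanishes (ζ : ℂ) (v : RSpace n) : VanishesOnRadical N.pairL (A.dlogSf ζ v) :=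
  fun x hx => by
    have h1 := D.dz_vanishes A.mem v x hx
    simp only [dlogSf, AddMonoidHom.add_apply, AddMonoidHom.smul_apply, h1,
      conjHom_vanishes (D.dz_vanishes A.mem v) x hx, D.dϑ_vanishes A.mem v x hx, smul_zero, add_zero]

lemma dlogSf_light (ζ : ℂ) (v : RSpace n) (γ : N.pos) :
    A.dlogSf ζ v γ = sfExp ζ (fderiv ℝ (D.z γ) s v, fderiv ℝ (D.t γ) s v) := by
  have h : fderiv ℝ (D.ϑ γ) s v = fderiv ℝ (D.t γ) s v := by
    have := D.dϑ_light A.mem v γ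
    rw [← (D.t_eventuallyEq A.mem γ).fderiv_eq] at this
    exact Complex.ofReal_injective this
  rw [dlogSf_apply, h]

lemma form_dlogSf {ζ : ℂ} (hζ : ζ ≠ 0) (v w : RSpace n) :
    M.form (A.dlogSf ζ v) (A.dlogSf ζ w) =
      Complex.I / ζ * (M.form (D.dz A.mem v) (D.dϑ A.mem w) -
        M.form (D.dz A.mem w) (D.dϑ A.mem v)) +
      (M.form (D.dz A.mem v) (conjHom (D.dz A.mem w)) -
        M.form (D.dz A.mem w) (conjHom (D.dz A.mem v))) -
      M.form (D.dϑ A.mem v) (D.dϑ A.mem w) +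
      Complex.I * ζ * conj (M.form (D.dz A.mem v) (D.dϑ A.mem w) -
        M.form (D.dz A.mem w) (D.dϑ A.mem v)) := by
  have hP := pairL_antisymm N
  have hϑ : ∀ v, conjHom (D.dϑ A.mem v) = D.dϑ A.mem v := fun v => by
    ext x
    exact Complex.conj_ofReal _
  have h0 : M.form (conjHom (D.dz A.mem v)) (conjHom (D.dz A.mem w)) = 0 := by
    rw [← conj_form, A.form_dz_dz M, map_zero]
  simp only [dlogSf, M.form_add_left, M.form_add_right, M.form_smul_left, M.form_smul_right,
    A.form_dz_dz M, h0, map_sub, conj_form, hϑ]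
  rw [M.form_antisymm hP (conjHom_vanishes (D.dz_vanishes A.mem v)) (D.dz_vanishes A.mem w),
    M.form_antisymm hP (D.dϑ_vanishes A.mem v) (D.dz_vanishes A.mem w),
    M.form_antisymm hP (D.dϑ_vanishes A.mem v) (conjHom_vanishes (D.dz_vanishes A.mem w))]
  field_simp
  ring_nf
  rw [Complex.I_sq]
  ring

include A in
/-- The model forms agree with the smooth forms over the regular locus. -/
theorem varpiModel_eq (V : Sectors) (hgood : N.IsGood V (q s).u) {ζ : ℂ} (hζ : ζ ≠ 0)
    (v w : RSpace n) :
    -(Complex.I / (2 * ζ)) * D.formPlus M s ![v, w] + D.formZero M s ![v, w] -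
      Complex.I / 2 * ζ * conj (D.formPlus M s ![v, w]) = N.varpiModel V ζ q s v w := by
  have hsW := mem_of_mem_nhds A.W_nhds
  have hmem := (q s).mem
  have hP := pairL_antisymm N
  have hpi : (Real.pi : ℂ) ≠ 0 := by exact_mod_cast Real.pi_ne_zero
  obtain ⟨Λ, hΛ, hlog⟩ := A.dlogXmodel_frame V hgood hζ
  set p : N.pos → RSpace n → ℂ × ℝ := fun γ v => (fderiv ℝ (D.z γ) s v, fderiv ℝ (D.t γ) s v)
    with hp
  set c : RSpace n → N.pos → ℂ := fun v γ => lightCoeff ζ (D.z γ s) (D.t γ s) (A.α s γ) (p γ v)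
    (fderiv ℝ (A.β₂ γ) s v) (Λ γ (p γ v)) with hc
  have key : ∀ v y, N.dlogXmodel V ζ q s v (N.frame (q s).u (A.α s) y) =
      (A.dlogSf ζ v + ∑ γ : N.pos, c v γ • InverseMatrix.pairRight N.pairL γ) y := fun v y => by
    rw [hlog, AddMonoidHom.add_apply, dlogSf_apply, AddMonoidHom.finsetSum_apply]
    rfl
  -- the light charges match one by one; the rest is the semi-flat form of the regular part
  have hlight : ∀ γ : N.pos, c v γ * A.dlogSf ζ w γ - c w γ * A.dlogSf ζ v γ =
      -(Complex.I / ζ) * lightPlus (D.w₁ γ) (D.w₂ γ) s ![v, w] +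
        lightZero (D.w₁ γ) (D.w₂ γ) s ![v, w] -
        Complex.I * ζ * conj (lightPlus (D.w₁ γ) (D.w₂ γ) s ![v, w]) := fun γ => by
    have hz := D.z_eventuallyEq A.mem γ
    have ht := D.t_eventuallyEq A.mem γ
    have hz0 := D.z_ne_zero A.mem γ
    have hz0' := hz0
    rw [hz.eq_of_nhds] at hz0'
    have hl := light_eq_of_ne_zero (D.contDiffAt_w₁ A.mem γ) (D.contDiffAt_w₂ A.mem γ)
      (D.spec A.mem γ).2.2 hz0' (b := fun v => (fderiv ℝ (A.β₂ γ) s v : ℂ)) (j := 0)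
      (fun v => by rw [A.fderiv₂, zero_mul, sub_zero]) v w
    simp only [add_zero, ← hz.fderiv_eq, ← hz.eq_of_nhds, ← ht.fderiv_eq, ← ht.eq_of_nhds] at hl
    rw [A.dlogSf_light, A.dlogSf_light]
    exact (lightCoeff_wedge hζ hz0 (p γ v) (p γ w) _ _ _ _ _ _ (hΛ γ (p γ v) (p γ w)) hl.1
      hl.2).symm
  rw [SingularNbhd.varpiModel, M.dualPairing_eq _ (N.frame_bijective _ hmem _ (A.branch hsW))
    (fun x y => N.frame_pair _ hmem _ (A.branch hsW) x y) hP _ _ _ _ (key v) (key w)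
    (vanishes_add_sum_pairRight hP _ (A.dlogSf_vanishes ζ v) _)
    (vanishes_add_sum_pairRight hP _ (A.dlogSf_vanishes ζ w) _),
    form_add_sum_pairRight M hP _ pair_light (A.dlogSf_vanishes ζ v) (A.dlogSf_vanishes ζ w),
    Finset.sum_congr rfl fun γ _ => hlight γ, A.form_dlogSf M hζ, D.formPlus_apply M A.mem,
    D.formZero_apply M A.mem, M.form_antisymm hP (D.dϑ_vanishes A.mem w) (D.dϑ_vanishes A.mem v),
    Finset.sum_sub_distrib, Finset.sum_add_distrib, ← Finset.mul_sum, ← Finset.mul_sum]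
  simp only [map_add, map_sub, map_mul, map_neg, map_div₀, map_one, map_ofNat, map_sum,
    Complex.conj_ofReal]
  field_simp
  ring

end Coords.Args

end ModelGeometry

end

open scoped Manifold ContDiff Topology in
theorem mainTheorem5 {r : ℕ} {B : Type} [TopologicalSpace B] [T2Space B]
    [SecondCountableTopology B] [ConnectedSpace B]
    [ChartedSpace (ModelGeometry.CSpace r) B]
    [IsManifold 𝓘(ℂ, ModelGeometry.CSpace r) ∞ B]
    (C : ModelGeometry.CoulombData r B) (N : ModelGeometry.SingularNbhd C) :
    ∃ ηplus ηzero ηminus : ModelGeometry.DForm 2 N.Total,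
      ηplus.IsClosed ∧ ηzero.IsClosed ∧ ηminus.IsClosed ∧ ηminus.IsConj ηplus ∧ ηzero.IsConj ηzero ∧
      ∀ ζ : ℂ, ζ ≠ 0 → ∀ (n : ℕ) (q : ModelGeometry.RSpace n → N.Regular),
        Diffeology.IsPlot (fun s => N.incl (q s)) →
        ∀ (s : ModelGeometry.RSpace n) (V : ModelGeometry.Sectors), N.IsGood V (q s).u →
        ∀ v w : ModelGeometry.RSpace n,
          -(Complex.I / (2 * ζ)) * ηplus.toFun (fun s => N.incl (q s)) s ![v, w] +
            ηzero.toFun (fun s => N.incl (q s)) s ![v, w] -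
            Complex.I / 2 * ζ * ηminus.toFun (fun s => N.incl (q s)) s ![v, w] =
          N.varpiModel V ζ q s v w := by
  open ModelGeometry in
  have := finite_lattice N
  obtain ⟨M⟩ := InverseMatrix.nonempty N.pairL
  refine ⟨(coordPlus M).toDForm, (coordZero M).toDForm, (coordMinus M).toDForm,
    (coordPlus M).toDForm_closed, (coordZero M).toDForm_closed, (coordMinus M).toDForm_closed,
    fun n p hp s v => ?_, fun n p hp s v => ?_, fun ζ hζ n q hq s V hgood v w => ?_⟩
  · obtain ⟨D, hD⟩ := exists_coords_of_isPlot hp s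
    change (coordMinus M).toFun p s v = (starRingEnd ℂ) ((coordPlus M).toFun p s v)
    rw [(coordMinus M).toFun_eq D hD, (coordPlus M).toFun_eq D hD]
    rfl
  · obtain ⟨D, hD⟩ := exists_coords_of_isPlot hp s
    change (coordZero M).toFun p s v = (starRingEnd ℂ) ((coordZero M).toFun p s v)
    rw [(coordZero M).toFun_eq D hD, show v = ![v 0, v 1] from by ext i; fin_cases i <;> rfl]
    exact (D.conj_formZero M hD _ _).symm
  · obtain ⟨D, hD⟩ := exists_coords_of_isPlot hq s
    obtain ⟨A⟩ := D.nonempty_args hD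
    refine Eq.trans ?_ (A.varpiModel_eq M V hgood hζ v w)
    change -(Complex.I / (2 * ζ)) * (coordPlus M).toFun _ s _ + (coordZero M).toFun _ s _ -
      Complex.I / 2 * ζ * (coordMinus M).toFun _ s _ = _
    rw [(coordPlus M).toFun_eq D hD, (coordZero M).toFun_eq D hD, (coordMinus M).toFun_eq D hD]
    rfl
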